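/- **Setting.** Let $\Gamma<\mathrm{SL}(2,\mathbb R)$ be a non-uniform lattice (discrete, with a Dirichlet region of finite hyperbolic area that is not compact), and let $A_1,\dots,A_p\in\mathrm{SL}(2,\mathbb R)$ be such that $A_1\cdot\infty,\dots,A_p\cdot\infty$ is a complete set of inequivalent parabolic fixed points of $\Gamma$. Let $\varphi(z)=\frac{z-i}{z+i}$; through $\varphi$ the elements of $\Gamma$ act on the closed unit disc by $F(\xi)=\frac{\alpha\xi+\overline\beta}{\beta\xi+\overline\alpha}$, $|\alpha|^2-|\beta|^2=1$. Put $I_F=\{|\beta\xi+\overline\alpha|=1\}$ and $U_F=\{|\beta\xi+\overline\alpha|<1\}$ (the isometric circle and its interior). Let $\Gamma_0<\Gamma$ be a free subgroup of finite index for which $\Omega_0=\overline{\mathbb D\setminus\bigcup_{F\in\Gamma_0}U_F}$ is an ideal polygon, i.e. a polygon with $2d$ sides and all $2d$ vertices on $\partial\mathbb D$. Label its sides $s_a$ by a finite alphabet $\mathcal A$ with a fixed-point-free involution $a\mapsto\widehat a$, so that $F_a\in\Gamma_0$ maps $s_{\widehat a}$ onto $s_a$, $F_{\widehat a}=F_a^{-1}$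 and $s_a=I_{F_{\widehat a}}\cap\mathbb D$. Let $[a]$ be the arc of $\partial\mathbb D$ cut by $s_a$ (inside $U_{F_{\widehat a}}$), from $\xi_a^L$ to $\xi_a^R$ in the clockwise direction, containing $\xi^L_a$ and not $\xi^R_a$; let $o:\mathcal A\to\mathbb Z/2d\mathbb Z$ be the clockwise cyclic order: $o(b)=o(a)+1$ iff $\xi_a^R=\xi_b^L$. **Expansion.** The Bowen–Series map is $\xi\mapsto F_a^{-1}\xi$ for $\xi\in[a]$; the boundary expansion of $\xi\in\partial\mathbb D$ is the sequence $(a_k)$ of letters such that the $k$-th iterate of $\xi$ lies in $[a_k]$. A word $(a_0,\dots,a_n)$ is admissible if $a_{k+1}\ne\widehat{a_k}$ for all $k$, and $F_{a_0,\dots,a_n}=F_{a_0}\circ\cdots\circ F_{a_n}$. A non-empty word is *cuspidal* if it is an initial factor of an admissible word $(a_0,\dots,a_m)$ with $F_{a_0,\dots,a_m}$ parabolic and fixing a vertex of $\Omega_0$. A cuspidal word with $n\ge1$ has type $R$ (resp. $L$) if $o(a_{k+1})=o(\widehat{a_k})-1$ (resp. $+1$) for all $k<n$, and then $\xi_W=\xi_{a_0}^R$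 (resp. $\xi^L_{a_0}$). Its *geometric length* $|W|$ is the distance between the real parts of the vertical half-lines $(BA_k)^{-1}\varphi^{-1}(s_{a_0})$ and $(BA_k)^{-1}\varphi^{-1}(F_{a_0,\dots,a_{n-1}}s_{a_n})$, where $B\in\Gamma$ and $k$ are such that $\varphi(BA_k\cdot\infty)=\xi_W$; for a one-letter word $|W|=0$. The cuspidal decomposition $W_0,W_1,\dots$ of a sequence $(a_k)$ that is not eventually cuspidal is obtained by successively cutting off the longest cuspidal initial factor. For $0<T<\infty$ let $\mathcal W_T$ be the set of cuspidal words with $|W|\le T$, and let $\mathbb E_T\subset\partial\mathbb D$ be the set of points whose boundary expansion has a cuspidal decomposition with $|W_r|\le T$ for all $r$. **Subshift.** For cuspidal words $W=(b_0,\dots,b_m)$ and $W'=(a_0,\dots,a_n)$ put $M_{W,W'}=0$ if $a_0=\widehat{b_m}$; or if $m=0$ and $o(a_0)=o(\widehat{b_0})\pm1$; or if $m\ge1$, $W$ has type $L$ and $o(a_0)=o(\widehat{b_m})+1$; or if $m\ge1$, $W$ has type $R$ and $o(a_0)=o(\widehat{b_m})-1$. Otherwise $M_{W,W'}=1$, and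 in that case we say that $a_0$ may follow $W$. Let $\Sigma=\{(W_r)\in\mathcal W_T^{\mathbb N}:M_{W_r,W_{r+1}}=1\ \forall r\}$ with the shift $\sigma$ and the product topology. Let $\Pi:\Sigma\to\partial\mathbb D$ send $w=(W_r)$ to the point whose boundary expansion is the concatenation $W_0W_1\cdots$. Write $F_W=F_{a_0,\dots,a_n}$ for $W=(a_0,\dots,a_n)$ and $\phi_T(w)=-\log|D_{\Pi(w)}F_{W_0}^{-1}|$. For $\theta\in(0,1)$ let $\mathrm{Lip}(\Sigma,\theta)$ be the space of those $f:\Sigma\to\mathbb C$ for which there is a $C$ with $|f(w)-f(w')|\le C\theta^n$ whenever $n\in\mathbb N$ and $w,w'$ agree in the entries $0,\dots,n$. Call $\theta\in(0,1)$ a contraction factor if $|D_\xi F_W|\le\theta$ for every cuspidal $W$, every letter $a$ that may follow $W$ and every $\xi\in U_{F_{\widehat a}}$. For $0\le s\le1$ let $$(\mathcal L_{(s,T)}f)(w)=\sum_{\sigma(w')=w}e^{s\phi_T(w')}f(w').$$ $M$ is called aperiodic on $\mathcal W_T$ if for some $m$ any two elements of $\mathcal W_T$ are joined by a chain of exactly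 $m$ allowed transitions between elements of $\mathcal W_T$. **Proposition.** Contraction factors exist, and $M$ is aperiodic on $\mathcal W_T$ for all sufficiently large $T$. Let $\theta$ be a contraction factor and let $0<T<\infty$ be such that $M$ is aperiodic on $\mathcal W_T$. Then for every $s\in[0,1]$ the operator $\mathcal L_{(s,T)}$ acts on $\mathrm{Lip}(\Sigma,\theta)$ and has there a maximal eigenvalue $\lambda(s,T)>0$: it is an (algebraically) simple eigenvalue with an eigenfunction $h>0$, and the rest of the spectrum lies in a disc centred at $0$ of radius smaller than $\lambda(s,T)$. With $\psi=s\phi_T-\log h\circ\sigma+\log h-\log\lambda(s,T)$ there is a unique $\sigma$-invariant Borel probability measure $m_{(s,T)}$ on $\Sigma$ with $\mathcal L_\psi^*m_{(s,T)}=m_{(s,T)}$, and it is a Gibbs measure for $s\phi_T$ with pressure $\log\lambda(s,T)$. Moreover: 1. The function $P(s)=\log\lambda(s,T)$, $s\in[0,1]$, is continuous and strictly decreasing, with $P(0)>0$ and $P(1)\le0$. 2. $\dim_H(\mathbb E_T)=s_T$, where $s_T$ is the unique zero of $P$ in $[0,1]$, and the measure $\nu_{(s_T,T)}=\Pi_*m_{(s_T,T)}$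 is equivalent (mutually absolutely continuous) to the restriction to $\mathbb E_T$ of the $s_T$-dimensional Hausdorff measure. -/

import Mathlib

open scoped MatrixGroups UpperHalfPlane
open MeasureTheory

noncomputable section

namespace BowenSeries

universe u

/-! ### Fuchsian groups and the disc model -/

/-- The Dirichlet region of `Γ` centred at `p`. -/
def dirichletRegion (Γ : Subgroup SL(2, ℝ)) (p : ℍ) : Set ℍ :=
  {z | ∀ γ ∈ Γ, dist z p ≤ dist z (γ • p)}

/-- `Γ` is a non-uniform lattice: a discrete group with a Dirichlet region (centred at a point
that is fixed only by elements acting trivially) that has finite hyperbolic area and is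
not compact. -/
structure IsNonuniformLattice (Γ : Subgroup SL(2, ℝ)) : Prop where
  discrete : DiscreteTopology Γ
  exists_dirichletRegion : ∃ p : ℍ, (∀ γ ∈ Γ, γ • p = p → ∀ z : ℍ, γ • z = z) ∧
    volume (dirichletRegion Γ p) < ⊤ ∧ ¬ IsCompact (dirichletRegion Γ p)

/-- The point `g · ∞` of `ℝ ∪ {∞}`. -/
def imageOfInfty (g : SL(2, ℝ)) : OnePoint ℝ :=
  (g : GL (Fin 2) ℝ) • (OnePoint.infty : OnePoint ℝ)

/-- `z` is a parabolic fixed point of `Γ`. -/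
def IsParabolicPoint (Γ : Subgroup SL(2, ℝ)) (z : OnePoint ℝ) : Prop :=
  IsCusp z (Γ.map Matrix.SpecialLinearGroup.toGL)

/-- The points `S k · ∞` form a complete set of inequivalent parabolic fixed points of `Γ`. -/
structure IsCuspSystem (Γ : Subgroup SL(2, ℝ)) {p : ℕ} (S : Fin p → SL(2, ℝ)) : Prop where
  isParabolicPoint : ∀ k, IsParabolicPoint Γ (imageOfInfty (S k))
  existsUnique : ∀ z, IsParabolicPoint Γ z → ∃! k, ∃ γ ∈ Γ, imageOfInfty (γ * S k) = z

/-- The map `φ(z) = (z - i) / (z + i)` from the upper half plane to the unit disc. -/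
def cayley (z : ℍ) : ℂ := ((z : ℂ) - Complex.I) / ((z : ℂ) + Complex.I)

/-- The extension of `φ` to `ℝ ∪ {∞}`, with `φ(∞) = 1`. -/
def cayleyBoundary : OnePoint ℝ → ℂ
  | none => 1
  | some x => ((x : ℂ) - Complex.I) / ((x : ℂ) + Complex.I)

/-- The coefficient `α` of the matrix `[α, conj β; β, conj α]` of `SU(1,1)` that is conjugate
to `g` under `φ`. -/
def coeffAlpha (g : SL(2, ℝ)) : ℂ :=
  (((g 0 0 + g 1 1 : ℝ) : ℂ) + ((g 0 1 - g 1 0 : ℝ) : ℂ) * Complex.I) / 2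

/-- The coefficient `β` of the matrix `[α, conj β; β, conj α]` of `SU(1,1)` that is conjugate
to `g` under `φ`. -/
def coeffBeta (g : SL(2, ℝ)) : ℂ :=
  (((g 0 0 - g 1 1 : ℝ) : ℂ) + ((g 0 1 + g 1 0 : ℝ) : ℂ) * Complex.I) / 2

/-- The action of `g` in the disc model. -/
def discMap (g : SL(2, ℝ)) (ξ : ℂ) : ℂ :=
  (coeffAlpha g * ξ + starRingEnd ℂ (coeffBeta g)) /
    (coeffBeta g * ξ + starRingEnd ℂ (coeffAlpha g))

/-- The norm `|D_ξ F|` of the derivative of the disc action. -/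
def derivNorm (g : SL(2, ℝ)) (ξ : ℂ) : ℝ := ‖deriv (discMap g) ξ‖

/-- The isometric circle `|β ξ + conj α| = 1` (for `β ≠ 0`: centre `-conj α / β`,
radius `1 / |β|`). -/
def isoCircle (g : SL(2, ℝ)) : Set ℂ :=
  {ξ | ‖coeffBeta g * ξ + starRingEnd ℂ (coeffAlpha g)‖ = 1}

/-- The interior of the isometric circle (empty for `β = 0`, as then `|α| = 1`). -/
def isoDisc (g : SL(2, ℝ)) : Set ℂ :=
  {ξ | ‖coeffBeta g * ξ + starRingEnd ℂ (coeffAlpha g)‖ < 1}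

/-- The region `Ω₀`: the closure of the complement in the unit disc of all the interiors of
isometric circles of elements of `Γ₀`. -/
def fordRegion (Γ₀ : Subgroup SL(2, ℝ)) : Set ℂ :=
  closure (Metric.ball (0 : ℂ) 1 \ ⋃ g ∈ Γ₀, isoDisc g)

/-- The region `Ω₀` of `Γ₀` is an ideal polygon with `2d` sides, and its sides are labelled by the
letters of `A`: the side `s_a` lies on the isometric circle of `F_{hat a}`, and `F_a ∈ Γ₀` maps
`s_{hat a}` to `s_a`. The vertices are `e^{-i t_j}`, `j` modulo `2d`, in clockwise order, and
the side with label `a` cuts the arc between the consecutive vertices with indices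
`o a` and `o a + 1`; thus `o` is the cyclic order of the letters. -/
structure LabelledIdealPolygon (Γ₀ : Subgroup SL(2, ℝ)) (A : Type u) where
  /-- Half of the number of sides. -/
  d : ℕ
  /-- The involution of the alphabet. -/
  hat : A → A
  hat_hat : ∀ a, hat (hat a) = a
  hat_ne : ∀ a, hat a ≠ a
  /-- The cyclic order of the letters. -/
  o : A ≃ ZMod (2 * d)
  /-- The side pairings. -/
  F : A → SL(2, ℝ)
  F_mem : ∀ a, F a ∈ Γ₀
  F_hat : ∀ a, F (hat a) = (F a)⁻¹
  /-- The angles of the vertices, measured clockwise. -/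
  t : ℤ → ℝ
  t_strictMono : StrictMono t
  t_add : ∀ j, t (j + 2 * d) = t j + 2 * Real.pi
  isoDisc_inter : ∀ a, isoDisc (F (hat a)) ∩ Metric.sphere (0 : ℂ) 1 =
    {ξ | ∃ x : ℝ, t (o a).cast < x ∧ x < t ((o a).cast + 1) ∧ ξ = Complex.exp (-(x * Complex.I))}
  fordRegion_eq : fordRegion Γ₀ = closure (Metric.ball (0 : ℂ) 1 \ ⋃ a, isoDisc (F a))

namespace LabelledIdealPolygon

variable {Γ₀ : Subgroup SL(2, ℝ)} {A : Type u} (P : LabelledIdealPolygon Γ₀ A)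

/-! ### The Bowen-Series expansion -/

/-- The vertex `e^{-i t_j}`. -/
def vertex (j : ℤ) : ℂ := Complex.exp (-(P.t j * Complex.I))

/-- The left endpoint `ξ_a^L` of the arc of `a`. -/
def leftEnd (a : A) : ℂ := P.vertex (P.o a).cast

/-- The right endpoint `ξ_a^R` of the arc of `a`. -/
def rightEnd (a : A) : ℂ := P.vertex ((P.o a).cast + 1)

/-- The right open arc `[a]` (clockwise orientation) cut by the side `s_a`. -/
def arc (a : A) : Set ℂ :=
  {ξ | ∃ x : ℝ, P.t (P.o a).cast ≤ x ∧ x < P.t ((P.o a).cast + 1) ∧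
    ξ = Complex.exp (-(x * Complex.I))}

/-- The side `s_a`, transported to the upper half plane. -/
def side (a : A) : Set ℍ := {z | cayley z ∈ isoCircle (P.F (P.hat a))}

open Classical in
/-- The Bowen-Series map of the unit circle: `ξ ↦ F_a⁻¹ ξ` for `ξ ∈ [a]` (the arcs are a partition
of the circle; outside the circle the value is irrelevant). -/
def bowenSeriesMap (ξ : ℂ) : ℂ :=
  if h : ∃ a, ξ ∈ P.arc a then discMap (P.F h.choose)⁻¹ ξ else ξ

/-- `(a_k)` is the boundary expansion of `ξ`. -/
def IsBoundaryExpansion (ξ : ℂ) (a : ℕ → A) : Prop :=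
  ∀ k, P.bowenSeriesMap^[k] ξ ∈ P.arc (a k)

/-- The arc `[a_0, …, a_n]` of a finite word. -/
def wordArc (W : List A) : Set ℂ :=
  {ξ | ξ ∈ Metric.sphere (0 : ℂ) 1 ∧
    ∀ (k : ℕ) (hk : k < W.length), P.bowenSeriesMap^[k] ξ ∈ P.arc W[k]}

/-- The element `F_{a_0, …, a_n} = F_{a_0} ∘ ⋯ ∘ F_{a_n}`. -/
def wordMap (W : List A) : SL(2, ℝ) := (W.map P.F).prod

/-- The no backtracking condition. -/
def Admissible (W : List A) : Prop := W.IsChain fun a b => b ≠ P.hat a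

/-! ### Cuspidal words -/

/-- `W` is a cuspidal word: a non-empty initial factor of an admissible word whose element
is parabolic and fixes a vertex of the polygon. -/
def IsCuspidal (W : List A) : Prop :=
  W ≠ [] ∧ ∃ V : List A, P.Admissible (W ++ V) ∧
    (P.wordMap (W ++ V) : Matrix (Fin 2) (Fin 2) ℝ).IsParabolic ∧
    ∃ j, discMap (P.wordMap (W ++ V)) (P.vertex j) = P.vertex j

/-- The type of the (cuspidal) word `W`, of at least two letters, is `R`. -/
def IsRight (W : List A) : Prop :=
  2 ≤ W.length ∧ W.IsChain fun a b => P.o b = P.o (P.hat a) - 1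

/-- The type of the (cuspidal) word `W`, of at least two letters, is `L`. -/
def IsLeft (W : List A) : Prop :=
  2 ≤ W.length ∧ W.IsChain fun a b => P.o b = P.o (P.hat a) + 1

open Classical in
/-- The vertex `ξ_W` of a cuspidal word. -/
def cuspVertex : List A → ℂ
  | [] => 0
  | a :: V => if P.IsLeft (a :: V) then P.leftEnd a else P.rightEnd a

/-- The letter `a` may follow the cuspidal word `W`. -/
def Follows (W : List A) (a : A) : Prop :=
  ∀ b ∈ W.getLast?, a ≠ P.hat b ∧
    (W.length = 1 → P.o a ≠ P.o (P.hat b) + 1 ∧ P.o a ≠ P.o (P.hat b) - 1) ∧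
    (P.IsLeft W → P.o a ≠ P.o (P.hat b) + 1) ∧
    (P.IsRight W → P.o a ≠ P.o (P.hat b) - 1)

/-- The relation `M_{W, W'} = 1` given by the transition matrix. -/
def Transition (W W' : List A) : Prop := ∀ a ∈ W'.head?, P.Follows W a

/-- `(W_r)` is the cuspidal decomposition of the sequence `(a_k)`: for every `r`, `W_r` is the
longest cuspidal word that `(a_k)` presents from the end `n r` of the previous words on. (An
eventually cuspidal sequence has no cuspidal decomposition.) -/
def IsCuspidalDecomposition (a : ℕ → A) (W : ℕ → List A) : Prop :=
  ∃ n : ℕ → ℕ, n 0 = 0 ∧ ∀ r, n r < n (r + 1) ∧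
    W r = (List.range (n (r + 1) - n r)).map (fun i => a (n r + i)) ∧
    P.IsCuspidal (W r) ∧
    ∀ N, n (r + 1) < N → ¬ P.IsCuspidal ((List.range (N - n r)).map fun i => a (n r + i))

/-- `θ ∈ (0, 1)` bounds the derivatives of the inverse branches of the cuspidal acceleration: for
every cuspidal word `W` and every letter `a` that may follow `W`, `|D_ξ F_W| ≤ θ` for all `ξ` in
the interior of the isometric circle through the endpoints of `[a]`. -/
def IsContractionFactor (θ : ℝ) : Prop :=
  0 < θ ∧ θ < 1 ∧ ∀ W, P.IsCuspidal W → ∀ a, P.Follows W a →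
    ∀ ξ ∈ isoDisc (P.F (P.hat a)), derivNorm (P.wordMap W) ξ ≤ θ

end LabelledIdealPolygon

/-! ### Geometric length and the Cantor set -/

/-- The distance `Δ(e, e', ξ)` of two geodesics ending at the vertex `ξ`: if `ξ = φ(B S_k ∞)`
with `B ∈ Γ`, it is the distance between the constant real parts of `(B S_k)⁻¹ e` and
`(B S_k)⁻¹ e'`. The set below has exactly one element for such data. -/
def cuspDist (Γ : Subgroup SL(2, ℝ)) {p : ℕ} (S : Fin p → SL(2, ℝ)) (e e' : Set ℍ) (ξ : ℂ) : ℝ :=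
  sSup {x | ∃ B ∈ Γ, ∃ k, cayleyBoundary (imageOfInfty (B * S k)) = ξ ∧
    ∃ z ∈ e, ∃ z' ∈ e', x = |((B * S k)⁻¹ • z).re - ((B * S k)⁻¹ • z').re|}

variable {Γ₀ : Subgroup SL(2, ℝ)} {A : Type u} (Γ : Subgroup SL(2, ℝ)) {p : ℕ}
  (S : Fin p → SL(2, ℝ)) (P : LabelledIdealPolygon Γ₀ A)

/-- The geometric length `|W|` of a cuspidal word `W = (a_0, …, a_n)`:
`Δ(s_{a_0}, F_{a_0, …, a_{n-1}}(s_{a_n}), ξ_W)` for `n ≥ 1`, and `0` for `n = 0`. -/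
def geomLength (W : List A) : ℝ :=
  if h : 2 ≤ W.length then
    cuspDist Γ S (P.side (W.head (List.ne_nil_of_length_pos (by omega))))
      ((fun z : ℍ => P.wordMap W.dropLast • z) ''
        P.side (W.getLast (List.ne_nil_of_length_pos (by omega))))
      (P.cuspVertex W)
  else 0

/-- The Cantor set `𝔼_T`. -/
def cantorSet (T : ℝ) : Set ℂ :=
  {ξ | ξ ∈ Metric.sphere (0 : ℂ) 1 ∧ ∃ (a : ℕ → A) (W : ℕ → List A),
    P.IsBoundaryExpansion ξ a ∧ P.IsCuspidalDecomposition a W ∧ ∀ r, geomLength Γ S P (W r) ≤ T}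

/-! ### The subshift -/

/-- The alphabet `𝒲_T` of cuspidal words of geometric length at most `T`. -/
def Alphabet (T : ℝ) : Type u := {W : List A // P.IsCuspidal W ∧ geomLength Γ S P W ≤ T}

instance (T : ℝ) : TopologicalSpace (Alphabet Γ S P T) := ⊥

instance (T : ℝ) : DiscreteTopology (Alphabet Γ S P T) := ⟨rfl⟩

/-- The transition matrix on `𝒲_T` is aperiodic: for some `m`, any two words are joined by a
chain of exactly `m` allowed transitions. -/
def IsAperiodic (T : ℝ) : Prop :=
  ∃ m : ℕ, ∀ W W' : Alphabet Γ S P T, ∃ c : ℕ → Alphabet Γ S P T,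
    c 0 = W ∧ c m = W' ∧ ∀ i < m, P.Transition (c i).1 (c (i + 1)).1

/-- The shift space `Σ`. -/
def ShiftSpace (T : ℝ) : Type u :=
  {w : ℕ → Alphabet Γ S P T // ∀ r, P.Transition (w r).1 (w (r + 1)).1}

instance (T : ℝ) : TopologicalSpace (ShiftSpace Γ S P T) :=
  inferInstanceAs (TopologicalSpace {w : ℕ → Alphabet Γ S P T //
    ∀ r, P.Transition (w r).1 (w (r + 1)).1})

instance (T : ℝ) : MeasurableSpace (ShiftSpace Γ S P T) := borel _

instance (T : ℝ) : BorelSpace (ShiftSpace Γ S P T) := ⟨rfl⟩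

variable {Γ S P} {T : ℝ}

/-- The `r`-th cuspidal word of a point of the shift space. -/
def ShiftSpace.word (w : ShiftSpace Γ S P T) (r : ℕ) : List A := (w.1 r).1

/-- The shift map `σ`. -/
def ShiftSpace.shift (w : ShiftSpace Γ S P T) : ShiftSpace Γ S P T :=
  ⟨fun r => w.1 (r + 1), fun r => w.2 (r + 1)⟩

/-- The cylinder of the points whose first `n` words are those of `w`. -/
def ShiftSpace.cylinder (w : ShiftSpace Γ S P T) (n : ℕ) : Set (ShiftSpace Γ S P T) :=
  {w' | ∀ r < n, w'.1 r = w.1 r}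

/-- The coding map `Π(w) = [W_0 * W_1 * ⋯]`: the unique point that lies in the arcs of all the
words `W_0 * ⋯ * W_r`. -/
def ShiftSpace.code (w : ShiftSpace Γ S P T) : ℂ :=
  Classical.epsilon fun ξ => ∀ r, ξ ∈ P.wordArc ((List.range (r + 1)).flatMap w.word)

/-- The potential `φ_T(w) = - log |D_{Π(w)} F_{W_0}⁻¹|`. -/
def potential (w : ShiftSpace Γ S P T) : ℝ :=
  -Real.log (derivNorm (P.wordMap (w.word 0))⁻¹ w.code)

/-! ### Transfer operators -/

/-- The transfer operator `(ℒ_φ f)(w) = ∑_{σ(w') = w} e^{φ(w')} f(w')`. -/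
def transfer (φ : ShiftSpace Γ S P T → ℝ) (f : ShiftSpace Γ S P T → ℂ)
    (w : ShiftSpace Γ S P T) : ℂ :=
  ∑' w' : {w' : ShiftSpace Γ S P T // w'.shift = w}, (Real.exp (φ w'.1) : ℂ) * f w'.1

variable (Γ S P T) in
/-- The space `Lip(Σ, θ)`: functions `f` with `var_n(f) ≤ C θ^n` for all `n`. -/
def lipschitzSpace (θ : ℝ) : Submodule ℂ (ShiftSpace Γ S P T → ℂ) where
  carrier := {f | ∃ C : ℝ, ∀ (n : ℕ) (w w' : ShiftSpace Γ S P T),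
    (∀ r ≤ n, w.1 r = w'.1 r) → ‖f w - f w'‖ ≤ C * θ ^ n}
  zero_mem' := ⟨0, fun n w w' _ => by simp⟩
  add_mem' := by
    rintro f g ⟨C, hC⟩ ⟨D, hD⟩
    refine ⟨C + D, fun n w w' h => ?_⟩
    calc ‖(f + g) w - (f + g) w'‖ = ‖(f w - f w') + (g w - g w')‖ := by
          simp only [Pi.add_apply]; congr 1; ring
      _ ≤ ‖f w - f w'‖ + ‖g w - g w'‖ := norm_add_le _ _
      _ ≤ (C + D) * θ ^ n := by rw [add_mul]; exact add_le_add (hC n w w' h) (hD n w w' h)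
  smul_mem' := by
    rintro c f ⟨C, hC⟩
    refine ⟨‖c‖ * C, fun n w w' h => ?_⟩
    calc ‖(c • f) w - (c • f) w'‖ = ‖c‖ * ‖f w - f w'‖ := by
          simp only [Pi.smul_apply, smul_eq_mul, ← mul_sub, norm_mul]
      _ ≤ ‖c‖ * C * θ ^ n := by
          rw [mul_assoc]; exact mul_le_mul_of_nonneg_left (hC n w w' h) (norm_nonneg c)

/-- `lam` is the maximal eigenvalue of `ℒ_φ` on `Lip(Σ, θ)`, with positive eigenfunction `h`:
`ℒ_φ` acts on `Lip(Σ, θ)`, `lam > 0` is an algebraically simple eigenvalue, and the rest of the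
spectrum lies in a disc around `0` of radius smaller than `lam`. (The spectrum of a bounded
operator of a Banach space is the set of `z` for which `z - ℒ` is not bijective.) -/
structure IsMaximalEigenpair (θ : ℝ) (φ : ShiftSpace Γ S P T → ℝ) (lam : ℝ)
    (h : ShiftSpace Γ S P T → ℝ) : Prop where
  lam_pos : 0 < lam
  h_pos : ∀ w, 0 < h w
  h_mem : (fun w => (h w : ℂ)) ∈ lipschitzSpace Γ S P T θ
  eigen : ∀ w, transfer φ (fun w => (h w : ℂ)) w = lam * h w
  spectral : ∃ L : Module.End ℂ (lipschitzSpace Γ S P T θ),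
    (∀ f w, (L f : ShiftSpace Γ S P T → ℂ) w = transfer φ (f : ShiftSpace Γ S P T → ℂ) w) ∧
    Module.finrank ℂ (L.maxGenEigenspace (lam : ℂ)) = 1 ∧
    ∃ ρ < lam, ∀ z ∈ spectrum ℂ L, z ≠ (lam : ℂ) → ‖z‖ ≤ ρ

/-- The normalized potential `ψ = φ - log h ∘ σ + log h - log lam`. -/
def normalizedPotential (φ : ShiftSpace Γ S P T → ℝ) (lam : ℝ) (h : ShiftSpace Γ S P T → ℝ)
    (w : ShiftSpace Γ S P T) : ℝ :=
  φ w - Real.log (h w.shift) + Real.log (h w) - Real.log lam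

/-- `m` is a shift invariant Borel probability measure with `ℒ_ψ^* m = m`. -/
structure IsInvariantFixedMeasure (ψ : ShiftSpace Γ S P T → ℝ)
    (m : Measure (ShiftSpace Γ S P T)) : Prop where
  isProbabilityMeasure : IsProbabilityMeasure m
  invariant : MeasurePreserving ShiftSpace.shift m m
  fixed : ∀ f : ShiftSpace Γ S P T → ℂ, Continuous f → ∫ w, transfer ψ f w ∂m = ∫ w, f w ∂m

/-- `m` is a Gibbs measure for `φ` with pressure `Q`. -/
def IsGibbs (φ : ShiftSpace Γ S P T → ℝ) (Q : ℝ) (m : Measure (ShiftSpace Γ S P T)) : Prop :=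
  IsProbabilityMeasure m ∧ ∃ C : ℝ, 1 < C ∧ ∀ (w : ShiftSpace Γ S P T) (n : ℕ),
    1 / C ≤ m.real (w.cylinder n) /
      Real.exp (-(n * Q) + ∑ k ∈ Finset.range n, φ (ShiftSpace.shift^[k] w)) ∧
    m.real (w.cylinder n) /
      Real.exp (-(n * Q) + ∑ k ∈ Finset.range n, φ (ShiftSpace.shift^[k] w)) ≤ C

end BowenSeries

end

/-! The geometry is reduced to a mixing subshift of finite type with a Hölder potential, and the
thermodynamic formalism, proved here with cones of positive functions, does the rest.

Geometry. In the disc model `|D_ξ F| = |den|⁻²`, and `|Fξ - Fη|` is exactly `|ξ - η|` times the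
geometric mean of the two derivatives (`norm_discMap_sub`). The way the isometric circles cut the
unit circle determines the coefficients of the side pairings (`exists_coeff`): the discs bounded by
these circles touch only at vertices, and a side pairing exchanges the ends of its arcs crosswise.
Following a vertex through the side pairings is therefore a permutation `turn` of the letters, and
the cuspidal words are exactly the chains of turns of one type (`isCuspidal_iff`). A letter may
follow a cuspidal word when it neither backtracks nor prolongs the word to a longer cuspidal one
(`follows_iff`). Derivatives of modulus one occur only at vertices, so cutting a sequence at maximal
cuspidal words restores uniform contraction (`exists_isContractionFactor`). Nested arcs then shrink
to single points that never meet an end of an arc, and the coding map is a continuous injection onto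
the Cantor set (`cantorSet_eq_range`). The alphabet is finite: seen from a cusp, the sides met by a
chain of turns are vertical lines that a parabolic element translates, so their distance grows with
the length of the chain (`exists_cuspLength_bound`); discreteness makes this distance independent of
the coordinates at the cusp (`cuspLength_eq`).

Thermodynamics. A positive eigenfunction comes from maximising `lam` subject to `lam f ≤ L f` on a
compact slice of a cone; mixing turns any strict inequality into an improvement
(`exists_transferReal_eq`). After normalisation to `L 1 = 1` a fixed power of `L` splits off a
definite constant and stays in the cone (`exists_split`), so iterates of Hölder functions converge
exponentially to constants (`exists_decay`). Spectral gap, simplicity, the measure, its invariance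
and its uniqueness all follow from this convergence; the Gibbs property follows by tracking
cylinders one entry at a time (`exists_gibbs_bounds`).

Pressure and dimension. Eigenvalues of positive operators with bounded eigenfunctions are compared
by `eigenvalue_le`: `-B ≤ φ_T ≤ log θ < 0` gives continuity and strict decrease, and two symbols
give `P(0) > 0`. A cylinder has diameter comparable to the exponential of the Birkhoff sum of `φ_T`,
in the sense that two points separated at order `n` are at least that far apart up to a factor
(`exists_norm_code_sub_bounds`). At pressure zero its Gibbs mass is comparable to the exponential of
`s` times that sum. The mass distribution principle and coverings by cylinders then compare the
push-forward with Hausdorff measure in both directions. With pressure `Q > 0` at `s = 1` the same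
bound would make the push-forward smaller than every multiple of the length of the circle, whence
`P(1) ≤ 0`. -/

namespace BowenSeries

open ComplexConjugate Complex

/-! ### The action of `SU(1,1)` on the disc -/

/-- The denominator `β ξ + conj α` of the disc action. -/
noncomputable def den (g : SL(2, ℝ)) (ξ : ℂ) : ℂ := coeffBeta g * ξ + conj (coeffAlpha g)

lemma det_entries (g : SL(2, ℝ)) : g 0 0 * g 1 1 - g 0 1 * g 1 0 = 1 := by
  have := g.det_coe
  rwa [Matrix.det_fin_two] at this

lemma coeffAlpha_re (g : SL(2, ℝ)) : (coeffAlpha g).re = (g 0 0 + g 1 1) / 2 := by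
  simp [coeffAlpha]

lemma coeffAlpha_im (g : SL(2, ℝ)) : (coeffAlpha g).im = (g 0 1 - g 1 0) / 2 := by
  simp [coeffAlpha]

lemma coeffBeta_re (g : SL(2, ℝ)) : (coeffBeta g).re = (g 0 0 - g 1 1) / 2 := by
  simp [coeffBeta]

lemma coeffBeta_im (g : SL(2, ℝ)) : (coeffBeta g).im = (g 0 1 + g 1 0) / 2 := by
  simp [coeffBeta]

lemma coeffAlpha_mul (g h : SL(2, ℝ)) :
    coeffAlpha (g * h) = coeffAlpha g * coeffAlpha h + conj (coeffBeta g) * coeffBeta h := by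
  apply Complex.ext <;>
  simp [coeffAlpha_re, coeffAlpha_im, coeffBeta_re, coeffBeta_im, Matrix.mul_apply,
    Fin.sum_univ_two] <;> ring

lemma coeffBeta_mul (g h : SL(2, ℝ)) :
    coeffBeta (g * h) = coeffBeta g * coeffAlpha h + conj (coeffAlpha g) * coeffBeta h := by
  apply Complex.ext <;>
  simp [coeffAlpha_re, coeffAlpha_im, coeffBeta_re, coeffBeta_im, Matrix.mul_apply,
    Fin.sum_univ_two] <;> ring

lemma coeffAlpha_one : coeffAlpha 1 = 1 := by
  apply Complex.ext <;> simp [coeffAlpha_re, coeffAlpha_im]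

lemma coeffBeta_one : coeffBeta 1 = 0 := by
  apply Complex.ext <;> simp [coeffBeta_re, coeffBeta_im]

lemma coeffAlpha_inv (g : SL(2, ℝ)) : coeffAlpha g⁻¹ = conj (coeffAlpha g) := by
  apply Complex.ext <;>
  simp [coeffAlpha_re, coeffAlpha_im, Matrix.SpecialLinearGroup.coe_inv,
    Matrix.adjugate_fin_two] <;> ring

lemma coeffBeta_inv (g : SL(2, ℝ)) : coeffBeta g⁻¹ = -coeffBeta g := by
  apply Complex.ext <;>
  simp [coeffBeta_re, coeffBeta_im, Matrix.SpecialLinearGroup.coe_inv,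
    Matrix.adjugate_fin_two] <;> ring

lemma coeff_mul_conj (g : SL(2, ℝ)) :
    coeffAlpha g * conj (coeffAlpha g) - coeffBeta g * conj (coeffBeta g) = 1 := by
  have h := det_entries g
  apply Complex.ext
  · simp [coeffAlpha_re, coeffAlpha_im, coeffBeta_re, coeffBeta_im]
    linear_combination h
  · simp [coeffAlpha_re, coeffAlpha_im, coeffBeta_re, coeffBeta_im]
    ring

lemma norm_coeff_sq (g : SL(2, ℝ)) : ‖coeffAlpha g‖ ^ 2 - ‖coeffBeta g‖ ^ 2 = 1 := by
  have h := coeff_mul_conj g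
  rw [Complex.mul_conj, Complex.mul_conj, Complex.normSq_eq_norm_sq, Complex.normSq_eq_norm_sq] at h
  exact_mod_cast h

lemma norm_coeffBeta_lt (g : SL(2, ℝ)) : ‖coeffBeta g‖ < ‖coeffAlpha g‖ := by
  have := norm_coeff_sq g
  nlinarith [norm_nonneg (coeffAlpha g), norm_nonneg (coeffBeta g)]

lemma den_ne_zero (g : SL(2, ℝ)) {ξ : ℂ} (hξ : ‖ξ‖ = 1) : den g ξ ≠ 0 := by
  intro h
  have h1 : coeffBeta g * ξ = -conj (coeffAlpha g) := by
    rw [den] at h; linear_combination h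
  have h2 := congrArg norm h1
  rw [norm_mul, hξ, norm_neg, Complex.norm_conj, mul_one] at h2
  exact (norm_coeffBeta_lt g).ne h2

lemma discMap_eq (g : SL(2, ℝ)) (ξ : ℂ) :
    discMap g ξ = (coeffAlpha g * ξ + conj (coeffBeta g)) / den g ξ := rfl

lemma mul_conj_of_norm_one {ξ : ℂ} (hξ : ‖ξ‖ = 1) : ξ * conj ξ = 1 := by
  rw [Complex.mul_conj, Complex.normSq_eq_norm_sq, hξ]; norm_num

/-- On the unit circle the numerator of the disc action is determined by the denominator. -/
lemma discMap_eq_of_norm_one (g : SL(2, ℝ)) {ξ : ℂ} (hξ : ‖ξ‖ = 1) :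
    discMap g ξ = ξ * conj (den g ξ) / den g ξ := by
  rw [discMap_eq]
  congr 1
  simp only [den, map_add, map_mul, Complex.conj_conj]
  linear_combination (-conj (coeffBeta g)) * mul_conj_of_norm_one hξ

lemma norm_discMap (g : SL(2, ℝ)) {ξ : ℂ} (hξ : ‖ξ‖ = 1) : ‖discMap g ξ‖ = 1 := by
  have h0 : ‖den g ξ‖ ≠ 0 := by simpa using den_ne_zero g hξ
  rw [discMap_eq_of_norm_one g hξ, norm_div, norm_mul, Complex.norm_conj, hξ, one_mul, div_self h0]

/-- This cocycle relation is the chain rule: `|D_ξ g|` is `‖den g ξ‖⁻²`, so derivatives of long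
words reduce to products of denominators. -/
lemma den_mul (g h : SL(2, ℝ)) {ξ : ℂ} (h0 : den h ξ ≠ 0) :
    den (g * h) ξ = den g (discMap h ξ) * den h ξ := by
  rw [discMap_eq]
  simp only [den, coeffAlpha_mul, coeffBeta_mul, map_add, map_mul, Complex.conj_conj] at h0 ⊢
  field_simp
  ring

lemma discMap_mul (g h : SL(2, ℝ)) {ξ : ℂ} (h0 : den h ξ ≠ 0) :
    discMap (g * h) ξ = discMap g (discMap h ξ) := by
  by_cases h1 : den g (discMap h ξ) = 0
  · rw [discMap_eq, den_mul g h h0, h1, zero_mul, div_zero, discMap_eq g, h1, div_zero]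
  rw [discMap_eq (g * h), den_mul g h h0, discMap_eq g, div_eq_div_iff (mul_ne_zero h1 h0) h1]
  have e : discMap h ξ * den h ξ = coeffAlpha h * ξ + conj (coeffBeta h) := by
    rw [discMap_eq]; field_simp
  simp only [coeffAlpha_mul, coeffBeta_mul, map_add, map_mul, Complex.conj_conj]
  simp only [den] at e ⊢
  linear_combination (-coeffAlpha g * (coeffBeta g * discMap h ξ + conj (coeffAlpha g))) * e

lemma discMap_one (ξ : ℂ) : discMap 1 ξ = ξ := by
  simp [discMap, coeffAlpha_one, coeffBeta_one]

lemma den_one (ξ : ℂ) : den 1 ξ = 1 := by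
  simp [den, coeffAlpha_one, coeffBeta_one]

lemma discMap_inv_discMap (g : SL(2, ℝ)) {ξ : ℂ} (h0 : den g ξ ≠ 0) :
    discMap g⁻¹ (discMap g ξ) = ξ := by
  rw [← discMap_mul g⁻¹ g h0, inv_mul_cancel, discMap_one]

lemma discMap_discMap_inv (g : SL(2, ℝ)) {ξ : ℂ} (h0 : den g⁻¹ ξ ≠ 0) :
    discMap g (discMap g⁻¹ ξ) = ξ := by
  rw [← discMap_mul g g⁻¹ h0, mul_inv_cancel, discMap_one]

lemma den_inv_mul_den (g : SL(2, ℝ)) {ξ : ℂ} (h0 : den g ξ ≠ 0) :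
    den g⁻¹ (discMap g ξ) * den g ξ = 1 := by
  rw [← den_mul g⁻¹ g h0, inv_mul_cancel, den_one]

lemma norm_den_inv (g : SL(2, ℝ)) {ξ : ℂ} (h0 : den g ξ ≠ 0) :
    ‖den g⁻¹ (discMap g ξ)‖ = ‖den g ξ‖⁻¹ := by
  have := congrArg norm (den_inv_mul_den g h0)
  rw [norm_mul, norm_one] at this
  exact eq_inv_of_mul_eq_one_left this

lemma hasDerivAt_discMap (g : SL(2, ℝ)) {ξ : ℂ} (h0 : den g ξ ≠ 0) :
    HasDerivAt (discMap g) (1 / den g ξ ^ 2) ξ := by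
  have h1 : HasDerivAt (fun x => coeffAlpha g * x + conj (coeffBeta g)) (coeffAlpha g) ξ := by
    simpa using ((hasDerivAt_id ξ).const_mul (coeffAlpha g)).add_const (conj (coeffBeta g))
  have h2 : HasDerivAt (fun x => den g x) (coeffBeta g) ξ := by
    simpa [den] using ((hasDerivAt_id ξ).const_mul (coeffBeta g)).add_const (conj (coeffAlpha g))
  have h3 := h1.div h2 h0
  have e : (1 : ℂ) / den g ξ ^ 2 = (coeffAlpha g * den g ξ
      - (coeffAlpha g * ξ + conj (coeffBeta g)) * coeffBeta g) / den g ξ ^ 2 := by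
    rw [div_left_inj' (pow_ne_zero 2 h0)]
    simp only [den]
    linear_combination -coeff_mul_conj g
  rw [e]
  exact h3

lemma derivNorm_eq (g : SL(2, ℝ)) {ξ : ℂ} (h0 : den g ξ ≠ 0) :
    derivNorm g ξ = 1 / ‖den g ξ‖ ^ 2 := by
  rw [derivNorm, (hasDerivAt_discMap g h0).deriv, norm_div, norm_one, norm_pow]

lemma derivNorm_pos (g : SL(2, ℝ)) {ξ : ℂ} (h0 : den g ξ ≠ 0) : 0 < derivNorm g ξ := by
  rw [derivNorm_eq g h0]
  have : 0 < ‖den g ξ‖ := norm_pos_iff.2 h0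
  positivity

lemma derivNorm_mul (g h : SL(2, ℝ)) {ξ : ℂ} (h0 : den h ξ ≠ 0) (h1 : den g (discMap h ξ) ≠ 0) :
    derivNorm (g * h) ξ = derivNorm g (discMap h ξ) * derivNorm h ξ := by
  rw [derivNorm_eq g h1, derivNorm_eq h h0, derivNorm_eq, den_mul g h h0, norm_mul]
  · field_simp
  · rw [den_mul g h h0]; exact mul_ne_zero h1 h0

/-- Since the determinant is one, the difference quotient is exactly a geometric mean of
derivatives, without error term. The metric estimates for the coding map rest on this. -/
lemma discMap_sub (g : SL(2, ℝ)) {ξ η : ℂ} (h0 : den g ξ ≠ 0) (h1 : den g η ≠ 0) :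
    discMap g ξ - discMap g η = (ξ - η) / (den g ξ * den g η) := by
  rw [discMap_eq, discMap_eq, div_sub_div _ _ h0 h1]
  congr 1
  simp only [den]
  linear_combination (ξ - η) * coeff_mul_conj g

lemma norm_discMap_sub (g : SL(2, ℝ)) {ξ η : ℂ} (h0 : den g ξ ≠ 0) (h1 : den g η ≠ 0) :
    ‖discMap g ξ - discMap g η‖ = ‖ξ - η‖ / (‖den g ξ‖ * ‖den g η‖) := by
  rw [discMap_sub g h0 h1, norm_div, norm_mul]

lemma isoDisc_eq (g : SL(2, ℝ)) : isoDisc g = {ξ | ‖den g ξ‖ < 1} := rfl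

lemma isoCircle_eq (g : SL(2, ℝ)) : isoCircle g = {ξ | ‖den g ξ‖ = 1} := rfl

lemma continuous_den (g : SL(2, ℝ)) : Continuous (den g) := by
  unfold den; fun_prop

/-- The square of the denominator as a function of the point. -/
lemma normSq_den (g : SL(2, ℝ)) (ξ : ℂ) :
    ‖den g ξ‖ ^ 2 - 1 =
      (‖ξ‖ ^ 2 + 1) * ‖coeffBeta g‖ ^ 2 + 2 * (coeffAlpha g * coeffBeta g * ξ).re := by
  have h := norm_coeff_sq g
  have h2 : ‖den g ξ‖ ^ 2 = ‖coeffBeta g‖ ^ 2 * ‖ξ‖ ^ 2 + ‖coeffAlpha g‖ ^ 2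
      + 2 * (coeffAlpha g * coeffBeta g * ξ).re := by
    rw [den]
    simp only [← Complex.normSq_eq_norm_sq, Complex.normSq_apply]
    simp
    ring
  rw [h2]
  linear_combination h

end BowenSeries

namespace BowenSeries

namespace LabelledIdealPolygon

open ComplexConjugate

variable {Γ₀ : Subgroup SL(2, ℝ)} {A : Type*} (P : LabelledIdealPolygon Γ₀ A)

/-! ### The arcs of an ideal polygon -/

/-- The point `e^{-ix}` of the unit circle. -/
noncomputable def pt (x : ℝ) : ℂ := Complex.exp (-(x * Complex.I))

lemma norm_pt (x : ℝ) : ‖pt x‖ = 1 := by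
  rw [pt, ← neg_mul, ← Complex.ofReal_neg, Complex.norm_exp_ofReal_mul_I]

lemma continuous_pt : Continuous pt := by unfold pt; fun_prop

lemma pt_eq_pt_iff {x y : ℝ} : pt x = pt y ↔ ∃ k : ℤ, y = x + 2 * Real.pi * k := by
  rw [pt, pt, Complex.exp_eq_exp_iff_exists_int]
  constructor
  · rintro ⟨k, hk⟩
    refine ⟨k, ?_⟩
    have := congrArg Complex.im hk
    simp at this
    linarith
  · rintro ⟨k, rfl⟩
    refine ⟨k, ?_⟩
    push_cast
    ring

lemma exists_eq_pt {ξ : ℂ} (hξ : ‖ξ‖ = 1) : ∃ x : ℝ, ξ = pt x := by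
  refine ⟨-ξ.arg, ?_⟩
  have := Complex.norm_mul_exp_arg_mul_I ξ
  rw [hξ, Complex.ofReal_one, one_mul] at this
  rw [pt]
  push_cast
  rw [neg_mul, neg_neg, this]

lemma re_exp_mul_pt (m x : ℝ) : (Complex.exp (m * Complex.I) * pt x).re = Real.cos (x - m) := by
  rw [pt, ← Complex.exp_add, show (m : ℂ) * Complex.I + -(x * Complex.I)
    = ((m - x : ℝ) : ℂ) * Complex.I by push_cast; ring, Complex.exp_ofReal_mul_I_re,
    ← Real.cos_neg]
  congr 1; ring

lemma im_exp_mul_pt (m x : ℝ) : (Complex.exp (m * Complex.I) * pt x).im = Real.sin (m - x) := by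
  rw [pt, ← Complex.exp_add, show (m : ℂ) * Complex.I + -(x * Complex.I)
    = ((m - x : ℝ) : ℂ) * Complex.I by push_cast; ring, Complex.exp_ofReal_mul_I_im]

lemma d_ne_zero : P.d ≠ 0 := by
  intro h
  have := P.t_add 0
  rw [h] at this
  simp at this

lemma t_add_mul (j k : ℤ) : P.t (j + 2 * P.d * k) = P.t j + 2 * Real.pi * k := by
  induction k using Int.induction_on with
  | zero => simp
  | succ k ih =>
    rw [show j + 2 * P.d * ((k : ℤ) + 1) = (j + 2 * P.d * k) + 2 * P.d by ring, P.t_add, ih]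
    push_cast; ring
  | pred k ih =>
    have := P.t_add (j + 2 * P.d * (-(k : ℤ) - 1))
    rw [show (j + 2 * P.d * (-(k : ℤ) - 1)) + 2 * P.d = j + 2 * P.d * (-(k : ℤ)) by ring, ih] at this
    push_cast at this ⊢
    linarith

lemma t_lt (j : ℤ) : P.t j < P.t (j + 1) := P.t_strictMono (by omega)

lemma t_succ_lt (j : ℤ) : P.t (j + 1) < P.t j + 2 * Real.pi := by
  rw [← P.t_add]
  have := P.d_ne_zero
  exact P.t_strictMono (by omega)

/-- The index of the left endpoint of `[a]`. -/
def idx (a : A) : ℤ := (P.o a).cast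

lemma idx_cast (a : A) : ((P.idx a : ℤ) : ZMod (2 * P.d)) = P.o a := by
  rw [idx, ZMod.intCast_cast, ZMod.cast_id]

lemma exists_eq_add_of_cast_eq {i j : ℤ} (h : (i : ZMod (2 * P.d)) = j) :
    ∃ k : ℤ, j = i + 2 * P.d * k := by
  rw [ZMod.intCast_eq_intCast_iff_dvd_sub] at h
  obtain ⟨k, hk⟩ := h
  exact ⟨k, by push_cast at hk; linarith⟩

lemma vertex_eq_pt (j : ℤ) : P.vertex j = pt (P.t j) := rfl

lemma leftEnd_eq (a : A) : P.leftEnd a = pt (P.t (P.idx a)) := rfl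

lemma rightEnd_eq (a : A) : P.rightEnd a = pt (P.t (P.idx a + 1)) := rfl

lemma vertex_eq_of_cast_eq {i j : ℤ} (h : (i : ZMod (2 * P.d)) = j) : P.vertex i = P.vertex j := by
  obtain ⟨k, rfl⟩ := P.exists_eq_add_of_cast_eq h
  rw [vertex_eq_pt, vertex_eq_pt, pt_eq_pt_iff]
  exact ⟨k, P.t_add_mul i k⟩

/-- The midpoint (as an angle) of the arc `[a]`. -/
noncomputable def mid (a : A) : ℝ := (P.t (P.idx a) + P.t (P.idx a + 1)) / 2

/-- Half of the length of the arc `[a]`. -/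
noncomputable def half (a : A) : ℝ := (P.t (P.idx a + 1) - P.t (P.idx a)) / 2

lemma half_pos (a : A) : 0 < P.half a := by
  have := P.t_lt (P.idx a)
  unfold half; linarith

lemma t_idx (a : A) : P.t (P.idx a) = P.mid a - P.half a := by
  unfold mid half; ring

lemma t_idx_succ (a : A) : P.t (P.idx a + 1) = P.mid a + P.half a := by
  unfold mid half; ring

lemma norm_den_lt_one_iff (a : A) (x : ℝ) : ‖den (P.F (P.hat a)) (pt x)‖ < 1 ↔
    ∃ k : ℤ, P.t (P.idx a) < x + 2 * Real.pi * k ∧ x + 2 * Real.pi * k < P.t (P.idx a + 1) := by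
  have h := Set.ext_iff.1 (P.isoDisc_inter a) (pt x)
  simp only [Set.mem_inter_iff, mem_sphere_zero_iff_norm, norm_pt, and_true, isoDisc_eq,
    Set.mem_ofPred_eq] at h
  rw [h]
  constructor
  · rintro ⟨y, h1, h2, h3⟩
    obtain ⟨k, rfl⟩ := pt_eq_pt_iff.1 h3
    exact ⟨k, h1, h2⟩
  · rintro ⟨k, h1, h2⟩
    exact ⟨_, h1, h2, pt_eq_pt_iff.2 ⟨k, rfl⟩⟩

/-- The coefficients of `F_{hat a}` in terms of the arc `[a]`. -/
lemma exists_coeff (a : A) : P.half a < Real.pi / 2 ∧ ∃ K : ℝ, 0 < K ∧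
    coeffAlpha (P.F (P.hat a)) * coeffBeta (P.F (P.hat a)) =
      -(K * Complex.exp (P.mid a * Complex.I)) ∧
    ‖coeffBeta (P.F (P.hat a))‖ ^ 2 = K * Real.cos (P.half a) := by
  set g := P.F (P.hat a) with hg
  set κ : ℝ := ‖-(coeffAlpha g * coeffBeta g)‖ with hκ
  set ψ : ℝ := (-(coeffAlpha g * coeffBeta g)).arg with hψ
  have hab : coeffAlpha g * coeffBeta g = -(κ * Complex.exp (ψ * Complex.I)) := by
    rw [Complex.norm_mul_exp_arg_mul_I, neg_neg]
  -- On the circle `|den|² - 1` is a shifted cosine. By `isoDisc_inter` it is negative on the open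
  -- arc and nonnegative off it, so it vanishes at both ends; this centres the cosine at the
  -- midpoint and expresses `|β|²` by the half-length.
  have hf : ∀ x : ℝ, ‖den g (pt x)‖ ^ 2 - 1 = 2 * (‖coeffBeta g‖ ^ 2 - κ * Real.cos (x - ψ)) := by
    intro x
    rw [normSq_den, norm_pt, hab, ← re_exp_mul_pt, neg_mul, Complex.neg_re, mul_assoc,
      Complex.re_ofReal_mul]
    ring
  have hneg : ∀ x ∈ Set.Ioo (P.t (P.idx a)) (P.t (P.idx a + 1)),
      ‖coeffBeta g‖ ^ 2 - κ * Real.cos (x - ψ) < 0 := by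
    intro x hx
    have h1 : ‖den g (pt x)‖ < 1 := (P.norm_den_lt_one_iff a x).2 ⟨0, by simpa using hx⟩
    have h2 := hf x
    have h3 : ‖den g (pt x)‖ ^ 2 < 1 := by nlinarith [norm_nonneg (den g (pt x))]
    linarith
  have hnn : ∀ x, ¬ (‖den g (pt x)‖ < 1) → 0 ≤ ‖coeffBeta g‖ ^ 2 - κ * Real.cos (x - ψ) := by
    intro x hx
    have h2 := hf x
    have h3 : 1 ≤ ‖den g (pt x)‖ ^ 2 := by nlinarith
    linarith
  have hlt := P.t_lt (P.idx a)
  have hlt2 := P.t_succ_lt (P.idx a)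
  have hpi := Real.pi_pos
  have hcl : ∀ x ∈ Set.Icc (P.t (P.idx a)) (P.t (P.idx a + 1)),
      ‖coeffBeta g‖ ^ 2 - κ * Real.cos (x - ψ) ≤ 0 := by
    intro x hx
    rw [← closure_Ioo hlt.ne] at hx
    have hc : IsClosed {x : ℝ | ‖coeffBeta g‖ ^ 2 - κ * Real.cos (x - ψ) ≤ 0} :=
      isClosed_le (by fun_prop) continuous_const
    exact closure_minimal (fun y hy => (hneg y hy).le) hc hx
  have h0 : ‖coeffBeta g‖ ^ 2 - κ * Real.cos (P.t (P.idx a) - ψ) = 0 := by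
    refine le_antisymm (hcl _ ⟨le_rfl, hlt.le⟩) (hnn _ fun h => ?_)
    obtain ⟨k, hk1, hk2⟩ := (P.norm_den_lt_one_iff a _).1 h
    have h1 : (0 : ℝ) < k := by
      by_contra hk; push Not at hk; nlinarith
    have h2 : (k : ℝ) < 1 := by
      by_contra hk; push Not at hk; nlinarith
    have h1' : 0 < k := by exact_mod_cast h1
    have h2' : k < 1 := by exact_mod_cast h2
    omega
  have h1 : ‖coeffBeta g‖ ^ 2 - κ * Real.cos (P.t (P.idx a + 1) - ψ) = 0 := by
    refine le_antisymm (hcl _ ⟨hlt.le, le_rfl⟩) (hnn _ fun h => ?_)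
    obtain ⟨k, hk1, hk2⟩ := (P.norm_den_lt_one_iff a _).1 h
    have h1 : (k : ℝ) < 0 := by
      by_contra hk; push Not at hk; nlinarith
    have h2 : (-1 : ℝ) < k := by
      by_contra hk; push Not at hk; nlinarith
    have h1' : k < 0 := by exact_mod_cast h1
    have h2' : -1 < k := by exact_mod_cast h2
    omega
  have hm := hneg (P.mid a) ⟨by unfold mid; linarith, by unfold mid; linarith⟩
  have hκ0 : 0 < κ := by
    refine lt_of_le_of_ne (norm_nonneg _) fun h => ?_
    rw [← h] at hm
    nlinarith [sq_nonneg ‖coeffBeta g‖]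
  have hβ : 0 < ‖coeffBeta g‖ := by
    rw [hκ, norm_neg, norm_mul] at hκ0
    exact pos_of_mul_pos_right hκ0 (norm_nonneg _)
  have hhalf := P.half_pos a
  have hhalf2 : P.half a < Real.pi := by unfold half; linarith
  have hsin : Real.sin (P.half a) ≠ 0 := (Real.sin_pos_of_pos_of_lt_pi hhalf hhalf2).ne'
  -- Equal cosines at the two ends give `mid ≡ ψ` modulo `π`, as `sin half ≠ 0`; the negative value
  -- at the midpoint then forces `cos (mid - ψ) = 1`.
  have hcc : Real.cos (P.t (P.idx a + 1) - ψ) - Real.cos (P.t (P.idx a) - ψ) = 0 := by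
    have : κ * (Real.cos (P.t (P.idx a + 1) - ψ) - Real.cos (P.t (P.idx a) - ψ)) = 0 := by linarith
    exact (mul_eq_zero.1 this).resolve_left hκ0.ne'
  rw [Real.cos_sub_cos] at hcc
  have e1 : (P.t (P.idx a + 1) - ψ + (P.t (P.idx a) - ψ)) / 2 = P.mid a - ψ := by unfold mid; ring
  have e2 : (P.t (P.idx a + 1) - ψ - (P.t (P.idx a) - ψ)) / 2 = P.half a := by unfold half; ring
  rw [e1, e2] at hcc
  have hs : Real.sin (P.mid a - ψ) = 0 := by
    rcases mul_eq_zero.1 hcc with h | h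
    · linarith
    · exact absurd h hsin
  have hcpos : 0 < Real.cos (P.mid a - ψ) := by
    by_contra h
    push Not at h
    nlinarith [sq_nonneg ‖coeffBeta g‖]
  have hc : Real.cos (P.mid a - ψ) = 1 := by
    have := Real.sin_sq_add_cos_sq (P.mid a - ψ)
    rw [hs] at this
    nlinarith
  have hexp : Complex.exp (ψ * Complex.I) = Complex.exp (P.mid a * Complex.I) := by
    have : Complex.exp (((P.mid a - ψ : ℝ) : ℂ) * Complex.I) = 1 := by
      rw [Complex.exp_mul_I, ← Complex.ofReal_cos, ← Complex.ofReal_sin, hs, hc]; simp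
    rw [show (P.mid a : ℂ) * Complex.I = ((P.mid a - ψ : ℝ) : ℂ) * Complex.I + ψ * Complex.I by
      push_cast; ring, Complex.exp_add, this, one_mul]
  have hch : ‖coeffBeta g‖ ^ 2 = κ * Real.cos (P.half a) := by
    rw [P.t_idx, show P.mid a - P.half a - ψ = (P.mid a - ψ) - P.half a by ring, Real.cos_sub,
      hs, hc] at h0
    linarith
  have hcos : 0 < Real.cos (P.half a) := by
    by_contra h
    push Not at h
    nlinarith [mul_pos hβ hβ]
  refine ⟨?_, κ, hκ0, by rw [hab, hexp], hch⟩
  by_contra h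
  push Not at h
  linarith [Real.cos_nonpos_of_pi_div_two_le_of_le h (by linarith)]

lemma half_lt (a : A) : P.half a < Real.pi / 2 := (P.exists_coeff a).1

lemma cos_half_pos (a : A) : 0 < Real.cos (P.half a) :=
  Real.cos_pos_of_mem_Ioo ⟨by linarith [P.half_pos a, Real.pi_pos], P.half_lt a⟩

lemma sin_half_pos (a : A) : 0 < Real.sin (P.half a) :=
  Real.sin_pos_of_pos_of_lt_pi (P.half_pos a) (by linarith [P.half_lt a, Real.pi_pos])

/-- The formula on the circle extends to the whole plane with one positive factor, so a single
expression describes the arcs as well as the discs bounded by the isometric circles. -/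
lemma exists_normSq_den (a : A) : ∃ K : ℝ, 0 < K ∧ ∀ ξ : ℂ, ‖den (P.F (P.hat a)) ξ‖ ^ 2 - 1 =
    K * ((‖ξ‖ ^ 2 + 1) * Real.cos (P.half a)
      - 2 * (Complex.exp (P.mid a * Complex.I) * ξ).re) := by
  obtain ⟨-, K, hK, h1, h2⟩ := P.exists_coeff a
  refine ⟨K, hK, fun ξ => ?_⟩
  rw [normSq_den, h1, h2, neg_mul, Complex.neg_re, mul_assoc, Complex.re_ofReal_mul]
  ring

lemma norm_sq_sub_one_lt_zero {z : ℂ} : ‖z‖ ^ 2 - 1 < 0 ↔ ‖z‖ < 1 := by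
  rw [sub_neg, sq_lt_one_iff_abs_lt_one, abs_norm]

lemma norm_sq_sub_one_le_zero {z : ℂ} : ‖z‖ ^ 2 - 1 ≤ 0 ↔ ‖z‖ ≤ 1 := by
  rw [sub_nonpos, sq_le_one_iff_abs_le_one, abs_norm]

lemma norm_sq_sub_one_eq_zero {z : ℂ} : ‖z‖ ^ 2 - 1 = 0 ↔ ‖z‖ = 1 := by
  rw [sub_eq_zero]
  exact pow_eq_one_iff_of_nonneg (norm_nonneg z) two_ne_zero

/-- Every arc is shorter than `π`, so two arcs cannot fill the circle. Having at least four letters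
is what leaves a continuation after every word. -/
lemma two_le_d : 2 ≤ P.d := by
  by_contra h
  have h1 : P.d = 1 := by have := P.d_ne_zero; omega
  have key : ∀ j : ℤ, P.t (j + 1) - P.t j < Real.pi := by
    intro j
    have h2 : ((P.idx (P.o.symm (j : ZMod (2 * P.d))) : ℤ) : ZMod (2 * P.d)) = j := by
      rw [idx_cast, Equiv.apply_symm_apply]
    obtain ⟨k, hk⟩ := P.exists_eq_add_of_cast_eq h2
    have h3 := P.half_lt (P.o.symm (j : ZMod (2 * P.d)))
    unfold half at h3
    rw [hk, add_right_comm, P.t_add_mul, P.t_add_mul]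
    linarith
  have h2 := P.t_add 0
  rw [h1] at h2
  have h3 := key 0
  have h4 := key 1
  norm_num at h2 h3 h4
  linarith

/-- The open arc cut by the side `s_a`. -/
def openArc (a : A) : Set ℂ :=
  {ξ | ∃ x : ℝ, P.t (P.idx a) < x ∧ x < P.t (P.idx a + 1) ∧ ξ = pt x}

/-- The closed arc cut by the side `s_a`. -/
def closedArc (a : A) : Set ℂ :=
  {ξ | ∃ x : ℝ, P.t (P.idx a) ≤ x ∧ x ≤ P.t (P.idx a + 1) ∧ ξ = pt x}

lemma mem_arc_iff {a : A} {ξ : ℂ} :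
    ξ ∈ P.arc a ↔ ∃ x : ℝ, P.t (P.idx a) ≤ x ∧ x < P.t (P.idx a + 1) ∧ ξ = pt x := Iff.rfl

lemma norm_of_mem_closedArc {a : A} {ξ : ℂ} (h : ξ ∈ P.closedArc a) : ‖ξ‖ = 1 := by
  obtain ⟨x, -, -, rfl⟩ := h; exact norm_pt x

lemma openArc_subset_arc (a : A) : P.openArc a ⊆ P.arc a := fun _ ⟨x, h1, h2, h3⟩ =>
  ⟨x, h1.le, h2, h3⟩

lemma arc_subset_closedArc (a : A) : P.arc a ⊆ P.closedArc a := fun _ ⟨x, h1, h2, h3⟩ =>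
  ⟨x, h1, h2.le, h3⟩

lemma norm_of_mem_arc {a : A} {ξ : ℂ} (h : ξ ∈ P.arc a) : ‖ξ‖ = 1 :=
  P.norm_of_mem_closedArc (P.arc_subset_closedArc a h)

lemma leftEnd_mem_arc (a : A) : P.leftEnd a ∈ P.arc a :=
  ⟨_, le_rfl, P.t_lt _, rfl⟩

lemma isCompact_closedArc (a : A) : IsCompact (P.closedArc a) := by
  have : P.closedArc a = pt '' Set.Icc (P.t (P.idx a)) (P.t (P.idx a + 1)) := by
    ext ξ; constructor
    · rintro ⟨x, h1, h2, rfl⟩; exact ⟨x, ⟨h1, h2⟩, rfl⟩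
    · rintro ⟨x, ⟨h1, h2⟩, rfl⟩; exact ⟨x, h1, h2, rfl⟩
  rw [this]
  exact isCompact_Icc.image continuous_pt

lemma mem_openArc_iff {a : A} {ξ : ℂ} (hξ : ‖ξ‖ = 1) :
    ξ ∈ P.openArc a ↔ ‖den (P.F (P.hat a)) ξ‖ < 1 := by
  have h := Set.ext_iff.1 (P.isoDisc_inter a) ξ
  simp only [Set.mem_inter_iff, mem_sphere_zero_iff_norm, hξ, and_true, isoDisc_eq] at h
  exact h.symm

lemma norm_den_eq_one_iff {a : A} {ξ : ℂ} (hξ : ‖ξ‖ = 1) :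
    ‖den (P.F (P.hat a)) ξ‖ = 1 ↔ ξ = P.leftEnd a ∨ ξ = P.rightEnd a := by
  obtain ⟨x, rfl⟩ := exists_eq_pt hξ
  obtain ⟨K, hK, h⟩ := P.exists_normSq_den a
  rw [← norm_sq_sub_one_eq_zero, h, norm_pt, re_exp_mul_pt, leftEnd_eq, rightEnd_eq, pt_eq_pt_iff,
    pt_eq_pt_iff, mul_eq_zero, or_iff_right hK.ne', P.t_idx, P.t_idx_succ]
  have : (1 ^ 2 + 1) * Real.cos (P.half a) - 2 * Real.cos (x - P.mid a) = 0 ↔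
      Real.cos (x - P.mid a) = Real.cos (P.half a) := by
    constructor <;> intro h <;> linarith
  rw [this, Real.cos_eq_cos_iff]
  constructor
  · rintro ⟨k, h | h⟩
    · right; exact ⟨k, by linarith⟩
    · left; exact ⟨-k, by push_cast; linarith⟩
  · rintro (⟨k, h⟩ | ⟨k, h⟩)
    · exact ⟨-k, Or.inr (by push_cast; linarith)⟩
    · exact ⟨k, Or.inl (by linarith)⟩

lemma norm_leftEnd (a : A) : ‖P.leftEnd a‖ = 1 := norm_pt _

lemma norm_rightEnd (a : A) : ‖P.rightEnd a‖ = 1 := norm_pt _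

lemma norm_vertex (j : ℤ) : ‖P.vertex j‖ = 1 := norm_pt _

lemma mem_closedArc_iff_or {a : A} {ξ : ℂ} :
    ξ ∈ P.closedArc a ↔ ξ ∈ P.openArc a ∨ ξ = P.leftEnd a ∨ ξ = P.rightEnd a := by
  constructor
  · rintro ⟨x, h1, h2, rfl⟩
    rcases h1.eq_or_lt with h1 | h1
    · right; left; rw [leftEnd_eq, h1]
    rcases h2.eq_or_lt with h2 | h2
    · right; right; rw [rightEnd_eq, h2]
    · left; exact ⟨x, h1, h2, rfl⟩
  · have := P.t_lt (P.idx a)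
    rintro (⟨x, h1, h2, rfl⟩ | rfl | rfl)
    · exact ⟨x, h1.le, h2.le, rfl⟩
    · exact ⟨_, le_rfl, this.le, rfl⟩
    · exact ⟨_, this.le, le_rfl, rfl⟩

lemma mem_closedArc_iff {a : A} {ξ : ℂ} (hξ : ‖ξ‖ = 1) :
    ξ ∈ P.closedArc a ↔ ‖den (P.F (P.hat a)) ξ‖ ≤ 1 := by
  rw [mem_closedArc_iff_or, P.mem_openArc_iff hξ, ← P.norm_den_eq_one_iff hξ, le_iff_lt_or_eq]

/-- Two closed arcs meet only if they are equal or adjacent. -/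
lemma eq_or_of_mem_closedArc {a b : A} {ξ : ℂ} (ha : ξ ∈ P.closedArc a) (hb : ξ ∈ P.closedArc b) :
    a = b ∨ (P.o b = P.o a + 1 ∧ ξ = P.rightEnd a ∧ ξ = P.leftEnd b) ∨
      (P.o a = P.o b + 1 ∧ ξ = P.rightEnd b ∧ ξ = P.leftEnd a) := by
  obtain ⟨x, h1, h2, rfl⟩ := ha
  obtain ⟨y, h3, h4, h5⟩ := hb
  obtain ⟨k, rfl⟩ := pt_eq_pt_iff.1 h5
  set i := P.idx a + 2 * P.d * k with hi
  have hio : (i : ZMod (2 * P.d)) = P.o a := by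
    rw [hi, ← P.idx_cast a]; push_cast
    have : (2 * P.d : ZMod (2 * P.d)) = 0 := by exact_mod_cast ZMod.natCast_self (2 * P.d)
    rw [this, zero_mul, add_zero]
  have h1' : P.t i ≤ x + 2 * Real.pi * k := by rw [hi, P.t_add_mul]; linarith
  have h2' : x + 2 * Real.pi * k ≤ P.t (i + 1) := by
    rw [hi, add_right_comm, P.t_add_mul]; linarith
  have e1 : P.idx b ≤ i + 1 := P.t_strictMono.le_iff_le.1 (h3.trans h2')
  have e2 : i ≤ P.idx b + 1 := P.t_strictMono.le_iff_le.1 (h1'.trans h4)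
  have : P.idx b = i ∨ P.idx b = i + 1 ∨ i = P.idx b + 1 := by omega
  rcases this with h | h | h
  · left
    apply P.o.injective
    rw [← hio, ← h, P.idx_cast]
  · right; left
    have e : x + 2 * Real.pi * k = P.t (P.idx b) := le_antisymm (by rwa [h]) h3
    refine ⟨by rw [← hio, ← P.idx_cast b, h]; push_cast; rfl, ?_, ?_⟩
    · rw [rightEnd_eq, pt_eq_pt_iff]
      refine ⟨0, ?_⟩
      rw [h, hi, add_right_comm, P.t_add_mul] at e
      push_cast; linarith
    · rw [h5, e, leftEnd_eq]
  · right; right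
    have e : x + 2 * Real.pi * k = P.t (P.idx b + 1) := le_antisymm h4 (by rwa [← h])
    refine ⟨by rw [← hio, ← P.idx_cast b, h]; push_cast; rfl, ?_, ?_⟩
    · rw [h5, e, rightEnd_eq]
    · rw [leftEnd_eq, pt_eq_pt_iff]
      refine ⟨0, ?_⟩
      rw [← h, hi, P.t_add_mul] at e
      push_cast; linarith

lemma exists_mem_arc {ξ : ℂ} (hξ : ‖ξ‖ = 1) : ∃ a, ξ ∈ P.arc a := by
  obtain ⟨x, rfl⟩ := exists_eq_pt hξ
  have hpi := Real.pi_pos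
  obtain ⟨N, hN⟩ := exists_int_gt ((x - P.t 0) / (2 * Real.pi))
  obtain ⟨M, hM⟩ := exists_int_lt ((x - P.t 0) / (2 * Real.pi))
  rw [div_lt_iff₀ (by positivity)] at hN
  rw [lt_div_iff₀ (by positivity)] at hM
  have hN' : x < P.t (0 + 2 * P.d * N) := by rw [P.t_add_mul]; linarith
  have hM' : P.t (0 + 2 * P.d * M) ≤ x := by rw [P.t_add_mul]; linarith
  obtain ⟨j, hj, hmax⟩ := Int.exists_greatest_of_bdd (P := fun j => P.t j ≤ x)
    ⟨0 + 2 * P.d * N, fun z hz => (P.t_strictMono.lt_iff_lt.1 (lt_of_le_of_lt hz hN')).le⟩ ⟨_, hM'⟩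
  have hj2 : x < P.t (j + 1) := by
    by_contra h
    push Not at h
    have := hmax _ h
    omega
  refine ⟨P.o.symm (j : ZMod (2 * P.d)), ?_⟩
  have h2 : (j : ZMod (2 * P.d)) = (P.idx (P.o.symm (j : ZMod (2 * P.d))) : ℤ) := by
    rw [idx_cast, Equiv.apply_symm_apply]
  obtain ⟨k, hk⟩ := P.exists_eq_add_of_cast_eq h2
  refine P.mem_arc_iff.2 ⟨x + 2 * Real.pi * k, ?_, ?_, pt_eq_pt_iff.2 ⟨k, rfl⟩⟩
  · rw [hk, P.t_add_mul]; linarith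
  · rw [hk, add_right_comm, P.t_add_mul]; linarith

lemma rightEnd_notMem_arc (a : A) : P.rightEnd a ∉ P.arc a := by
  rintro ⟨x, h1, h2, h3⟩
  obtain ⟨k, rfl⟩ := pt_eq_pt_iff.1 h3
  have hlt := P.t_lt (P.idx a)
  have hlt2 := P.t_succ_lt (P.idx a)
  have hpi := Real.pi_pos
  change P.t (P.idx a) ≤ P.t (P.idx a + 1) + _ at h1
  change P.t (P.idx a + 1) + 2 * Real.pi * k < P.t (P.idx a + 1) at h2
  have h1 : (k : ℝ) < 0 := by
    by_contra hk; push Not at hk; nlinarith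
  have h2 : (-1 : ℝ) < k := by
    by_contra hk; push Not at hk; nlinarith
  have h1' : k < 0 := by exact_mod_cast h1
  have h2' : -1 < k := by exact_mod_cast h2
  omega

lemma mem_arc_iff_closedArc {a : A} {ξ : ℂ} :
    ξ ∈ P.arc a ↔ ξ ∈ P.closedArc a ∧ ξ ≠ P.rightEnd a := by
  constructor
  · intro h
    exact ⟨P.arc_subset_closedArc a h, fun e => P.rightEnd_notMem_arc a (e ▸ h)⟩
  · rintro ⟨h, h2⟩
    rcases P.mem_closedArc_iff_or.1 h with h | rfl | h
    · exact P.openArc_subset_arc a h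
    · exact P.leftEnd_mem_arc a
    · exact absurd h h2

lemma eq_of_mem_arc {a b : A} {ξ : ℂ} (ha : ξ ∈ P.arc a) (hb : ξ ∈ P.arc b) : a = b := by
  rw [mem_arc_iff_closedArc] at ha hb
  rcases P.eq_or_of_mem_closedArc ha.1 hb.1 with h | ⟨-, h, -⟩ | ⟨-, h, -⟩
  · exact h
  · exact absurd h ha.2
  · exact absurd h hb.2

lemma notMem_openArc_of_ends {a : A} {ξ : ℂ} (h : ξ = P.leftEnd a ∨ ξ = P.rightEnd a) :
    ξ ∉ P.openArc a := by
  have hξ : ‖ξ‖ = 1 := by rcases h with rfl | rfl <;> exact norm_pt _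
  rw [P.mem_openArc_iff hξ, (P.norm_den_eq_one_iff hξ).2 h]
  exact lt_irrefl 1

lemma notMem_openArc_of_mem_closedArc {a b : A} (hab : a ≠ b) {ξ : ℂ} (h : ξ ∈ P.closedArc a) :
    ξ ∉ P.openArc b := by
  intro h2
  have h3 : ξ ∈ P.closedArc b := P.mem_closedArc_iff_or.2 (Or.inl h2)
  rcases P.eq_or_of_mem_closedArc h h3 with h | ⟨-, -, h⟩ | ⟨-, h, -⟩
  · exact hab h
  · exact P.notMem_openArc_of_ends (Or.inl h) h2
  · exact P.notMem_openArc_of_ends (Or.inr h) h2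

lemma exists_letter_vertex (j : ℤ) : ∃ a, P.vertex j = P.leftEnd a := by
  refine ⟨P.o.symm (j : ZMod (2 * P.d)), ?_⟩
  refine P.vertex_eq_of_cast_eq (j := P.idx _) ?_
  rw [idx_cast, Equiv.apply_symm_apply]

lemma vertex_notMem_openArc (j : ℤ) (b : A) : P.vertex j ∉ P.openArc b := by
  obtain ⟨a, ha⟩ := P.exists_letter_vertex j
  rw [ha]
  by_cases hab : a = b
  · subst hab; exact P.notMem_openArc_of_ends (Or.inl rfl)
  · exact P.notMem_openArc_of_mem_closedArc hab
      (P.arc_subset_closedArc a (P.leftEnd_mem_arc a))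

lemma rightEnd_eq_leftEnd {a b : A} (h : P.o b = P.o a + 1) : P.rightEnd a = P.leftEnd b := by
  refine P.vertex_eq_of_cast_eq (i := P.idx a + 1) (j := P.idx b) ?_
  push_cast
  rw [idx_cast, idx_cast, h]

/-! ### The side pairings on the arcs -/

lemma norm_den_hat (a : A) {ξ : ℂ} (h : den (P.F a) ξ ≠ 0) :
    ‖den (P.F (P.hat a)) (discMap (P.F a) ξ)‖ = ‖den (P.F a) ξ‖⁻¹ := by
  rw [P.F_hat, norm_den_inv _ h]

lemma discMap_hat_discMap (a : A) {ξ : ℂ} (hξ : ‖ξ‖ = 1) :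
    discMap (P.F (P.hat a)) (discMap (P.F a) ξ) = ξ := by
  rw [P.F_hat, discMap_inv_discMap _ (den_ne_zero _ hξ)]

lemma discMap_discMap_hat (a : A) {ξ : ℂ} (hξ : ‖ξ‖ = 1) :
    discMap (P.F a) (discMap (P.F (P.hat a)) ξ) = ξ := by
  rw [P.F_hat, discMap_discMap_inv _ (den_ne_zero _ hξ)]

/-- `F_a` inverts the modulus of the denominator, so what lies outside its own isometric circle goes
inside, or onto, that of its inverse. -/
lemma discMap_mem_closedArc (a : A) {ξ : ℂ} (hξ : ‖ξ‖ = 1) (h : ξ ∉ P.openArc (P.hat a)) :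
    discMap (P.F a) ξ ∈ P.closedArc a := by
  rw [P.mem_openArc_iff hξ, P.hat_hat, not_lt] at h
  rw [P.mem_closedArc_iff (norm_discMap _ hξ), P.norm_den_hat a (den_ne_zero _ hξ)]
  exact inv_le_one_of_one_le₀ h

lemma discMap_hat_notMem_openArc (a : A) {ξ : ℂ} (h : ξ ∈ P.closedArc a) :
    discMap (P.F (P.hat a)) ξ ∉ P.openArc (P.hat a) := by
  have hξ := P.norm_of_mem_closedArc h
  rw [P.mem_closedArc_iff hξ] at h
  rw [P.mem_openArc_iff (norm_discMap _ hξ), P.norm_den_hat (P.hat a) (den_ne_zero _ hξ), not_lt]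
  exact (one_le_inv₀ (norm_pos_iff.2 (den_ne_zero _ hξ))).2 h

lemma im_leftEnd (a : A) :
    0 < (Complex.exp (P.mid a * Complex.I) * P.leftEnd a).im := by
  rw [leftEnd_eq, im_exp_mul_pt, P.t_idx]
  simpa using P.sin_half_pos a

lemma im_rightEnd (a : A) :
    (Complex.exp (P.mid a * Complex.I) * P.rightEnd a).im < 0 := by
  rw [rightEnd_eq, im_exp_mul_pt, P.t_idx_succ]
  simpa using P.sin_half_pos a

/-- The side pairings reverse the orientation of the endpoints of the arcs. -/
lemma im_discMap_neg (a : A) {ξ : ℂ} (hξ : ‖ξ‖ = 1) (hd : ‖den (P.F a) ξ‖ = 1) :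
    0 < (Complex.exp (P.mid a * Complex.I) * discMap (P.F a) ξ).im ↔
      (Complex.exp (P.mid (P.hat a) * Complex.I) * ξ).im < 0 := by
  obtain ⟨-, K, hK, h1, -⟩ := P.exists_coeff a
  obtain ⟨-, K', hK', h2, -⟩ := P.exists_coeff (P.hat a)
  rw [P.F_hat, coeffAlpha_inv, coeffBeta_inv] at h1
  rw [P.hat_hat] at h2
  set g := P.F a
  have hd0 := den_ne_zero g hξ
  have huu := mul_conj_of_norm_one hd
  -- Up to positive factors the two numbers are `|α|² - α den` and `|α|²` minus the conjugate of `α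
  -- den`; their imaginary parts are opposite.
  have e2 : K' * (Complex.exp (P.mid (P.hat a) * Complex.I) * ξ) =
      coeffAlpha g * conj (coeffAlpha g) - coeffAlpha g * den g ξ := by
    rw [den]
    linear_combination ξ * h2
  have e3 : coeffBeta g * discMap g ξ = coeffAlpha g - conj (den g ξ) := by
    have : discMap g ξ * den g ξ = coeffAlpha g * ξ + conj (coeffBeta g) := by
      rw [discMap_eq]; field_simp
    have hc := coeff_mul_conj g
    have : coeffBeta g * discMap g ξ * den g ξ = (coeffAlpha g - conj (den g ξ)) * den g ξ := by
      have hdd : den g ξ = coeffBeta g * ξ + conj (coeffAlpha g) := rfl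
      linear_combination coeffBeta g * this + huu - coeffAlpha g * hdd - hc
    exact mul_right_cancel₀ hd0 this
  have e1 : K * (Complex.exp (P.mid a * Complex.I) * discMap g ξ) =
      coeffAlpha g * conj (coeffAlpha g) - conj (coeffAlpha g * den g ξ) := by
    rw [map_mul]
    linear_combination discMap g ξ * h1 + conj (coeffAlpha g) * e3
  have i1 := congrArg Complex.im e1
  have i2 := congrArg Complex.im e2
  rw [Complex.im_ofReal_mul, Complex.sub_im, Complex.conj_im, Complex.mul_conj, Complex.ofReal_im]
    at i1
  rw [Complex.im_ofReal_mul, Complex.sub_im, Complex.mul_conj, Complex.ofReal_im] at i2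
  rw [← mul_pos_iff_of_pos_left hK, i1, ← neg_pos (a := (_ : ℂ).im),
    ← mul_pos_iff_of_pos_left (b := -(_ : ℂ).im) hK', mul_neg, i2]
  constructor <;> intro h <;> linarith

lemma norm_den_leftEnd (a : A) : ‖den (P.F (P.hat a)) (P.leftEnd a)‖ = 1 :=
  (P.norm_den_eq_one_iff (P.norm_leftEnd a)).2 (Or.inl rfl)

lemma norm_den_rightEnd (a : A) : ‖den (P.F (P.hat a)) (P.rightEnd a)‖ = 1 :=
  (P.norm_den_eq_one_iff (P.norm_rightEnd a)).2 (Or.inr rfl)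

/-- The denominator has modulus one at the image, which is hence an end of `[hat a]`; the reversal
of orientation decides which one. -/
lemma discMap_rightEnd (a : A) : discMap (P.F (P.hat a)) (P.rightEnd a) = P.leftEnd (P.hat a) := by
  have h1 : ‖den (P.F (P.hat (P.hat a))) (discMap (P.F (P.hat a)) (P.rightEnd a))‖ = 1 := by
    rw [P.norm_den_hat _ (den_ne_zero _ (P.norm_rightEnd a)), P.norm_den_rightEnd, inv_one]
  rw [P.norm_den_eq_one_iff (norm_discMap _ (P.norm_rightEnd a))] at h1
  refine h1.resolve_right fun h => ?_
  have h2 := P.im_discMap_neg (P.hat a) (P.norm_rightEnd a) (P.norm_den_rightEnd a)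
  rw [P.hat_hat] at h2
  have h3 := h2.2 (P.im_rightEnd a)
  rw [h] at h3
  exact lt_asymm h3 (P.im_rightEnd _)

lemma discMap_leftEnd (a : A) : discMap (P.F (P.hat a)) (P.leftEnd a) = P.rightEnd (P.hat a) := by
  have h1 : ‖den (P.F (P.hat (P.hat a))) (discMap (P.F (P.hat a)) (P.leftEnd a))‖ = 1 := by
    rw [P.norm_den_hat _ (den_ne_zero _ (P.norm_leftEnd a)), P.norm_den_leftEnd, inv_one]
  rw [P.norm_den_eq_one_iff (norm_discMap _ (P.norm_leftEnd a))] at h1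
  refine h1.resolve_left fun h => ?_
  have h2 := P.im_discMap_neg (P.hat a) (P.norm_leftEnd a) (P.norm_den_leftEnd a)
  rw [P.hat_hat] at h2
  rw [h] at h2
  exact lt_asymm (h2.1 (P.im_leftEnd _)) (P.im_leftEnd a)

lemma discMap_mem_arc {a b : A} (hb : b ≠ P.hat a) {ξ : ℂ} (h : ξ ∈ P.arc b) :
    discMap (P.F a) ξ ∈ P.arc a := by
  have hξ := P.norm_of_mem_arc h
  rw [mem_arc_iff_closedArc]
  -- The right end of `[a]` is excluded because its preimage is the left end of `[hat a]`, which
  -- belongs to that half-open arc.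
  refine ⟨P.discMap_mem_closedArc a hξ
    (P.notMem_openArc_of_mem_closedArc hb (P.arc_subset_closedArc b h)), fun e => hb ?_⟩
  have e2 := congrArg (discMap (P.F (P.hat a))) e
  rw [P.discMap_hat_discMap a hξ, P.discMap_rightEnd] at e2
  rw [e2] at h
  exact P.eq_of_mem_arc h (P.leftEnd_mem_arc _)

/-- Expansions do not backtrack. The half-open convention matters here: the left end of `[a]` goes
to the right end of `[hat a]`, which is not a point of that arc. -/
lemma exists_mem_arc_discMap_hat {a : A} {ξ : ℂ} (h : ξ ∈ P.arc a) :
    ∃ b, b ≠ P.hat a ∧ discMap (P.F (P.hat a)) ξ ∈ P.arc b := by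
  have hξ := P.norm_of_mem_arc h
  obtain ⟨b, hb⟩ := P.exists_mem_arc (norm_discMap (P.F (P.hat a)) hξ)
  refine ⟨b, ?_, hb⟩
  rintro rfl
  rcases P.mem_closedArc_iff_or.1 (P.arc_subset_closedArc _ hb) with h1 | h1 | h1
  · exact P.discMap_hat_notMem_openArc a (P.arc_subset_closedArc _ h) h1
  · have e := congrArg (discMap (P.F a)) h1
    have e2 := P.discMap_leftEnd (P.hat a)
    rw [P.hat_hat] at e2
    rw [P.discMap_discMap_hat a hξ, e2] at e
    exact P.rightEnd_notMem_arc a (e ▸ h)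
  · rw [h1] at hb
    exact P.rightEnd_notMem_arc _ hb

lemma bowenSeriesMap_eq {a : A} {ξ : ℂ} (h : ξ ∈ P.arc a) :
    P.bowenSeriesMap ξ = discMap (P.F (P.hat a)) ξ := by
  have hex : ∃ a, ξ ∈ P.arc a := ⟨a, h⟩
  rw [bowenSeriesMap, dif_pos hex, P.eq_of_mem_arc hex.choose_spec h, P.F_hat]

end LabelledIdealPolygon

end BowenSeries

/-! ### Parabolic elements and the combinatorics of cuspidal words -/

namespace BowenSeries

open ComplexConjugate

/-- An element that fixes a point of the unit circle with derivative of norm one, and moves another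
point of the circle, is parabolic. -/
lemma isParabolic_of_fixed {g : SL(2, ℝ)} {ξ η : ℂ} (hξ : ‖ξ‖ = 1) (hfix : discMap g ξ = ξ)
    (hd : ‖den g ξ‖ = 1) (hη : ‖η‖ = 1) (hmove : discMap g η ≠ η) :
    (g : Matrix (Fin 2) (Fin 2) ℝ).IsParabolic := by
  constructor
  · rintro ⟨c, hc⟩
    apply hmove
    have e : ∀ i j, g i j = (Matrix.scalar (Fin 2) c) i j := fun i j => by rw [hc]
    have hβ : coeffBeta g = 0 := by
      apply Complex.ext <;> simp [coeffBeta_re, coeffBeta_im, e]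
    have hα : conj (coeffAlpha g) = coeffAlpha g := by
      apply Complex.ext <;> simp [coeffAlpha_re, coeffAlpha_im, e]
    have hα0 := den_ne_zero g hη
    rw [den, hβ, hα] at hα0
    have hα1 : coeffAlpha g ≠ 0 := by simpa using hα0
    rw [discMap, hβ, hα, map_zero, add_zero, zero_mul, zero_add, mul_div_cancel_left₀ _ hα1]
  · have hd0 := den_ne_zero g hξ
    have hξ0 : ξ ≠ 0 := by rintro rfl; simp at hξ
    -- At a fixed point of the circle the denominator is real, hence `±1` when it has modulus one;
    -- substitution into `|α|² - |β|² = 1` then gives trace `±2`.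
    have h1 : conj (den g ξ) = den g ξ := by
      have := discMap_eq_of_norm_one g hξ
      rw [hfix, eq_div_iff hd0] at this
      exact (mul_left_cancel₀ hξ0 this).symm
    have huu := mul_conj_of_norm_one hd
    have hcc := mul_conj_of_norm_one hξ
    rw [h1] at huu
    have e1 : coeffBeta g * ξ = den g ξ - conj (coeffAlpha g) := by rw [den]; ring
    have e2 : conj (coeffBeta g) * conj ξ = den g ξ - coeffAlpha g := by
      rw [← map_mul, e1, map_sub, h1, Complex.conj_conj]
    have hc := coeff_mul_conj g
    have e3 : den g ξ * (coeffAlpha g + conj (coeffAlpha g)) = 2 := by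
      have : coeffBeta g * conj (coeffBeta g) =
          (den g ξ - conj (coeffAlpha g)) * (den g ξ - coeffAlpha g) := by
        rw [← e1, ← e2]
        linear_combination (-coeffBeta g * conj (coeffBeta g)) * hcc
      linear_combination this + hc + huu
    have e4 : (coeffAlpha g + conj (coeffAlpha g)) ^ 2 = 4 := by
      have : (den g ξ * (coeffAlpha g + conj (coeffAlpha g))) ^ 2 = 4 := by rw [e3]; norm_num
      linear_combination this - (coeffAlpha g + conj (coeffAlpha g)) ^ 2 * huu
    rw [Complex.add_conj, coeffAlpha_re] at e4
    have e5 : (2 * ((g 0 0 + g 1 1) / 2)) ^ 2 = (4 : ℝ) := by exact_mod_cast e4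
    rw [Matrix.discr_fin_two, Matrix.trace_fin_two, g.det_coe]
    linarith

namespace LabelledIdealPolygon

variable {Γ₀ : Subgroup SL(2, ℝ)} {A : Type*} (P : LabelledIdealPolygon Γ₀ A)

/-! ### Cuspidal words -/

/-- The letter that follows `a` in a cuspidal word of type `L` (`s = true`) or `R`
(`s = false`). -/
def turn (s : Bool) (a : A) : A := P.o.symm (P.o (P.hat a) + if s then 1 else -1)

/-- The vertex of a cuspidal word with first letter `a` of type `L` (`s = true`) or `R`
(`s = false`). -/
noncomputable def tip (s : Bool) (a : A) : ℂ := if s then P.leftEnd a else P.rightEnd a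

lemma finite_letters (P : LabelledIdealPolygon Γ₀ A) : Finite A := by
  have := P.d_ne_zero
  have : NeZero (2 * P.d) := ⟨by omega⟩
  exact Finite.of_equiv _ P.o.symm

lemma o_turn (s : Bool) (a : A) : P.o (P.turn s a) = P.o (P.hat a) + if s then 1 else -1 := by
  rw [turn, Equiv.apply_symm_apply]

lemma hat_injective : Function.Injective P.hat := (show Function.Involutive P.hat from P.hat_hat).injective

lemma turn_injective (s : Bool) : Function.Injective (P.turn s) := by
  intro a b h
  have h := congrArg P.o h
  rw [o_turn, o_turn] at h
  exact P.hat_injective (P.o.injective (add_right_cancel h))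

lemma one_ne_zero_zmod : (1 : ZMod (2 * P.d)) ≠ 0 := by
  have h := P.two_le_d
  have : Fact (1 < 2 * P.d) := ⟨by omega⟩
  exact one_ne_zero

lemma two_ne_zero_zmod : (1 : ZMod (2 * P.d)) + 1 ≠ 0 := by
  have h := P.two_le_d
  intro h2
  have : ((2 : ℕ) : ZMod (2 * P.d)) = 0 := by push_cast; rw [← h2]; ring
  rw [ZMod.natCast_eq_zero_iff] at this
  have := Nat.le_of_dvd (by norm_num) this
  omega

lemma turn_ne_hat (s : Bool) (a : A) : P.turn s a ≠ P.hat a := by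
  intro h
  have h := congrArg P.o h
  rw [o_turn] at h
  have := P.one_ne_zero_zmod
  cases s <;> simp at h <;> exact this h

lemma turn_true_ne_turn_false (a : A) : P.turn true a ≠ P.turn false a := by
  intro h
  have h := congrArg P.o h
  rw [o_turn, o_turn] at h
  simp only [if_true, Bool.false_eq_true, if_false] at h
  exact P.two_ne_zero_zmod (by linear_combination h)

/-- There are `2d ≥ 4` letters, one more than the three that a cuspidal word can forbid. -/
lemma exists_notMem_finset (P : LabelledIdealPolygon Γ₀ A) (s : Finset A) (hs : s.card ≤ 3) : ∃ a, a ∉ s := by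
  classical
  have h := P.two_le_d
  have : NeZero (2 * P.d) := ⟨by omega⟩
  have := P.finite_letters
  have := Fintype.ofFinite A
  have h2 : Fintype.card A = 2 * P.d := by rw [Fintype.card_congr P.o, ZMod.card]
  by_contra hh
  push Not at hh
  have h3 := Finset.card_le_card (show Finset.univ ⊆ s from fun a _ => hh a)
  rw [Finset.card_univ, h2] at h3
  omega

lemma norm_tip (s : Bool) (a : A) : ‖P.tip s a‖ = 1 := by
  cases s <;> exact norm_pt _

lemma norm_den_tip (s : Bool) (a : A) : ‖den (P.F (P.hat a)) (P.tip s a)‖ = 1 := by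
  rw [P.norm_den_eq_one_iff (P.norm_tip s a)]
  cases s
  · exact Or.inr rfl
  · exact Or.inl rfl

/-- Ends are exchanged crosswise, and the end of `[hat a]` so reached is shared with a neighbouring
arc, that of `turn s a`. Iterating `turn` thus follows one vertex through the side pairings. -/
lemma discMap_tip (s : Bool) (a : A) :
    discMap (P.F (P.hat a)) (P.tip s a) = P.tip s (P.turn s a) := by
  cases s
  · refine (P.discMap_rightEnd a).trans (P.rightEnd_eq_leftEnd ?_).symm
    rw [o_turn]; simp
  · refine (P.discMap_leftEnd a).trans (P.rightEnd_eq_leftEnd ?_)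
    rw [o_turn]; simp

lemma tip_mem_closedArc (s : Bool) (a : A) : P.tip s a ∈ P.closedArc a := by
  rw [mem_closedArc_iff_or]
  cases s
  · exact Or.inr (Or.inr rfl)
  · exact Or.inr (Or.inl rfl)

lemma leftEnd_ne_rightEnd (a : A) : P.leftEnd a ≠ P.rightEnd a := fun h =>
  P.rightEnd_notMem_arc a (h ▸ P.leftEnd_mem_arc a)

/-- A vertex lies on two closed arcs only, and the one belonging to `hat a` is excluded by
non-backtracking. -/
lemma eq_turn_of_mem_closedArc {s : Bool} {a b : A} (hb : b ≠ P.hat a)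
    (h : P.tip s (P.turn s a) ∈ P.closedArc b) : b = P.turn s a := by
  have h2 : P.tip s (P.turn s a) = P.tip (!s) (P.hat a) := by
    rw [← P.discMap_tip]
    cases s
    · exact P.discMap_rightEnd a
    · exact P.discMap_leftEnd a
  have h3 : P.tip s (P.turn s a) ∈ P.closedArc (P.hat a) := h2 ▸ P.tip_mem_closedArc _ _
  apply P.o.injective
  rw [o_turn]
  rcases P.eq_or_of_mem_closedArc h h3 with h4 | ⟨h4, -, h5⟩ | ⟨h4, h5, -⟩
  · exact absurd h4 hb
  · rw [h2] at h5
    cases s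
    · rw [h4]; simp
    · exact absurd h5.symm (P.leftEnd_ne_rightEnd _)
  · rw [h2] at h5
    cases s
    · exact absurd h5 (P.leftEnd_ne_rightEnd _)
    · rw [h4]; simp

lemma wordMap_cons (a : A) (U : List A) : P.wordMap (a :: U) = P.F a * P.wordMap U := by
  simp [wordMap]

lemma wordMap_append (U V : List A) : P.wordMap (U ++ V) = P.wordMap U * P.wordMap V := by
  simp [wordMap]

lemma wordMap_nil : P.wordMap [] = 1 := rfl

lemma wordMap_singleton (a : A) : P.wordMap [a] = P.F a := by
  simp [wordMap]

lemma discMap_wordMap_cons (a : A) (U : List A) {ξ : ℂ} (hξ : ‖ξ‖ = 1) :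
    discMap (P.wordMap (a :: U)) ξ = discMap (P.F a) (discMap (P.wordMap U) ξ) := by
  rw [wordMap_cons, discMap_mul _ _ (den_ne_zero _ hξ)]

lemma Admissible.tail {a : A} {U : List A} (h : P.Admissible (a :: U)) : P.Admissible U :=
  (List.isChain_cons.1 h).2

lemma wordMap_mem_closedArc {a : A} {U : List A} (h : P.Admissible (a :: U)) {ξ : ℂ} (hξ : ‖ξ‖ = 1)
    (hv : ∀ b, ξ ∉ P.openArc b) : discMap (P.wordMap (a :: U)) ξ ∈ P.closedArc a := by
  induction U generalizing a with
  | nil =>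
    rw [wordMap_singleton]
    exact P.discMap_mem_closedArc a hξ (hv _)
  | cons b U ih =>
    rw [P.discMap_wordMap_cons _ _ hξ]
    have h2 := List.isChain_cons_cons.1 h
    exact P.discMap_mem_closedArc a (norm_discMap _ hξ)
      (P.notMem_openArc_of_mem_closedArc h2.1 (ih h2.2))

lemma wordMap_mem_arc {U : List A} {b : A} (h : P.Admissible (U ++ [b])) {ξ : ℂ}
    (hξ : ξ ∈ P.arc b) : ∀ a ∈ (U ++ [b]).head?, discMap (P.wordMap U) ξ ∈ P.arc a := by
  induction U with
  | nil => simpa [wordMap_nil, discMap_one] using hξ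
  | cons c U ih =>
    intro a ha
    obtain rfl : c = a := by simpa using ha
    rw [P.discMap_wordMap_cons _ _ (P.norm_of_mem_arc hξ)]
    have h2 := List.isChain_cons.1 h
    cases U with
    | nil =>
      exact P.discMap_mem_arc (h2.1 b (by simp)) (ih h2.2 b (by simp))
    | cons e U =>
      exact P.discMap_mem_arc (h2.1 e (by simp)) (ih h2.2 e (by simp))

/-- The chains of letters in which every letter follows the previous one at a common vertex. -/
def TurnChain (s : Bool) (W : List A) : Prop := W.IsChain fun a b => b = P.turn s a

lemma TurnChain.admissible {s : Bool} {W : List A} (h : P.TurnChain s W) : P.Admissible W :=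
  List.IsChain.imp (fun a b (e : b = P.turn s a) => e ▸ P.turn_ne_hat s a) h

/-- Undoing the first letter moves its tip to the tip of `turn s a`. The rest of the word ends up in
the closed arc of the next letter, which leaves no choice for that letter. -/
lemma turnChain_of_discMap_eq {s : Bool} {a : A} {U : List A} (h : P.Admissible (a :: U)) {ξ : ℂ}
    (hξ : ‖ξ‖ = 1) (hv : ∀ b, ξ ∉ P.openArc b)
    (hfix : discMap (P.wordMap (a :: U)) ξ = P.tip s a) : P.TurnChain s (a :: U) := by
  induction U generalizing a with
  | nil => exact List.isChain_singleton _
  | cons b U ih =>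
    have h2 := List.isChain_cons_cons.1 h
    have h3 : discMap (P.wordMap (b :: U)) ξ = P.tip s (P.turn s a) := by
      rw [← P.discMap_tip, ← hfix, P.discMap_wordMap_cons a _ hξ,
        P.discMap_hat_discMap _ (norm_discMap _ hξ)]
    have h4 := P.wordMap_mem_closedArc h2.2 hξ hv
    rw [h3] at h4
    have h5 := P.eq_turn_of_mem_closedArc h2.1 h4
    refine List.isChain_cons_cons.2 ⟨h5, ih h2.2 ?_⟩
    rw [h3, h5]

lemma turnChain_iterate (s : Bool) (a : A) (n : ℕ) :
    P.TurnChain s (List.iterate (P.turn s) a n) := by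
  induction n generalizing a with
  | zero => exact List.isChain_nil
  | succ n ih =>
    refine List.isChain_cons.2 ⟨?_, ih _⟩
    cases n <;> simp [List.iterate]

lemma TurnChain.eq_iterate {s : Bool} {a : A} {U : List A} (h : P.TurnChain s (a :: U)) :
    a :: U = List.iterate (P.turn s) a (U.length + 1) := by
  induction U generalizing a with
  | nil => rfl
  | cons b U ih =>
    have h2 := List.isChain_cons_cons.1 h
    rw [List.length_cons, List.iterate, ← h2.1, ← ih h2.2]

/-- Tips lie on the isometric circles, so every step of a chain of turns is isometric there and no
contraction accumulates at the vertex. -/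
lemma wordMap_iterate_inv (s : Bool) (a : A) (n : ℕ) :
    discMap (P.wordMap (List.iterate (P.turn s) a n))⁻¹ (P.tip s a) =
      P.tip s ((P.turn s)^[n] a) ∧
    ‖den (P.wordMap (List.iterate (P.turn s) a n))⁻¹ (P.tip s a)‖ = 1 := by
  induction n generalizing a with
  | zero => simp [List.iterate, wordMap_nil, discMap_one, den_one]
  | succ n ih =>
    have h0 := den_ne_zero (P.F (P.hat a)) (P.norm_tip s a)
    rw [List.iterate, wordMap_cons, mul_inv_rev, ← P.F_hat, discMap_mul _ _ h0, den_mul _ _ h0,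
      norm_mul, P.norm_den_tip, P.discMap_tip, mul_one]
    exact ih _

/-- `turn s` is a permutation of a finite set; its order is a common period. One period is a vertex
cycle, which produces a parabolic element. -/
lemma exists_period (s : Bool) : ∃ ℓ : ℕ, 0 < ℓ ∧ ∀ a, (P.turn s)^[ℓ] a = a := by
  have := P.finite_letters
  let e : Equiv.Perm A := Equiv.ofBijective _ (Finite.injective_iff_bijective.1 (P.turn_injective s))
  refine ⟨orderOf e, orderOf_pos e, fun a => ?_⟩
  have h := congrArg (fun f : Equiv.Perm A => f a) (pow_orderOf_eq_one e)
  simp only [Equiv.Perm.coe_one, id] at h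
  rw [Equiv.Perm.coe_pow] at h
  exact h

/-- A letter `b` other than the inverse of the last one has its arc mapped into `[a]`; for `b ≠ a`
its left end must move. This excludes scalar matrices among the words that fix a vertex. -/
lemma exists_move {a : A} {U : List A} (h : P.Admissible (a :: U)) :
    ∃ η : ℂ, ‖η‖ = 1 ∧ discMap (P.wordMap (a :: U)) η ≠ η := by
  classical
  obtain ⟨b, hb⟩ := P.exists_notMem_finset
    {a, P.hat ((a :: U).getLast (List.cons_ne_nil _ _))} ((Finset.card_le_two).trans (by norm_num))
  simp only [Finset.mem_insert, Finset.mem_singleton, not_or] at hb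
  refine ⟨P.leftEnd b, P.norm_leftEnd b, fun e => hb.1 ?_⟩
  have h2 : P.Admissible ((a :: U) ++ [b]) := by
    refine List.isChain_append.2 ⟨h, List.isChain_singleton _, ?_⟩
    intro x hx y hy
    rw [List.getLast?_eq_getLast_of_ne_nil (List.cons_ne_nil _ _)] at hx
    simp only [Option.mem_def, Option.some.injEq, List.head?_cons] at hx hy
    rw [← hx, ← hy]
    exact hb.2
  have h3 := P.wordMap_mem_arc h2 (P.leftEnd_mem_arc b) a (by simp)
  rw [e] at h3
  exact P.eq_of_mem_arc (P.leftEnd_mem_arc b) h3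

lemma wordMap_cycle (s : Bool) (a : A) {n : ℕ} (hn : 0 < n) (hp : (P.turn s)^[n] a = a) :
    discMap (P.wordMap (List.iterate (P.turn s) a n)) (P.tip s a) = P.tip s a ∧
    ‖den (P.wordMap (List.iterate (P.turn s) a n)) (P.tip s a)‖ = 1 ∧
    (P.wordMap (List.iterate (P.turn s) a n) : Matrix (Fin 2) (Fin 2) ℝ).IsParabolic := by
  obtain ⟨h1, h2⟩ := P.wordMap_iterate_inv s a n
  set g := P.wordMap (List.iterate (P.turn s) a n) with hg
  rw [hp] at h1
  have hn1 := P.norm_tip s a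
  have h3 : discMap g (P.tip s a) = P.tip s a := by
    conv_lhs => rw [← h1]
    exact discMap_discMap_inv g (den_ne_zero _ hn1)
  have h4 : ‖den g (P.tip s a)‖ = 1 := by
    have := norm_den_inv g (den_ne_zero g hn1)
    rw [h3, h2] at this
    rw [← inv_inv ‖den g (P.tip s a)‖, ← this, inv_one]
  refine ⟨h3, h4, ?_⟩
  obtain ⟨m, rfl⟩ := Nat.exists_eq_succ_of_ne_zero hn.ne'
  obtain ⟨η, hη, hmove⟩ := P.exists_move
    (TurnChain.admissible P (P.turnChain_iterate s a (m + 1)))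
  exact isParabolic_of_fixed hn1 h3 h4 hη hmove

lemma tip_eq_vertex (s : Bool) (a : A) : ∃ j, P.tip s a = P.vertex j := by
  cases s
  · exact ⟨P.idx a + 1, rfl⟩
  · exact ⟨P.idx a, rfl⟩

/-- This removes parabolic elements from the combinatorics. A fixed vertex lies in the closed arc of
the first letter and in no open arc, so it is a tip, and undoing the letters forces turns.
Conversely, a chain of turns extends to a full number of periods, where the element is parabolic. -/
lemma isCuspidal_iff {W : List A} :
    P.IsCuspidal W ↔ W ≠ [] ∧ ∃ s, P.TurnChain s W := by
  constructor
  · rintro ⟨h0, V, h1, -, j, h2⟩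
    refine ⟨h0, ?_⟩
    obtain ⟨a, U, rfl⟩ := List.exists_cons_of_ne_nil h0
    rw [List.cons_append] at h1 h2
    have hv := P.vertex_notMem_openArc j
    have h3 := P.wordMap_mem_closedArc h1 (P.norm_vertex j) hv
    rcases P.mem_closedArc_iff_or.1 h3 with h4 | h4 | h4
    · rw [h2] at h4; exact absurd h4 (hv a)
    · exact ⟨true, List.IsChain.left_of_append (l₂ := V)
        (P.turnChain_of_discMap_eq h1 (P.norm_vertex j) hv h4)⟩
    · exact ⟨false, List.IsChain.left_of_append (l₂ := V)
        (P.turnChain_of_discMap_eq h1 (P.norm_vertex j) hv h4)⟩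
  · rintro ⟨h0, s, h1⟩
    refine ⟨h0, ?_⟩
    obtain ⟨a, U, rfl⟩ := List.exists_cons_of_ne_nil h0
    obtain ⟨ℓ, hℓ, hp⟩ := P.exists_period s
    -- A multiple of the period that is at least the length of the word.
    obtain ⟨m, hm⟩ : ∃ m, (U.length + 1) * ℓ = (U.length + 1) + m :=
      Nat.exists_eq_add_of_le (Nat.le_mul_of_pos_right _ hℓ)
    have hp2 : (P.turn s)^[(U.length + 1) * ℓ] a = a := by
      rw [mul_comm, Function.iterate_mul]
      exact Function.iterate_fixed (hp a) _
    obtain ⟨h2, -, h3⟩ := P.wordMap_cycle s a (by positivity) hp2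
    have h4 := P.turnChain_iterate s a ((U.length + 1) * ℓ)
    obtain ⟨j, hj⟩ := P.tip_eq_vertex s a
    rw [hm, List.iterate_add, ← TurnChain.eq_iterate P h1] at h2 h3 h4
    exact ⟨_, TurnChain.admissible P h4, h3, j, by rw [← hj]; exact h2⟩

lemma IsCuspidal.of_append {W V : List A} (h0 : W ≠ []) (h : P.IsCuspidal (W ++ V)) :
    P.IsCuspidal W := by
  obtain ⟨-, U, h1, h2⟩ := h
  rw [List.append_assoc] at h1 h2
  exact ⟨h0, _, h1, h2⟩

lemma IsCuspidal.admissible {W : List A} (h : P.IsCuspidal W) : P.Admissible W := by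
  obtain ⟨-, s, hs⟩ := P.isCuspidal_iff.1 h
  exact TurnChain.admissible P hs

lemma eq_turn_iff {s : Bool} {a b : A} :
    b = P.turn s a ↔ P.o b = P.o (P.hat a) + if s then 1 else -1 := by
  rw [← P.o_turn, P.o.injective.eq_iff]

lemma isLeft_iff {W : List A} : P.IsLeft W ↔ 2 ≤ W.length ∧ P.TurnChain true W := by
  simp only [IsLeft, TurnChain, eq_turn_iff, if_true]

lemma isRight_iff {W : List A} : P.IsRight W ↔ 2 ≤ W.length ∧ P.TurnChain false W := by
  simp only [IsRight, TurnChain, eq_turn_iff, Bool.false_eq_true, if_false, sub_eq_add_neg]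

lemma not_isLeft_and_isRight {W : List A} (h1 : P.IsLeft W) (h2 : P.IsRight W) : False := by
  obtain ⟨hl, h1⟩ := P.isLeft_iff.1 h1
  obtain ⟨-, h2⟩ := P.isRight_iff.1 h2
  match W, hl, h1, h2 with
  | a :: b :: U, _, h1, h2 =>
    exact P.turn_true_ne_turn_false a
      ((List.isChain_cons_cons.1 h1).1.symm.trans (List.isChain_cons_cons.1 h2).1)

lemma turnChain_append_singleton {s : Bool} {U : List A} {b a : A} :
    P.TurnChain s (U ++ [b] ++ [a]) ↔ P.TurnChain s (U ++ [b]) ∧ a = P.turn s b := by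
  unfold TurnChain
  rw [List.isChain_append (l₁ := U ++ [b])]
  simp

/-- A letter may follow a cuspidal word if it neither backtracks nor continues the word to a longer
cuspidal word. -/
lemma follows_iff {U : List A} {b a : A} (h : P.IsCuspidal (U ++ [b])) :
    P.Follows (U ++ [b]) a ↔ a ≠ P.hat b ∧ ¬ P.IsCuspidal (U ++ [b] ++ [a]) := by
  have hl : (U ++ [b]).getLast? = some b := by simp
  have e1 : P.o a = P.o (P.hat b) + 1 ↔ a = P.turn true b := by simp [eq_turn_iff]
  have e2 : P.o a = P.o (P.hat b) - 1 ↔ a = P.turn false b := by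
    simp [eq_turn_iff, sub_eq_add_neg]
  rw [Follows, hl]
  simp only [Option.mem_def, Option.some.injEq, forall_eq', ne_eq, e1, e2, isCuspidal_iff,
    turnChain_append_singleton, isLeft_iff, isRight_iff]
  rw [isCuspidal_iff] at h
  obtain ⟨-, h⟩ := h
  refine and_congr_right fun _ => ?_
  -- A one-letter word is a chain of both types, so both turns prolong it; a longer word has a
  -- single type and only the turn of this type prolongs it.
  rcases Nat.eq_zero_or_pos U.length with h0 | h0
  · rw [List.length_eq_zero_iff] at h0
    subst h0
    have hc : ∀ s, P.TurnChain s [b] := fun s => List.isChain_singleton _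
    simp [hc]
    tauto
  · have h1 : (U ++ [b]).length ≠ 1 := by simp; intro h; simp [h] at h0
    have h3 : U ≠ [] := by rintro rfl; simp at h0
    have h4 : 1 ≤ U.length := h0
    simp [h3, h4]
    tauto

lemma Follows.ne_hat {U : List A} {b a : A} (h : P.Follows (U ++ [b]) a) : a ≠ P.hat b :=
  (h b (by simp)).1

lemma exists_follows (W : List A) : ∃ a, P.Follows W a := by
  classical
  rcases W.eq_nil_or_concat with rfl | ⟨U, b, rfl⟩
  · obtain ⟨a, -⟩ := P.exists_notMem_finset ∅ (by simp)
    exact ⟨a, by simp [Follows]⟩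
  · obtain ⟨a, ha⟩ := P.exists_notMem_finset {P.hat b, P.turn true b, P.turn false b}
      Finset.card_le_three
    simp only [Finset.mem_insert, Finset.mem_singleton, not_or, eq_turn_iff, if_true,
      Bool.false_eq_true, if_false, ← sub_eq_add_neg] at ha
    refine ⟨a, ?_⟩
    simp only [Follows, List.concat_eq_append, List.getLast?_append, List.getLast?_singleton,
      Option.some_or, Option.mem_def, Option.some.injEq, forall_eq']
    exact ⟨ha.1, fun _ => ha.2, fun _ => ha.2.1, fun _ => ha.2.2⟩

lemma iterate_succ_eq_append (s : Bool) (a : A) (n : ℕ) :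
    List.iterate (P.turn s) a (n + 1) =
      List.iterate (P.turn s) a n ++ [(P.turn s)^[n] a] := by
  rw [List.iterate_add]; rfl

lemma isCuspidal_iterate (s : Bool) (a : A) (n : ℕ) :
    P.IsCuspidal (List.iterate (P.turn s) a (n + 1)) :=
  P.isCuspidal_iff.2 ⟨by simp [List.iterate], s, P.turnChain_iterate s a _⟩

lemma follows_iterate {s : Bool} {a b : A} {n : ℕ} (hn : 0 < n)
    (h1 : b ≠ P.hat ((P.turn s)^[n] a)) (h2 : b ≠ P.turn s ((P.turn s)^[n] a)) :
    P.Follows (List.iterate (P.turn s) a (n + 1)) b := by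
  have hc := P.isCuspidal_iterate s a n
  have ht := P.turnChain_iterate s a (n + 1)
  have hlen : 2 ≤ (List.iterate (P.turn s) a (n + 1)).length := by
    rw [List.length_iterate]; omega
  rw [iterate_succ_eq_append] at hc ht hlen ⊢
  rw [P.follows_iff hc]
  refine ⟨h1, fun h => ?_⟩
  obtain ⟨-, s', hs'⟩ := P.isCuspidal_iff.1 h
  rw [turnChain_append_singleton] at hs'
  have : s' = s := by
    by_contra hne
    cases s <;> cases s' <;> simp at hne
    · exact P.not_isLeft_and_isRight (P.isLeft_iff.2 ⟨hlen, hs'.1⟩) (P.isRight_iff.2 ⟨hlen, ht⟩)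
    · exact P.not_isLeft_and_isRight (P.isLeft_iff.2 ⟨hlen, ht⟩) (P.isRight_iff.2 ⟨hlen, hs'.1⟩)
  subst this
  exact h2 hs'.2

/-- Any letter may follow a suitable cuspidal word with a given first letter. -/
lemma exists_isCuspidal_follows (a b : A) :
    ∃ W, P.IsCuspidal W ∧ W.head? = some a ∧ P.Follows W b := by
  obtain ⟨s, hs⟩ : ∃ s, P.turn s a ≠ a := by
    by_contra h
    push Not at h
    exact P.turn_true_ne_turn_false a ((h true).trans (h false).symm)
  obtain ⟨ℓ, hℓ, hp⟩ := P.exists_period s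
  have key : ∀ n, 0 < n → b ≠ P.hat ((P.turn s)^[n] a) → b ≠ P.turn s ((P.turn s)^[n] a) →
      ∃ W, P.IsCuspidal W ∧ W.head? = some a ∧ P.Follows W b := fun n hn h1 h2 =>
    ⟨_, P.isCuspidal_iterate s a n, by simp [List.iterate], P.follows_iterate hn h1 h2⟩
  -- The candidates have `n + 1` letters with `n = ℓ, 1, 2`; at least two letters, so that only one
  -- turn is forbidden afterwards. If `b` were rejected by all three, it would force coincidences
  -- incompatible with `turn s a ≠ a` and `hat` having no fixed point.
  by_contra hne
  have hx : ∀ n, 0 < n → b = P.hat ((P.turn s)^[n] a) ∨ b = P.turn s ((P.turn s)^[n] a) := by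
    intro n hn
    by_contra h
    rw [not_or] at h
    exact hne (key n hn h.1 h.2)
  have h0 := hx ℓ hℓ
  rw [hp] at h0
  have h1 := hx 1 one_pos
  have h2 := hx 2 two_pos
  simp only [Function.iterate_succ, Function.iterate_zero, Function.comp, id] at h1 h2
  have inj := P.turn_injective s
  have hinj := P.hat_injective
  have hh := P.hat_ne
  rcases h0 with h0 | h0
  · rcases h1 with h1 | h1
    · exact hs (hinj (h1.symm.trans h0))
    · have e : P.turn s (P.turn s a) = P.hat a := h1.symm.trans h0
      rw [e, P.hat_hat] at h2
      rcases h2 with h2 | h2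
      · exact hh a (h0.symm.trans h2)
      · have e2 : P.turn s (P.turn s a) = P.turn s (P.hat a) := h1.symm.trans h2
        have e3 := inj e2
        rw [e3] at e
        exact hs (inj (by rw [e3, e]))
  · rcases h1 with h1 | h1
    · exact hh (P.turn s a) (h1.symm.trans h0)
    · exact hs (inj (h1.symm.trans h0))

end LabelledIdealPolygon

/-! ### Aperiodicity of the transition matrix -/

section Aperiodic

variable {Γ₀ : Subgroup SL(2, ℝ)} {A : Type*} (Γ : Subgroup SL(2, ℝ)) {p : ℕ}
  (S : Fin p → SL(2, ℝ)) (P : LabelledIdealPolygon Γ₀ A)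

/-- The transition matrix is aperiodic on `𝒲_T` for all large `T`. -/
theorem exists_isAperiodic : ∃ T₀ : ℝ, ∀ T ≥ T₀, IsAperiodic Γ S P T := by
  choose w hw1 hw2 hw3 using P.exists_isCuspidal_follows
  have := P.finite_letters
  obtain ⟨T₀, hT₀⟩ := (Set.finite_range fun x : A × A => geomLength Γ S P (w x.1 x.2)).bddAbove
  -- One intermediate word suffices: it begins with a letter that may follow `W` and may itself be
  -- followed by the first letter of `W'`. Only finitely many such words are used, and `T₀` bounds
  -- their geometric lengths.
  refine ⟨T₀, fun T hT => ⟨2, fun W W' => ?_⟩⟩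
  obtain ⟨a, ha⟩ := P.exists_follows W.1
  obtain ⟨b, U, hb⟩ := List.exists_cons_of_ne_nil W'.2.1.1
  let V : Alphabet Γ S P T := ⟨w a b, hw1 a b, (hT₀ ⟨(a, b), rfl⟩).trans hT⟩
  refine ⟨fun n => if n = 0 then W else if n = 1 then V else W', rfl, rfl, fun i hi => ?_⟩
  interval_cases i
  · intro c hc
    obtain rfl : a = c := by simpa [V, hw2] using hc
    exact ha
  · intro c hc
    obtain rfl : b = c := by simpa [hb] using hc
    exact hw3 a b

end Aperiodic

end BowenSeries

namespace BowenSeries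

namespace LabelledIdealPolygon

open ComplexConjugate

variable {Γ₀ : Subgroup SL(2, ℝ)} {A : Type*} (P : LabelledIdealPolygon Γ₀ A)

/-! ### Contraction factors -/

/-- The closed disc bounded by the isometric circle that contains the side `s_a`. -/
def disc (a : A) : Set ℂ := {ξ | ‖den (P.F (P.hat a)) ξ‖ ≤ 1}

lemma closedArc_subset_disc (a : A) : P.closedArc a ⊆ P.disc a := fun _ h =>
  (P.mem_closedArc_iff (P.norm_of_mem_closedArc h)).1 h

/-- Since `|ξ|² + 1 ≥ 2|ξ|`, with equality only on the unit circle, radial projection sends the disc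
into the closed arc, and its points off the circle into the open arc. Questions about discs thereby
become questions about arcs. -/
lemma radial_of_mem_disc {a : A} {ξ : ℂ} (h : ξ ∈ P.disc a) :
    0 < ‖ξ‖ ∧ ξ / ‖ξ‖ ∈ P.closedArc a ∧ (‖ξ‖ ≠ 1 → ξ / ‖ξ‖ ∈ P.openArc a) := by
  obtain ⟨K, hK, hf⟩ := P.exists_normSq_den a
  have hc := P.cos_half_pos a
  have h1 : ‖den (P.F (P.hat a)) ξ‖ ^ 2 - 1 ≤ 0 := norm_sq_sub_one_le_zero.2 h
  rw [hf] at h1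
  have h2 : (‖ξ‖ ^ 2 + 1) * Real.cos (P.half a) -
      2 * (Complex.exp (P.mid a * Complex.I) * ξ).re ≤ 0 := by
    by_contra hh
    push Not at hh
    exact absurd h1 (not_le.2 (mul_pos hK hh))
  have h0 : 0 < ‖ξ‖ := by
    rw [norm_pos_iff]
    rintro rfl
    simp at h2
    linarith
  have hr : (Complex.exp (P.mid a * Complex.I) * ξ).re =
      ‖ξ‖ * (Complex.exp (P.mid a * Complex.I) * (ξ / ‖ξ‖)).re := by
    rw [← Complex.re_ofReal_mul]
    congr 1
    have : (‖ξ‖ : ℂ) ≠ 0 := by exact_mod_cast h0.ne'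
    field_simp
  have hn : ‖ξ / ‖ξ‖‖ = 1 := by
    rw [norm_div, Complex.norm_real, norm_norm, div_self h0.ne']
  have hζ := hf (ξ / ‖ξ‖)
  rw [hn] at hζ
  rw [hr] at h2
  refine ⟨h0, ?_, fun hne => ?_⟩
  · rw [P.mem_closedArc_iff hn, ← norm_sq_sub_one_le_zero, hζ]
    apply mul_nonpos_of_nonneg_of_nonpos hK.le
    have := mul_nonneg (sq_nonneg (‖ξ‖ - 1)) hc.le
    have : ‖ξ‖ * ((1 ^ 2 + 1) * Real.cos (P.half a) -
      2 * (Complex.exp (P.mid a * Complex.I) * (ξ / ‖ξ‖)).re) ≤ 0 := by linarith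
    by_contra hh
    push Not at hh
    exact absurd this (not_le.2 (mul_pos h0 hh))
  · rw [P.mem_openArc_iff hn, ← norm_sq_sub_one_lt_zero, hζ]
    apply mul_neg_of_pos_of_neg hK
    have := mul_pos (sq_pos_of_ne_zero (sub_ne_zero.2 hne)) hc
    have : ‖ξ‖ * ((1 ^ 2 + 1) * Real.cos (P.half a) -
      2 * (Complex.exp (P.mid a * Complex.I) * (ξ / ‖ξ‖)).re) < 0 := by linarith
    by_contra hh
    push Not at hh
    exact absurd this (not_lt.2 (mul_nonneg h0.le hh))

/-- Off the unit circle the radial projection would lie in an open arc and in a different closed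
arc. Hence distinct discs touch only on the unit circle. -/
lemma mem_closedArc_of_mem_disc {a b : A} (hab : a ≠ b) {ξ : ℂ} (ha : ξ ∈ P.disc a)
    (hb : ξ ∈ P.disc b) : ξ ∈ P.closedArc a ∧ ξ ∈ P.closedArc b := by
  obtain ⟨-, h1, h2⟩ := P.radial_of_mem_disc ha
  obtain ⟨-, h3, -⟩ := P.radial_of_mem_disc hb
  have h4 : ‖ξ‖ = 1 := by
    by_contra h
    exact P.notMem_openArc_of_mem_closedArc hab.symm h3 (h2 h)
  rw [h4, Complex.ofReal_one, div_one] at h1 h3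
  exact ⟨h1, h3⟩

lemma one_lt_norm_den {a b : A} (hab : a ≠ P.hat b) {ξ : ℂ} (ha : ξ ∈ P.disc a)
    (h : ¬ (ξ ∈ P.closedArc a ∧ ξ ∈ P.closedArc (P.hat b))) : 1 < ‖den (P.F b) ξ‖ := by
  by_contra hh
  push Not at hh
  refine h (P.mem_closedArc_of_mem_disc hab ha ?_)
  rwa [disc, Set.mem_ofPred_eq, P.hat_hat]

lemma one_le_norm_den {a b : A} (hab : a ≠ P.hat b) {ξ : ℂ} (ha : ξ ∈ P.disc a) :
    1 ≤ ‖den (P.F b) ξ‖ := by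
  by_cases h : ξ ∈ P.closedArc a ∧ ξ ∈ P.closedArc (P.hat b)
  · have h2 := P.notMem_openArc_of_mem_closedArc hab h.1
    rwa [P.mem_openArc_iff (P.norm_of_mem_closedArc h.1), P.hat_hat, not_lt] at h2
  · exact (P.one_lt_norm_den hab ha h).le

lemma discMap_mem_disc {a b : A} (hab : a ≠ P.hat b) {ξ : ℂ} (ha : ξ ∈ P.disc a) :
    discMap (P.F b) ξ ∈ P.disc b := by
  have h := P.one_le_norm_den hab ha
  rw [disc, Set.mem_ofPred_eq, P.norm_den_hat b (norm_pos_iff.1 (by linarith))]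
  exact inv_le_one_of_one_le₀ h

lemma wordMap_mem_disc {U : List A} {b : A} (h : P.Admissible (U ++ [b])) {ξ : ℂ}
    (hξ : ξ ∈ P.disc b) : 1 ≤ ‖den (P.wordMap U) ξ‖ ∧
      ∀ a ∈ (U ++ [b]).head?, discMap (P.wordMap U) ξ ∈ P.disc a := by
  induction U with
  | nil => simpa [wordMap_nil, discMap_one, den_one] using hξ
  | cons c U ih =>
    have h2 := List.isChain_cons.1 h
    obtain ⟨h3, h4⟩ := ih h2.2
    have h0 : den (P.wordMap U) ξ ≠ 0 := norm_pos_iff.1 (by linarith)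
    obtain ⟨e, he⟩ : ∃ e, e ∈ (U ++ [b]).head? := by cases U <;> simp
    have h5 := P.one_le_norm_den (h2.1 e he) (h4 e he)
    rw [wordMap_cons, den_mul _ _ h0, norm_mul, discMap_mul _ _ h0]
    refine ⟨one_le_mul_of_one_le_of_one_le h5 h3, fun a ha => ?_⟩
    obtain rfl : c = a := by simpa using ha
    exact P.discMap_mem_disc (h2.1 e he) (h4 e he)

lemma isCompact_disc (a : A) : IsCompact (P.disc a) := by
  apply Metric.isCompact_of_isClosed_isBounded
  · exact isClosed_le (continuous_den _).norm continuous_const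
  · obtain ⟨K, hK, hf⟩ := P.exists_normSq_den a
    have hc := P.cos_half_pos a
    refine (Metric.isBounded_closedBall (x := (0 : ℂ)) (r := 2 / Real.cos (P.half a))).subset ?_
    intro ξ h
    have h1 : ‖den (P.F (P.hat a)) ξ‖ ^ 2 - 1 ≤ 0 := norm_sq_sub_one_le_zero.2 h
    rw [hf] at h1
    have h2 : (‖ξ‖ ^ 2 + 1) * Real.cos (P.half a) -
        2 * (Complex.exp (P.mid a * Complex.I) * ξ).re ≤ 0 := by
      by_contra hh
      push Not at hh
      exact absurd h1 (not_le.2 (mul_pos hK hh))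
    have h3 : (Complex.exp (P.mid a * Complex.I) * ξ).re ≤ ‖ξ‖ := by
      refine (Complex.re_le_norm _).trans ?_
      rw [norm_mul, Complex.norm_exp_ofReal_mul_I, one_mul]
    rw [mem_closedBall_zero_iff, le_div_iff₀ hc]
    have h0 := (P.radial_of_mem_disc h).1
    nlinarith

lemma exists_derivNorm_le (a : A) (g : SL(2, ℝ)) (hg : ∀ ξ ∈ P.disc a, 1 < ‖den g ξ‖) :
    ∃ θ : ℝ, 0 < θ ∧ θ < 1 ∧ ∀ ξ ∈ P.disc a, derivNorm g ξ ≤ θ := by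
  obtain ⟨ξ₀, h0, hmin⟩ := (P.isCompact_disc a).exists_isMinOn
    ⟨_, P.closedArc_subset_disc a (P.tip_mem_closedArc true a)⟩ (continuous_den g).norm.continuousOn
  have h1 := hg ξ₀ h0
  refine ⟨1 / ‖den g ξ₀‖ ^ 2, by positivity, ?_, fun ξ hξ => ?_⟩
  · rw [div_lt_one (by positivity)]
    nlinarith
  · have h2 := hg ξ hξ
    rw [derivNorm_eq g (norm_pos_iff.1 (by linarith))]
    have h3 : ‖den g ξ₀‖ ≤ ‖den g ξ‖ := hmin hξ
    gcongr

/-- Equality would need `[a]` and `[hat b]` to share a vertex, which makes `a` one of the two turns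
of `b`; both are forbidden after a one-letter word. -/
lemma one_lt_norm_den_singleton {a b : A} (h : P.Follows [b] a) {ξ : ℂ} (hξ : ξ ∈ P.disc a) :
    1 < ‖den (P.wordMap [b]) ξ‖ := by
  obtain ⟨h1, h2, -⟩ := h b (by simp)
  obtain ⟨h2, h3⟩ := h2 rfl
  rw [wordMap_singleton]
  refine P.one_lt_norm_den h1 hξ fun ⟨h4, h5⟩ => ?_
  rcases P.eq_or_of_mem_closedArc h4 h5 with h | ⟨h, -⟩ | ⟨h, -⟩
  · exact h1 h
  · exact h3 (by rw [h]; ring)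
  · exact h2 h

/-- Both factors of the denominator have modulus at least one. Equality in both identifies `ξ` and
its image with tips of the chain, so that `a` would be the next turn. A single letter would not do,
since it is isometric at a vertex. -/
lemma one_lt_norm_den_pair {s : Bool} {a c : A} (h1 : a ≠ P.hat (P.turn s c))
    (h2 : a ≠ P.turn s (P.turn s c)) {ξ : ℂ} (hξ : ξ ∈ P.disc a) :
    1 < ‖den (P.wordMap [c, P.turn s c]) ξ‖ := by
  have h3 := P.one_le_norm_den h1 hξ
  have h4 := P.discMap_mem_disc h1 hξ
  have hne := P.turn_ne_hat s c
  have h5 := P.one_le_norm_den hne h4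
  have h0 : den (P.F (P.turn s c)) ξ ≠ 0 := norm_pos_iff.1 (by linarith)
  have e : P.wordMap [c, P.turn s c] = P.F c * P.F (P.turn s c) := by simp [wordMap]
  rw [e, den_mul _ _ h0, norm_mul]
  by_contra hh
  push Not at hh
  have h6 : ¬ 1 < ‖den (P.F (P.turn s c)) ξ‖ := fun h => by nlinarith
  have h7 : ¬ 1 < ‖den (P.F c) (discMap (P.F (P.turn s c)) ξ)‖ := fun h => by nlinarith
  have h8 : ξ ∈ P.closedArc a ∧ ξ ∈ P.closedArc (P.hat (P.turn s c)) := by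
    by_contra h; exact h6 (P.one_lt_norm_den h1 hξ h)
  have hn := P.norm_of_mem_closedArc h8.1
  obtain ⟨h9, h10⟩ : discMap (P.F (P.turn s c)) ξ ∈ P.closedArc (P.turn s c) ∧
      discMap (P.F (P.turn s c)) ξ ∈ P.closedArc (P.hat c) := by
    by_contra h; exact h7 (P.one_lt_norm_den hne h4 h)
  have h11 : discMap (P.F (P.turn s c)) ξ = P.tip s (P.turn s c) := by
    have h2z := P.two_ne_zero_zmod
    have ho := P.o_turn s c
    rcases P.eq_or_of_mem_closedArc h9 h10 with h | ⟨h, h', -⟩ | ⟨h, -, h'⟩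
    · exact absurd h hne
    · cases s
      · exact h'
      · rw [h, if_pos rfl] at ho
        exact absurd (by linear_combination -ho) h2z
    · cases s
      · rw [h] at ho
        simp only [Bool.false_eq_true, if_false] at ho
        exact absurd (by linear_combination ho) h2z
      · exact h'
  have h12 : ξ = P.tip s (P.turn s (P.turn s c)) := by
    rw [← P.discMap_tip, ← h11, P.discMap_hat_discMap _ hn]
  exact h2 (P.eq_turn_of_mem_closedArc h1 (h12 ▸ h8.1))

/-- Contraction factors exist. -/
theorem exists_isContractionFactor : ∃ θ : ℝ, P.IsContractionFactor θ := by
  have hfin := P.finite_letters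
  -- The bound is made total in the pair so that it can be chosen as a function; `1 / 2` is a filler
  -- where the strict inequality fails.
  have key : ∀ x : List A × A, ∃ θ : ℝ, 0 < θ ∧ θ < 1 ∧
      ((∀ ξ ∈ P.disc x.2, 1 < ‖den (P.wordMap x.1) ξ‖) →
        ∀ ξ ∈ P.disc x.2, derivNorm (P.wordMap x.1) ξ ≤ θ) := by
    intro x
    by_cases h : ∀ ξ ∈ P.disc x.2, 1 < ‖den (P.wordMap x.1) ξ‖
    · obtain ⟨θ, h1, h2, h3⟩ := P.exists_derivNorm_le _ _ h
      exact ⟨θ, h1, h2, fun _ => h3⟩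
    · exact ⟨1 / 2, by norm_num, by norm_num, fun h' => absurd h' h⟩
  choose f hf0 hf1 hf using key
  obtain ⟨a₀, -⟩ := P.exists_notMem_finset ∅ (by simp)
  have : Nonempty A := ⟨a₀⟩
  -- Only the last two letters matter: the earlier letters of a cuspidal word have denominators of
  -- modulus at least one on the disc reached. Maxima over the finitely many one- and two-letter
  -- words thus serve for words of any length.
  obtain ⟨x₁, hx₁⟩ := Finite.exists_max fun x : A × A => f ([x.1], x.2)
  obtain ⟨x₂, hx₂⟩ := Finite.exists_max fun x : A × A × A => f ([x.1, x.2.1], x.2.2)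
  refine ⟨max (f ([x₁.1], x₁.2)) (f ([x₂.1, x₂.2.1], x₂.2.2)), lt_max_of_lt_left (hf0 _),
    max_lt (hf1 _) (hf1 _), fun W hW a ha ξ hξ => ?_⟩
  have hξ : ξ ∈ P.disc a := le_of_lt (show ‖den (P.F (P.hat a)) ξ‖ < 1 from hξ)
  rcases W.eq_nil_or_concat with rfl | ⟨U, b, rfl⟩
  · exact absurd rfl hW.1
  rw [List.concat_eq_append] at *
  rcases U.eq_nil_or_concat with rfl | ⟨U, c, rfl⟩
  · refine le_max_of_le_left ((hf ([b], a) ?_ ξ hξ).trans (hx₁ (b, a)))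
    exact fun η hη => P.one_lt_norm_den_singleton ha hη
  · rw [List.concat_eq_append] at *
    rw [P.follows_iff hW, isCuspidal_iff] at ha
    obtain ⟨-, s, hs⟩ := P.isCuspidal_iff.1 hW
    have hb := P.turnChain_append_singleton.1 hs
    have ha2 : a ≠ P.turn s b := fun e =>
      ha.2 ⟨by simp, s, P.turnChain_append_singleton.2 ⟨hs, e⟩⟩
    obtain rfl := hb.2
    have h1 : ∀ η ∈ P.disc a, 1 < ‖den (P.wordMap [c, P.turn s c]) η‖ := fun η hη =>
      P.one_lt_norm_den_pair ha.1 ha2 hη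
    have h2 : P.Admissible ([c, P.turn s c] ++ [a]) := by
      simpa [Admissible] using ⟨P.turn_ne_hat s c, ha.1⟩
    have h3 : P.Admissible (U ++ [c]) := TurnChain.admissible P hb.1
    have e : U ++ [c] ++ [P.turn s c] = U ++ [c, P.turn s c] := by simp
    have h4 := P.wordMap_mem_disc h2 hξ
    have h5 := P.wordMap_mem_disc h3 (h4.2 c (by simp))
    have h6 := h1 ξ hξ
    rw [e, wordMap_append, derivNorm_mul _ _ (norm_pos_iff.1 (by linarith))
      (norm_pos_iff.1 (by linarith))]
    refine le_max_of_le_right (le_trans ?_ ((hf ([c, P.turn s c], a) h1 ξ hξ).trans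
      (hx₂ (c, P.turn s c, a))))
    refine mul_le_of_le_one_left (norm_nonneg _) ?_
    rw [derivNorm_eq _ (norm_pos_iff.1 (by linarith))]
    have := h5.1
    rw [div_le_one (by positivity)]
    nlinarith

end LabelledIdealPolygon

end BowenSeries

namespace BowenSeries

namespace LabelledIdealPolygon

variable {Γ₀ : Subgroup SL(2, ℝ)} {A : Type*} (P : LabelledIdealPolygon Γ₀ A)

/-! ### Arcs of words -/

lemma norm_of_mem_wordArc {W : List A} {ξ : ℂ} (h : ξ ∈ P.wordArc W) : ‖ξ‖ = 1 :=
  mem_sphere_zero_iff_norm.1 h.1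

lemma norm_bowenSeriesMap {ξ : ℂ} (hξ : ‖ξ‖ = 1) : ‖P.bowenSeriesMap ξ‖ = 1 := by
  obtain ⟨a, ha⟩ := P.exists_mem_arc hξ
  rw [P.bowenSeriesMap_eq ha]
  exact norm_discMap _ hξ

lemma norm_bowenSeriesMap_iterate {ξ : ℂ} (hξ : ‖ξ‖ = 1) (k : ℕ) :
    ‖P.bowenSeriesMap^[k] ξ‖ = 1 := by
  induction k with
  | zero => exact hξ
  | succ k ih => rw [Function.iterate_succ_apply']; exact P.norm_bowenSeriesMap ih

lemma mem_wordArc_append {U V : List A} {ξ : ℂ} :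
    ξ ∈ P.wordArc (U ++ V) ↔ ξ ∈ P.wordArc U ∧ P.bowenSeriesMap^[U.length] ξ ∈ P.wordArc V := by
  constructor
  · rintro ⟨h1, h2⟩
    refine ⟨⟨h1, fun k hk => ?_⟩, ?_, fun k hk => ?_⟩
    · have := h2 k (by rw [List.length_append]; omega)
      rwa [List.getElem_append_left hk] at this
    · exact mem_sphere_zero_iff_norm.2
        (P.norm_bowenSeriesMap_iterate (mem_sphere_zero_iff_norm.1 h1) _)
    · have := h2 (k + U.length) (by rw [List.length_append]; omega)
      rw [List.getElem_append_right (by omega), Function.iterate_add_apply] at this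
      simpa using this
  · rintro ⟨⟨h1, h2⟩, -, h3⟩
    refine ⟨h1, fun k hk => ?_⟩
    rcases lt_or_ge k U.length with h | h
    · rw [List.getElem_append_left h]; exact h2 k h
    · obtain ⟨m, rfl⟩ := Nat.exists_eq_add_of_le' h
      rw [List.length_append] at hk
      rw [List.getElem_append_right (by omega), Function.iterate_add_apply]
      simpa using h3 m (by omega)

lemma mem_wordArc_singleton {a : A} {ξ : ℂ} : ξ ∈ P.wordArc [a] ↔ ξ ∈ P.arc a := by
  constructor
  · rintro ⟨-, h⟩; exact h 0 (by simp)
  · intro h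
    refine ⟨mem_sphere_zero_iff_norm.2 (P.norm_of_mem_arc h), fun k hk => ?_⟩
    obtain rfl : k = 0 := by simpa using hk
    exact h

lemma mem_wordArc_cons {a : A} {U : List A} {ξ : ℂ} : ξ ∈ P.wordArc (a :: U) ↔
    ξ ∈ P.arc a ∧ discMap (P.F (P.hat a)) ξ ∈ P.wordArc U := by
  rw [← List.singleton_append, mem_wordArc_append, mem_wordArc_singleton]
  refine and_congr_right fun h => ?_
  rw [List.length_singleton, Function.iterate_one, P.bowenSeriesMap_eq h]

lemma bowenSeriesMap_iterate {U : List A} {ξ : ℂ} (h : ξ ∈ P.wordArc U) :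
    P.bowenSeriesMap^[U.length] ξ = discMap (P.wordMap U)⁻¹ ξ := by
  induction U generalizing ξ with
  | nil => simp [wordMap_nil, discMap_one]
  | cons a U ih =>
    have h2 := P.mem_wordArc_cons.1 h
    rw [List.length_cons, Function.iterate_succ_apply, P.bowenSeriesMap_eq h2.1, ih h2.2,
      wordMap_cons, mul_inv_rev, ← P.F_hat, discMap_mul _ _ (den_ne_zero _ (P.norm_of_mem_arc h2.1))]

lemma mem_wordArc_append' {U V : List A} {ξ : ℂ} :
    ξ ∈ P.wordArc (U ++ V) ↔ ξ ∈ P.wordArc U ∧ discMap (P.wordMap U)⁻¹ ξ ∈ P.wordArc V := by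
  rw [mem_wordArc_append]
  exact and_congr_right fun h => by rw [P.bowenSeriesMap_iterate h]

lemma prefix_of_mem_wordArc {U V : List A} {ξ : ℂ} (hU : ξ ∈ P.wordArc U) (hV : ξ ∈ P.wordArc V)
    (hl : U.length ≤ V.length) : U <+: V := by
  rw [List.prefix_iff_eq_take]
  refine List.ext_getElem (by simpa using hl) fun k h1 h2 => ?_
  rw [List.getElem_take]
  exact P.eq_of_mem_arc (hU.2 k h1) (hV.2 k (by omega))

lemma wordArc_nonempty {U : List A} (h : P.Admissible U) : (P.wordArc U).Nonempty := by
  induction U with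
  | nil => exact ⟨1, by simp [wordArc]⟩
  | cons a U ih =>
    obtain ⟨ξ, hξ⟩ := ih h.tail
    have hn := P.norm_of_mem_wordArc hξ
    have key : ∀ η : ℂ, ‖η‖ = 1 → η ∈ P.wordArc U → (∃ b, b ≠ P.hat a ∧ η ∈ P.arc b) →
        (P.wordArc (a :: U)).Nonempty := by
      rintro η hη h1 ⟨b, hb, h2⟩
      refine ⟨discMap (P.F a) η, P.mem_wordArc_cons.2 ⟨P.discMap_mem_arc hb h2, ?_⟩⟩
      rwa [P.discMap_hat_discMap a hη]
    cases U with
    | nil =>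
      classical
      obtain ⟨b, hb⟩ := P.exists_notMem_finset {P.hat a} (by simp)
      have h1 := P.leftEnd_mem_arc b
      exact key _ (P.norm_leftEnd b) ⟨mem_sphere_zero_iff_norm.2 (P.norm_leftEnd b), by simp⟩
        ⟨b, by simpa using hb, h1⟩
    | cons b U =>
      exact key ξ hn hξ ⟨b, (List.isChain_cons_cons.1 h).1, (P.mem_wordArc_cons.1 hξ).1⟩

lemma norm_of_mem_closure_wordArc {W : List A} {ξ : ℂ} (h : ξ ∈ closure (P.wordArc W)) :
    ‖ξ‖ = 1 :=
  mem_sphere_zero_iff_norm.1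
    (closure_minimal (fun _ h => h.1) Metric.isClosed_sphere h)

lemma closure_wordArc_cons {a : A} {U : List A} {ξ : ℂ} (h : ξ ∈ closure (P.wordArc (a :: U))) :
    ξ ∈ P.closedArc a :=
  closure_minimal (fun _ h => P.arc_subset_closedArc a (P.mem_wordArc_cons.1 h).1)
    (P.isCompact_closedArc a).isClosed h

lemma closure_wordArc_append {U V : List A} {ξ : ℂ} (h : ξ ∈ closure (P.wordArc (U ++ V))) :
    discMap (P.wordMap U)⁻¹ ξ ∈ closure (P.wordArc V) := by
  have hξ := P.norm_of_mem_closure_wordArc h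
  have h1 := mem_closure_image
    (hasDerivAt_discMap (P.wordMap U)⁻¹ (den_ne_zero _ hξ)).continuousAt h
  refine closure_mono ?_ h1
  rintro _ ⟨η, hη, rfl⟩
  exact (P.mem_wordArc_append'.1 hη).2

/-- An end of an arc is a limit point of the arc of a word only if the word keeps turning at that
end. Sequences of `Σ` break every chain of turns, so their limit points stay inside open arcs. -/
lemma turnChain_of_mem_closure {s : Bool} {a : A} {U : List A} (h : P.Admissible (a :: U))
    (hc : P.tip s a ∈ closure (P.wordArc (a :: U))) : P.TurnChain s (a :: U) := by
  induction U generalizing a with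
  | nil => exact List.isChain_singleton _
  | cons b U ih =>
    have h2 := List.isChain_cons_cons.1 h
    rw [← List.singleton_append] at hc
    have h3 := P.closure_wordArc_append hc
    rw [wordMap_singleton, ← P.F_hat, P.discMap_tip] at h3
    have h4 := P.eq_turn_of_mem_closedArc h2.1 (P.closure_wordArc_cons h3)
    refine List.isChain_cons_cons.2 ⟨h4, ih h2.2 ?_⟩
    rwa [h4] at h3 ⊢

end LabelledIdealPolygon

/-! ### The coding map of the shift space -/

section Coding

variable {Γ₀ : Subgroup SL(2, ℝ)} {A : Type*} {Γ : Subgroup SL(2, ℝ)} {p : ℕ}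
  {S : Fin p → SL(2, ℝ)} {P : LabelledIdealPolygon Γ₀ A} {T : ℝ}

open LabelledIdealPolygon

namespace ShiftSpace

lemma ext_word {w w' : ShiftSpace Γ S P T} (h : ∀ r, w.1 r = w'.1 r) : w = w' :=
  Subtype.ext (funext h)

/-- The concatenation of the first `n` words. -/
def pre (w : ShiftSpace Γ S P T) (n : ℕ) : List A := (List.range n).flatMap w.word

lemma pre_succ (w : ShiftSpace Γ S P T) (n : ℕ) : w.pre (n + 1) = w.pre n ++ w.word n := by
  simp [pre, List.range_succ]

lemma pre_one (w : ShiftSpace Γ S P T) : w.pre 1 = w.word 0 := by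
  simp [pre]

lemma pre_succ' (w : ShiftSpace Γ S P T) (n : ℕ) :
    w.pre (n + 1) = w.word 0 ++ w.shift.pre n := by
  induction n with
  | zero => simp [pre]
  | succ n ih =>
    rw [pre_succ, ih, pre_succ, List.append_assoc]
    rfl

lemma isCuspidal (w : ShiftSpace Γ S P T) (r : ℕ) : P.IsCuspidal (w.word r) := (w.1 r).2.1

lemma word_ne_nil (w : ShiftSpace Γ S P T) (r : ℕ) : w.word r ≠ [] := (w.isCuspidal r).1

/-- The first letter of the `r`-th word. -/
def letter (w : ShiftSpace Γ S P T) (r : ℕ) : A := (w.word r).head (w.word_ne_nil r)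

lemma head?_word (w : ShiftSpace Γ S P T) (r : ℕ) : (w.word r).head? = some (w.letter r) :=
  List.head?_eq_some_head _

lemma exists_word_eq (w : ShiftSpace Γ S P T) (r : ℕ) : ∃ U, w.word r = w.letter r :: U :=
  ⟨_, (List.cons_head_tail (w.word_ne_nil r)).symm⟩

lemma follows (w : ShiftSpace Γ S P T) (r : ℕ) : P.Follows (w.word r) (w.letter (r + 1)) :=
  w.2 r _ (w.head?_word (r + 1))

lemma not_isCuspidal_append (w : ShiftSpace Γ S P T) (r : ℕ) :
    ¬ P.IsCuspidal (w.word r ++ [w.letter (r + 1)]) := by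
  have h := w.follows r
  have hc := w.isCuspidal r
  rcases (w.word r).eq_nil_or_concat with h0 | ⟨U, b, h0⟩
  · exact absurd h0 (w.word_ne_nil r)
  · rw [List.concat_eq_append] at h0
    rw [h0] at h hc ⊢
    exact ((P.follows_iff hc).1 h).2

lemma admissible_pre (w : ShiftSpace Γ S P T) (n : ℕ) : P.Admissible (w.pre n) := by
  -- The next letter is carried along so that the induction controls the junction of two words.
  suffices h : P.Admissible (w.pre n ++ [w.letter n]) from List.IsChain.left_of_append h
  induction n with
  | zero => exact List.isChain_singleton _
  | succ n ih =>
    have hc := w.isCuspidal n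
    have hf := w.follows n
    rw [pre_succ]
    have h1 : P.Admissible (w.pre n ++ w.word n) := by
      refine List.isChain_append.2 ⟨List.IsChain.left_of_append ih, hc.admissible, ?_⟩
      intro x hx y hy
      rw [w.head?_word] at hy
      exact (List.isChain_append.1 ih).2.2 x hx y hy
    refine List.isChain_append.2 ⟨h1, List.isChain_singleton _, ?_⟩
    intro x hx y hy
    rcases (w.word n).eq_nil_or_concat with h0 | ⟨U, b, h0⟩
    · exact absurd h0 (w.word_ne_nil n)
    · rw [List.concat_eq_append] at h0
      rw [h0] at hx hf
      rw [← List.append_assoc, List.getLast?_append] at hx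
      simp only [List.getLast?_singleton, Option.some_or, Option.mem_def, Option.some.injEq,
        List.head?_cons] at hx hy
      rw [← hx, ← hy]
      exact hf.ne_hat

/-- A point in the closures of all the arcs of `w` never meets an endpoint of an arc. -/
lemma mem_openArc {w : ShiftSpace Γ S P T} {ξ : ℂ} (h : ∀ n, ξ ∈ closure (P.wordArc (w.pre n)))
    {n : ℕ} {U V : List A} {b : A} (hn : w.pre n = U ++ b :: V) :
    discMap (P.wordMap U)⁻¹ ξ ∈ P.openArc b := by
  -- Two more words are appended so that the suffix contains a whole cuspidal word together with the
  -- letter that comes after it.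
  have e : w.pre (n + 2) = U ++ b :: (V ++ w.word n ++ w.word (n + 1)) := by
    rw [show n + 2 = n + 1 + 1 from rfl, pre_succ, pre_succ, hn]; simp
  have h1 := h (n + 2)
  rw [e] at h1
  have h2 := P.closure_wordArc_append h1
  have hadm : P.Admissible (b :: (V ++ w.word n ++ w.word (n + 1))) := by
    have := w.admissible_pre (n + 2)
    rw [e] at this
    exact List.IsChain.right_of_append this
  -- At a tip the whole suffix would be a chain of turns, and then `w.word n` with the letter after
  -- it would be cuspidal, against the transition rule.
  have key : ∀ s, discMap (P.wordMap U)⁻¹ ξ ≠ P.tip s b := by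
    intro s hs
    rw [hs] at h2
    have h3 := P.turnChain_of_mem_closure hadm h2
    obtain ⟨Y, hY⟩ := w.exists_word_eq (n + 1)
    rw [hY, show b :: (V ++ w.word n ++ w.letter (n + 1) :: Y)
      = (b :: V) ++ (w.word n ++ [w.letter (n + 1)] ++ Y) by simp] at h3
    exact w.not_isCuspidal_append n (P.isCuspidal_iff.2 ⟨by simp, s,
      List.IsChain.left_of_append (List.IsChain.right_of_append h3)⟩)
  rcases P.mem_closedArc_iff_or.1 (P.closure_wordArc_cons h2) with h3 | h3 | h3
  · exact h3
  · exact absurd h3 (key true)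
  · exact absurd h3 (key false)

/-- The arcs are half-open, so lying in all the closures is a priori weaker; it suffices because
limit points never sit at an end. -/
lemma mem_wordArc_of_closure {w : ShiftSpace Γ S P T} {ξ : ℂ}
    (h : ∀ n, ξ ∈ closure (P.wordArc (w.pre n))) (n : ℕ) : ξ ∈ P.wordArc (w.pre n) := by
  have hξ := P.norm_of_mem_closure_wordArc (h 0)
  suffices H : ∀ U V, w.pre n = U ++ V → ξ ∈ P.wordArc U from H _ [] (by simp)
  intro U
  induction U using List.reverseRecOn with
  | nil => intro _ _; exact ⟨mem_sphere_zero_iff_norm.2 hξ, by simp⟩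
  | append_singleton U b ih =>
    intro V hV
    have e : w.pre n = U ++ b :: V := by simpa using hV
    rw [mem_wordArc_append', mem_wordArc_singleton]
    exact ⟨ih _ e, P.openArc_subset_arc _ (mem_openArc h e)⟩

lemma exists_mem_closure (w : ShiftSpace Γ S P T) :
    ∃ ξ, ∀ n, ξ ∈ closure (P.wordArc (w.pre n)) := by
  have := IsCompact.nonempty_iInter_of_sequence_nonempty_isCompact_isClosed
    (fun n => closure (P.wordArc (w.pre n))) (fun n => closure_mono fun ξ hξ => by
      rw [pre_succ] at hξ
      exact (P.mem_wordArc_append.1 hξ).1)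
    (fun n => (P.wordArc_nonempty (w.admissible_pre n)).closure)
    ((isCompact_sphere (0 : ℂ) 1).of_isClosed_subset isClosed_closure
      (closure_minimal (fun _ h => h.1) Metric.isClosed_sphere)) (fun n => isClosed_closure)
  obtain ⟨ξ, hξ⟩ := this
  exact ⟨ξ, fun n => Set.mem_iInter.1 hξ n⟩

lemma mem_openArc_letter {w : ShiftSpace Γ S P T} {ξ : ℂ}
    (h : ∀ n, ξ ∈ closure (P.wordArc (w.pre n))) (n : ℕ) :
    discMap (P.wordMap (w.pre n))⁻¹ ξ ∈ P.openArc (w.letter n) := by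
  obtain ⟨U, hU⟩ := w.exists_word_eq n
  exact mem_openArc h (n := n + 1) (V := U) (by rw [pre_succ, hU])

lemma derivNorm_le_of_openArc {θ : ℝ} (hθ : P.IsContractionFactor θ) {W : List A}
    (hW : P.IsCuspidal W) {a : A} (ha : P.Follows W a) {ξ : ℂ} (hξ : ξ ∈ P.openArc a) :
    derivNorm (P.wordMap W) ξ ≤ θ := by
  refine hθ.2.2 W hW a ha ξ ?_
  have hn : ‖ξ‖ = 1 := P.norm_of_mem_closedArc (P.mem_closedArc_iff_or.2 (Or.inl hξ))
  exact (P.mem_openArc_iff hn).1 hξ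

/-- Chain rule, one word at a time: the point left after a word lies in the open arc of the next
first letter, where the contraction factor applies. -/
lemma derivNorm_wordMap_pre_le {θ : ℝ} (hθ : P.IsContractionFactor θ) (n : ℕ)
    (w : ShiftSpace Γ S P T) {ξ : ℂ} (h : ∀ n, ξ ∈ closure (P.wordArc (w.pre n))) :
    derivNorm (P.wordMap (w.pre n)) (discMap (P.wordMap (w.pre n))⁻¹ ξ) ≤ θ ^ n := by
  induction n with
  | zero =>
    have : P.wordMap (w.pre 0) = 1 := rfl
    rw [this, derivNorm_eq _ (by rw [den_one]; exact one_ne_zero), den_one]; simp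
  | succ n ih =>
    have hξ := P.norm_of_mem_closure_wordArc (h 0)
    have hη := norm_discMap (P.wordMap (w.pre (n + 1)))⁻¹ hξ
    have e : discMap (P.wordMap (w.word n)) (discMap (P.wordMap (w.pre (n + 1)))⁻¹ ξ)
        = discMap (P.wordMap (w.pre n))⁻¹ ξ := by
      rw [← discMap_mul _ _ (den_ne_zero _ hξ), pre_succ, wordMap_append, mul_inv_rev,
        mul_inv_cancel_left]
    have e2 : P.wordMap (w.pre (n + 1)) = P.wordMap (w.pre n) * P.wordMap (w.word n) := by
      rw [pre_succ, wordMap_append]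
    rw [e2, derivNorm_mul _ _ (den_ne_zero _ (norm_discMap _ hξ))
      (den_ne_zero _ (norm_discMap _ (norm_discMap _ hξ))), ← e2, e, pow_succ]
    exact mul_le_mul ih (derivNorm_le_of_openArc hθ (w.isCuspidal n) (w.follows n)
      (mem_openArc_letter h _)) (norm_nonneg _) (pow_nonneg hθ.1.le _)

/-- The distance is at most `2` times the geometric mean of two derivatives, each at most `θ ^ n`.
-/
lemma eq_of_mem_closure (w : ShiftSpace Γ S P T) {ξ η : ℂ}
    (hξ : ∀ n, ξ ∈ closure (P.wordArc (w.pre n))) (hη : ∀ n, η ∈ closure (P.wordArc (w.pre n))) :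
    ξ = η := by
  obtain ⟨θ, hθ⟩ := P.exists_isContractionFactor
  have hξ1 := P.norm_of_mem_closure_wordArc (hξ 0)
  have hη1 := P.norm_of_mem_closure_wordArc (hη 0)
  have key : ∀ n : ℕ, ‖ξ - η‖ ≤ 2 * θ ^ n := by
    intro n
    set g := P.wordMap (w.pre n) with hg
    have h1 := derivNorm_wordMap_pre_le hθ n w hξ
    have h2 := derivNorm_wordMap_pre_le hθ n w hη
    rw [← hg] at h1 h2
    set x := discMap g⁻¹ ξ with hx
    set y := discMap g⁻¹ η with hy
    have hx1 : ‖x‖ = 1 := norm_discMap _ hξ1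
    have hy1 : ‖y‖ = 1 := norm_discMap _ hη1
    have hgx : discMap g x = ξ := discMap_discMap_inv g (den_ne_zero _ hξ1)
    have hgy : discMap g y = η := discMap_discMap_inv g (den_ne_zero _ hη1)
    have dx := norm_pos_iff.2 (den_ne_zero g hx1)
    have dy := norm_pos_iff.2 (den_ne_zero g hy1)
    rw [derivNorm_eq _ (den_ne_zero g hx1)] at h1
    rw [derivNorm_eq _ (den_ne_zero g hy1)] at h2
    rw [← hgx, ← hgy, norm_discMap_sub g (den_ne_zero g hx1) (den_ne_zero g hy1)]
    have h3 : ‖x - y‖ ≤ 2 := (norm_sub_le _ _).trans (by rw [hx1, hy1]; norm_num)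
    have h4 : 1 / (‖den g x‖ * ‖den g y‖) ≤ θ ^ n := by
      have : (1 / (‖den g x‖ * ‖den g y‖)) ^ 2 ≤ (θ ^ n) ^ 2 := by
        have e : (1 / (‖den g x‖ * ‖den g y‖)) ^ 2 = 1 / ‖den g x‖ ^ 2 * (1 / ‖den g y‖ ^ 2) := by
          field_simp
        rw [e, sq (θ ^ n)]
        exact mul_le_mul h1 h2 (by positivity) (pow_nonneg hθ.1.le _)
      exact le_of_sq_le_sq this (pow_nonneg hθ.1.le _)
    rw [div_eq_mul_one_div]
    exact mul_le_mul h3 h4 (by positivity) (by norm_num)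
  have lim : Filter.Tendsto (fun n : ℕ => 2 * θ ^ n) Filter.atTop (nhds (2 * 0)) :=
    (tendsto_pow_atTop_nhds_zero_of_lt_one hθ.1.le hθ.2.1).const_mul 2
  rw [mul_zero] at lim
  have h0 : ‖ξ - η‖ ≤ 0 := ge_of_tendsto' lim key
  exact sub_eq_zero.1 (norm_le_zero_iff.1 h0)

lemma code_mem (w : ShiftSpace Γ S P T) (n : ℕ) : w.code ∈ P.wordArc (w.pre n) := by
  have h : ∀ r, w.code ∈ P.wordArc ((List.range (r + 1)).flatMap w.word) := by
    obtain ⟨ξ, hξ⟩ := w.exists_mem_closure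
    exact Classical.epsilon_spec (p := fun ξ => ∀ r, ξ ∈ P.wordArc
      ((List.range (r + 1)).flatMap w.word)) ⟨ξ, fun r => mem_wordArc_of_closure hξ (r + 1)⟩
  have h1 := h n
  change w.code ∈ P.wordArc (w.pre (n + 1)) at h1
  rw [pre_succ, mem_wordArc_append] at h1
  exact h1.1

lemma code_mem_closure (w : ShiftSpace Γ S P T) (n : ℕ) :
    w.code ∈ closure (P.wordArc (w.pre n)) := subset_closure (w.code_mem n)

lemma code_eq_of_mem {w : ShiftSpace Γ S P T} {ξ : ℂ} (h : ∀ n, ξ ∈ P.wordArc (w.pre n)) :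
    w.code = ξ :=
  w.eq_of_mem_closure w.code_mem_closure fun n => subset_closure (h n)

lemma norm_code (w : ShiftSpace Γ S P T) : ‖w.code‖ = 1 := P.norm_of_mem_wordArc (w.code_mem 0)

lemma code_mem_openArc (w : ShiftSpace Γ S P T) : w.code ∈ P.openArc (w.letter 0) := by
  have := mem_openArc_letter w.code_mem_closure 0
  rwa [show P.wordMap (w.pre 0) = 1 from rfl, inv_one, discMap_one] at this

lemma code_shift (w : ShiftSpace Γ S P T) :
    w.shift.code = discMap (P.wordMap (w.word 0))⁻¹ w.code := by
  refine code_eq_of_mem fun n => ?_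
  have h := w.code_mem (n + 1)
  rw [pre_succ', mem_wordArc_append'] at h
  exact h.2

lemma code_eq (w : ShiftSpace Γ S P T) :
    w.code = discMap (P.wordMap (w.word 0)) w.shift.code := by
  rw [code_shift, discMap_discMap_inv _ (den_ne_zero _ w.norm_code)]

lemma shift_iterate_apply (w : ShiftSpace Γ S P T) (n r : ℕ) : (shift^[n] w).1 r = w.1 (r + n) := by
  induction n generalizing w with
  | zero => rfl
  | succ n ih =>
    rw [Function.iterate_succ_apply, ih]
    change w.1 (r + n + 1) = _
    rw [add_assoc]

/-- Cuspidal words are closed under initial factors. If one first word were shorter than the other,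
that word with its next letter would be a prefix of the longer cuspidal word, hence cuspidal, which
the transition rule forbids. Equal first words can be undone, and the argument repeats. -/
lemma code_injective : Function.Injective (code : ShiftSpace Γ S P T → ℂ) := by
  have key : ∀ w w' : ShiftSpace Γ S P T, w.code = w'.code →
      ¬ (w.word 0).length < (w'.word 0).length := by
    intro w w' h hl
    obtain ⟨U, hU⟩ := w.exists_word_eq 1
    have h1 := w.code_mem 2
    rw [show (2 : ℕ) = 1 + 1 from rfl, pre_succ, pre_one, hU, show w.word 0 ++ w.letter 1 :: U
      = (w.word 0 ++ [w.letter 1]) ++ U by simp, mem_wordArc_append] at h1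
    have h2 := w'.code_mem 1
    rw [pre_one, ← h] at h2
    obtain ⟨V, hV⟩ := P.prefix_of_mem_wordArc h1.1 h2 (by rw [List.length_append]; exact hl)
    have hc := w'.isCuspidal 0
    rw [← hV] at hc
    exact w.not_isCuspidal_append 0 (hc.of_append P (by simp))
  have key2 : ∀ w w' : ShiftSpace Γ S P T, w.code = w'.code → w.1 0 = w'.1 0 := by
    intro w w' h
    have hl : (w.word 0).length = (w'.word 0).length :=
      le_antisymm (not_lt.1 (key w' w h.symm)) (not_lt.1 (key w w' h))
    have h1 := w.code_mem 1
    have h2 := w'.code_mem 1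
    rw [pre_one] at h1 h2
    rw [← h] at h2
    exact Subtype.ext ((P.prefix_of_mem_wordArc h1 h2 hl.le).eq_of_length hl)
  intro w w' h
  have key3 : ∀ n, (shift^[n] w).code = (shift^[n] w').code := by
    intro n
    induction n with
    | zero => exact h
    | succ n ih =>
      rw [Function.iterate_succ_apply', Function.iterate_succ_apply', code_shift, code_shift, ih]
      have := congrArg Subtype.val (key2 _ _ ih)
      unfold word
      rw [this]
  refine ext_word fun r => ?_
  have := key2 _ _ (key3 r)
  rwa [shift_iterate_apply, shift_iterate_apply, zero_add] at this

end ShiftSpace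

/-! ### The potential, and the Cantor set as the image of the coding map -/

open ShiftSpace

/-- The derivative of the inverse is evaluated at the image point instead: the potential becomes an
explicit function of the first word and of the coded tail. -/
lemma potential_eq (w : ShiftSpace Γ S P T) :
    potential w = -2 * Real.log ‖den (P.wordMap (w.word 0)) w.shift.code‖ := by
  have h0 := den_ne_zero (P.wordMap (w.word 0)) w.shift.norm_code
  rw [potential, derivNorm_eq _ (den_ne_zero _ w.norm_code)]
  conv_lhs => rw [w.code_eq]
  rw [norm_den_inv _ h0, inv_pow, one_div, inv_inv, Real.log_pow]
  push_cast; ring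

lemma potential_le_log {θ : ℝ} (hθ : P.IsContractionFactor θ) (w : ShiftSpace Γ S P T) :
    potential w ≤ Real.log θ := by
  have h0 := den_ne_zero (P.wordMap (w.word 0)) w.shift.norm_code
  have h1 := derivNorm_le_of_openArc hθ (w.isCuspidal 0) (w.follows 0) w.shift.code_mem_openArc
  have h2 : potential w = Real.log (derivNorm (P.wordMap (w.word 0)) w.shift.code) := by
    rw [potential_eq, derivNorm_eq _ h0, one_div, Real.log_inv, Real.log_pow]
    push_cast; ring
  rw [h2]
  exact Real.log_le_log (derivNorm_pos _ h0) h1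

/-- The exact mean value formula in terms of the potential; prefixing a common word scales distances
by the exponential of the mean of the two potentials. -/
lemma norm_code_sub {w w' : ShiftSpace Γ S P T} (h : w.1 0 = w'.1 0) :
    ‖w.code - w'.code‖ = Real.exp ((potential w + potential w') / 2) *
      ‖w.shift.code - w'.shift.code‖ := by
  have hw : w'.word 0 = w.word 0 := (congrArg Subtype.val h).symm
  have h0 := den_ne_zero (P.wordMap (w.word 0)) w.shift.norm_code
  have h0' := den_ne_zero (P.wordMap (w.word 0)) w'.shift.norm_code
  have p0 := norm_pos_iff.2 h0
  have p0' := norm_pos_iff.2 h0'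
  rw [w.code_eq, w'.code_eq, potential_eq, potential_eq, hw, norm_discMap_sub _ h0 h0',
    div_eq_inv_mul]
  congr 1
  rw [show ∀ x y : ℝ, (-2 * x + -2 * y) / 2 = -(x + y) by intros; ring, Real.exp_neg, Real.exp_add,
    Real.exp_log p0, Real.exp_log p0']

/-- For a fixed word the denominator is affine and bounded below on the circle by `|α| - |β| > 0`,
so its logarithm is Lipschitz. -/
lemma exists_abs_potential_sub_le (W : Alphabet Γ S P T) : ∃ C : ℝ, ∀ w w' : ShiftSpace Γ S P T,
    w.1 0 = W → w'.1 0 = W →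
      |potential w - potential w'| ≤ C * ‖w.shift.code - w'.shift.code‖ := by
  set g := P.wordMap W.1 with hg
  have hc : 0 < ‖coeffAlpha g‖ - ‖coeffBeta g‖ := sub_pos.2 (norm_coeffBeta_lt g)
  set c := ‖coeffAlpha g‖ - ‖coeffBeta g‖ with hcdef
  have hlow : ∀ ξ : ℂ, ‖ξ‖ = 1 → c ≤ ‖den g ξ‖ := by
    intro ξ hξ
    have := norm_sub_le_norm_add (starRingEnd ℂ (coeffAlpha g)) (coeffBeta g * ξ)
    rwa [norm_mul, hξ, mul_one, Complex.norm_conj, add_comm (starRingEnd ℂ _)] at this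
  have hlog : ∀ x y : ℝ, c ≤ x → c ≤ y → Real.log x - Real.log y ≤ |x - y| / c := by
    intro x y hx hy
    have hx0 : 0 < x := hc.trans_le hx
    have hy0 : 0 < y := hc.trans_le hy
    rw [← Real.log_div hx0.ne' hy0.ne']
    have h1 := Real.log_le_sub_one_of_pos (div_pos hx0 hy0)
    have h2 : x / y - 1 = (x - y) / y := by field_simp
    rw [h2] at h1
    refine h1.trans ((div_le_div_of_nonneg_right (le_abs_self _) hy0.le).trans ?_)
    exact div_le_div_of_nonneg_left (abs_nonneg _) hc hy
  refine ⟨2 * (‖coeffBeta g‖ / c), fun w w' h h' => ?_⟩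
  have e : w.word 0 = W.1 := congrArg Subtype.val h
  have e' : w'.word 0 = W.1 := congrArg Subtype.val h'
  rw [potential_eq, potential_eq, e, e', ← hg]
  have h1 := hlow _ w.shift.norm_code
  have h2 := hlow _ w'.shift.norm_code
  have h3 := hlog _ _ h1 h2
  have h4 := hlog _ _ h2 h1
  rw [abs_sub_comm] at h4
  have h5 : |‖den g w.shift.code‖ - ‖den g w'.shift.code‖| ≤
      ‖coeffBeta g‖ * ‖w.shift.code - w'.shift.code‖ := by
    refine (abs_norm_sub_norm_le _ _).trans ?_
    rw [← norm_mul, den, den]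
    apply le_of_eq; congr 1; ring
  have h6 : |‖den g w.shift.code‖ - ‖den g w'.shift.code‖| / c ≤
      ‖coeffBeta g‖ / c * ‖w.shift.code - w'.shift.code‖ := by
    rw [div_mul_eq_mul_div]
    exact div_le_div_of_nonneg_right h5 hc.le
  rw [abs_le]
  constructor <;> linarith

lemma exists_le_potential (W : Alphabet Γ S P T) : ∃ M : ℝ, ∀ w : ShiftSpace Γ S P T,
    w.1 0 = W → M ≤ potential w := by
  set g := P.wordMap W.1 with hg
  refine ⟨-2 * Real.log (‖coeffBeta g‖ + ‖coeffAlpha g‖), fun w h => ?_⟩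
  have e : w.word 0 = W.1 := congrArg Subtype.val h
  rw [potential_eq, e, ← hg]
  have h1 : ‖den g w.shift.code‖ ≤ ‖coeffBeta g‖ + ‖coeffAlpha g‖ := by
    refine (norm_add_le _ _).trans ?_
    rw [norm_mul, w.shift.norm_code, mul_one, Complex.norm_conj]
  have := Real.log_le_log (norm_pos_iff.2 (den_ne_zero g w.shift.norm_code)) h1
  linarith

/-- The Cantor set `𝔼_T` is the image of the coding map. -/
theorem cantorSet_eq_range : cantorSet Γ S P T =
    Set.range (ShiftSpace.code : ShiftSpace Γ S P T → ℂ) := by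
  ext ξ
  constructor
  · rintro ⟨hξ, a, W, ha, ⟨n, hn0, hn⟩, hT⟩
    have hξ := mem_sphere_zero_iff_norm.1 hξ
    have hget : ∀ (i m k : ℕ) (hk : k < ((List.range m).map fun j => a (i + j)).length),
        ((List.range m).map fun j => a (i + j))[k] = a (i + k) := by
      intro i m k hk; simp
    have hlast : ∀ r, ∃ U, W r = U ++ [a (n (r + 1) - 1)] ∧
        W r ++ [a (n (r + 1))] = (List.range (n (r + 1) + 1 - n r)).map fun i => a (n r + i) := by
      intro r
      obtain ⟨h1, h2, -⟩ := hn r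
      obtain ⟨m, hm⟩ : ∃ m, n (r + 1) = n r + m + 1 := ⟨n (r + 1) - n r - 1, by omega⟩
      rw [h2, hm, show n r + m + 1 - n r = m + 1 by omega,
        show n r + m + 1 + 1 - n r = m + 1 + 1 by omega, List.range_succ (n := m + 1),
        List.map_append, List.range_succ, List.map_append]
      exact ⟨_, rfl, rfl⟩
    have hstep : ∀ k, a (k + 1) ≠ P.hat (a k) := by
      intro k
      obtain ⟨b, hb, hb2⟩ := P.exists_mem_arc_discMap_hat (ha k)
      have h1 := ha (k + 1)
      rw [Function.iterate_succ_apply', P.bowenSeriesMap_eq (ha k)] at h1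
      rwa [P.eq_of_mem_arc h1 hb2]
    let w : ShiftSpace Γ S P T := ⟨fun r => ⟨W r, (hn r).2.2.1, hT r⟩, fun r b hb => by
      obtain ⟨h1, h2, -⟩ := hn (r + 1)
      have hb' : b = a (n (r + 1)) := by
        obtain ⟨m, hm⟩ : ∃ m, n (r + 1 + 1) - n (r + 1) = m + 1 :=
          ⟨n (r + 1 + 1) - n (r + 1) - 1, by omega⟩
        rw [hm, List.range_succ_eq_map] at h2
        simp only at hb
        rw [h2] at hb
        simpa using hb.symm
      obtain ⟨U, hU1, hU2⟩ := hlast r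
      have hc := (hn r).2.2.1
      -- Maximality of `W r`, tested on one further letter, is the part of `Follows` that goes
      -- beyond non-backtracking.
      have hmax := (hn r).2.2.2 (n (r + 1) + 1) (by omega)
      rw [← hU2] at hmax
      simp only
      rw [hU1] at hc hmax ⊢
      rw [hb', P.follows_iff hc]
      refine ⟨?_, hmax⟩
      have := hstep (n (r + 1) - 1)
      rwa [show n (r + 1) - 1 + 1 = n (r + 1) by have := (hn r).1; omega] at this⟩
    refine ⟨w, code_eq_of_mem fun r => ?_⟩
    have hlen : ∀ r, (w.pre r).length = n r := by
      intro r
      induction r with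
      | zero => rw [hn0]; rfl
      | succ r ih =>
        rw [pre_succ, List.length_append, ih]
        change n r + (W r).length = _
        obtain ⟨h1, h2, -⟩ := hn r
        rw [h2, List.length_map, List.length_range]
        omega
    induction r with
    | zero => exact ⟨mem_sphere_zero_iff_norm.2 hξ, fun k hk => by simp [pre] at hk⟩
    | succ r ih =>
      rw [pre_succ, mem_wordArc_append, hlen]
      refine ⟨ih, mem_sphere_zero_iff_norm.2 (P.norm_bowenSeriesMap_iterate hξ _), fun k hk => ?_⟩
      have e : w.word r = (List.range (n (r + 1) - n r)).map fun i => a (n r + i) := (hn r).2.1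
      simp only [e]
      rw [hget, ← Function.iterate_add_apply, add_comm]
      exact ha _
  · rintro ⟨w, rfl⟩
    refine ⟨mem_sphere_zero_iff_norm.2 w.norm_code, ?_⟩
    choose a ha using fun k => P.exists_mem_arc (P.norm_bowenSeriesMap_iterate w.norm_code k)
    refine ⟨a, w.word, ha, ⟨fun r => (w.pre r).length, rfl, fun r => ?_⟩, fun r => (w.1 r).2.2⟩
    have hlen : (w.pre (r + 1)).length = (w.pre r).length + (w.word r).length := by
      rw [pre_succ, List.length_append]
    have hpos : 0 < (w.word r).length := List.length_pos_of_ne_nil (w.word_ne_nil r)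
    have key : ∀ {U V : List A} {s : ℕ}, w.pre s = w.pre r ++ (U ++ V) →
        U = (List.range U.length).map fun i => a ((w.pre r).length + i) := by
      intro U V s hs
      have h1 := w.code_mem s
      rw [hs, mem_wordArc_append, mem_wordArc_append] at h1
      refine List.ext_getElem (by simp) fun k h2 h3 => ?_
      have h4 := h1.2.1.2 k h2
      rw [← Function.iterate_add_apply, add_comm] at h4
      simpa using P.eq_of_mem_arc h4 (ha _)
    -- A factor longer than the `r`-th word begins with this word and its next letter, which is
    -- already not cuspidal.
    have hpre : ∀ N, 0 < N → (w.pre (r + 1)).length < N → ¬ P.IsCuspidal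
        ((List.range (N - (w.pre r).length)).map fun i => a ((w.pre r).length + i)) := by
      intro N hN0 hN hc
      obtain ⟨U, hU⟩ := w.exists_word_eq (r + 1)
      have h1 := key (U := w.word r ++ [w.letter (r + 1)]) (V := U) (s := r + 2) (by
        rw [show r + 2 = r + 1 + 1 from rfl, pre_succ, pre_succ, hU]; simp)
      obtain ⟨m, hm⟩ : ∃ m, N - (w.pre r).length = (w.word r ++ [w.letter (r + 1)]).length + m :=
        Nat.exists_eq_add_of_le (by rw [List.length_append, List.length_singleton]; omega)
      rw [hm, List.range_add, List.map_append, ← h1] at hc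
      exact w.not_isCuspidal_append r (hc.of_append P (by simp))
    simp only
    refine ⟨by omega, ?_, w.isCuspidal r, fun N hN => hpre N (by omega) hN⟩
    rw [hlen, Nat.add_sub_cancel_left]
    exact key (U := w.word r) (V := []) (s := r + 1) (by rw [pre_succ, List.append_nil])

end Coding

end BowenSeries

namespace BowenSeries

open ComplexConjugate

/-! ### The cusps of an ideal polygon -/

lemma imageOfInfty_mul (g h : SL(2, ℝ)) :
    imageOfInfty (g * h) = (g : GL (Fin 2) ℝ) • imageOfInfty h := by
  rw [imageOfInfty, imageOfInfty, ← mul_smul]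
  simp

lemma column_ne_zero (g : SL(2, ℝ)) : ((g 0 0 : ℝ) : ℂ) + (g 1 0 : ℝ) * Complex.I ≠ 0 := by
  intro h
  have h1 := congrArg Complex.re h
  have h2 := congrArg Complex.im h
  simp at h1 h2
  have := det_entries g
  rw [h1, h2] at this
  simp at this

lemma cayleyBoundary_imageOfInfty (g : SL(2, ℝ)) : cayleyBoundary (imageOfInfty g) =
    (g 0 0 - g 1 0 * Complex.I) / (g 0 0 + g 1 0 * Complex.I) := by
  have h0 := column_ne_zero g
  have e : imageOfInfty g = if g 1 0 = 0 then OnePoint.infty else ((g 0 0 / g 1 0 : ℝ) : OnePoint ℝ) := by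
    rw [imageOfInfty, OnePoint.smul_infty_eq_ite]; rfl
  rw [e]
  by_cases h : g 1 0 = 0
  · rw [if_pos h, h]
    rw [h] at h0
    simp only [Complex.ofReal_zero, zero_mul, add_zero, sub_zero] at h0 ⊢
    rw [div_self h0]; rfl
  · rw [if_neg h]
    change (((g 0 0 / g 1 0 : ℝ) : ℂ) - Complex.I) / (((g 0 0 / g 1 0 : ℝ) : ℂ) + Complex.I) = _
    have h1 : ((g 1 0 : ℝ) : ℂ) ≠ 0 := by exact_mod_cast h
    push_cast
    rw [← mul_div_mul_right _ _ h1]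
    congr 1 <;> field_simp

lemma cayleyBoundary_injective : Function.Injective cayleyBoundary := by
  have h0 : ∀ x : ℝ, (x : ℂ) + Complex.I ≠ 0 := by
    intro x h
    have := congrArg Complex.im h
    simp at this
  have h1 : ∀ x : ℝ, ((x : ℂ) - Complex.I) / (x + Complex.I) ≠ 1 := by
    intro x h
    rw [div_eq_one_iff_eq (h0 x)] at h
    have := congrArg Complex.im h
    simp at this
    linarith
  intro x y h
  match x, y with
  | none, none => rfl
  | none, some y => exact absurd h.symm (h1 y)
  | some x, none => exact absurd h (h1 x)
  | some x, some y =>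
    change ((x : ℂ) - Complex.I) / (x + Complex.I) = ((y : ℂ) - Complex.I) / (y + Complex.I) at h
    rw [div_eq_div_iff (h0 x) (h0 y)] at h
    have : (2 * Complex.I) * x = (2 * Complex.I) * y := by linear_combination h
    have h2 := mul_left_cancel₀ (by simp) this
    have h3 : x = y := by exact_mod_cast h2
    rw [h3]

/-- The entries of the Gram matrix of `g`. -/
def gramR (g : SL(2, ℝ)) : ℝ := g 0 0 ^ 2 + g 1 0 ^ 2

/-- The off-diagonal entry of the Gram matrix of `g`. -/
def gramQ (g : SL(2, ℝ)) : ℝ := g 0 0 * g 0 1 + g 1 0 * g 1 1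

lemma gramR_pos (g : SL(2, ℝ)) : 0 < gramR g := by
  have h := det_entries g
  rw [gramR]
  by_contra hh
  push Not at hh
  have h1 : g 0 0 = 0 := by nlinarith [sq_nonneg (g 0 0), sq_nonneg (g 1 0)]
  have h2 : g 1 0 = 0 := by nlinarith [sq_nonneg (g 0 0), sq_nonneg (g 1 0)]
  rw [h1, h2] at h; simp at h

lemma normSq_column (g : SL(2, ℝ)) : ‖((g 0 0 : ℝ) : ℂ) + (g 1 0 : ℝ) * Complex.I‖ ^ 2 = gramR g := by
  rw [← Complex.normSq_eq_norm_sq, Complex.normSq_add_mul_I, gramR]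

lemma norm_cayleyBoundary_imageOfInfty (g : SL(2, ℝ)) : ‖cayleyBoundary (imageOfInfty g)‖ = 1 := by
  have h0 := column_ne_zero g
  rw [cayleyBoundary_imageOfInfty, norm_div, div_eq_one_iff_eq (norm_ne_zero_iff.2 h0)]
  rw [← Complex.norm_conj]
  simp

lemma den_cayleyBoundary (h g : SL(2, ℝ)) : den h (cayleyBoundary (imageOfInfty g)) =
    (((h * g) 0 0 : ℝ) + ((h * g) 1 0 : ℝ) * Complex.I) / (g 0 0 + g 1 0 * Complex.I) := by
  have h0 := column_ne_zero g
  rw [cayleyBoundary_imageOfInfty, den, eq_div_iff h0, add_mul, mul_assoc, div_mul_cancel₀ _ h0]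
  apply Complex.ext <;>
  simp [coeffAlpha_re, coeffAlpha_im, coeffBeta_re, coeffBeta_im, Matrix.mul_apply,
    Fin.sum_univ_two] <;> ring

/-- The squared length of the first column changes by `|den|²` at the boundary point `g · ∞`, so it
is preserved by elements isometric at that point. -/
lemma gramR_mul (h g : SL(2, ℝ)) : gramR (h * g) =
    ‖den h (cayleyBoundary (imageOfInfty g))‖ ^ 2 * gramR g := by
  have h0 := norm_ne_zero_iff.2 (column_ne_zero g)
  rw [den_cayleyBoundary, norm_div, ← normSq_column, ← normSq_column, div_pow,
    div_mul_cancel₀ _ (pow_ne_zero 2 h0)]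

lemma discMap_cayleyBoundary (h g : SL(2, ℝ)) : discMap h (cayleyBoundary (imageOfInfty g)) =
    cayleyBoundary (imageOfInfty (h * g)) := by
  have hn := norm_cayleyBoundary_imageOfInfty g
  have h0 := column_ne_zero g
  have h1 := column_ne_zero (h * g)
  have hc : ∀ x y : ℝ, conj ((x : ℂ) + y * Complex.I) = x - y * Complex.I := by
    intro x y; simp [sub_eq_add_neg]
  have h0' : ((g 0 0 : ℝ) : ℂ) - (g 1 0 : ℝ) * Complex.I ≠ 0 := by
    rw [← hc]; exact (map_ne_zero _).2 h0
  rw [discMap_eq_of_norm_one _ hn, den_cayleyBoundary, map_div₀, hc, hc,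
    cayleyBoundary_imageOfInfty, cayleyBoundary_imageOfInfty]
  field_simp

/-- The form `|az + b|² + |cz + d|²`. -/
noncomputable def ford (g : SL(2, ℝ)) (z : ℂ) : ℝ :=
  ‖(g 0 0 : ℂ) * z + g 0 1‖ ^ 2 + ‖(g 1 0 : ℂ) * z + g 1 1‖ ^ 2

/-- The Gram matrix has determinant one, so its third entry is `(1 + Q²) / R`, and the form depends
on `R` and `Q` alone. -/
lemma ford_eq (g : SL(2, ℝ)) (z : ℂ) : ford g z =
    gramR g * ‖z‖ ^ 2 + 2 * gramQ g * z.re + (1 + gramQ g ^ 2) / gramR g := by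
  have h := det_entries g
  have hR := (gramR_pos g).ne'
  have e : (1 + gramQ g ^ 2) / gramR g = g 0 1 ^ 2 + g 1 1 ^ 2 := by
    rw [div_eq_iff hR, gramQ, gramR]
    linear_combination (-(g 0 0 * g 1 1 - g 0 1 * g 1 0) - 1) * h
  rw [e, ford, gramR, gramQ]
  simp only [← Complex.normSq_eq_norm_sq, Complex.normSq_apply]
  simp
  ring

/-- In the half plane `|den|²` is the quotient of `ford h + 2 Im z` by `ford 1 + 2 Im z`, the
determinant being one. Isometric circles become loci where two forms agree. -/
lemma norm_den_cayley_eq_one_iff (h : SL(2, ℝ)) (z : ℍ) :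
    ‖den h (cayley z)‖ = 1 ↔ ford h z = ford 1 z := by
  have hz : (z : ℂ) + Complex.I ≠ 0 := by
    intro hh
    have h1 := congrArg Complex.im hh
    have h2 := z.im_pos
    simp at h1
    linarith
  have e : den h (cayley z) * (z + Complex.I) =
      (h 0 0 * z + h 0 1) + (h 1 0 * z + h 1 1) * Complex.I := by
    rw [cayley, den, add_mul, mul_assoc, div_mul_cancel₀ _ hz]
    apply Complex.ext <;>
    simp [coeffAlpha_re, coeffAlpha_im, coeffBeta_re, coeffBeta_im] <;> ring
  have e2 := congrArg (fun x => ‖x‖ ^ 2) e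
  have hdet := det_entries h
  have h1 : ‖((h 0 0 : ℂ) * z + h 0 1) + (h 1 0 * z + h 1 1) * Complex.I‖ ^ 2 =
      ford h z + 2 * z.im := by
    rw [ford]
    simp only [← Complex.normSq_eq_norm_sq, Complex.normSq_apply]
    simp
    linear_combination 2 * z.im * hdet
  have h2 : ‖(z : ℂ) + Complex.I‖ ^ 2 = ford 1 z + 2 * z.im := by
    rw [ford]
    simp only [← Complex.normSq_eq_norm_sq, Complex.normSq_apply]
    simp
    ring
  simp only [norm_mul, mul_pow] at e2
  rw [h1, h2] at e2
  have hpos : 0 < ford 1 z + 2 * z.im := by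
    rw [← h2]; exact pow_pos (norm_pos_iff.2 hz) 2
  constructor
  · intro h3
    rw [h3] at e2
    linarith
  · intro h3
    rw [h3] at e2
    have : ‖den h (cayley z)‖ ^ 2 = 1 := by
      have := mul_right_cancel₀ hpos.ne' (e2.trans (one_mul _).symm)
      exact this
    exact (pow_eq_one_iff_of_nonneg (norm_nonneg _) two_ne_zero).1 this

lemma denom_ne_zero (g : SL(2, ℝ)) (z : ℍ) : (g 1 0 : ℂ) * z + g 1 1 ≠ 0 := by
  intro h
  have h1 := congrArg Complex.im h
  have h2 := congrArg Complex.re h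
  simp at h1 h2
  have hz := z.im_pos.ne'
  have h3 : g 1 0 = 0 := h1.resolve_right hz
  rw [h3] at h2
  have := det_entries g
  rw [h3] at this
  have h4 : g 1 1 = 0 := by simpa using h2
  rw [h4] at this
  simp at this

lemma coe_smul_eq (g : SL(2, ℝ)) (z : ℍ) :
    ((g • z : ℍ) : ℂ) = (g 0 0 * z + g 0 1) / (g 1 0 * z + g 1 1) := by
  rw [UpperHalfPlane.coe_specialLinearGroup_apply]; rfl

lemma ford_smul (h g : SL(2, ℝ)) (z : ℍ) :
    ford h (g • z : ℍ) = ford (h * g) z / ‖(g 1 0 : ℂ) * z + g 1 1‖ ^ 2 := by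
  have h0 := denom_ne_zero g z
  have h1 := norm_ne_zero_iff.2 h0
  rw [coe_smul_eq]
  have key : ∀ x y : ℝ, ‖(x : ℂ) * ((g 0 0 * z + g 0 1) / (g 1 0 * z + g 1 1)) + y‖ ^ 2 =
      ‖(x : ℂ) * (g 0 0 * z + g 0 1) + y * (g 1 0 * z + g 1 1)‖ ^ 2 / ‖(g 1 0 : ℂ) * z + g 1 1‖ ^ 2 := by
    intro x y
    rw [← div_pow, ← norm_div]
    congr 2
    rw [eq_div_iff h0, add_mul, mul_assoc, div_mul_cancel₀ _ h0]
  rw [ford, ford, key, key, ← add_div]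
  congr 1
  simp only [Matrix.SpecialLinearGroup.coe_mul, Matrix.mul_apply, Fin.sum_univ_two]
  push_cast
  congr 3 <;> ring

lemma ford_smul_eq_iff (h g : SL(2, ℝ)) (z : ℍ) :
    ford h (g • z : ℍ) = ford 1 (g • z : ℍ) ↔ ford (h * g) z = ford g z := by
  have h1 := norm_ne_zero_iff.2 (denom_ne_zero g z)
  rw [ford_smul, ford_smul, one_mul, div_left_inj' (pow_ne_zero 2 h1)]

/-- Isometric circles through `∞` are vertical lines. -/
lemma ford_eq_ford_iff {g h : SL(2, ℝ)} (hR : gramR h = gramR g) (hQ : gramQ h ≠ gramQ g) (z : ℂ) :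
    ford h z = ford g z ↔ z.re = -(gramQ h + gramQ g) / (2 * gramR g) := by
  have hR0 := (gramR_pos g).ne'
  rw [ford_eq, ford_eq, hR, eq_div_iff (by simpa using hR0)]
  have hne := sub_ne_zero.2 hQ
  constructor
  · intro h1
    field_simp at h1
    apply mul_left_cancel₀ hne
    linear_combination h1
  · intro h1
    field_simp
    linear_combination (gramQ h - gramQ g) * h1

/-- The unipotent element with upper right entry `x`. -/
def unip (x : ℝ) : SL(2, ℝ) := ⟨!![1, x; 0, 1], by simp⟩

lemma coe_unip (x : ℝ) : (unip x : Matrix (Fin 2) (Fin 2) ℝ) = !![1, x; 0, 1] := rfl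

lemma continuous_unip : Continuous unip := by
  refine Continuous.subtype_mk ?_ _
  refine continuous_matrix fun i j => ?_
  fin_cases i <;> fin_cases j <;> simp <;> fun_prop

lemma unip_zero : unip 0 = 1 := by
  ext i j; fin_cases i <;> fin_cases j <;> simp [unip]

/-- A neighbourhood of the identity contains no other element of `Γ`, and conjugates of small
unipotents lie in it. -/
lemma exists_unip_discrete {Γ : Subgroup SL(2, ℝ)} (hΓ : DiscreteTopology Γ) (N : SL(2, ℝ)) :
    ∃ δ > 0, ∀ x : ℝ, |x| < δ → N * unip x * N⁻¹ ∈ Γ → x = 0 := by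
  have h1 : IsOpen ({1} : Set Γ) := isOpen_discrete _
  obtain ⟨V, hV, hV2⟩ := isOpen_induced_iff.1 h1
  have h1V : (1 : SL(2, ℝ)) ∈ V := by
    have : (1 : Γ) ∈ Subtype.val ⁻¹' V := by rw [hV2]; rfl
    exact this
  have hc : Continuous fun x : ℝ => N * unip x * N⁻¹ := by
    have := continuous_unip
    fun_prop
  have hmem : (fun x : ℝ => N * unip x * N⁻¹) ⁻¹' V ∈ nhds (0 : ℝ) := by
    refine (hV.preimage hc).mem_nhds ?_
    simpa [unip_zero] using h1V
  obtain ⟨δ, hδ, hball⟩ := Metric.mem_nhds_iff.1 hmem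
  refine ⟨δ, hδ, fun x hx hxΓ => ?_⟩
  have h2 : N * unip x * N⁻¹ ∈ V := hball (by simpa using hx)
  have h3 : (⟨_, hxΓ⟩ : Γ) ∈ Subtype.val ⁻¹' V := h2
  rw [hV2, Set.mem_singleton_iff] at h3
  have h4 : N * unip x * N⁻¹ = 1 := congrArg Subtype.val h3
  have h5 : unip x = 1 := by
    have := congrArg (fun y => N⁻¹ * y * N) h4
    simpa [mul_assoc] using this
  have h6 := congrArg (fun g : SL(2, ℝ) => g 0 1) h5
  simpa [unip] using h6

lemma upper_conj {Q : SL(2, ℝ)} (h : Q 1 0 = 0) (x : ℝ) :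
    Q * unip x * Q⁻¹ = unip (Q 0 0 ^ 2 * x) := by
  have hd := det_entries Q
  rw [h, mul_zero, sub_zero] at hd
  rw [mul_inv_eq_iff_eq_mul]
  ext i j
  fin_cases i <;> fin_cases j <;> simp [coe_unip, Matrix.mul_apply, Fin.sum_univ_two, h]
  linear_combination (-Q 0 0 * x) * hd

/-- In a discrete group, an element that fixes a parabolic fixed point acts on it with derivative
of norm one. -/
lemma abs_upper_le_one {Γ : Subgroup SL(2, ℝ)} (hΓ : DiscreteTopology Γ) {N : SL(2, ℝ)} {τ : ℝ}
    (hτ : τ ≠ 0) (hu : N * unip τ * N⁻¹ ∈ Γ) {γ : SL(2, ℝ)} (hγ : γ ∈ Γ)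
    (h : (N⁻¹ * γ * N) 1 0 = 0) : 1 ≤ (N⁻¹ * γ * N) 0 0 ^ 2 := by
  obtain ⟨δ, hδ, hd⟩ := exists_unip_discrete hΓ N
  set Q := N⁻¹ * γ * N with hQ
  by_contra hlt
  push Not at hlt
  have hγ' : γ = N * Q * N⁻¹ := by rw [hQ]; group
  have hdet := det_entries Q
  rw [h, mul_zero, sub_zero] at hdet
  have h0 : 0 < Q 0 0 ^ 2 := by
    have : Q 0 0 ≠ 0 := by intro h0; rw [h0] at hdet; simp at hdet
    positivity
  -- Conjugation by `γ` multiplies the translation length by `Q 0 0 ^ 2 < 1`; iterating would give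
  -- arbitrarily short translations in `Γ`.
  have key : ∀ n : ℕ, N * unip ((Q 0 0 ^ 2) ^ n * τ) * N⁻¹ ∈ Γ := by
    intro n
    induction n with
    | zero => simpa using hu
    | succ n ih =>
      have h1 : N * unip ((Q 0 0 ^ 2) ^ (n + 1) * τ) * N⁻¹ =
          γ * (N * unip ((Q 0 0 ^ 2) ^ n * τ) * N⁻¹) * γ⁻¹ := by
        rw [pow_succ', mul_assoc (Q 0 0 ^ 2), ← upper_conj h, hγ']
        group
      rw [h1]
      exact Γ.mul_mem (Γ.mul_mem hγ ih) (Γ.inv_mem hγ)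
  have lim : Filter.Tendsto (fun n : ℕ => |(Q 0 0 ^ 2) ^ n * τ|) Filter.atTop (nhds |0 * τ|) :=
    ((tendsto_pow_atTop_nhds_zero_of_lt_one h0.le hlt).mul_const τ).abs
  rw [zero_mul, abs_zero] at lim
  obtain ⟨n, hn⟩ := (lim.eventually (gt_mem_nhds hδ)).exists
  have := hd _ hn (key n)
  rcases mul_eq_zero.1 this with h2 | h2
  · exact absurd h2 (pow_pos h0 n).ne'
  · exact hτ h2

lemma gramR_mul_upper (g : SL(2, ℝ)) {Q : SL(2, ℝ)} (h : Q 1 0 = 0) :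
    gramR (g * Q) = Q 0 0 ^ 2 * gramR g := by
  simp [gramR, Matrix.mul_apply, Fin.sum_univ_two, h]
  ring

lemma gramQ_mul_upper (g : SL(2, ℝ)) {Q : SL(2, ℝ)} (h : Q 1 0 = 0) :
    gramQ (g * Q) = Q 0 0 * Q 0 1 * gramR g + gramQ g := by
  have hd := det_entries Q
  rw [h, mul_zero, sub_zero] at hd
  simp [gramQ, gramR, Matrix.mul_apply, Fin.sum_univ_two, h]
  linear_combination (g 0 0 * g 0 1 + g 1 0 * g 1 1) * hd

end BowenSeries

namespace BowenSeries

/-! ### Finiteness of the alphabet -/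

lemma imageOfInfty_eq_iff {g h : SL(2, ℝ)} :
    imageOfInfty g = imageOfInfty h ↔ (h⁻¹ * g) 1 0 = 0 := by
  have e : imageOfInfty (h⁻¹ * g) = OnePoint.infty ↔ (h⁻¹ * g) 1 0 = 0 :=
    OnePoint.smul_infty_eq_self_iff
  rw [← e, imageOfInfty_mul]
  have e2 : (OnePoint.infty : OnePoint ℝ) = ((h⁻¹ : SL(2, ℝ)) : GL (Fin 2) ℝ) • imageOfInfty h := by
    rw [← imageOfInfty_mul, inv_mul_cancel, imageOfInfty]
    simp
  rw [e2, smul_left_cancel_iff]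

lemma exists_imageOfInfty_eq {ξ : ℂ} (hξ : ‖ξ‖ = 1) :
    ∃ N : SL(2, ℝ), cayleyBoundary (imageOfInfty N) = ξ := by
  obtain ⟨x, rfl⟩ := LabelledIdealPolygon.exists_eq_pt hξ
  -- The rotation by `x / 2`: its image of `∞` is read off as the conjugate of the first column
  -- divided by the column, which doubles the angle.
  obtain ⟨N, hN00, hN10⟩ : ∃ N : SL(2, ℝ), N 0 0 = Real.cos (x / 2) ∧ N 1 0 = Real.sin (x / 2) := by
    refine ⟨⟨!![Real.cos (x / 2), -Real.sin (x / 2); Real.sin (x / 2), Real.cos (x / 2)], ?_⟩,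
      rfl, rfl⟩
    rw [Matrix.det_fin_two_of]
    linear_combination Real.sin_sq_add_cos_sq (x / 2)
  · refine ⟨N, ?_⟩
    rw [cayleyBoundary_imageOfInfty, hN00, hN10]
    have h1 : (Real.cos (x / 2) : ℂ) - Real.sin (x / 2) * Complex.I =
        Complex.exp (-(x / 2 : ℝ) * Complex.I) := by
      rw [← Complex.ofReal_neg, Complex.exp_mul_I, ← Complex.ofReal_cos, ← Complex.ofReal_sin,
        Real.cos_neg, Real.sin_neg]
      push_cast; ring
    have h2 : (Real.cos (x / 2) : ℂ) + Real.sin (x / 2) * Complex.I =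
        Complex.exp ((x / 2 : ℝ) * Complex.I) := by
      rw [Complex.exp_mul_I, ← Complex.ofReal_cos, ← Complex.ofReal_sin]
    rw [h1, h2, ← Complex.exp_sub, LabelledIdealPolygon.pt]
    congr 1
    push_cast; ring

lemma cayley_I : cayley UpperHalfPlane.I = 0 := by
  simp [cayley]

namespace LabelledIdealPolygon

variable {Γ₀ : Subgroup SL(2, ℝ)} {A : Type*} (P : LabelledIdealPolygon Γ₀ A)

/-- The transport of `N` along the first `k` letters of a cuspidal word. -/
noncomputable def transport (s : Bool) (a : A) (N : SL(2, ℝ)) (k : ℕ) : SL(2, ℝ) :=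
  (P.wordMap (List.iterate (P.turn s) a k))⁻¹ * N

lemma transport_zero (s : Bool) (a : A) (N : SL(2, ℝ)) : P.transport s a N 0 = N := by
  simp [transport, List.iterate, wordMap_nil]

lemma transport_succ (s : Bool) (a : A) (N : SL(2, ℝ)) (k : ℕ) :
    P.transport s a N (k + 1) = P.F (P.hat ((P.turn s)^[k] a)) * P.transport s a N k := by
  rw [transport, iterate_succ_eq_append, wordMap_append, wordMap_singleton, mul_inv_rev, P.F_hat,
    transport, mul_assoc]

lemma transport_mul (s : Bool) (a : A) (N Q : SL(2, ℝ)) (k : ℕ) :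
    P.transport s a (N * Q) k = P.transport s a N k * Q := by
  rw [transport, transport, mul_assoc]

/-- Every step of the chain is isometric at the vertex, so all transports share the same
normalisation at the cusp. -/
lemma gramR_transport {s : Bool} {a : A} {N : SL(2, ℝ)}
    (hN : cayleyBoundary (imageOfInfty N) = P.tip s a) (k : ℕ) :
    gramR (P.transport s a N k) = gramR N := by
  rw [transport, gramR_mul, hN, (P.wordMap_iterate_inv s a k).2, one_pow, one_mul]

/-- Equality would put the centre of the disc on an isometric circle, that is `|α| = 1` and `β = 0`.
The inequality guarantees that the side really is a line in the cusp coordinate. -/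
lemma gramQ_transport_ne {s : Bool} {a : A} {N : SL(2, ℝ)}
    (hN : cayleyBoundary (imageOfInfty N) = P.tip s a) (k : ℕ) :
    gramQ (P.transport s a N (k + 1)) ≠ gramQ (P.transport s a N k) := by
  intro h
  set b := (P.turn s)^[k] a with hb
  set M := P.transport s a N k
  have h1 : ford (P.F (P.hat b) * M) (M⁻¹ • UpperHalfPlane.I : ℍ) =
      ford M (M⁻¹ • UpperHalfPlane.I : ℍ) := by
    rw [← P.transport_succ, ford_eq, ford_eq, h, P.gramR_transport hN, P.gramR_transport hN]
  rw [← ford_smul_eq_iff, ← norm_den_cayley_eq_one_iff, smul_inv_smul, cayley_I, den, mul_zero,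
    zero_add, Complex.norm_conj] at h1
  obtain ⟨-, K, hK, -, h2⟩ := P.exists_coeff b
  have h3 := norm_coeff_sq (P.F (P.hat b))
  have h4 := mul_pos hK (P.cos_half_pos b)
  rw [h1] at h3
  linarith

/-- The sum of the off-diagonal Gram entries of two consecutive transports: up to a factor, the
position of a side in the cusp. -/
noncomputable def sidePos (s : Bool) (a : A) (N : SL(2, ℝ)) (k : ℕ) : ℝ :=
  gramQ (P.transport s a N (k + 1)) + gramQ (P.transport s a N k)

/-- The side is the locus where the forms of two consecutive transports agree. Their `R` entries are
equal, so the quadratic terms cancel and a vertical line remains, at a height-independent abscissa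
given by the `Q` entries. -/
lemma transport_smul_mem_side {s : Bool} {a : A} {N : SL(2, ℝ)}
    (hN : cayleyBoundary (imageOfInfty N) = P.tip s a) (k : ℕ) (w : ℍ) :
    P.transport s a N k • w ∈ P.side ((P.turn s)^[k] a) ↔
      w.re = -P.sidePos s a N k / (2 * gramR N) := by
  have hR := P.gramR_transport hN k
  have hR' := P.gramR_transport hN (k + 1)
  rw [side, Set.mem_ofPred_eq, isoCircle_eq, Set.mem_ofPred_eq, norm_den_cayley_eq_one_iff,
    ford_smul_eq_iff, ← P.transport_succ,
    ford_eq_ford_iff (hR'.trans hR.symm) (P.gramQ_transport_ne hN k), hR]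
  rfl

/-- The distance of the first and the last side of a cuspidal word of `n + 1` letters, in the
coordinates of the cusp given by `N`. -/
noncomputable def cuspLength (s : Bool) (a : A) (n : ℕ) (N : SL(2, ℝ)) : ℝ :=
  |P.sidePos s a N n - P.sidePos s a N 0| / (2 * gramR N)

/-- Both sides are vertical lines in the coordinate given by `N`, so all choices of points on them
give one and the same distance; the supremum in `cuspDist` is taken over such values. -/
lemma exists_side_iff {s : Bool} {a : A} {N : SL(2, ℝ)}
    (hN : cayleyBoundary (imageOfInfty N) = P.tip s a) (n : ℕ) (x : ℝ) :
    (∃ z ∈ P.side a, ∃ z' ∈ (fun z : ℍ => P.wordMap (List.iterate (P.turn s) a n) • z) ''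
        P.side ((P.turn s)^[n] a), x = |(N⁻¹ • z).re - (N⁻¹ • z').re|) ↔
      x = P.cuspLength s a n N := by
  have hR := gramR_pos N
  have habs : ∀ u v : ℝ, |-u / (2 * gramR N) - -v / (2 * gramR N)| = |v - u| / (2 * gramR N) := by
    intro u v
    rw [← sub_div, abs_div, abs_of_pos (by positivity : 0 < 2 * gramR N)]
    congr 2; ring
  have h0 : ∀ w : ℍ, N • w ∈ P.side a ↔ w.re = -P.sidePos s a N 0 / (2 * gramR N) := by
    intro w
    have := P.transport_smul_mem_side hN 0 w
    rwa [transport_zero] at this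
  have hn : ∀ w : ℍ, N • w ∈ (fun z : ℍ => P.wordMap (List.iterate (P.turn s) a n) • z) ''
      P.side ((P.turn s)^[n] a) ↔ w.re = -P.sidePos s a N n / (2 * gramR N) := by
    intro w
    rw [← P.transport_smul_mem_side hN n w, transport, mul_smul]
    constructor
    · rintro ⟨y, hy, hyw⟩
      simp only at hyw
      rwa [← hyw, inv_smul_smul]
    · intro h
      exact ⟨_, h, smul_inv_smul _ _⟩
  constructor
  · rintro ⟨z, hz, z', hz', rfl⟩
    rw [← smul_inv_smul N z, h0] at hz
    rw [← smul_inv_smul N z', hn] at hz'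
    rw [hz, hz', habs, cuspLength]
  · intro hx
    refine ⟨N • ⟨⟨-P.sidePos s a N 0 / (2 * gramR N), 1⟩, one_pos⟩, (h0 _).2 rfl,
      N • ⟨⟨-P.sidePos s a N n / (2 * gramR N), 1⟩, one_pos⟩, (hn _).2 rfl, ?_⟩
    rw [inv_smul_smul, inv_smul_smul, hx, cuspLength]
    exact (habs _ _).symm

/-- The parabolic element of a vertex in the coordinates of the cusp. -/
lemma exists_cycle_eq {s : Bool} {a : A} {N : SL(2, ℝ)}
    (hN : cayleyBoundary (imageOfInfty N) = P.tip s a) {ℓ : ℕ} (hℓ : 0 < ℓ)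
    (hp : (P.turn s)^[ℓ] a = a) : ∃ V : SL(2, ℝ),
      P.wordMap (List.iterate (P.turn s) a ℓ) * N = N * V ∧ V 1 0 = 0 ∧ V 0 0 = V 1 1 ∧
      V 0 0 ^ 2 = 1 ∧ V 0 1 ≠ 0 := by
  obtain ⟨h1, -, h3⟩ := P.wordMap_cycle s a hℓ hp
  set g := P.wordMap (List.iterate (P.turn s) a ℓ)
  have h4 : (N⁻¹ * (g * N)) 1 0 = 0 := by
    rw [← imageOfInfty_eq_iff]
    apply cayleyBoundary_injective
    rw [← discMap_cayleyBoundary, hN, h1]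
  have h5 : ((N⁻¹ * (g * N) : SL(2, ℝ)) : Matrix (Fin 2) (Fin 2) ℝ).IsParabolic := by
    have := (Matrix.isParabolic_conj'_iff (m := (g : Matrix (Fin 2) (Fin 2) ℝ))
      (g := (N : GL (Fin 2) ℝ))).2 h3
    rw [← mul_assoc]
    convert this using 1
    rw [Matrix.SpecialLinearGroup.coe_mul, Matrix.SpecialLinearGroup.coe_mul]
    congr 2
    rw [← Matrix.coe_units_inv, ← map_inv]
    rfl
  rw [Matrix.isParabolic_iff_of_upperTriangular h4] at h5
  refine ⟨N⁻¹ * (g * N), by rw [mul_inv_cancel_left], h4, h5.1, ?_, h5.2⟩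
  have := det_entries (N⁻¹ * (g * N))
  rw [h4, ← h5.1] at this
  linarith

lemma transport_add_period {s : Bool} {a : A} {ℓ : ℕ} (hp : ∀ a, (P.turn s)^[ℓ] a = a)
    {N V : SL(2, ℝ)} (hV : P.wordMap (List.iterate (P.turn s) a ℓ) * N = N * V) (k : ℕ) :
    P.transport s a N (k + ℓ) * V = P.transport s a N k := by
  rw [transport, add_comm, List.iterate_add, wordMap_append, hp, mul_inv_rev, transport, mul_assoc,
    mul_assoc, ← hV, inv_mul_cancel_left]

/-- After each period the parabolic element of the vertex displaces the side positions by the same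
nonzero amount. Hence they drift linearly in the number of periods, and a bounded distance leaves
finitely many `n`; `C` absorbs the position within one period. -/
lemma exists_cuspLength_bound {s : Bool} {a : A} {N : SL(2, ℝ)}
    (hN : cayleyBoundary (imageOfInfty N) = P.tip s a) (T : ℝ) :
    ∃ m : ℕ, ∀ n, P.cuspLength s a n N ≤ T → n < m := by
  obtain ⟨ℓ, hℓ, hp⟩ := P.exists_period s
  obtain ⟨V, hV, hV10, -, hV00, hV01⟩ := P.exists_cycle_eq hN hℓ (hp a)
  set c := V 0 0 * V 0 1 * gramR N with hc
  have hR := gramR_pos N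
  have hV0 : V 0 0 ≠ 0 := by intro h; rw [h] at hV00; norm_num at hV00
  have hc0 : 0 < |c| := abs_pos.2 (mul_ne_zero (mul_ne_zero hV0 hV01) hR.ne')
  have hq : ∀ k, gramQ (P.transport s a N (k + ℓ)) = gramQ (P.transport s a N k) - c := by
    intro k
    rw [← P.transport_add_period hp hV k, gramQ_mul_upper _ hV10, P.gramR_transport hN]
    ring
  have hpos : ∀ k, P.sidePos s a N (k + ℓ) = P.sidePos s a N k - 2 * c := by
    intro k
    rw [sidePos, sidePos, hq, add_right_comm, hq]
    ring
  have hpos2 : ∀ j k : ℕ, P.sidePos s a N (k + ℓ * j) = P.sidePos s a N k - 2 * j * c := by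
    intro j k
    induction j with
    | zero => simp
    | succ j ih =>
      rw [mul_add, mul_one, ← add_assoc, hpos, ih]
      push_cast; ring
  obtain ⟨C, hC⟩ := ((Set.finite_lt_nat ℓ).image
    fun k => |P.sidePos s a N k - P.sidePos s a N 0|).bddAbove
  obtain ⟨J, hJ⟩ := exists_nat_gt ((2 * gramR N * T + C) / (2 * |c|))
  refine ⟨ℓ * J, fun n hn => ?_⟩
  rw [cuspLength, div_le_iff₀ (by positivity)] at hn
  have h1 := hpos2 (n / ℓ) (n % ℓ)
  rw [Nat.mod_add_div] at h1
  rw [h1] at hn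
  have h2 : |P.sidePos s a N (n % ℓ) - P.sidePos s a N 0| ≤ C :=
    hC ⟨n % ℓ, Nat.mod_lt n hℓ, rfl⟩
  have h3 : |2 * ((n / ℓ : ℕ) : ℝ) * c| ≤ 2 * gramR N * T + C := by
    have e : 2 * ((n / ℓ : ℕ) : ℝ) * c = (P.sidePos s a N (n % ℓ) - P.sidePos s a N 0) -
      (P.sidePos s a N (n % ℓ) - 2 * ((n / ℓ : ℕ) : ℝ) * c - P.sidePos s a N 0) := by ring
    rw [e]
    refine (abs_sub _ _).trans ?_
    linarith
  rw [abs_mul, abs_of_nonneg (by positivity)] at h3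
  rw [div_lt_iff₀ (by positivity)] at hJ
  have h4 : ((n / ℓ : ℕ) : ℝ) < J := by
    by_contra h
    push Not at h
    nlinarith
  have h5 : n / ℓ < J := by exact_mod_cast h4
  rw [mul_comm]
  exact (Nat.div_lt_iff_lt_mul hℓ).1 h5

end LabelledIdealPolygon

variable {Γ₀ : Subgroup SL(2, ℝ)} {A : Type*} {Γ : Subgroup SL(2, ℝ)} {p : ℕ}
  {S : Fin p → SL(2, ℝ)} {P : LabelledIdealPolygon Γ₀ A}

lemma wordMap_mem (W : List A) : P.wordMap W ∈ Γ₀ :=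
  list_prod_mem fun g hg => by
    obtain ⟨a, -, rfl⟩ := List.mem_map.1 hg
    exact P.F_mem a

/-- The vertices of the polygon are cusps. -/
lemma exists_cusp_eq_tip (hle : Γ₀ ≤ Γ) (hS : IsCuspSystem Γ S) (s : Bool) (a : A) :
    ∃ B ∈ Γ, ∃ k, cayleyBoundary (imageOfInfty (B * S k)) = P.tip s a := by
  obtain ⟨N, hN⟩ := exists_imageOfInfty_eq (P.norm_tip s a)
  obtain ⟨ℓ, hℓ, hp⟩ := P.exists_period s
  obtain ⟨h1, -, h3⟩ := P.wordMap_cycle s a hℓ (hp a)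
  have hcusp : IsParabolicPoint Γ (imageOfInfty N) := by
    refine ⟨_, ⟨_, hle (wordMap_mem _), rfl⟩, h3, ?_⟩
    change ((P.wordMap (List.iterate (P.turn s) a ℓ) : SL(2, ℝ)) : GL (Fin 2) ℝ) • _ = _
    rw [← imageOfInfty_mul]
    apply cayleyBoundary_injective
    rw [← discMap_cayleyBoundary, hN, h1]
  obtain ⟨k, ⟨γ, hγ, hk⟩, -⟩ := hS.existsUnique _ hcusp
  exact ⟨γ, hγ, k, by rw [hk, hN]⟩

/-- Inequivalence of the cusps gives `k = k'`. The two coordinates then differ by an upper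
triangular matrix, which by discreteness has diagonal entries of modulus one; it translates all
sides equally and so preserves their distances. -/
lemma cuspLength_eq (hΓ : DiscreteTopology Γ) (hle : Γ₀ ≤ Γ) (hS : IsCuspSystem Γ S)
    {s : Bool} {a : A} (n : ℕ) {B B' : SL(2, ℝ)} (hB : B ∈ Γ) (hB' : B' ∈ Γ) {k k' : Fin p}
    (h : cayleyBoundary (imageOfInfty (B * S k)) = P.tip s a)
    (h' : cayleyBoundary (imageOfInfty (B' * S k')) = P.tip s a) :
    P.cuspLength s a n (B' * S k') = P.cuspLength s a n (B * S k) := by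
  have himg : imageOfInfty (B' * S k') = imageOfInfty (B * S k) :=
    cayleyBoundary_injective (h'.trans h.symm)
  have hcusp : IsParabolicPoint Γ (imageOfInfty (B * S k)) := by
    obtain ⟨g, ⟨γ, hγ, rfl⟩, hg1, hg2⟩ := hS.isParabolicPoint k
    refine ⟨_, ⟨B * γ * B⁻¹, Γ.mul_mem (Γ.mul_mem hB hγ) (Γ.inv_mem hB), rfl⟩, ?_, ?_⟩
    · rw [map_mul, map_mul, map_inv]
      exact (Matrix.GeneralLinearGroup.isParabolic_conj_iff _ _).2 hg1
    · rw [imageOfInfty_mul, ← mul_smul, map_mul, map_mul, map_inv, inv_mul_cancel_right, mul_smul,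
        hg2]
  obtain rfl : k = k' := (hS.existsUnique _ hcusp).unique ⟨B, hB, rfl⟩ ⟨B', hB', himg⟩
  set N := B * S k with hNdef
  obtain ⟨ℓ, hℓ, hp⟩ := P.exists_period s
  obtain ⟨V, hV, hV10, hV11, hV00, hV01⟩ := P.exists_cycle_eq h hℓ (hp a)
  have hV0 : V 0 0 ≠ 0 := by intro h; rw [h] at hV00; norm_num at hV00
  -- The diagonal of `V` may be `-1`; the square is genuinely unipotent.
  have hVV : V * V = unip (2 * (V 0 0 * V 0 1)) := by
    ext i j
    fin_cases i <;> fin_cases j <;>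
    simp [coe_unip, Matrix.mul_apply, Fin.sum_univ_two, hV10, ← hV11]
    · linarith
    · ring
    · linarith
  have hu : N * unip (2 * (V 0 0 * V 0 1)) * N⁻¹ ∈ Γ := by
    have e : N * unip (2 * (V 0 0 * V 0 1)) * N⁻¹ =
        P.wordMap (List.iterate (P.turn s) a ℓ) * P.wordMap (List.iterate (P.turn s) a ℓ) := by
      have : P.wordMap (List.iterate (P.turn s) a ℓ) = N * V * N⁻¹ := by
        rw [← hV, mul_inv_cancel_right]
      rw [this, ← hVV]
      group
    rw [e]
    exact Γ.mul_mem (hle (wordMap_mem _)) (hle (wordMap_mem _))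
  have hτ : 2 * (V 0 0 * V 0 1) ≠ 0 := mul_ne_zero two_ne_zero (mul_ne_zero hV0 hV01)
  set Q := N⁻¹ * (B' * S k) with hQ
  have hQ10 : Q 1 0 = 0 := imageOfInfty_eq_iff.1 himg
  have hQe : Q = N⁻¹ * (B' * B⁻¹) * N := by rw [hQ, hNdef]; group
  have hQe' : Q⁻¹ = N⁻¹ * (B * B'⁻¹) * N := by rw [hQe]; group
  have hi : (Q⁻¹ : SL(2, ℝ)) 1 0 = 0 ∧ (Q⁻¹ : SL(2, ℝ)) 0 0 = Q 1 1 := by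
    simp [Matrix.SpecialLinearGroup.coe_inv, Matrix.adjugate_fin_two, hQ10]
  have hd := det_entries Q
  rw [hQ10, mul_zero, sub_zero] at hd
  -- The bound is applied to `Q` and to its inverse; as the two diagonal entries have product one,
  -- both squares equal one.
  have h1 : 1 ≤ Q 0 0 ^ 2 := by
    rw [hQe]
    exact abs_upper_le_one hΓ hτ hu (Γ.mul_mem hB' (Γ.inv_mem hB)) (hQe ▸ hQ10)
  have h2 : 1 ≤ Q 1 1 ^ 2 := by
    rw [← hi.2, hQe']
    exact abs_upper_le_one hΓ hτ hu (Γ.mul_mem hB (Γ.inv_mem hB')) (hQe' ▸ hi.1)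
  have h3 : Q 0 0 ^ 2 * Q 1 1 ^ 2 = 1 := by rw [← mul_pow, hd, one_pow]
  have h4 : Q 0 0 ^ 2 = 1 := le_antisymm (by nlinarith) h1
  have hN' : B' * S k = N * Q := by rw [hQ, mul_inv_cancel_left]
  have hR : gramR (B' * S k) = gramR N := by rw [hN', gramR_mul_upper _ hQ10, h4, one_mul]
  have hpos : ∀ m, P.sidePos s a (N * Q) m =
      P.sidePos s a N m + 2 * (Q 0 0 * Q 0 1 * gramR N) := by
    intro m
    rw [LabelledIdealPolygon.sidePos, P.transport_mul s a N Q (m + 1), P.transport_mul s a N Q m,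
      gramQ_mul_upper _ hQ10,
      gramQ_mul_upper _ hQ10, P.gramR_transport h, P.gramR_transport h,
      LabelledIdealPolygon.sidePos]
    ring
  rw [LabelledIdealPolygon.cuspLength, LabelledIdealPolygon.cuspLength, hR, hN', hpos, hpos]
  congr 2
  ring

lemma geomLength_iterate (hΓ : DiscreteTopology Γ) (hle : Γ₀ ≤ Γ) (hS : IsCuspSystem Γ S)
    {s : Bool} {a : A} {n : ℕ} (hn : 0 < n) {B : SL(2, ℝ)} (hB : B ∈ Γ) {k : Fin p}
    (h : cayleyBoundary (imageOfInfty (B * S k)) = P.tip s a) :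
    geomLength Γ S P (List.iterate (P.turn s) a (n + 1)) = P.cuspLength s a n (B * S k) := by
  have hlen : 2 ≤ (List.iterate (P.turn s) a (n + 1)).length := by
    rw [List.length_iterate]; omega
  have hchain := P.turnChain_iterate s a (n + 1)
  have hvert : P.cuspVertex (List.iterate (P.turn s) a (n + 1)) = P.tip s a := by
    rw [List.iterate, LabelledIdealPolygon.cuspVertex, ← List.iterate]
    cases s
    · rw [if_neg fun hl => P.not_isLeft_and_isRight hl (P.isRight_iff.2 ⟨hlen, hchain⟩)]; rfl
    · rw [if_pos (P.isLeft_iff.2 ⟨hlen, hchain⟩)]; rfl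
  have hdrop : (List.iterate (P.turn s) a (n + 1)).dropLast = List.iterate (P.turn s) a n := by
    rw [P.iterate_succ_eq_append, List.dropLast_concat]
  have hlast : ∀ hne, (List.iterate (P.turn s) a (n + 1)).getLast hne = (P.turn s)^[n] a := by
    intro hne
    simp only [P.iterate_succ_eq_append, List.getLast_concat]
  have hhead : ∀ hne, (List.iterate (P.turn s) a (n + 1)).head hne = a := fun _ => rfl
  rw [geomLength, dif_pos hlen, hhead, hlast, hdrop, hvert, cuspDist]
  have hset : {x | ∃ B ∈ Γ, ∃ k, cayleyBoundary (imageOfInfty (B * S k)) = P.tip s a ∧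
      ∃ z ∈ P.side a, ∃ z' ∈ (fun z : ℍ => P.wordMap (List.iterate (P.turn s) a n) • z) ''
        P.side ((P.turn s)^[n] a), x = |((B * S k)⁻¹ • z).re - ((B * S k)⁻¹ • z').re|} =
      {P.cuspLength s a n (B * S k)} := by
    ext x
    simp only [Set.mem_ofPred_eq, Set.mem_singleton_iff]
    constructor
    · rintro ⟨B', hB', k', h', hx⟩
      rw [P.exists_side_iff h'] at hx
      rw [hx, cuspLength_eq hΓ hle hS n hB hB' h h']
    · intro hx
      exact ⟨B, hB, k, h, (P.exists_side_iff h n x).2 hx⟩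
  rw [hset, csSup_singleton]

/-- There are only finitely many cuspidal words of bounded geometric length. -/
theorem finite_alphabet (hΓ : DiscreteTopology Γ) (hle : Γ₀ ≤ Γ) (hS : IsCuspSystem Γ S) (T : ℝ) :
    Finite (Alphabet Γ S P T) := by
  have := P.finite_letters
  have key : ∀ x : Bool × A, ∃ m : ℕ, ∀ n, 0 < n →
      geomLength Γ S P (List.iterate (P.turn x.1) x.2 (n + 1)) ≤ T → n < m := by
    rintro ⟨s, a⟩
    obtain ⟨B, hB, k, h⟩ := exists_cusp_eq_tip (P := P) hle hS s a
    obtain ⟨m, hm⟩ := P.exists_cuspLength_bound h T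
    refine ⟨m, fun n hn hT => hm n ?_⟩
    rwa [geomLength_iterate hΓ hle hS hn hB h] at hT
  choose m hm using key
  -- The bounds `m x` concern words of at least two letters; the `+ 1` keeps the one-letter words
  -- even when `m x = 0`.
  have hfin : (⋃ x : Bool × A, (fun n => List.iterate (P.turn x.1) x.2 (n + 1)) ''
      {n | n < m x + 1}).Finite :=
    Set.finite_iUnion fun x => (Set.finite_lt_nat _).image _
  suffices h : {W | P.IsCuspidal W ∧ geomLength Γ S P W ≤ T}.Finite from h.to_subtype
  refine hfin.subset ?_
  rintro W ⟨hW, hT⟩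
  obtain ⟨h0, s, hs⟩ := P.isCuspidal_iff.1 hW
  obtain ⟨a, U, rfl⟩ := List.exists_cons_of_ne_nil h0
  refine Set.mem_iUnion.2 ⟨(s, a), U.length, ?_, (hs.eq_iterate P).symm⟩
  rcases Nat.eq_zero_or_pos U.length with h | h
  · simp [h]
  · rw [hs.eq_iterate P] at hT
    have := hm (s, a) U.length h hT
    simp only [Set.mem_ofPred_eq]
    omega

end BowenSeries

namespace BowenSeries

section Transfer

variable {Γ₀ : Subgroup SL(2, ℝ)} {A : Type*} {Γ : Subgroup SL(2, ℝ)} {p : ℕ}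
  {S : Fin p → SL(2, ℝ)} {P : LabelledIdealPolygon Γ₀ A} {T : ℝ}

/-! ### Agreement of sequences, fibres of the shift -/

namespace ShiftSpace

/-- The two sequences agree in the entries `0, …, n`. -/
def Agree (n : ℕ) (w w' : ShiftSpace Γ S P T) : Prop := ∀ r ≤ n, w.1 r = w'.1 r

lemma Agree.symm {n : ℕ} {w w' : ShiftSpace Γ S P T} (h : Agree n w w') : Agree n w' w :=
  fun r hr => (h r hr).symm

lemma Agree.trans {n : ℕ} {w w' w'' : ShiftSpace Γ S P T} (h : Agree n w w')
    (h' : Agree n w' w'') : Agree n w w'' :=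
  fun r hr => (h r hr).trans (h' r hr)

lemma Agree.refl (n : ℕ) (w : ShiftSpace Γ S P T) : Agree n w w := fun _ _ => rfl

lemma Agree.mono {n k : ℕ} (hk : k ≤ n) {w w' : ShiftSpace Γ S P T} (h : Agree n w w') :
    Agree k w w' :=
  fun r hr => h r (hr.trans hk)

lemma Agree.shift {n : ℕ} {w w' : ShiftSpace Γ S P T} (h : Agree (n + 1) w w') :
    Agree n w.shift w'.shift :=
  fun r hr => h (r + 1) (Nat.succ_le_succ hr)

lemma agree_succ_iff {n : ℕ} {w w' : ShiftSpace Γ S P T} :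
    Agree (n + 1) w w' ↔ w.1 0 = w'.1 0 ∧ Agree n w.shift w'.shift := by
  constructor
  · exact fun h => ⟨h 0 (Nat.zero_le _), h.shift⟩
  · rintro ⟨h0, h⟩ r hr
    cases r with
    | zero => exact h0
    | succ r => exact h r (Nat.le_of_succ_le_succ hr)

lemma agree_zero_iff {w w' : ShiftSpace Γ S P T} : Agree 0 w w' ↔ w.1 0 = w'.1 0 :=
  ⟨fun h => h 0 le_rfl, fun h r hr => by rwa [Nat.le_zero.1 hr]⟩

/-- The sequence with first entry `W` and shift `w`. -/
def cons (W : Alphabet Γ S P T) (w : ShiftSpace Γ S P T) (h : P.Transition W.1 (w.1 0).1) :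
    ShiftSpace Γ S P T :=
  ⟨fun r => Nat.casesOn r W w.1, fun r => by
    cases r with
    | zero => exact h
    | succ r => exact w.2 r⟩

lemma ext_shift {w w' : ShiftSpace Γ S P T} (h0 : w.1 0 = w'.1 0) (h : w.shift = w'.shift) :
    w = w' :=
  ext_word fun r => by
    cases r with
    | zero => exact h0
    | succ r => exact congrFun (congrArg Subtype.val h) r

/-- The preimages of a sequence under the shift. -/
abbrev Fiber (w : ShiftSpace Γ S P T) := {w' : ShiftSpace Γ S P T // w'.shift = w}

instance finite_fiber [Finite (Alphabet Γ S P T)] (w : ShiftSpace Γ S P T) : Finite (Fiber w) :=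
  Finite.of_injective (fun u : Fiber w => u.1.1 0) fun u v h =>
    Subtype.ext (ext_shift h (u.2.trans v.2.symm))

noncomputable instance fintypeFiber [Finite (Alphabet Γ S P T)] (w : ShiftSpace Γ S P T) :
    Fintype (Fiber w) := Fintype.ofFinite _

lemma transition_of_fiber {w w' : ShiftSpace Γ S P T} (h : w.1 0 = w'.1 0) (u : Fiber w) :
    P.Transition (u.1.1 0).1 (w'.1 0).1 := by
  have := u.1.2 0
  rwa [show u.1.1 (0 + 1) = w'.1 0 by rw [← h]; exact congrFun (congrArg Subtype.val u.2) 0] at this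

/-- Points with the same first entry have the same preimages, up to the tails. -/
def fiberEquiv {w w' : ShiftSpace Γ S P T} (h : w.1 0 = w'.1 0) : Fiber w ≃ Fiber w' where
  toFun u := ⟨cons (u.1.1 0) w' (transition_of_fiber h u), rfl⟩
  invFun u := ⟨cons (u.1.1 0) w (transition_of_fiber h.symm u), rfl⟩
  left_inv u := Subtype.ext (ext_shift rfl u.2.symm)
  right_inv u := Subtype.ext (ext_shift rfl u.2.symm)

lemma agree_fiberEquiv {n : ℕ} {w w' : ShiftSpace Γ S P T} (h : w.1 0 = w'.1 0)
    (hn : Agree n w w') (u : Fiber w) : Agree (n + 1) u.1 (fiberEquiv h u).1 := by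
  rw [agree_succ_iff, (fiberEquiv h u).2, u.2]
  exact ⟨rfl, hn⟩

/-- A mixing property: every point has preimages of order `m` with arbitrary first entry. -/
def Mixing (Γ : Subgroup SL(2, ℝ)) {p : ℕ} (S : Fin p → SL(2, ℝ)) (P : LabelledIdealPolygon Γ₀ A)
    (T : ℝ) (m : ℕ) : Prop :=
  ∀ (W : Alphabet Γ S P T) (w : ShiftSpace Γ S P T), ∃ u, u.1 0 = W ∧ shift^[m] u = w

lemma exists_mixing (h : IsAperiodic Γ S P T) : ∃ m, Mixing Γ S P T m := by
  obtain ⟨m, hm⟩ := h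
  refine ⟨m, fun W w => ?_⟩
  obtain ⟨c, hc0, hcm, hc⟩ := hm W (w.1 0)
  obtain ⟨u, hu⟩ : ∃ u : ShiftSpace Γ S P T, ∀ r, u.1 r = if r < m then c r else w.1 (r - m) := by
    refine ⟨⟨fun r => if r < m then c r else w.1 (r - m), fun r => ?_⟩, fun r => rfl⟩
    rcases lt_trichotomy (r + 1) m with h | h | h
    · simp only [if_pos h, if_pos (Nat.lt_of_succ_lt h)]
      exact hc r (Nat.lt_of_succ_lt h)
    · have : r < m := by omega
      simp only [if_pos this, h, lt_irrefl, if_false, Nat.sub_self]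
      rw [← hcm, ← h]
      exact hc r this
    · simp only [if_neg (by omega : ¬ r < m), if_neg (by omega : ¬ r + 1 < m),
        show r + 1 - m = r - m + 1 by omega]
      exact w.2 _
  refine ⟨u, ?_, ext_word fun r => ?_⟩
  · rw [hu]
    split_ifs with h
    · exact hc0
    · obtain rfl : m = 0 := by omega
      rw [← hc0, hcm]
  · rw [shift_iterate_apply, hu, if_neg (by omega), Nat.add_sub_cancel]

/-- Prescribing a whole initial block of the preimages. -/
lemma Mixing.exists_agree {m : ℕ} (hm : Mixing Γ S P T m) (n : ℕ) (v w : ShiftSpace Γ S P T) :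
    ∃ u, Agree n u v ∧ shift^[n + m] u = w := by
  induction n generalizing v with
  | zero =>
    obtain ⟨u, hu, h⟩ := hm (v.1 0) w
    exact ⟨u, agree_zero_iff.2 hu, by rwa [zero_add]⟩
  | succ n ih =>
    obtain ⟨u, hu, h⟩ := ih v.shift
    have htr : P.Transition (v.1 0).1 (u.1 0).1 := by
      rw [hu 0 (Nat.zero_le _)]; exact v.2 0
    refine ⟨cons (v.1 0) u htr, agree_succ_iff.2 ⟨rfl, hu⟩, ?_⟩
    rw [show n + 1 + m = n + m + 1 by omega, Function.iterate_succ_apply]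
    exact h

end ShiftSpace

open ShiftSpace

/-! ### Real transfer operators and cones -/

/-- The transfer operator on real functions. -/
noncomputable def transferReal [Finite (Alphabet Γ S P T)] (φ : ShiftSpace Γ S P T → ℝ) :
    Module.End ℝ (ShiftSpace Γ S P T → ℝ) where
  toFun f w := ∑ u : Fiber w, Real.exp (φ u.1) * f u.1
  map_add' f g := by ext w; simp [mul_add, Finset.sum_add_distrib]
  map_smul' c f := by ext w; simp [Finset.mul_sum, mul_left_comm]

/-- The potential `φ` is bounded by `B` and Hölder continuous with constant `C`. -/
structure IsRegular (θ C B : ℝ) (φ : ShiftSpace Γ S P T → ℝ) : Prop where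
  nonneg : 0 ≤ C
  abs_sub_le : ∀ {n w w'}, Agree n w w' → |φ w - φ w'| ≤ C * θ ^ n
  abs_le : ∀ w, |φ w| ≤ B

/-- The cone of the nonnegative functions whose logarithm is Hölder continuous
with constant `a`. -/
structure InCone (θ a : ℝ) (f : ShiftSpace Γ S P T → ℝ) : Prop where
  nonneg : ∀ w, 0 ≤ f w
  le : ∀ {n w w'}, Agree n w w' → f w ≤ Real.exp (a * θ ^ n) * f w'

lemma InCone.mono {θ a b : ℝ} (hθ : 0 ≤ θ) (hab : a ≤ b) {f : ShiftSpace Γ S P T → ℝ}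
    (hf : InCone θ a f) : InCone θ b f :=
  ⟨hf.nonneg, fun h => (hf.le h).trans (mul_le_mul_of_nonneg_right
    (Real.exp_le_exp.2 (mul_le_mul_of_nonneg_right hab (pow_nonneg hθ _))) (hf.nonneg _))⟩

lemma InCone.smul {θ a c : ℝ} (hc : 0 ≤ c) {f : ShiftSpace Γ S P T → ℝ}
    (hf : InCone θ a f) : InCone θ a (c • f) :=
  ⟨fun w => mul_nonneg hc (hf.nonneg w), fun h => by
    have := mul_le_mul_of_nonneg_left (hf.le h) hc
    simpa [mul_left_comm] using this⟩

lemma inCone_one {θ a : ℝ} (hθ : 0 ≤ θ) (ha : 0 ≤ a) :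
    InCone θ a (1 : ShiftSpace Γ S P T → ℝ) :=
  ⟨fun _ => zero_le_one, fun _ => by
    simpa using mul_nonneg ha (pow_nonneg hθ _)⟩

variable [Finite (Alphabet Γ S P T)] {φ : ShiftSpace Γ S P T → ℝ} {θ C B : ℝ}

lemma transferReal_apply (f : ShiftSpace Γ S P T → ℝ) (w : ShiftSpace Γ S P T) :
    transferReal φ f w = ∑ u : Fiber w, Real.exp (φ u.1) * f u.1 := rfl

lemma transferReal_mono {f g : ShiftSpace Γ S P T → ℝ} (h : f ≤ g) :
    transferReal φ f ≤ transferReal φ g := fun _ =>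
  Finset.sum_le_sum fun u _ => mul_le_mul_of_nonneg_left (h u.1) (Real.exp_pos _).le

lemma transferReal_pow_succ (n : ℕ) (f : ShiftSpace Γ S P T → ℝ) :
    (transferReal φ ^ (n + 1)) f = transferReal φ ((transferReal φ ^ n) f) := by
  rw [pow_succ']; rfl

lemma transferReal_pow_add (n k : ℕ) (f : ShiftSpace Γ S P T → ℝ) :
    (transferReal φ ^ (n + k)) f = (transferReal φ ^ n) ((transferReal φ ^ k) f) := by
  rw [pow_add]; rfl

lemma transferReal_pow_mono (n : ℕ) {f g : ShiftSpace Γ S P T → ℝ} (h : f ≤ g) :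
    (transferReal φ ^ n) f ≤ (transferReal φ ^ n) g := by
  induction n with
  | zero => exact h
  | succ n ih =>
    rw [transferReal_pow_succ, transferReal_pow_succ]
    exact transferReal_mono ih

lemma transferReal_pow_nonneg (n : ℕ) {f : ShiftSpace Γ S P T → ℝ} (h : 0 ≤ f) :
    0 ≤ (transferReal φ ^ n) f := by
  have := transferReal_pow_mono (φ := φ) n h
  rwa [map_zero] at this

lemma le_transferReal {f : ShiftSpace Γ S P T → ℝ} (h : 0 ≤ f) (u : ShiftSpace Γ S P T) :
    Real.exp (φ u) * f u ≤ transferReal φ f u.shift :=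
  Finset.single_le_sum (f := fun v : Fiber u.shift => Real.exp (φ v.1) * f v.1)
    (fun _ _ => mul_nonneg (Real.exp_pos _).le (h _)) (Finset.mem_univ ⟨u, rfl⟩)

/-- Keep a single preimage in each sum; every step costs at most a factor `exp (-B)`. -/
lemma le_transferReal_pow (hφ : IsRegular θ C B φ) {f : ShiftSpace Γ S P T → ℝ} (h : 0 ≤ f)
    (n : ℕ) (u : ShiftSpace Γ S P T) :
    Real.exp (-(n * B)) * f u ≤ (transferReal φ ^ n) f (shift^[n] u) := by
  induction n with
  | zero => simp
  | succ n ih =>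
    rw [transferReal_pow_succ, Function.iterate_succ_apply']
    refine le_trans ?_ (le_transferReal (transferReal_pow_nonneg n h) _)
    have e : Real.exp (-((n + 1 : ℕ) * B)) = Real.exp (-B) * Real.exp (-(n * B)) := by
      rw [← Real.exp_add]; congr 1; push_cast; ring
    rw [e, mul_assoc]
    exact mul_le_mul (Real.exp_le_exp.2 (neg_le_of_abs_le (hφ.abs_le _))) ih
      (mul_nonneg (Real.exp_pos _).le (h _)) (Real.exp_pos _).le

/-- Corresponding preimages agree in one more entry than their images, so the constants of `f` and
of `φ` both gain a factor `θ`. This makes the cone invariant for large `a`. -/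
lemma InCone.transferReal (hφ : IsRegular θ C B φ) {a : ℝ} {f : ShiftSpace Γ S P T → ℝ}
    (hf : InCone θ a f) : InCone θ (θ * (a + C)) (transferReal φ f) := by
  refine ⟨fun w => Finset.sum_nonneg fun u _ => mul_nonneg (Real.exp_pos _).le (hf.nonneg _),
    fun {n w w'} h => ?_⟩
  have h0 := h 0 (Nat.zero_le _)
  rw [transferReal_apply, transferReal_apply, ← (fiberEquiv h0).sum_comp, Finset.mul_sum]
  refine Finset.sum_le_sum fun u _ => ?_
  have hag := agree_fiberEquiv h0 h u
  set u' := (fiberEquiv h0 u).1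
  have h1 := hf.le hag
  have h2 := (abs_le.1 (hφ.abs_sub_le hag)).2
  calc Real.exp (φ u.1) * f u.1
      ≤ Real.exp (φ u' + C * θ ^ (n + 1)) * (Real.exp (a * θ ^ (n + 1)) * f u') :=
        mul_le_mul (Real.exp_le_exp.2 (by linarith)) h1 (hf.nonneg _) (Real.exp_pos _).le
    _ = Real.exp (θ * (a + C) * θ ^ n) * (Real.exp (φ u') * f u') := by
        rw [← mul_assoc, ← mul_assoc, ← Real.exp_add, ← Real.exp_add]
        congr 2; ring

lemma InCone.transferReal_pow (hφ : IsRegular θ C B φ) (hθ : 0 ≤ θ) {a : ℝ}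
    (ha : θ * (a + C) ≤ a) {f : ShiftSpace Γ S P T → ℝ} (hf : InCone θ a f) (n : ℕ) :
    InCone θ a ((BowenSeries.transferReal φ ^ n) f) := by
  induction n with
  | zero => exact hf
  | succ n ih => rw [transferReal_pow_succ]; exact (ih.transferReal hφ).mono hθ ha

/-- Positivity improvement on the cone. -/
lemma InCone.mul_le_transferReal_pow (hφ : IsRegular θ C B φ) {m : ℕ} (hm : Mixing Γ S P T m)
    {a : ℝ} {f : ShiftSpace Γ S P T → ℝ} (hf : InCone θ a f) (v w : ShiftSpace Γ S P T) :
    Real.exp (-(m * B) - a) * f v ≤ (BowenSeries.transferReal φ ^ m) f w := by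
  obtain ⟨u, hu, rfl⟩ := hm (v.1 0) w
  refine le_trans ?_ (le_transferReal_pow hφ hf.nonneg m u)
  rw [sub_eq_add_neg, Real.exp_add, mul_assoc]
  refine mul_le_mul_of_nonneg_left ?_ (Real.exp_pos _).le
  have h := hf.le (agree_zero_iff.2 hu.symm)
  rw [pow_zero, mul_one] at h
  rw [Real.exp_neg, inv_mul_le_iff₀ (Real.exp_pos _)]
  exact h

lemma exists_transferReal_le (hφ : IsRegular θ C B φ) : ∃ M : ℝ, 0 < M ∧
    ∀ (f : ShiftSpace Γ S P T → ℝ) (c : ℝ), (∀ w, f w ≤ c) → 0 ≤ c →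
      ∀ w, transferReal φ f w ≤ M * c := by
  have := Fintype.ofFinite (Alphabet Γ S P T)
  refine ⟨(Fintype.card (Alphabet Γ S P T) + 1) * Real.exp B, by positivity,
    fun f c hf hc w => ?_⟩
  have h1 : transferReal φ f w ≤ ∑ u : Fiber w, Real.exp B * c :=
    Finset.sum_le_sum fun u _ =>
      (mul_le_mul_of_nonneg_left (hf _) (Real.exp_pos _).le).trans
        (mul_le_mul_of_nonneg_right (Real.exp_le_exp.2 (le_of_abs_le (hφ.abs_le _))) hc)
  have h2 : Fintype.card (Fiber w) ≤ Fintype.card (Alphabet Γ S P T) :=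
    Fintype.card_le_of_injective (fun u : Fiber w => u.1.1 0) fun u v h =>
      Subtype.ext (ext_shift h (u.2.trans v.2.symm))
  rw [Finset.sum_const, nsmul_eq_mul, Finset.card_univ, ← mul_assoc] at h1
  refine h1.trans (mul_le_mul_of_nonneg_right (mul_le_mul_of_nonneg_right ?_ (Real.exp_pos _).le) hc)
  have h3 : (Fintype.card (Fiber w) : ℝ) ≤ Fintype.card (Alphabet Γ S P T) := by exact_mod_cast h2
  linarith

lemma exists_transferReal_pow_le (hφ : IsRegular θ C B φ) (n : ℕ) : ∃ M : ℝ, 0 < M ∧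
    ∀ (f : ShiftSpace Γ S P T → ℝ) (c : ℝ), (∀ w, f w ≤ c) → 0 ≤ c →
      ∀ w, (transferReal φ ^ n) f w ≤ M * c := by
  obtain ⟨M, hM, h⟩ := exists_transferReal_le hφ
  refine ⟨M ^ n, pow_pos hM n, fun f c hf hc => ?_⟩
  induction n with
  | zero => simpa using hf
  | succ n ih =>
    intro w
    rw [transferReal_pow_succ, pow_succ', mul_assoc]
    exact h _ _ ih (by positivity) w

/-- Functions of the cone are bounded. -/
lemma InCone.bddAbove {a : ℝ} {f : ShiftSpace Γ S P T → ℝ} (hf : InCone θ a f) :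
    BddAbove (Set.range f) := by
  have hch : ∀ W : Alphabet Γ S P T, ∃ c : ℝ, ∀ w : ShiftSpace Γ S P T, w.1 0 = W → f w ≤ c := by
    intro W
    by_cases h : ∃ v : ShiftSpace Γ S P T, v.1 0 = W
    · obtain ⟨v, rfl⟩ := h
      exact ⟨_, fun w hw => hf.le (agree_zero_iff.2 hw)⟩
    · exact ⟨0, fun w hw => absurd ⟨w, hw⟩ h⟩
  choose c hc using hch
  obtain ⟨M, hM⟩ := (Set.finite_range c).bddAbove
  exact ⟨M, by rintro _ ⟨w, rfl⟩; exact (hc _ w rfl).trans (hM ⟨_, rfl⟩)⟩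

/-! ### The eigenfunction -/

/-- A Collatz-Wielandt argument. Among normalised functions of the cone take a pair with `lam f ≤ L
f` and `lam` maximal, which exists by compactness. If the inequality were strict at one point, it
would be strict on a cylinder, and by mixing a power of `L` would make it uniformly strict, against
maximality. -/
lemma exists_transferReal_eq [Nonempty (ShiftSpace Γ S P T)] (hθ0 : 0 < θ) (hθ1 : θ < 1)
    (hφ : IsRegular θ C B φ) {m : ℕ} (hm : Mixing Γ S P T m) :
    ∃ (lam a : ℝ) (h : ShiftSpace Γ S P T → ℝ), 0 < lam ∧ 0 < a ∧ InCone θ a h ∧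
      (∀ w, 0 < h w) ∧ transferReal φ h = lam • h := by
  let o := Classical.arbitrary (ShiftSpace Γ S P T)
  -- `a` lies beyond the fixed point `θ C / (1 - θ)` of `a ↦ θ (a + C)`, so the cone is mapped into
  -- itself.
  obtain ⟨a, ha0, ha⟩ : ∃ a : ℝ, 0 < a ∧ θ * (a + C) ≤ a := by
    refine ⟨C / (1 - θ) + 1, by have := div_nonneg hφ.nonneg (sub_pos.2 hθ1).le; linarith, ?_⟩
    have h1 : C / (1 - θ) * (1 - θ) = C := div_mul_cancel₀ _ (sub_pos.2 hθ1).ne'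
    nlinarith [hφ.nonneg]
  obtain ⟨M, hM, hMle⟩ := exists_transferReal_pow_le hφ m
  obtain ⟨M₁, hM₁, hM₁le⟩ := exists_transferReal_le hφ
  set δ := Real.exp (-(m * B) - a) with hδ
  have hδ0 : 0 < δ := Real.exp_pos _
  set D := M / δ with hD
  have hD0 : 0 < D := div_pos hM hδ0
  -- the image of the cone under the `m`-th power
  have hratio : ∀ f : ShiftSpace Γ S P T → ℝ, InCone θ a f → ∀ w w',
      (transferReal φ ^ m) f w ≤ D * (transferReal φ ^ m) f w' := by
    intro f hf w w'
    have hb := hf.bddAbove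
    have h1 := hMle f (⨆ v, f v) (fun v => le_ciSup hb v)
      ((hf.nonneg o).trans (le_ciSup hb o)) w
    have h2 : (⨆ v, f v) ≤ (transferReal φ ^ m) f w' / δ :=
      ciSup_le fun v => by
        rw [le_div_iff₀ hδ0, mul_comm]; exact hf.mul_le_transferReal_pow hφ hm v w'
    calc _ ≤ _ := h1
      _ ≤ M * ((transferReal φ ^ m) f w' / δ) := mul_le_mul_of_nonneg_left h2 hM.le
      _ = _ := by rw [hD]; ring
  -- Normalisation at `o` and the bounded ratio confine the values to `[0, D]`. All conditions are
  -- closed under pointwise convergence, so the product topology already gives compactness.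
  set Y : Set (ShiftSpace Γ S P T → ℝ) :=
    {f | InCone θ a f ∧ (∀ w w', f w ≤ D * f w') ∧ f o = 1} with hY
  have hYpos : ∀ f ∈ Y, ∀ w, 0 < f w := by
    rintro f ⟨-, h2, h3⟩ w
    have := h2 o w
    rw [h3] at this
    by_contra hc
    nlinarith
  have hYle : ∀ f ∈ Y, ∀ w, f w ≤ D := by
    rintro f ⟨-, h2, h3⟩ w
    simpa [h3] using h2 w o
  have ev : ∀ w, Continuous fun f : ShiftSpace Γ S P T → ℝ => f w := fun w => continuous_apply w
  have hYclosed : IsClosed Y := by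
    have e : Y = (⋂ w, {f | 0 ≤ f w}) ∩ (⋂ n, ⋂ w, ⋂ w', ⋂ (_ : Agree n w w'),
        {f | f w ≤ Real.exp (a * θ ^ n) * f w'}) ∩ (⋂ w, ⋂ w', {f | f w ≤ D * f w'}) ∩
        {f | f o = 1} := by
      ext f
      simp only [hY, Set.mem_ofPred_eq, Set.mem_inter_iff, Set.mem_iInter]
      constructor
      · rintro ⟨h1, h2, h3⟩
        exact ⟨⟨⟨h1.nonneg, fun _ _ _ h => h1.le h⟩, h2⟩, h3⟩
      · rintro ⟨⟨⟨h1, h1'⟩, h2⟩, h3⟩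
        exact ⟨⟨h1, fun h => h1' _ _ _ h⟩, h2, h3⟩
    rw [e]
    refine ((IsClosed.inter ?_ ?_).inter ?_).inter ?_
    · exact isClosed_iInter fun w => isClosed_le continuous_const (ev w)
    · exact isClosed_iInter fun n => isClosed_iInter fun w => isClosed_iInter fun w' =>
        isClosed_iInter fun _ => isClosed_le (ev w) (continuous_const.mul (ev w'))
    · exact isClosed_iInter fun w => isClosed_iInter fun w' =>
        isClosed_le (ev w) (continuous_const.mul (ev w'))
    · exact isClosed_eq (ev o) continuous_const
  have hYcompact : IsCompact Y := by
    refine (isCompact_univ_pi fun _ : ShiftSpace Γ S P T => isCompact_Icc (a := (0 : ℝ)) (b := D)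
      ).of_isClosed_subset hYclosed ?_
    intro f hf w _
    exact ⟨(hYpos f hf w).le, hYle f hf w⟩
  -- normalization of the powers
  have hnorm : ∀ (f : ShiftSpace Γ S P T → ℝ) (k : ℕ), InCone θ a f → (∀ w, 0 < f w) →
      ∃ c : ℝ, 0 < c ∧ c • (transferReal φ ^ (m + k)) f ∈ Y := by
    intro f k hf hpos
    set g := (transferReal φ ^ (m + k)) f with hg
    have hfk := hf.transferReal_pow hφ hθ0.le ha k
    have hgr := hratio _ hfk
    rw [← transferReal_pow_add, ← hg] at hgr
    have hg0 : 0 < g o := by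
      obtain ⟨u, -, hu⟩ := hm.exists_agree k o o
      have := le_transferReal_pow hφ hf.nonneg (k + m) u
      rw [hu, add_comm k m] at this
      exact (mul_pos (Real.exp_pos _) (hpos u)).trans_le this
    refine ⟨(g o)⁻¹, inv_pos.2 hg0,
      (hf.transferReal_pow hφ hθ0.le ha _).smul (inv_pos.2 hg0).le, fun w w' => ?_, ?_⟩
    · have := mul_le_mul_of_nonneg_left (hgr w w') (inv_pos.2 hg0).le
      simpa [mul_left_comm] using this
    · simp [hg0.ne']
  have hcontL : ∀ w, Continuous fun f : ShiftSpace Γ S P T → ℝ => transferReal φ f w := fun w =>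
    continuous_finsetSum _ fun u _ => continuous_const.mul (ev u.1)
  -- the maximal `lam`
  set Z : Set (ℝ × (ShiftSpace Γ S P T → ℝ)) :=
    (Set.Icc 0 (M₁ * D) ×ˢ Y) ∩ {q | ∀ w, q.1 * q.2 w ≤ transferReal φ q.2 w} with hZ
  have hZcompact : IsCompact Z := by
    refine (isCompact_Icc.prod hYcompact).inter_right ?_
    simp only [Set.ofPred_forall]
    exact isClosed_iInter fun w => isClosed_le (continuous_fst.mul ((ev w).comp continuous_snd))
      ((hcontL w).comp continuous_snd)
  have hZne : Z.Nonempty := by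
    obtain ⟨c, -, hc⟩ := hnorm 1 0 (inCone_one hθ0.le ha0.le) fun _ => one_pos
    refine ⟨(0, _), ⟨⟨le_rfl, by positivity⟩, hc⟩, fun w => ?_⟩
    simp only [zero_mul]
    exact ((hc.1.transferReal hφ).nonneg w)
  obtain ⟨⟨lam, f⟩, ⟨⟨hlam, hf⟩, hle⟩, hmax⟩ := hZcompact.exists_isMaxOn hZne
    continuous_fst.continuousOn
  simp only at hlam hf
  replace hle : ∀ w, lam * f w ≤ transferReal φ f w := hle
  have hfpos := hYpos f hf
  have hmax' : ∀ (μ : ℝ) (f' : ShiftSpace Γ S P T → ℝ), f' ∈ Y → 0 ≤ μ →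
      (∀ w, μ * f' w ≤ transferReal φ f' w) → μ ≤ lam := by
    intro μ f' hf' hμ h
    refine hmax (a := (μ, f')) ⟨⟨⟨hμ, ?_⟩, hf'⟩, h⟩
    have h1 := hM₁le f' D (hYle f' hf') hD0.le o
    have h2 := h o
    rw [hf'.2.2, mul_one] at h2
    exact h2.trans h1
  have heq : transferReal φ f = lam • f := by
    by_contra hne
    obtain ⟨v, hv⟩ := Function.ne_iff.1 hne
    have hv' : lam * f v < transferReal φ f v := lt_of_le_of_ne (hle v) (Ne.symm hv)
    have hLf : InCone θ a (transferReal φ f) := (hf.1.transferReal hφ).mono hθ0.le ha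
    -- For large `n` the cone estimates lose so little on the cylinder of order `n` at `v` that the
    -- strict inequality survives there by a fixed amount.
    obtain ⟨n, hn⟩ : ∃ n : ℕ, lam * (Real.exp (a * θ ^ n) * f v) <
        Real.exp (-(a * θ ^ n)) * transferReal φ f v := by
      have lim : Filter.Tendsto (fun n : ℕ => a * θ ^ n) Filter.atTop (nhds (a * 0)) :=
        (tendsto_pow_atTop_nhds_zero_of_lt_one hθ0.le hθ1).const_mul a
      rw [mul_zero] at lim
      have l1 := ((Real.continuous_exp.tendsto 0).comp lim).mul_const (f v)
      have l2 := ((Real.continuous_exp.tendsto (-0)).comp lim.neg).mul_const (transferReal φ f v)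
      rw [neg_zero, Real.exp_zero, one_mul] at l2
      rw [Real.exp_zero, one_mul] at l1
      exact ((l1.const_mul lam).eventually_lt l2 hv').exists
    set g : ShiftSpace Γ S P T → ℝ := transferReal φ f - lam • f with hg
    have hg0 : 0 ≤ g := fun w => sub_nonneg.2 (hle w)
    set c := Real.exp (-(a * θ ^ n)) * transferReal φ f v - lam * (Real.exp (a * θ ^ n) * f v)
      with hc
    have hc0 : 0 < c := sub_pos.2 hn
    have hgc : ∀ u, Agree n u v → c ≤ g u := by
      intro u hu
      have h1 := hLf.le hu.symm
      have h2 := hf.1.le hu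
      rw [mul_comm, ← div_le_iff₀ (Real.exp_pos _), div_eq_inv_mul, ← Real.exp_neg] at h1
      exact sub_le_sub h1 (mul_le_mul_of_nonneg_left h2 hlam.1)
    set N := m + n with hN
    obtain ⟨M₂, hM₂, hM₂le⟩ := exists_transferReal_pow_le hφ N
    set f' := (transferReal φ ^ N) f with hf'
    -- Every point has a preimage of order `N` in that cylinder, so `L ^ N g` is at least `exp (-(N
    -- * B)) * c` everywhere, while `f'` is at most `M₂ * D`; the quotient is an admissible increase
    -- of `lam`.
    set ε := Real.exp (-(N * B)) * c / (M₂ * D) with hε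
    have hε0 : 0 < ε := by positivity
    have hcomm : transferReal φ f' = lam • f' + (transferReal φ ^ N) g := by
      rw [hg, map_sub, map_smul, add_sub_cancel, hf', ← transferReal_pow_succ, pow_succ]
      rfl
    have hstep : ∀ w, (lam + ε) * f' w ≤ transferReal φ f' w := by
      intro w
      obtain ⟨u, hu, hw⟩ := hm.exists_agree n v w
      have h1 := le_transferReal_pow hφ hg0 (n + m) u
      rw [hw, add_comm n m, ← hN] at h1
      have h2 : f' w ≤ M₂ * D := hM₂le f D (hYle f hf) hD0.le w
      have h3 : ε * f' w ≤ Real.exp (-(N * B)) * c := by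
        calc ε * f' w ≤ ε * (M₂ * D) := mul_le_mul_of_nonneg_left h2 hε0.le
          _ = _ := div_mul_cancel₀ _ (by positivity)
      have h4 := mul_le_mul_of_nonneg_left (hgc u hu) (Real.exp_pos (-(N * B))).le
      have h5 := congrFun hcomm w
      simp only [Pi.add_apply, Pi.smul_apply, smul_eq_mul] at h5
      rw [h5, add_mul]
      linarith
    obtain ⟨b, hb0, hb⟩ := hnorm f n hf.1 hfpos
    have := hmax' (lam + ε) _ hb (by have := hlam.1; positivity) fun w => by
      rw [map_smul]
      have := mul_le_mul_of_nonneg_left (hstep w) hb0.le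
      simpa [mul_left_comm] using this
    linarith
  refine ⟨lam, a, f, ?_, ha0, hf.1, hfpos, heq⟩
  obtain ⟨u, -, hu⟩ := hm.exists_agree 1 o o
  have h1 := le_transferReal (φ := φ) hf.1.nonneg (shift^[m] u)
  have e : (shift^[m] u).shift = o := by
    rw [← hu, add_comm 1 m, Function.iterate_succ_apply']
  rw [e, heq] at h1
  have h2 : lam * f o = lam := by rw [hf.2.2, mul_one]
  have h3 := mul_pos (Real.exp_pos (φ (shift^[m] u))) (hfpos (shift^[m] u))
  simp only [Pi.smul_apply, smul_eq_mul, h2] at h1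
  exact h3.trans_le h1

end Transfer

end BowenSeries

namespace BowenSeries

section Decay

open ShiftSpace

variable {Γ₀ : Subgroup SL(2, ℝ)} {A : Type*} {Γ : Subgroup SL(2, ℝ)} {p : ℕ}
  {S : Fin p → SL(2, ℝ)} {P : LabelledIdealPolygon Γ₀ A} {T : ℝ}

/-! ### Exponential decay for normalized transfer operators -/

/-- The function `f` and its Hölder seminorm are bounded by `c`. -/
structure LipBound {E : Type*} [SeminormedAddCommGroup E] (θ c : ℝ)
    (f : ShiftSpace Γ S P T → E) : Prop where
  norm_le : ∀ w, ‖f w‖ ≤ c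
  norm_sub_le : ∀ {n w w'}, Agree n w w' → ‖f w - f w'‖ ≤ c * θ ^ n

lemma ShiftSpace.Mixing.succ {m : ℕ} (hm : Mixing Γ S P T m) : Mixing Γ S P T (m + 1) := by
  intro W w
  obtain ⟨v, hv, -⟩ := hm W w
  obtain ⟨u, hu, h⟩ := hm.exists_agree 1 v w
  exact ⟨u, (hu 0 (Nat.zero_le _)).trans hv, by rwa [add_comm] at h⟩

lemma exp_sub_one_le {t a : ℝ} (ht : 0 ≤ t) (hta : t ≤ a) :
    Real.exp t - 1 ≤ t * Real.exp a := by
  have h1 := Real.add_one_le_exp (-t)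
  have h2 : Real.exp (-t) * Real.exp t = 1 := by rw [← Real.exp_add]; simp
  have h3 := Real.exp_pos t
  have h4 := mul_le_mul_of_nonneg_left (Real.exp_le_exp.2 hta) ht
  nlinarith

variable {θ : ℝ}

lemma LipBound.re {c : ℝ} {f : ShiftSpace Γ S P T → ℂ} (hf : LipBound θ c f) :
    LipBound θ c fun w => (f w).re :=
  ⟨fun w => (Complex.abs_re_le_norm _).trans (hf.norm_le w), fun h => by
    rw [← Complex.sub_re]; exact (Complex.abs_re_le_norm _).trans (hf.norm_sub_le h)⟩

lemma LipBound.im {c : ℝ} {f : ShiftSpace Γ S P T → ℂ} (hf : LipBound θ c f) :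
    LipBound θ c fun w => (f w).im :=
  ⟨fun w => (Complex.abs_im_le_norm _).trans (hf.norm_le w), fun h => by
    rw [← Complex.sub_im]; exact (Complex.abs_im_le_norm _).trans (hf.norm_sub_le h)⟩

lemma LipBound.of_re_im {c c' : ℝ} {f : ShiftSpace Γ S P T → ℂ}
    (hre : LipBound θ c fun w => (f w).re) (him : LipBound θ c' fun w => (f w).im) :
    LipBound θ (c + c') f := by
  refine ⟨fun w => (Complex.norm_le_abs_re_add_abs_im _).trans
    (add_le_add (hre.norm_le w) (him.norm_le w)), fun h => ?_⟩
  rw [add_mul]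
  refine (Complex.norm_le_abs_re_add_abs_im _).trans (add_le_add ?_ ?_)
  · rw [Complex.sub_re]; exact hre.norm_sub_le h
  · rw [Complex.sub_im]; exact him.norm_sub_le h

lemma LipBound.mem {c : ℝ} {f : ShiftSpace Γ S P T → ℂ} (hf : LipBound θ c f) :
    f ∈ lipschitzSpace Γ S P T θ :=
  ⟨c, fun _ _ _ h => hf.norm_sub_le h⟩

variable [Finite (Alphabet Γ S P T)] {φ : ShiftSpace Γ S P T → ℝ} {C B : ℝ}

lemma transferReal_pow_one (h1 : transferReal φ 1 = 1) (n : ℕ) : (transferReal φ ^ n) 1 = 1 := by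
  induction n with
  | zero => rfl
  | succ n ih => rw [transferReal_pow_succ, ih, h1]

lemma transferReal_pow_le (h1 : transferReal φ 1 = 1) {f : ShiftSpace Γ S P T → ℝ} {c : ℝ}
    (h : ∀ w, f w ≤ c) (n : ℕ) (w : ShiftSpace Γ S P T) : (transferReal φ ^ n) f w ≤ c := by
  have h2 : f ≤ c • (1 : ShiftSpace Γ S P T → ℝ) := fun w => by simpa using h w
  have h3 := transferReal_pow_mono (φ := φ) n h2 w
  rw [map_smul, transferReal_pow_one h1] at h3
  simpa using h3

lemma abs_transferReal_pow_le (h1 : transferReal φ 1 = 1) {f : ShiftSpace Γ S P T → ℝ} {c : ℝ}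
    (h : ∀ w, |f w| ≤ c) (n : ℕ) (w : ShiftSpace Γ S P T) : |(transferReal φ ^ n) f w| ≤ c := by
  refine abs_le'.2 ⟨transferReal_pow_le h1 (fun w => (abs_le'.1 (h w)).1) n w, ?_⟩
  have := transferReal_pow_le h1 (f := -f) (fun w => (abs_le'.1 (h w)).2) n w
  rwa [map_neg] at this

/-- The power `N` sends the cone with constant `a` into the smaller one with constant `κ a`, and
mixing bounds the image below by `δ sup f`. The room between the two cones allows a fixed fraction
of this lower bound to be subtracted without leaving the larger cone. -/
lemma exists_split [Nonempty (ShiftSpace Γ S P T)] (hθ0 : 0 < θ) (hθ1 : θ < 1)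
    (hφ : IsRegular θ C B φ) {m : ℕ} (hm : Mixing Γ S P T m) (h1 : transferReal φ 1 = 1) :
    ∃ (a ε : ℝ) (N : ℕ), 0 < a ∧ θ * (a + C) ≤ a ∧ 0 < ε ∧ ε < 1 ∧ 0 < N ∧
      ∀ (f : ShiftSpace Γ S P T → ℝ) (M : ℝ), InCone θ a f → (∀ w, f w ≤ M) →
        ∃ (g : ShiftSpace Γ S P T → ℝ) (c : ℝ), InCone θ a g ∧
          (transferReal φ ^ N) f = g + c • 1 ∧ ∀ w, g w ≤ (1 - ε) * M := by
  let o := Classical.arbitrary (ShiftSpace Γ S P T)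
  -- Any `κ` strictly between `θ` and `1` works; `a` is then taken large enough for `θ (a + C) ≤ κ
  -- a`.
  set κ := (1 + θ) / 2 with hκ
  have hκ1 : 0 < 1 - κ := by rw [hκ]; linarith
  obtain ⟨a, ha0, ha⟩ : ∃ a : ℝ, 0 < a ∧ θ * (a + C) ≤ κ * a := by
    refine ⟨2 * (C / (1 - θ)) + 1,
      by have := div_nonneg hφ.nonneg (sub_pos.2 hθ1).le; linarith, ?_⟩
    have h1 : C / (1 - θ) * (1 - θ) = C := div_mul_cancel₀ _ (sub_pos.2 hθ1).ne'
    rw [hκ]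
    nlinarith [hφ.nonneg]
  have ha' : θ * (a + C) ≤ a := ha.trans (by nlinarith)
  have hB : 0 ≤ B := (abs_nonneg _).trans (hφ.abs_le o)
  -- One application beyond `m`: the last one brings the function into the smaller cone, and `N` is
  -- positive even if `m = 0`.
  set N := m + 1 with hN
  set δ := Real.exp (-(N * B) - a) with hδ
  set η := (1 - κ) * Real.exp (-a) with hη
  have hδ0 : 0 < δ := Real.exp_pos _
  have hδ1 : δ < 1 := by
    have : 0 ≤ (N : ℝ) * B := by positivity
    exact Real.exp_lt_one_iff.2 (by linarith)
  have hη0 : 0 < η := mul_pos hκ1 (Real.exp_pos _)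
  have hη1 : η < 1 := by
    have : Real.exp (-a) < 1 := Real.exp_lt_one_iff.2 (by linarith)
    have h3 : 1 - κ < 1 := by rw [hκ]; linarith
    calc η < 1 * 1 := mul_lt_mul'' h3 this hκ1.le (Real.exp_pos _).le
      _ = 1 := one_mul 1
  refine ⟨a, η * δ, N, ha0, ha', mul_pos hη0 hδ0,
    (mul_lt_mul'' hη1 hδ1 hη0.le hδ0.le).trans_eq (one_mul 1), Nat.succ_pos m, fun f M hf hM => ?_⟩
  have hb := hf.bddAbove
  set M₀ := ⨆ v, f v with hM₀
  have hM₀le : M₀ ≤ M := ciSup_le hM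
  have hfM₀ : ∀ v, f v ≤ M₀ := fun v => le_ciSup hb v
  have hM₀0 : 0 ≤ M₀ := (hf.nonneg o).trans (hfM₀ o)
  set F := (transferReal φ ^ N) f with hF
  have hFcone : InCone θ (κ * a) F := by
    rw [hF, hN, transferReal_pow_succ]
    exact ((hf.transferReal_pow hφ hθ0.le ha' m).transferReal hφ).mono hθ0.le ha
  have hlow : ∀ w, δ * M₀ ≤ F w := by
    intro w
    have h2 : M₀ ≤ F w / δ := ciSup_le fun v => by
      rw [le_div_iff₀ hδ0, mul_comm]; exact hf.mul_le_transferReal_pow hφ hm.succ v w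
    rwa [le_div_iff₀ hδ0, mul_comm] at h2
  have hcne : 0 ≤ δ * M₀ := mul_nonneg hδ0.le hM₀0
  refine ⟨F - (η * (δ * M₀)) • 1, η * (δ * M₀), ⟨fun w => ?_, fun {n w w'} h => ?_⟩,
    by rw [sub_add_cancel], fun w => ?_⟩
  · have := hlow w
    simp only [Pi.sub_apply, Pi.smul_apply, Pi.one_apply, smul_eq_mul, mul_one]
    nlinarith
  · simp only [Pi.sub_apply, Pi.smul_apply, Pi.one_apply, smul_eq_mul, mul_one]
    set t := a * θ ^ n with ht
    have ht0 : 0 ≤ t := by positivity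
    have hta : t ≤ a := mul_le_of_le_one_right ha0.le (pow_le_one₀ hθ0.le hθ1.le)
    have h2 := hFcone.le h
    rw [mul_assoc, ← ht] at h2
    have h3 := hlow w'
    have h4 := exp_sub_one_le ht0 hta
    -- This inequality determines `η`: multiplied by `δ M₀`, it says that subtracting `η δ M₀` is
    -- paid for by the gap between `exp (κ t)` and `exp t`.
    have h5 : η * (Real.exp t - 1) ≤ Real.exp t - Real.exp (κ * t) := by
      have e1 : η * (Real.exp t - 1) ≤ (1 - κ) * t := by
        calc η * (Real.exp t - 1) ≤ η * (t * Real.exp a) := mul_le_mul_of_nonneg_left h4 hη0.le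
          _ = (1 - κ) * t * (Real.exp (-a) * Real.exp a) := by rw [hη]; ring
          _ = _ := by rw [← Real.exp_add]; simp
      have e2 : Real.exp t = Real.exp (κ * t) * Real.exp ((1 - κ) * t) := by
        rw [← Real.exp_add]; congr 1; ring
      have e3 := Real.add_one_le_exp ((1 - κ) * t)
      have e4 : 1 ≤ Real.exp (κ * t) := Real.one_le_exp (by rw [hκ]; positivity)
      have e5 : 0 ≤ (1 - κ) * t := mul_nonneg hκ1.le ht0
      rw [e2]
      nlinarith
    have h6 : 0 ≤ Real.exp t - Real.exp (κ * t) :=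
      (mul_nonneg hη0.le (sub_nonneg.2 (Real.one_le_exp ht0))).trans h5
    have h7 := mul_le_mul_of_nonneg_right h5 hcne
    have h8 := mul_le_mul_of_nonneg_left h3 h6
    linarith
  · have h2 := transferReal_pow_le h1 hfM₀ N w
    simp only [Pi.sub_apply, Pi.smul_apply, Pi.one_apply, smul_eq_mul, mul_one]
    have h3 : (1 - η * δ) * M₀ ≤ (1 - η * δ) * M :=
      mul_le_mul_of_nonneg_left hM₀le (by nlinarith)
    linarith

/-- Constants are fixed by the operator, so the parts split off simply add up while the remainder
shrinks geometrically. -/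
lemma exists_split_iterate {a ε : ℝ} {N : ℕ} (h1 : transferReal φ 1 = 1)
    (hN : ∀ (f : ShiftSpace Γ S P T → ℝ) (M : ℝ), InCone θ a f → (∀ w, f w ≤ M) →
        ∃ (g : ShiftSpace Γ S P T → ℝ) (c : ℝ), InCone θ a g ∧
          (transferReal φ ^ N) f = g + c • 1 ∧ ∀ w, g w ≤ (1 - ε) * M)
    {f : ShiftSpace Γ S P T → ℝ} {M : ℝ} (hf : InCone θ a f) (hM : ∀ w, f w ≤ M) (k : ℕ) :
    ∃ (g : ShiftSpace Γ S P T → ℝ) (c : ℝ), InCone θ a g ∧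
      (transferReal φ ^ (N * k)) f = g + c • 1 ∧ ∀ w, g w ≤ (1 - ε) ^ k * M := by
  induction k with
  | zero => exact ⟨f, 0, hf, by simp, by simpa using hM⟩
  | succ k ih =>
    obtain ⟨g, c, hg, he, hgM⟩ := ih
    obtain ⟨g', c', hg', he', hgM'⟩ := hN g _ hg hgM
    refine ⟨g', c' + c, hg', ?_, fun w => by rw [pow_succ', mul_assoc]; exact hgM' w⟩
    rw [mul_add, mul_one, add_comm, transferReal_pow_add, he, map_add, he', map_smul,
      transferReal_pow_one h1, add_smul, add_assoc]

/-- A normalized transfer operator contracts Hölder functions to constants. -/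
theorem exists_decay [Nonempty (ShiftSpace Γ S P T)] (hθ0 : 0 < θ) (hθ1 : θ < 1)
    (hφ : IsRegular θ C B φ) {m : ℕ} (hm : Mixing Γ S P T m) (h1 : transferReal φ 1 = 1) :
    ∃ K γ : ℝ, 0 < K ∧ 0 < γ ∧ γ < 1 ∧ ∀ (f : ShiftSpace Γ S P T → ℝ) (c : ℝ), LipBound θ c f →
      ∃ ν : ℝ, ∀ j, LipBound θ (K * c * γ ^ j) fun w => (transferReal φ ^ j) f w - ν := by
  let o := Classical.arbitrary (ShiftSpace Γ S P T)
  obtain ⟨a, ε, N, ha0, ha, hε0, hε1, hN0, hN⟩ := exists_split hθ0 hθ1 hφ hm h1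
  have hN1 : (1 : ℝ) ≤ N := by exact_mod_cast hN0
  -- By Bernoulli's inequality `1 - ε ≤ γ ^ N`: the contraction of `N` steps is spread over single
  -- steps.
  set γ := 1 - ε / N with hγ
  have hεN : ε / N ≤ ε := div_le_self hε0.le hN1
  have hεN0 : 0 < ε / N := by positivity
  have hγ0 : 0 < γ := by rw [hγ]; linarith
  have hγ1 : γ < 1 := by rw [hγ]; linarith
  have hγN : 1 - ε ≤ γ ^ N := by
    have h2 := one_add_mul_le_pow (a := -(ε / N)) (by linarith) N
    have e : (1 : ℝ) + N * -(ε / N) = 1 - ε := by field_simp; ring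
    rw [e] at h2
    exact h2.trans_eq (by rw [hγ]; ring)
  set K := (2 + 1 / a) * (1 + a * Real.exp a) / γ ^ N with hK
  have hK0 : 0 < K := by positivity
  refine ⟨K, γ, hK0, hγ0, hγ1, fun f c hf => ?_⟩
  have hc : 0 ≤ c := (norm_nonneg _).trans (hf.norm_le o)
  -- Adding `R` makes the function at least `c / a`, and then a variation of `c θ ^ n` is at most `a
  -- θ ^ n` times the value: the shifted function is in the cone.
  set R := c + c / a with hR
  have hR0 : 0 ≤ R := by positivity
  set F := f + R • (1 : ShiftSpace Γ S P T → ℝ) with hF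
  have hFapp : ∀ w, F w = f w + R := fun w => by simp [hF]
  have hFcone : InCone θ a F := by
    refine ⟨fun w => ?_, fun {n w w'} h => ?_⟩
    · have := (abs_le.1 (hf.norm_le w)).1
      have h3 : 0 ≤ c / a := by positivity
      rw [hFapp, hR]; linarith
    · have h3 := (abs_le.1 (hf.norm_sub_le h)).2
      have h4 := (abs_le.1 (hf.norm_le w')).1
      have h5 := Real.add_one_le_exp (a * θ ^ n)
      have h6 : c / a ≤ f w' + R := by rw [hR]; linarith
      have h7 : 0 ≤ f w' + R := le_trans (by positivity) h6
      have h8 : c ≤ a * (f w' + R) := by rwa [div_le_iff₀ ha0, mul_comm] at h6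
      have h9 := mul_le_mul_of_nonneg_right h8 (pow_nonneg hθ0.le n)
      have h10 := mul_le_mul_of_nonneg_right h5 h7
      rw [hFapp, hFapp]
      nlinarith
  have hFM : ∀ w, F w ≤ (2 + 1 / a) * c := by
    intro w
    have := (abs_le.1 (hf.norm_le w)).2
    rw [hFapp, hR]
    have e : (2 + 1 / a) * c = c + (c + c / a) := by ring
    linarith
  -- oscillation and variation of the iterates
  have key : ∀ j, (∀ w w', |(transferReal φ ^ j) f w - (transferReal φ ^ j) f w'| ≤ K * c * γ ^ j) ∧
      ∀ n w w', Agree n w w' →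
        |(transferReal φ ^ j) f w - (transferReal φ ^ j) f w'| ≤ K * c * γ ^ j * θ ^ n := by
    intro j
    have hr := hFcone.transferReal_pow hφ hθ0.le ha (j % N)
    obtain ⟨g, c', hg, he, hgM⟩ := exists_split_iterate h1 hN hr
      (transferReal_pow_le h1 hFM (j % N)) (j / N)
    rw [← transferReal_pow_add, Nat.div_add_mod] at he
    have hdiff : ∀ w w', (transferReal φ ^ j) f w - (transferReal φ ^ j) f w' = g w - g w' := by
      intro w w'
      have h2 : ∀ w, (transferReal φ ^ j) f w + R = g w + c' := by
        intro w
        have := congrFun he w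
        rw [hF, map_add, map_smul, transferReal_pow_one h1] at this
        simpa using this
      linarith [h2 w, h2 w']
    -- Rounding `j` down to a multiple of `N` costs at most a factor `γ ^ N`, which is the
    -- denominator in `K`.
    have hpow : (1 - ε) ^ (j / N) ≤ γ ^ j / γ ^ N := by
      rw [le_div_iff₀ (by positivity)]
      calc (1 - ε) ^ (j / N) * γ ^ N ≤ (γ ^ N) ^ (j / N) * γ ^ (j % N) :=
            mul_le_mul (pow_le_pow_left₀ (by linarith) hγN _)
              (pow_le_pow_of_le_one hγ0.le hγ1.le (Nat.mod_lt j hN0).le) (by positivity)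
              (by positivity)
        _ = γ ^ j := by rw [← pow_mul, ← pow_add, Nat.div_add_mod]
    set b := γ ^ j / γ ^ N * ((2 + 1 / a) * c) with hb
    have hgb : ∀ w, g w ≤ b := fun w =>
      (hgM w).trans (mul_le_mul_of_nonneg_right hpow (by positivity))
    have hb0 : 0 ≤ b := by positivity
    have hbK : b * (1 + a * Real.exp a) = K * c * γ ^ j := by rw [hb, hK]; ring
    have hae : 0 ≤ a * Real.exp a := by positivity
    refine ⟨fun w w' => ?_, fun n w w' h => ?_⟩
    · rw [hdiff, ← hbK, abs_le]
      have := hgb w; have := hgb w'; have := hg.nonneg w; have := hg.nonneg w'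
      have : 0 ≤ b * (a * Real.exp a) := mul_nonneg hb0 hae
      constructor <;> linarith
    · have hone : ∀ w w', Agree n w w' → g w - g w' ≤ K * c * γ ^ j * θ ^ n := by
        intro w w' h
        have h2 := hg.le h
        have ht0 : 0 ≤ a * θ ^ n := by positivity
        have hta : a * θ ^ n ≤ a := mul_le_of_le_one_right ha0.le (pow_le_one₀ hθ0.le hθ1.le)
        have h3 := exp_sub_one_le ht0 hta
        have h4 := mul_le_mul_of_nonneg_right h3 (hg.nonneg w')
        have h5 := mul_le_mul_of_nonneg_left (hgb w')
          (show 0 ≤ a * θ ^ n * Real.exp a by positivity)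
        have h6 : 0 ≤ b * θ ^ n := by positivity
        rw [← hbK]
        linarith
      rw [hdiff, abs_le]
      exact ⟨by linarith [hone w' w h.symm], hone w w' h⟩
  -- the limit
  have hstep : ∀ j k w w', |(transferReal φ ^ (j + k)) f w - (transferReal φ ^ j) f w'| ≤
      K * c * γ ^ j := by
    intro j k w w'
    have h2 := abs_transferReal_pow_le h1
      (f := (transferReal φ ^ j) f - ((transferReal φ ^ j) f w') • 1)
      (fun v => by simpa using (key j).1 v w') k w
    rw [map_sub, map_smul, transferReal_pow_one h1, ← transferReal_pow_add, add_comm k] at h2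
    simpa using h2
  have hlim0 : Filter.Tendsto (fun j : ℕ => K * c * γ ^ j) Filter.atTop (nhds 0) := by
    simpa using (tendsto_pow_atTop_nhds_zero_of_lt_one hγ0.le hγ1).const_mul (K * c)
  have hcauchy : CauchySeq fun j => (transferReal φ ^ j) f o := by
    refine cauchySeq_of_le_tendsto_0' (fun j => K * c * γ ^ j) (fun i j hij => ?_) hlim0
    obtain ⟨k, rfl⟩ := Nat.exists_eq_add_of_le hij
    rw [dist_comm]
    exact hstep i k o o
  obtain ⟨ν, hν⟩ := cauchySeq_tendsto_of_complete hcauchy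
  refine ⟨ν, fun j => ⟨fun w => ?_, fun {n w w'} h => ?_⟩⟩
  · have h2 : Filter.Tendsto (fun k => |(transferReal φ ^ (j + k)) f o - (transferReal φ ^ j) f w|)
        Filter.atTop (nhds |ν - (transferReal φ ^ j) f w|) := by
      refine ((Filter.Tendsto.sub_const ?_ _).abs)
      exact hν.comp (Filter.tendsto_atTop_mono (fun k => Nat.le_add_left k j) Filter.tendsto_id)
    rw [Real.norm_eq_abs, abs_sub_comm]
    exact le_of_tendsto' h2 fun k => hstep j k o w
  · simpa using (key j).2 n w w' h

/-! ### Complex functions -/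

/-- The transfer operator as a linear map. -/
noncomputable def transferLinear (φ : ShiftSpace Γ S P T → ℝ) :
    Module.End ℂ (ShiftSpace Γ S P T → ℂ) where
  toFun := transfer φ
  map_add' f g := by
    ext w
    simp [transfer, tsum_fintype, mul_add, Finset.sum_add_distrib]
  map_smul' c f := by
    ext w
    simp [transfer, tsum_fintype, Finset.mul_sum, mul_left_comm]

lemma transferLinear_apply (f : ShiftSpace Γ S P T → ℂ) : transferLinear φ f = transfer φ f := rfl

lemma transfer_eq_sum (f : ShiftSpace Γ S P T → ℂ) (w : ShiftSpace Γ S P T) :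
    transfer φ f w = ∑ u : Fiber w, (Real.exp (φ u.1) : ℂ) * f u.1 := tsum_fintype _

lemma transfer_ofReal (f : ShiftSpace Γ S P T → ℝ) (w : ShiftSpace Γ S P T) :
    transfer φ (fun w => (f w : ℂ)) w = transferReal φ f w := by
  rw [transfer_eq_sum, transferReal_apply]
  push_cast
  rfl

lemma re_transfer (f : ShiftSpace Γ S P T → ℂ) (w : ShiftSpace Γ S P T) :
    (transfer φ f w).re = transferReal φ (fun w => (f w).re) w := by
  rw [transfer_eq_sum, transferReal_apply, Complex.re_sum]
  exact Finset.sum_congr rfl fun u _ => Complex.re_ofReal_mul _ _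

lemma im_transfer (f : ShiftSpace Γ S P T → ℂ) (w : ShiftSpace Γ S P T) :
    (transfer φ f w).im = transferReal φ (fun w => (f w).im) w := by
  rw [transfer_eq_sum, transferReal_apply, Complex.im_sum]
  exact Finset.sum_congr rfl fun u _ => Complex.im_ofReal_mul _ _

lemma transferLinear_pow_succ (n : ℕ) (f : ShiftSpace Γ S P T → ℂ) :
    (transferLinear φ ^ (n + 1)) f = transfer φ ((transferLinear φ ^ n) f) := by
  rw [pow_succ']; rfl

lemma re_transferLinear_pow (n : ℕ) (f : ShiftSpace Γ S P T → ℂ) :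
    (fun w => ((transferLinear φ ^ n) f w).re) = (transferReal φ ^ n) fun w => (f w).re := by
  induction n with
  | zero => rfl
  | succ n ih =>
    rw [transferReal_pow_succ, ← ih, transferLinear_pow_succ]
    exact funext fun w => re_transfer _ w

lemma im_transferLinear_pow (n : ℕ) (f : ShiftSpace Γ S P T → ℂ) :
    (fun w => ((transferLinear φ ^ n) f w).im) = (transferReal φ ^ n) fun w => (f w).im := by
  induction n with
  | zero => rfl
  | succ n ih =>
    rw [transferReal_pow_succ, ← ih, transferLinear_pow_succ]
    exact funext fun w => im_transfer _ w

theorem exists_decay_complex [Nonempty (ShiftSpace Γ S P T)] (hθ0 : 0 < θ) (hθ1 : θ < 1)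
    (hφ : IsRegular θ C B φ) {m : ℕ} (hm : Mixing Γ S P T m) (h1 : transferReal φ 1 = 1) :
    ∃ K γ : ℝ, 0 < K ∧ 0 < γ ∧ γ < 1 ∧ ∀ (f : ShiftSpace Γ S P T → ℂ) (c : ℝ), LipBound θ c f →
      ∃ ν : ℂ, ∀ j, LipBound θ (K * c * γ ^ j) fun w => (transferLinear φ ^ j) f w - ν := by
  obtain ⟨K, γ, hK, hγ0, hγ1, h⟩ := exists_decay hθ0 hθ1 hφ hm h1
  refine ⟨K + K, γ, add_pos hK hK, hγ0, hγ1, fun f c hf => ?_⟩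
  obtain ⟨x, hx⟩ := h _ c hf.re
  obtain ⟨y, hy⟩ := h _ c hf.im
  refine ⟨⟨x, y⟩, fun j => ?_⟩
  have e : (K + K) * c * γ ^ j = K * c * γ ^ j + K * c * γ ^ j := by ring
  rw [e]
  refine LipBound.of_re_im ?_ ?_
  · have := hx j
    rw [← re_transferLinear_pow] at this
    exact this
  · have := hy j
    rw [← im_transferLinear_pow] at this
    exact this

/-- The condition on `f` only compares points with the same first entry; boundedness comes from the
finiteness of the alphabet. -/
lemma exists_lipBound {f : ShiftSpace Γ S P T → ℂ} (hf : f ∈ lipschitzSpace Γ S P T θ)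
    (hθ0 : 0 ≤ θ) : ∃ c : ℝ, 0 ≤ c ∧ LipBound θ c f := by
  obtain ⟨C, hC⟩ := hf
  have hch : ∀ W : Alphabet Γ S P T, ∃ c : ℝ, ∀ w : ShiftSpace Γ S P T, w.1 0 = W → ‖f w‖ ≤ c := by
    intro W
    by_cases h : ∃ v : ShiftSpace Γ S P T, v.1 0 = W
    · obtain ⟨v, rfl⟩ := h
      refine ⟨C + ‖f v‖, fun w hw => ?_⟩
      have h1 := hC 0 w v (agree_zero_iff.2 hw)
      rw [pow_zero, mul_one] at h1
      have h2 := norm_add_le (f w - f v) (f v)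
      rw [sub_add_cancel] at h2
      linarith
    · exact ⟨0, fun w hw => absurd ⟨w, hw⟩ h⟩
  choose c hc using hch
  obtain ⟨M, hM⟩ := (Set.finite_range c).bddAbove
  refine ⟨max |C| |M|, le_max_of_le_left (abs_nonneg _), fun w => ?_, fun {n w w'} h => ?_⟩
  · exact ((hc _ w rfl).trans (hM ⟨_, rfl⟩)).trans ((le_abs_self M).trans (le_max_right _ _))
  · exact (hC n w w' h).trans (mul_le_mul_of_nonneg_right
      ((le_abs_self C).trans (le_max_left _ _)) (pow_nonneg hθ0 _))

end Decay

end BowenSeries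

namespace BowenSeries

section Spectrum

open ShiftSpace

variable {Γ₀ : Subgroup SL(2, ℝ)} {A : Type*} {Γ : Subgroup SL(2, ℝ)} {p : ℕ}
  {S : Fin p → SL(2, ℝ)} {P : LabelledIdealPolygon Γ₀ A} {T θ : ℝ}

/-! ### Hölder functions -/

lemma lipBound_const {E : Type*} [SeminormedAddCommGroup E] (hθ0 : 0 ≤ θ) (c : E) :
    LipBound θ ‖c‖ (fun _ : ShiftSpace Γ S P T => c) :=
  ⟨fun _ => le_rfl, fun _ => by rw [sub_self, norm_zero]; positivity⟩

lemma const_mem_lipschitzSpace (hθ0 : 0 ≤ θ) (c : ℂ) :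
    (fun _ => c) ∈ lipschitzSpace Γ S P T θ :=
  (lipBound_const hθ0 c).mem

lemma InCone.inv {a : ℝ} {f : ShiftSpace Γ S P T → ℝ} (hf : InCone θ a f) (hpos : ∀ w, 0 < f w) :
    InCone θ a fun w => (f w)⁻¹ := by
  refine ⟨fun w => (inv_pos.2 (hpos w)).le, fun {n w w'} h => ?_⟩
  rw [inv_le_iff_one_le_mul₀ (hpos w), mul_comm, ← mul_assoc, ← div_eq_mul_inv,
    le_div_iff₀ (hpos w'), one_mul, mul_comm]
  exact hf.le h.symm

lemma InCone.abs_log_sub_le {a : ℝ} {f : ShiftSpace Γ S P T → ℝ} (hf : InCone θ a f)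
    (hpos : ∀ w, 0 < f w) {n : ℕ} {w w' : ShiftSpace Γ S P T} (h : Agree n w w') :
    |Real.log (f w) - Real.log (f w')| ≤ a * θ ^ n := by
  have key : ∀ {w w'}, Agree n w w' → Real.log (f w) - Real.log (f w') ≤ a * θ ^ n := by
    intro w w' h
    have := Real.log_le_log (hpos w) (hf.le h)
    rw [Real.log_mul (Real.exp_pos _).ne' (hpos w').ne', Real.log_exp] at this
    linarith
  exact abs_le.2 ⟨by linarith [key h.symm], key h⟩

lemma exp_normalizedPotential {φ : ShiftSpace Γ S P T → ℝ} {lam : ℝ} (hlam : 0 < lam) {h : ShiftSpace Γ S P T → ℝ}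
    (hpos : ∀ w, 0 < h w) (w : ShiftSpace Γ S P T) :
    Real.exp (normalizedPotential φ lam h w) = Real.exp (φ w) * h w / (lam * h w.shift) := by
  rw [normalizedPotential, Real.exp_sub, Real.exp_add, Real.exp_sub, Real.exp_log hlam,
    Real.exp_log (hpos _), Real.exp_log (hpos _)]
  have := (hpos w.shift).ne'
  field_simp

variable [Finite (Alphabet Γ S P T)] {φ ψ : ShiftSpace Γ S P T → ℝ}

lemma InCone.mem_lipschitzSpace (hθ0 : 0 ≤ θ) (hθ1 : θ ≤ 1) {a : ℝ} (ha0 : 0 ≤ a)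
    {f : ShiftSpace Γ S P T → ℝ} (hf : InCone θ a f) :
    (fun w => (f w : ℂ)) ∈ lipschitzSpace Γ S P T θ := by
  obtain ⟨M, hM⟩ := hf.bddAbove
  refine ⟨M * (a * Real.exp a), fun n w w' h => ?_⟩
  have key : ∀ {w w'}, Agree n w w' → f w - f w' ≤ M * (a * Real.exp a) * θ ^ n := by
    intro w w' h
    have ht0 : 0 ≤ a * θ ^ n := by positivity
    have h1 := exp_sub_one_le ht0 (mul_le_of_le_one_right ha0 (pow_le_one₀ hθ0 hθ1))
    have h2 := hf.le h
    have h3 := mul_le_mul_of_nonneg_right h1 (hf.nonneg w')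
    have h4 := mul_le_mul_of_nonneg_left (hM ⟨w', rfl⟩)
      (show 0 ≤ a * θ ^ n * Real.exp a by positivity)
    linarith
  rw [← Complex.ofReal_sub, Complex.norm_real, Real.norm_eq_abs]
  exact abs_le.2 ⟨by linarith [key (Agree.symm h)], key h⟩

lemma mul_mem_lipschitzSpace (hθ0 : 0 ≤ θ) {f g : ShiftSpace Γ S P T → ℂ}
    (hf : f ∈ lipschitzSpace Γ S P T θ) (hg : g ∈ lipschitzSpace Γ S P T θ) :
    (fun w => f w * g w) ∈ lipschitzSpace Γ S P T θ := by
  obtain ⟨c, hc, hf⟩ := exists_lipBound hf hθ0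
  obtain ⟨d, hd, hg⟩ := exists_lipBound hg hθ0
  refine ⟨c * d + c * d, fun n w w' h => ?_⟩
  have e : f w * g w - f w' * g w' = f w * (g w - g w') + (f w - f w') * g w' := by ring
  rw [e]
  refine (norm_add_le _ _).trans ?_
  rw [norm_mul, norm_mul]
  have h1 := mul_le_mul (hf.norm_le w) (hg.norm_sub_le h) (norm_nonneg _) hc
  have h2 := mul_le_mul (hf.norm_sub_le h) (hg.norm_le w') (norm_nonneg _)
    (mul_nonneg hc (pow_nonneg hθ0 n))
  linarith

/-! ### Spectral consequences of the decay -/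

/-- The iterates of the transfer operator of `ψ` converge to constants at the rate `γ`. -/
structure HasDecay (θ K γ : ℝ) (ψ : ShiftSpace Γ S P T → ℝ) : Prop where
  K_pos : 0 < K
  γ_pos : 0 < γ
  γ_lt_one : γ < 1
  exists_limit : ∀ (f : ShiftSpace Γ S P T → ℂ) (c : ℝ), LipBound θ c f →
    ∃ ν : ℂ, ∀ j, LipBound θ (K * c * γ ^ j) fun w => (transferLinear ψ ^ j) f w - ν

lemma tendsto_const_mul_pow {γ : ℝ} (h0 : 0 ≤ γ) (h1 : γ < 1) (c : ℝ) :
    Filter.Tendsto (fun j : ℕ => c * γ ^ j) Filter.atTop (nhds 0) := by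
  simpa using (tendsto_pow_atTop_nhds_zero_of_lt_one h0 h1).const_mul c

lemma transfer_const (h1 : transferReal ψ 1 = 1) (c : ℂ) : transfer ψ (fun _ => c) = fun _ => c := by
  have e : (fun _ => c) = c • fun w : ShiftSpace Γ S P T => ((1 : ShiftSpace Γ S P T → ℝ) w : ℂ) := by
    ext w; simp
  ext w
  rw [← transferLinear_apply, e, map_smul, transferLinear_apply, Pi.smul_apply, transfer_ofReal, h1]
  simp

/-- The oscillation of `L ^ j f = z ^ j f` is of order `γ ^ j`, so that of `f` is of order `(γ /
|z|) ^ j` for every `j`. -/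
lemma HasDecay.eq_of_eigen {K γ : ℝ} (hd : HasDecay θ K γ ψ) (hθ0 : 0 ≤ θ)
    {f : ShiftSpace Γ S P T → ℂ} (hf : f ∈ lipschitzSpace Γ S P T θ) {z : ℂ} (hz : γ < ‖z‖)
    (he : ∀ w, transfer ψ f w = z * f w) (w w' : ShiftSpace Γ S P T) : f w = f w' := by
  obtain ⟨c, hc, hfc⟩ := exists_lipBound hf hθ0
  obtain ⟨ν, hν⟩ := hd.exists_limit f c hfc
  have hz0 : 0 < ‖z‖ := hd.γ_pos.trans hz
  have hpow : ∀ j, (transferLinear ψ ^ j) f = z ^ j • f := by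
    intro j
    induction j with
    | zero => simp
    | succ j ih =>
      rw [transferLinear_pow_succ, ih, ← transferLinear_apply, map_smul, pow_succ, mul_smul]
      congr 1
      exact funext he
  have hb : ∀ j : ℕ, ‖f w - f w'‖ ≤ 2 * (K * c) * (γ / ‖z‖) ^ j := by
    intro j
    have h1 := (hν j).norm_le w
    have h2 := (hν j).norm_le w'
    rw [hpow] at h1 h2
    have h3 := norm_sub_le (z ^ j * f w - ν) (z ^ j * f w' - ν)
    rw [sub_sub_sub_cancel_right, ← mul_sub, norm_mul, norm_pow] at h3
    simp only [Pi.smul_apply, smul_eq_mul] at h1 h2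
    have h4 : ‖z‖ ^ j * ‖f w - f w'‖ ≤ 2 * (K * c) * γ ^ j := by linarith
    rw [div_pow, mul_div_assoc', le_div_iff₀ (pow_pos hz0 j)]
    linarith
  have h0 : ‖f w - f w'‖ ≤ 0 := ge_of_tendsto' (tendsto_const_mul_pow
    (div_nonneg hd.γ_pos.le hz0.le) ((div_lt_one hz0).2 hz) (2 * (K * c))) hb
  exact sub_eq_zero.1 (norm_le_zero_iff.1 h0)

/-- Each iteration would add `x` once more, which is incompatible with convergence unless `x = 0`.
This rules out a Jordan block at the eigenvalue one. -/
lemma HasDecay.eq_zero_of_sub_eq {K γ : ℝ} (hd : HasDecay θ K γ ψ) (h1 : transferReal ψ 1 = 1)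
    [Nonempty (ShiftSpace Γ S P T)] (hθ0 : 0 ≤ θ)
    {f : ShiftSpace Γ S P T → ℂ} (hf : f ∈ lipschitzSpace Γ S P T θ) {x : ℂ}
    (he : ∀ w, transfer ψ f w - f w = x) : x = 0 := by
  let o := Classical.arbitrary (ShiftSpace Γ S P T)
  obtain ⟨c, hc, hfc⟩ := exists_lipBound hf hθ0
  obtain ⟨ν, hν⟩ := hd.exists_limit f c hfc
  have hstep : ∀ j, (transferLinear ψ ^ (j + 1)) f = (transferLinear ψ ^ j) f + fun _ => x := by
    intro j
    induction j with
    | zero =>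
      ext w
      rw [zero_add, pow_one, transferLinear_apply, pow_zero]
      simp [← he w]
    | succ j ih =>
      conv_lhs => rw [transferLinear_pow_succ, ih, ← transferLinear_apply, map_add,
        transferLinear_apply, transferLinear_apply, transfer_const h1, ← transferLinear_pow_succ]
  have hb : ∀ j : ℕ, ‖x‖ ≤ 2 * (K * c) * γ ^ j := by
    intro j
    have h2 := (hν j).norm_le o
    have h3 := (hν (j + 1)).norm_le o
    rw [hstep] at h3
    have h4 := norm_sub_le ((transferLinear ψ ^ j) f o + x - ν) ((transferLinear ψ ^ j) f o - ν)
    rw [sub_sub_sub_cancel_right, add_sub_cancel_left] at h4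
    have h5 : K * c * γ ^ (j + 1) ≤ K * c * γ ^ j :=
      mul_le_mul_of_nonneg_left (pow_le_pow_of_le_one hd.γ_pos.le hd.γ_lt_one.le (Nat.le_succ j))
        (mul_nonneg hd.K_pos.le hc)
    simp only [Pi.add_apply] at h3
    linarith
  have h0 : ‖x‖ ≤ 0 := ge_of_tendsto' (tendsto_const_mul_pow hd.γ_pos.le hd.γ_lt_one _) hb
  exact norm_le_zero_iff.1 h0

/-- The Neumann series converges for `|z| > γ` once the limit constant `ν` is removed from the
iterates of `g`; on constants the operator is the identity, which contributes `ν / (z - 1)`. -/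
lemma HasDecay.exists_resolvent {K γ : ℝ} (hd : HasDecay θ K γ ψ) (h1 : transferReal ψ 1 = 1)
    (hθ0 : 0 ≤ θ) {g : ShiftSpace Γ S P T → ℂ} (hg : g ∈ lipschitzSpace Γ S P T θ) {z : ℂ}
    (hz : γ < ‖z‖) (hz1 : z ≠ 1) :
    ∃ f ∈ lipschitzSpace Γ S P T θ, ∀ w, z * f w - transfer ψ f w = g w := by
  obtain ⟨c, hc, hgc⟩ := exists_lipBound hg hθ0
  obtain ⟨ν, hν⟩ := hd.exists_limit g c hgc
  have hz0 : 0 < ‖z‖ := hd.γ_pos.trans hz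
  have hzne : z ≠ 0 := norm_pos_iff.1 hz0
  set q := γ / ‖z‖ with hq
  have hq0 : 0 ≤ q := div_nonneg hd.γ_pos.le hz0.le
  have hq1 : q < 1 := (div_lt_one hz0).2 hz
  set a : ℕ → ShiftSpace Γ S P T → ℂ := fun j w =>
    (z ^ (j + 1))⁻¹ * ((transferLinear ψ ^ j) g w - ν) with ha
  have hgeom : HasSum (fun j : ℕ => K * c / ‖z‖ * q ^ j) (K * c / ‖z‖ * (1 - q)⁻¹) :=
    (hasSum_geometric_of_lt_one hq0 hq1).mul_left _
  have e1 : ∀ (j : ℕ) (x : ℝ), (‖z‖ ^ (j + 1))⁻¹ * (K * c * γ ^ j * x) = K * c / ‖z‖ * q ^ j * x := by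
    intro j x
    rw [hq, div_pow, pow_succ]
    field_simp
  have ha_le : ∀ j w, ‖a j w‖ ≤ K * c / ‖z‖ * q ^ j := by
    intro j w
    have h2 := mul_le_mul_of_nonneg_left ((hν j).norm_le w)
      (inv_pos.2 (pow_pos hz0 (j + 1))).le
    have h3 := e1 j 1
    rw [mul_one, mul_one] at h3
    rw [h3] at h2
    simpa [ha] using h2
  have ha_sub : ∀ j n w w', Agree n w w' → ‖a j w - a j w'‖ ≤ K * c / ‖z‖ * q ^ j * θ ^ n := by
    intro j n w w' h
    have h2 := mul_le_mul_of_nonneg_left ((hν j).norm_sub_le h)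
      (inv_pos.2 (pow_pos hz0 (j + 1))).le
    rw [e1] at h2
    rwa [← norm_pow, ← norm_inv, ← norm_mul, mul_sub] at h2
  have hsum : ∀ w, Summable fun j => a j w := fun w =>
    Summable.of_norm_bounded hgeom.summable fun j => ha_le j w
  set F : ShiftSpace Γ S P T → ℂ := fun w => ∑' j, a j w with hF
  have hF_has : ∀ w, HasSum (fun j => a j w) (F w) := fun w => (hsum w).hasSum
  have hFmem : F ∈ lipschitzSpace Γ S P T θ := by
    refine ⟨K * c / ‖z‖ * (1 - q)⁻¹, fun n w w' h => ?_⟩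
    rw [hF, ← (hsum w).tsum_sub (hsum w')]
    exact tsum_of_norm_bounded (hgeom.mul_right (θ ^ n)) fun j => ha_sub j n w w' h
  have hstep : ∀ j, transfer ψ (a j) = z • a (j + 1) := by
    intro j
    have e2 : a j = (z ^ (j + 1))⁻¹ • ((transferLinear ψ ^ j) g - fun _ => ν) := rfl
    have e3 : a (j + 1) = (z ^ (j + 1 + 1))⁻¹ • ((transferLinear ψ ^ (j + 1)) g - fun _ => ν) := rfl
    rw [e2, e3, ← transferLinear_apply, map_smul, map_sub, transferLinear_apply,
      transferLinear_apply, ← transferLinear_pow_succ, transfer_const h1, smul_smul]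
    congr 1
    rw [pow_succ z (j + 1)]
    field_simp
  have hTF : ∀ w, transfer ψ F w = z * F w - (g w - ν) := by
    intro w
    have h2 : HasSum (fun j => transfer ψ (a j) w) (transfer ψ F w) := by
      simp only [transfer_eq_sum]
      exact hasSum_sum fun u _ => (hF_has u.1).mul_left _
    have h3 := (hF_has w).mul_left z
    have h4 := (hasSum_nat_add_iff' 1).2 h3
    have h5 : z * a 0 w = g w - ν := by
      simp only [ha, zero_add, pow_one, pow_zero, Module.End.one_apply]
      rw [mul_inv_cancel_left₀ hzne]
    rw [Finset.sum_range_one, h5] at h4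
    simp only [hstep, Pi.smul_apply, smul_eq_mul] at h2
    exact h2.unique h4
  refine ⟨fun w => ν / (z - 1) + F w,
    (lipschitzSpace Γ S P T θ).add_mem (const_mem_lipschitzSpace hθ0 (ν / (z - 1))) hFmem,
    fun w => ?_⟩
  have e4 : transfer ψ (fun w => ν / (z - 1) + F w) w = ν / (z - 1) + transfer ψ F w := by
    have e5 : (fun w => ν / (z - 1) + F w) = (fun _ => ν / (z - 1)) + F := rfl
    rw [e5, ← transferLinear_apply, map_add, transferLinear_apply, transferLinear_apply,
      transfer_const h1]
    rfl
  rw [e4, hTF]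
  have h6 : z - 1 ≠ 0 := sub_ne_zero.2 hz1
  field_simp
  ring

/-! ### Normalization -/

lemma InCone.exists_abs_log_le {a : ℝ} {h : ShiftSpace Γ S P T → ℝ} (hcone : InCone θ a h)
    (hpos : ∀ w, 0 < h w) : ∃ H : ℝ, 0 ≤ H ∧ ∀ w, |Real.log (h w)| ≤ H := by
  obtain ⟨M, hM⟩ := hcone.bddAbove
  obtain ⟨M', hM'⟩ := (hcone.inv hpos).bddAbove
  refine ⟨max 0 (max (Real.log M) (Real.log M')), le_max_left _ _, fun w => abs_le'.2 ⟨?_, ?_⟩⟩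
  · exact (Real.log_le_log (hpos w) (hM ⟨w, rfl⟩)).trans
      ((le_max_left _ _).trans (le_max_right _ _))
  · rw [← Real.log_inv]
    exact (Real.log_le_log (inv_pos.2 (hpos w)) (hM' ⟨w, rfl⟩)).trans
      ((le_max_right _ _).trans (le_max_right _ _))

lemma exists_isRegular_normalizedPotential (hθ0 : 0 < θ) {C B : ℝ} (hφ : IsRegular θ C B φ) {a lam : ℝ}
    (ha0 : 0 ≤ a) {h : ShiftSpace Γ S P T → ℝ} (hcone : InCone θ a h) (hpos : ∀ w, 0 < h w) :
    ∃ C' B', IsRegular θ C' B' (normalizedPotential φ lam h) := by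
  obtain ⟨H, hH0, hH⟩ := hcone.exists_abs_log_le hpos
  have hC := hφ.nonneg
  refine ⟨C + a + (a / θ + 2 * H), B + 2 * H + |Real.log lam|, by positivity,
    fun {n w w'} hag => ?_, fun w => ?_⟩
  · have h1 := abs_le.1 (hφ.abs_sub_le hag)
    have h2 := abs_le.1 (hcone.abs_log_sub_le hpos hag)
    -- The shift loses one entry of agreement, hence the factor `1 / θ`; for `n = 0` no agreement
    -- remains and the bound `2 H` on the oscillation is used.
    have h3 : |Real.log (h w.shift) - Real.log (h w'.shift)| ≤ (a / θ + 2 * H) * θ ^ n := by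
      have hp : 0 ≤ θ ^ n := by positivity
      cases n with
      | zero =>
        have h4 := abs_le.1 (hH w.shift)
        have h5 := abs_le.1 (hH w'.shift)
        have h6 : 0 ≤ a / θ := by positivity
        rw [pow_zero, mul_one]
        exact abs_le.2 ⟨by linarith, by linarith⟩
      | succ n =>
        refine (hcone.abs_log_sub_le hpos hag.shift).trans ?_
        have e : a * θ ^ n = a / θ * θ ^ (n + 1) := by rw [pow_succ]; field_simp
        rw [e, add_mul]
        have : 0 ≤ 2 * H * θ ^ (n + 1) := by positivity
        linarith
    have h3 := abs_le.1 h3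
    unfold normalizedPotential
    exact abs_le.2 ⟨by linarith, by linarith⟩
  · have h1 := abs_le.1 (hφ.abs_le w)
    have h2 := abs_le.1 (hH w)
    have h3 := abs_le.1 (hH w.shift)
    have h4 := abs_le.1 (le_refl |Real.log lam|)
    unfold normalizedPotential
    exact abs_le.2 ⟨by linarith, by linarith⟩

/-- Multiplication by `h` conjugates the operator of `φ` to `lam` times the normalised one; every
spectral statement is transported along it. -/
lemma transfer_normalizedPotential {lam : ℝ} (hlam : 0 < lam) {h : ShiftSpace Γ S P T → ℝ}
    (hpos : ∀ w, 0 < h w) (f : ShiftSpace Γ S P T → ℂ) (w : ShiftSpace Γ S P T) :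
    transfer φ (fun w => h w * f w) w =
      lam * h w * transfer (normalizedPotential φ lam h) f w := by
  rw [transfer_eq_sum, transfer_eq_sum, Finset.mul_sum]
  refine Finset.sum_congr rfl fun u _ => ?_
  rw [exp_normalizedPotential hlam hpos, u.2]
  have h1 : (h w : ℂ) ≠ 0 := Complex.ofReal_ne_zero.2 (hpos w).ne'
  have h2 : (lam : ℂ) ≠ 0 := Complex.ofReal_ne_zero.2 hlam.ne'
  push_cast
  field_simp

lemma transferReal_normalizedPotential {lam : ℝ} (hlam : 0 < lam) {h : ShiftSpace Γ S P T → ℝ}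
    (hpos : ∀ w, 0 < h w) (heq : transferReal φ h = lam • h) :
    transferReal (normalizedPotential φ lam h) 1 = 1 := by
  ext w
  have h1 := congrFun heq w
  rw [transferReal_apply] at h1 ⊢
  have e : ∀ u : Fiber w, Real.exp (normalizedPotential φ lam h u.1) *
      (1 : ShiftSpace Γ S P T → ℝ) u.1 = Real.exp (φ u.1) * h u.1 / (lam * h w) := by
    intro u
    rw [exp_normalizedPotential hlam hpos, u.2, Pi.one_apply, mul_one]
  simp only [e, ← Finset.sum_div, h1, Pi.smul_apply, smul_eq_mul]
  exact div_self (mul_pos hlam (hpos w)).ne'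

/-- After division by `h` and `lam` the normalised operator is the identity on constants and
contracts modulo constants at rate `γ`. The rest of the spectrum therefore lies in the disc of
radius `γ lam`. -/
theorem isMaximalEigenpair [Nonempty (ShiftSpace Γ S P T)] (hθ0 : 0 < θ) (hθ1 : θ < 1)
    {a lam K γ : ℝ} (ha0 : 0 ≤ a) (hlam : 0 < lam) {h : ShiftSpace Γ S P T → ℝ}
    (hcone : InCone θ a h) (hpos : ∀ w, 0 < h w) (heq : transferReal φ h = lam • h)
    (hd : HasDecay θ K γ (normalizedPotential φ lam h)) : IsMaximalEigenpair θ φ lam h := by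
  set ψ := normalizedPotential φ lam h with hψ
  have h1 : transferReal ψ 1 = 1 := transferReal_normalizedPotential hlam hpos heq
  have hne : ∀ w, (h w : ℂ) ≠ 0 := fun w => Complex.ofReal_ne_zero.2 (hpos w).ne'
  have hlamne : (lam : ℂ) ≠ 0 := Complex.ofReal_ne_zero.2 hlam.ne'
  have hmem : (fun w => (h w : ℂ)) ∈ lipschitzSpace Γ S P T θ :=
    hcone.mem_lipschitzSpace hθ0.le hθ1.le ha0
  have hdiv : ∀ {f : ShiftSpace Γ S P T → ℂ}, f ∈ lipschitzSpace Γ S P T θ →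
      (fun w => (h w : ℂ)⁻¹ * f w) ∈ lipschitzSpace Γ S P T θ := by
    intro f hf
    refine mul_mem_lipschitzSpace hθ0.le ?_ hf
    have := (hcone.inv hpos).mem_lipschitzSpace hθ0.le hθ1.le ha0
    simpa only [Complex.ofReal_inv] using this
  have hform : ∀ (f : ShiftSpace Γ S P T → ℂ) w,
      transfer φ f w = lam * h w * transfer ψ (fun w => (h w : ℂ)⁻¹ * f w) w := by
    intro f w
    rw [← transfer_normalizedPotential hlam hpos]
    congr 1
    ext v
    rw [mul_inv_cancel_left₀ (hne v)]
  have hTmem : ∀ {f : ShiftSpace Γ S P T → ℂ}, f ∈ lipschitzSpace Γ S P T θ →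
      transfer ψ f ∈ lipschitzSpace Γ S P T θ := by
    intro f hf
    obtain ⟨c, -, hc⟩ := exists_lipBound hf hθ0.le
    obtain ⟨ν, hν⟩ := hd.exists_limit f c hc
    have := (lipschitzSpace Γ S P T θ).add_mem (hν 1).mem (const_mem_lipschitzSpace hθ0.le ν)
    convert this using 1
    ext w
    simp [transferLinear_apply]
  have hLmem : ∀ {f : ShiftSpace Γ S P T → ℂ}, f ∈ lipschitzSpace Γ S P T θ →
      transfer φ f ∈ lipschitzSpace Γ S P T θ := by
    intro f hf
    have h2 := mul_mem_lipschitzSpace hθ0.le hmem (hTmem (hdiv hf))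
    have h3 := (lipschitzSpace Γ S P T θ).smul_mem (lam : ℂ) h2
    convert h3 using 1
    ext w
    rw [hform]
    simp [mul_assoc]
  refine ⟨hlam, hpos, hmem, fun w => ?_, ?_⟩
  · rw [transfer_ofReal, heq]
    simp
  let L : Module.End ℂ (lipschitzSpace Γ S P T θ) := (transferLinear φ).restrict fun f hf => hLmem hf
  have hL : ∀ f w, (L f : ShiftSpace Γ S P T → ℂ) w = transfer φ (f : ShiftSpace Γ S P T → ℂ) w :=
    fun _ _ => rfl
  refine ⟨L, hL, ?_, γ * lam, ?_, fun z hz hzne => ?_⟩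
  · -- the generalized eigenspace
    set h' : lipschitzSpace Γ S P T θ := ⟨_, hmem⟩ with hh'
    have hLh : L h' = (lam : ℂ) • h' := by
      ext w
      rw [hL, transfer_ofReal, heq]
      simp [hh']
    -- If `(L - lam) f = c h`, then `F = f / h` satisfies `L_ψ F - F = c / lam`; hence `c = 0`, and
    -- `F` is an eigenfunction for one, so constant.
    have key : ∀ (k : ℕ) (f : lipschitzSpace Γ S P T θ), ((L - (lam : ℂ) • 1) ^ k) f = 0 →
        ∃ c : ℂ, c • h' = f := by
      intro k
      induction k with
      | zero => intro f hf; exact ⟨0, by rw [zero_smul]; exact hf.symm⟩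
      | succ k ih =>
        intro f hf
        rw [pow_succ] at hf
        obtain ⟨c, hc⟩ := ih _ hf
        set F : ShiftSpace Γ S P T → ℂ := fun w => (h w : ℂ)⁻¹ * f.1 w with hF
        have hFm : F ∈ lipschitzSpace Γ S P T θ := hdiv f.2
        have hFf : ∀ w, f.1 w = h w * F w := fun w => by rw [hF, mul_inv_cancel_left₀ (hne w)]
        have hsub : ∀ w, transfer ψ F w - F w = c / lam := by
          intro w
          have h2 := congrFun (congrArg Subtype.val hc) w
          have h3 : c * h w = transfer φ f.1 w - lam * f.1 w := h2
          rw [hform, hFf] at h3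
          rw [eq_div_iff hlamne]
          refine mul_left_cancel₀ (hne w) ?_
          linear_combination -h3
        have hc0 := hd.eq_zero_of_sub_eq h1 hθ0.le hFm hsub
        have heig : ∀ w, transfer ψ F w = 1 * F w := by
          intro w
          have := hsub w
          rw [hc0] at this
          rw [one_mul]
          exact sub_eq_zero.1 this
        let o := Classical.arbitrary (ShiftSpace Γ S P T)
        refine ⟨F o, Subtype.ext (funext fun w => ?_)⟩
        have h4 := hd.eq_of_eigen hθ0.le hFm (by rw [norm_one]; exact hd.γ_lt_one) heig w o
        rw [hFf, h4, mul_comm]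
        rfl
    have hspan : L.maxGenEigenspace (lam : ℂ) = Submodule.span ℂ {h'} := by
      ext f
      rw [Module.End.mem_maxGenEigenspace, Submodule.mem_span_singleton]
      constructor
      · rintro ⟨k, hk⟩
        exact key k f hk
      · rintro ⟨c, rfl⟩
        refine ⟨1, ?_⟩
        rw [pow_one, map_smul, LinearMap.sub_apply, hLh, LinearMap.smul_apply,
          Module.End.one_apply, sub_self, smul_zero]
    rw [hspan]
    refine finrank_span_singleton fun h0 => ?_
    have := congrFun (congrArg Subtype.val h0) (Classical.arbitrary _)
    exact hne _ this
  · nlinarith [hd.γ_lt_one]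
  · -- the rest of the spectrum
    by_contra hlt
    push Not at hlt
    rw [spectrum.mem_iff] at hz
    refine hz ((Module.End.isUnit_iff _).2 ⟨?_, ?_⟩)
    · rw [← LinearMap.ker_eq_bot, LinearMap.ker_eq_bot']
      intro f hf
      have hnorm : γ < ‖z / lam‖ := by
        rw [norm_div, Complex.norm_real, Real.norm_of_nonneg hlam.le, lt_div_iff₀ hlam]
        exact hlt
      set F : ShiftSpace Γ S P T → ℂ := fun w => (h w : ℂ)⁻¹ * f.1 w with hF
      have hFm : F ∈ lipschitzSpace Γ S P T θ := hdiv f.2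
      have hFf : ∀ w, f.1 w = h w * F w := fun w => by rw [hF, mul_inv_cancel_left₀ (hne w)]
      have heig : ∀ w, transfer ψ F w = z / lam * F w := by
        intro w
        have h3 : z * f.1 w - transfer φ f.1 w = 0 := congrFun (congrArg Subtype.val hf) w
        rw [hform, hFf] at h3
        rw [div_mul_eq_mul_div, eq_div_iff hlamne]
        refine mul_left_cancel₀ (hne w) ?_
        linear_combination -h3
      have hconst := hd.eq_of_eigen hθ0.le hFm hnorm heig
      refine Subtype.ext (funext fun w => ?_)
      have h4 : F = fun _ => F w := funext fun v => hconst v w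
      have h5 := heig w
      rw [h4, transfer_const h1] at h5
      have h6 : F w * (z - lam) = 0 := by
        field_simp at h5
        linear_combination -h5
      rcases mul_eq_zero.1 h6 with h7 | h7
      · rw [hFf, h7, mul_zero]; rfl
      · exact absurd (sub_eq_zero.1 h7) hzne
    · intro g
      have hnorm : γ < ‖z / lam‖ := by
        rw [norm_div, Complex.norm_real, Real.norm_of_nonneg hlam.le, lt_div_iff₀ hlam]
        exact hlt
      have hne1 : z / lam ≠ 1 := fun h => hzne (by rwa [div_eq_one_iff_eq hlamne] at h)
      obtain ⟨F, hFm, hF⟩ := hd.exists_resolvent h1 hθ0.le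
        ((lipschitzSpace Γ S P T θ).smul_mem (lam : ℂ)⁻¹ (hdiv g.2)) hnorm hne1
      refine ⟨⟨fun w => h w * F w, mul_mem_lipschitzSpace hθ0.le hmem hFm⟩,
        Subtype.ext (funext fun w => ?_)⟩
      change z * (h w * F w) - transfer φ (fun w => h w * F w) w = g.1 w
      rw [transfer_normalizedPotential hlam hpos, ← hψ]
      have h2 := hF w
      simp only [Pi.smul_apply, smul_eq_mul] at h2
      have h3 : g.1 w = lam * h w * ((lam : ℂ)⁻¹ * ((h w : ℂ)⁻¹ * g.1 w)) := by
        have := hne w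
        field_simp
      rw [h3, ← h2]
      field_simp

end Spectrum

end BowenSeries

namespace BowenSeries

section Measures

open ShiftSpace Filter

variable {Γ₀ : Subgroup SL(2, ℝ)} {A : Type*} {Γ : Subgroup SL(2, ℝ)} {p : ℕ}
  {S : Fin p → SL(2, ℝ)} {P : LabelledIdealPolygon Γ₀ A} {T θ : ℝ}

/-! ### Topology of the shift space -/

namespace ShiftSpace

instance : T2Space (ShiftSpace Γ S P T) :=
  inferInstanceAs (T2Space {w : ℕ → Alphabet Γ S P T // ∀ r, P.Transition (w r).1 (w (r + 1)).1})

instance : TopologicalSpace.PseudoMetrizableSpace (ShiftSpace Γ S P T) :=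
  Topology.IsInducing.pseudoMetrizableSpace
    (f := (Subtype.val : ShiftSpace Γ S P T → ℕ → Alphabet Γ S P T)) ⟨rfl⟩

lemma continuous_entry (r : ℕ) : Continuous fun w : ShiftSpace Γ S P T => w.1 r :=
  (continuous_apply r).comp continuous_subtype_val

lemma continuous_shift : Continuous (shift : ShiftSpace Γ S P T → ShiftSpace Γ S P T) :=
  Continuous.subtype_mk (continuous_pi fun r => continuous_entry (r + 1)) _

lemma isClopen_entry_eq (r : ℕ) (w : ShiftSpace Γ S P T) :
    IsClopen {w' : ShiftSpace Γ S P T | w'.1 r = w.1 r} :=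
  (isClopen_discrete {w.1 r}).preimage (continuous_entry r)

lemma isClopen_cylinder (w : ShiftSpace Γ S P T) (n : ℕ) : IsClopen (w.cylinder n) := by
  have e : w.cylinder n = ⋂ r ∈ Finset.range n, {w' | w'.1 r = w.1 r} := by
    ext w'; simp [cylinder]
  rw [e]
  exact isClopen_biInter_finset fun r _ => isClopen_entry_eq r w

lemma mem_cylinder_succ {w w' : ShiftSpace Γ S P T} {n : ℕ} :
    w' ∈ w.cylinder (n + 1) ↔ Agree n w' w :=
  ⟨fun h r hr => h r (Nat.lt_succ_of_le hr), fun h r hr => h r (Nat.le_of_lt_succ hr)⟩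

lemma measurableSet_cylinder (w : ShiftSpace Γ S P T) (n : ℕ) : MeasurableSet (w.cylinder n) :=
  (isClopen_cylinder w n).isOpen.measurableSet

lemma isClosed_agree (n : ℕ) :
    IsClosed {q : ShiftSpace Γ S P T × ShiftSpace Γ S P T | Agree n q.1 q.2} := by
  have e : {q : ShiftSpace Γ S P T × ShiftSpace Γ S P T | Agree n q.1 q.2} =
      ⋂ r, ⋂ (_ : r ≤ n), {q | q.1.1 r = q.2.1 r} := by
    ext q; simp [Agree]
  rw [e]
  exact isClosed_iInter fun r => isClosed_iInter fun _ =>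
    isClosed_eq ((continuous_entry r).comp continuous_fst) ((continuous_entry r).comp continuous_snd)

lemma continuous_of_agree {E : Type*} [PseudoMetricSpace E] {f : ShiftSpace Γ S P T → E}
    (h : ∀ ε > 0, ∃ n, ∀ w w', Agree n w w' → dist (f w) (f w') < ε) : Continuous f := by
  refine continuous_iff_continuousAt.2 fun w => Metric.tendsto_nhds.2 fun ε hε => ?_
  obtain ⟨n, hn⟩ := h ε hε
  filter_upwards [(isClopen_cylinder w (n + 1)).isOpen.mem_nhds fun _ _ => rfl] with w' hw'
  exact hn w' w (mem_cylinder_succ.1 hw')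

variable [Finite (Alphabet Γ S P T)]

instance : CompactSpace (ShiftSpace Γ S P T) := by
  have h1 : IsClosed {q : Alphabet Γ S P T × Alphabet Γ S P T | P.Transition q.1.1 q.2.1} :=
    isClosed_discrete _
  have h2 : IsClosed {w : ℕ → Alphabet Γ S P T | ∀ r, P.Transition (w r).1 (w (r + 1)).1} := by
    have e : {w : ℕ → Alphabet Γ S P T | ∀ r, P.Transition (w r).1 (w (r + 1)).1} =
        ⋂ r, (fun w => (w r, w (r + 1))) ⁻¹' {q | P.Transition q.1.1 q.2.1} := by
      ext w; simp
    rw [e]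
    exact isClosed_iInter fun r => h1.preimage
      ((continuous_apply r).prodMk (continuous_apply (r + 1)))
  exact isCompact_iff_compactSpace.1 h2.isCompact

/-- Uniform continuity in terms of cylinders: the compact sets of pairs that agree up to `n` but
have distant values would otherwise have a common point, on the diagonal. -/
lemma exists_agree_dist_lt {E : Type*} [PseudoMetricSpace E] {f : ShiftSpace Γ S P T → E}
    (hf : Continuous f) {ε : ℝ} (hε : 0 < ε) :
    ∃ n, ∀ w w', Agree n w w' → dist (f w) (f w') < ε := by
  by_contra! hcon
  have := IsCompact.nonempty_iInter_of_sequence_nonempty_isCompact_isClosed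
    (fun n => {q : ShiftSpace Γ S P T × ShiftSpace Γ S P T | Agree n q.1 q.2} ∩
      {q | ε ≤ dist (f q.1) (f q.2)})
    (fun n => Set.inter_subset_inter_left _ fun q hq => Agree.mono (Nat.le_succ n) hq)
    (fun n => by obtain ⟨w, w', h1, h2⟩ := hcon n; exact ⟨(w, w'), h1, h2⟩)
    (isCompact_univ.of_isClosed_subset ((isClosed_agree 0).inter (isClosed_le continuous_const
      ((hf.comp continuous_fst).dist (hf.comp continuous_snd)))) (Set.subset_univ _))
    (fun n => (isClosed_agree n).inter (isClosed_le continuous_const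
      ((hf.comp continuous_fst).dist (hf.comp continuous_snd))))
  obtain ⟨⟨w, w'⟩, hq⟩ := this
  have hq := Set.mem_iInter.1 hq
  have hww : w = w' := ext_word fun r => (hq r).1 r le_rfl
  have := (hq 0).2
  simp only [hww, Set.mem_ofPred_eq, dist_self] at this
  linarith

lemma continuous_sum_fiber {E : Type*} [SeminormedAddCommGroup E] {F : ShiftSpace Γ S P T → E}
    (hF : Continuous F) : Continuous fun w => ∑ u : Fiber w, F u.1 := by
  have := Fintype.ofFinite (Alphabet Γ S P T)
  refine continuous_of_agree fun ε hε => ?_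
  set c : ℝ := Fintype.card (Alphabet Γ S P T) + 1 with hc
  have hc0 : 0 < c := by positivity
  obtain ⟨n, hn⟩ := exists_agree_dist_lt hF (div_pos hε hc0)
  refine ⟨n, fun w w' h => ?_⟩
  have h0 := h 0 (Nat.zero_le _)
  rw [dist_eq_norm, ← (fiberEquiv h0).sum_comp, ← Finset.sum_sub_distrib]
  have h2 : Fintype.card (Fiber w) ≤ Fintype.card (Alphabet Γ S P T) :=
    Fintype.card_le_of_injective (fun u : Fiber w => u.1.1 0) fun u v h =>
      Subtype.ext (ext_shift h (u.2.trans v.2.symm))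
  have h3 : (Fintype.card (Fiber w) : ℝ) < c := by
    rw [hc]
    have : (Fintype.card (Fiber w) : ℝ) ≤ Fintype.card (Alphabet Γ S P T) := by exact_mod_cast h2
    linarith
  calc ‖∑ u : Fiber w, (F u.1 - F (fiberEquiv h0 u).1)‖ ≤ ∑ u : Fiber w, ε / c :=
        norm_sum_le_of_le _ fun u _ => by
          rw [← dist_eq_norm]
          exact (hn _ _ ((agree_fiberEquiv h0 h u).mono (Nat.le_succ n))).le
    _ = Fintype.card (Fiber w) * (ε / c) := by
        rw [Finset.sum_const, nsmul_eq_mul, Finset.card_univ]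
    _ < c * (ε / c) := mul_lt_mul_of_pos_right h3 (div_pos hε hc0)
    _ = ε := mul_div_cancel₀ _ hc0.ne'

end ShiftSpace

lemma IsRegular.continuous {C B : ℝ} {φ : ShiftSpace Γ S P T → ℝ} (hφ : IsRegular θ C B φ)
    (hθ0 : 0 ≤ θ) (hθ1 : θ < 1) : Continuous φ := by
  refine continuous_of_agree fun ε hε => ?_
  obtain ⟨n, hn⟩ := ((tendsto_const_mul_pow hθ0 hθ1 C).eventually (gt_mem_nhds hε)).exists
  exact ⟨n, fun w w' h => (hφ.abs_sub_le h).trans_lt hn⟩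

lemma measure_ext {m m' : Measure (ShiftSpace Γ S P T)} [IsFiniteMeasure m] [IsFiniteMeasure m']
    (h : ∀ f : ShiftSpace Γ S P T → ℝ, Continuous f → ∫ w, f w ∂m = ∫ w, f w ∂m') : m = m' :=
  ext_of_forall_integral_eq_of_IsFiniteMeasure fun f => h f f.continuous

variable [Finite (Alphabet Γ S P T)] {ψ : ShiftSpace Γ S P T → ℝ}

lemma continuous_transferReal (hψ : Continuous ψ) {f : ShiftSpace Γ S P T → ℝ}
    (hf : Continuous f) : Continuous (transferReal ψ f) :=
  continuous_sum_fiber ((Real.continuous_exp.comp hψ).mul hf)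

lemma continuous_transfer (hψ : Continuous ψ) {f : ShiftSpace Γ S P T → ℂ}
    (hf : Continuous f) : Continuous (transfer ψ f) := by
  have e : transfer ψ f = fun w => ∑ u : Fiber w, (Real.exp (ψ u.1) : ℂ) * f u.1 :=
    funext fun w => transfer_eq_sum f w
  rw [e]
  exact continuous_sum_fiber
    ((Complex.continuous_ofReal.comp (Real.continuous_exp.comp hψ)).mul hf)

/-! ### The limit functional -/

/-- Replace `f` by its value at one representative of each cylinder of a high order. The result
depends on finitely many entries, hence is Hölder, with a constant of size `θ ^ (-n)`. -/
lemma exists_lipBound_approx (hθ0 : 0 < θ) (hθ1 : θ < 1) {f : ShiftSpace Γ S P T → ℝ}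
    (hf : Continuous f) {ε : ℝ} (hε : 0 < ε) : ∃ (g : ShiftSpace Γ S P T → ℝ) (c : ℝ),
      LipBound θ c g ∧ ∀ w, |f w - g w| ≤ ε := by
  obtain ⟨n, hn⟩ := exists_agree_dist_lt hf hε
  obtain ⟨M, hM⟩ := (isCompact_range hf).isBounded.exists_norm_le
  have hM' : ∀ w, |f w| ≤ M := fun w => hM _ ⟨w, rfl⟩
  have hspec : ∀ w : ShiftSpace Γ S P T, ∃ v, Agree n v w := fun w => ⟨w, Agree.refl n w⟩
  -- The choice depends only on the predicate, and the predicate only on the cylinder, so points of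
  -- one cylinder get the same representative.
  set r : ShiftSpace Γ S P T → ShiftSpace Γ S P T := fun w =>
    @Classical.epsilon _ ⟨w⟩ fun v => Agree n v w with hr
  have hrw : ∀ w, Agree n (r w) w := fun w => Classical.epsilon_spec (hspec w)
  have hreq : ∀ w w', Agree n w w' → r w = r w' := by
    intro w w' h
    have : (fun v => Agree n v w) = fun v => Agree n v w' :=
      funext fun v => propext ⟨fun h' => h'.trans h, fun h' => h'.trans h.symm⟩
    simp only [hr, this]
  refine ⟨fun w => f (r w), 2 * M / θ ^ n, ⟨fun w => ?_, fun {k w w'} h => ?_⟩, fun w => ?_⟩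
  · have hM0 : 0 ≤ M := (abs_nonneg _).trans (hM' w)
    refine (hM' _).trans ?_
    rw [le_div_iff₀ (by positivity)]
    have : θ ^ n ≤ 1 := pow_le_one₀ hθ0.le hθ1.le
    nlinarith
  · have hM0 : 0 ≤ M := (abs_nonneg _).trans (hM' w)
    rcases le_total n k with hk | hk
    · rw [hreq w w' (h.mono hk), sub_self, norm_zero]
      positivity
    · have h1 := abs_sub (f (r w)) (f (r w'))
      have h2 := hM' (r w)
      have h3 := hM' (r w')
      have h4 : θ ^ n ≤ θ ^ k := pow_le_pow_of_le_one hθ0.le hθ1.le hk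
      rw [Real.norm_eq_abs, div_mul_eq_mul_div, le_div_iff₀ (by positivity)]
      have h5 : |f (r w) - f (r w')| ≤ 2 * M := by linarith
      exact mul_le_mul h5 h4 (by positivity) (by positivity)
  · have := hn _ _ (hrw w)
    rw [dist_comm, Real.dist_eq] at this
    exact this.le

lemma HasDecay.exists_limit_real {K γ : ℝ} (hd : HasDecay θ K γ ψ) {f : ShiftSpace Γ S P T → ℝ}
    {c : ℝ} (hf : LipBound θ c f) : ∃ ν : ℝ, ∀ j w,
      |(transferReal ψ ^ j) f w - ν| ≤ K * c * γ ^ j := by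
  have hf' : LipBound θ c fun w => (f w : ℂ) :=
    ⟨fun w => by rw [Complex.norm_real]; exact hf.norm_le w, fun h => by
      rw [← Complex.ofReal_sub, Complex.norm_real]; exact hf.norm_sub_le h⟩
  obtain ⟨ν, hν⟩ := hd.exists_limit _ c hf'
  refine ⟨ν.re, fun j w => ?_⟩
  have h1 := (hν j).norm_le w
  have h2 := congrFun (re_transferLinear_pow (φ := ψ) j fun w => (f w : ℂ)) w
  simp only [Complex.ofReal_re] at h2
  rw [← h2, ← Complex.sub_re]
  exact (Complex.abs_re_le_norm _).trans h1

/-- Normalised iterates do not increase the sup norm, so convergence to constants passes from Hölder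
functions to their uniform limits. -/
lemma HasDecay.exists_tendsto [Nonempty (ShiftSpace Γ S P T)] {K γ : ℝ} (hd : HasDecay θ K γ ψ)
    (hθ0 : 0 < θ) (hθ1 : θ < 1)
    (h1 : transferReal ψ 1 = 1) {f : ShiftSpace Γ S P T → ℝ} (hf : Continuous f) :
    ∃ ν : ℝ, ∀ w, Tendsto (fun j => (transferReal ψ ^ j) f w) atTop (nhds ν) := by
  let o := Classical.arbitrary (ShiftSpace Γ S P T)
  have key : ∀ ε > 0, ∃ J, ∀ i ≥ J, ∀ j ≥ J, ∀ w w',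
      |(transferReal ψ ^ i) f w - (transferReal ψ ^ j) f w'| < ε := by
    intro ε hε
    obtain ⟨g, c, hg, hfg⟩ := exists_lipBound_approx hθ0 hθ1 hf (show 0 < ε / 5 by positivity)
    obtain ⟨ν, hν⟩ := hd.exists_limit_real hg
    have hlim := (tendsto_const_mul_pow hd.γ_pos.le hd.γ_lt_one (K * c)).eventually
      (gt_mem_nhds (show 0 < ε / 5 by positivity))
    obtain ⟨J, hJ⟩ := eventually_atTop.1 hlim
    have hone : ∀ i ≥ J, ∀ w, |(transferReal ψ ^ i) f w - ν| ≤ 2 * (ε / 5) := by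
      intro i hi w
      have h2 := abs_transferReal_pow_le h1 (f := f - g) hfg i w
      rw [map_sub, Pi.sub_apply] at h2
      have h3 := (hν i w).trans (hJ i hi).le
      have h4 := abs_add_le ((transferReal ψ ^ i) f w - (transferReal ψ ^ i) g w)
        ((transferReal ψ ^ i) g w - ν)
      rw [sub_add_sub_cancel] at h4
      linarith
    refine ⟨J, fun i hi j hj w w' => ?_⟩
    have h2 := hone i hi w
    have h3 := hone j hj w'
    have h4 := abs_sub ((transferReal ψ ^ i) f w - ν) ((transferReal ψ ^ j) f w' - ν)
    rw [sub_sub_sub_cancel_right] at h4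
    linarith
  have hcauchy : CauchySeq fun j => (transferReal ψ ^ j) f o := by
    refine Metric.cauchySeq_iff.2 fun ε hε => ?_
    obtain ⟨J, hJ⟩ := key ε hε
    exact ⟨J, fun i hi j hj => hJ i hi j hj o o⟩
  obtain ⟨ν, hν⟩ := cauchySeq_tendsto_of_complete hcauchy
  refine ⟨ν, fun w => ?_⟩
  have h0 : Tendsto (fun j => (transferReal ψ ^ j) f w - (transferReal ψ ^ j) f o) atTop
      (nhds 0) := by
    refine Metric.tendsto_atTop.2 fun ε hε => ?_
    obtain ⟨J, hJ⟩ := key ε hε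
    refine ⟨J, fun j hj => ?_⟩
    rw [Real.dist_eq, sub_zero]
    exact hJ j hj j hj w o
  simpa using h0.add hν

/-- The iterates of a normalized transfer operator converge to the integral with respect to
a probability measure. -/
theorem HasDecay.exists_measure [Nonempty (ShiftSpace Γ S P T)] {K γ : ℝ} (hd : HasDecay θ K γ ψ)
    (hθ0 : 0 < θ) (hθ1 : θ < 1) (h1 : transferReal ψ 1 = 1) :
    ∃ m : Measure (ShiftSpace Γ S P T), IsProbabilityMeasure m ∧
      ∀ f : ShiftSpace Γ S P T → ℝ, Continuous f →
        ∀ w, Tendsto (fun j => (transferReal ψ ^ j) f w) atTop (nhds (∫ v, f v ∂m)) := by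
  let o := Classical.arbitrary (ShiftSpace Γ S P T)
  choose ν hν using fun f : CompactlySupportedContinuousMap (ShiftSpace Γ S P T) ℝ =>
    hd.exists_tendsto hθ0 hθ1 h1 (f := f) (map_continuous f)
  -- The limit constant is a positive linear functional of the function; the Riesz-Markov theorem
  -- turns it into a measure, and its value one at the constant `1` makes it a probability.
  let Λ : CompactlySupportedContinuousMap (ShiftSpace Γ S P T) ℝ →ₚ[ℝ] ℝ :=
    PositiveLinearMap.mk₀
      { toFun := ν
        map_add' := fun f g => by
          refine tendsto_nhds_unique (hν (f + g) o) ?_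
          have := (hν f o).add (hν g o)
          refine this.congr fun j => ?_
          rw [CompactlySupportedContinuousMap.coe_add, map_add]
          rfl
        map_smul' := fun c f => by
          refine tendsto_nhds_unique (hν (c • f) o) ?_
          have := (hν f o).const_mul c
          refine this.congr fun j => ?_
          rw [CompactlySupportedContinuousMap.coe_smul, map_smul]
          rfl }
      fun f hf => ge_of_tendsto' (hν f o) fun j => transferReal_pow_nonneg j (fun w => hf w) o
  have hint : ∀ f : ShiftSpace Γ S P T → ℝ, Continuous f →
        ∀ w, Tendsto (fun j => (transferReal ψ ^ j) f w) atTop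
          (nhds (∫ v, f v ∂(RealRMK.rieszMeasure Λ))) := by
    intro f hf w
    have := RealRMK.integral_rieszMeasure Λ
      (CompactlySupportedContinuousMap.continuousMapEquiv ⟨f, hf⟩)
    have e : ∫ v, f v ∂(RealRMK.rieszMeasure Λ) =
      ν (CompactlySupportedContinuousMap.continuousMapEquiv ⟨f, hf⟩) := this
    rw [e]
    exact hν (CompactlySupportedContinuousMap.continuousMapEquiv ⟨f, hf⟩) w
  refine ⟨RealRMK.rieszMeasure Λ, ?_, hint⟩
  have h2 := hint 1 continuous_const o
  simp only [transferReal_pow_one h1, Pi.one_apply] at h2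
  have h3 := tendsto_nhds_unique h2 tendsto_const_nhds
  rw [integral_const, smul_eq_mul, mul_one] at h3
  refine ⟨?_⟩
  rw [measureReal_def, ENNReal.toReal_eq_one_iff] at h3
  exact h3

lemma integrable_of_continuous {E : Type*} [NormedAddCommGroup E]
    [SecondCountableTopologyEither (ShiftSpace Γ S P T) E] {m : Measure (ShiftSpace Γ S P T)}
    [IsFiniteMeasure m] {f : ShiftSpace Γ S P T → E} (hf : Continuous f) : Integrable f m := by
  obtain ⟨M, hM⟩ := (isCompact_range hf).isBounded.exists_norm_le
  exact Integrable.of_bound hf.aestronglyMeasurable M (Filter.Eventually.of_forall fun w =>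
    hM _ ⟨w, rfl⟩)

lemma integral_transferReal_of_tendsto [Nonempty (ShiftSpace Γ S P T)] (hψ : Continuous ψ)
    {m : Measure (ShiftSpace Γ S P T)}
    (hm : ∀ f : ShiftSpace Γ S P T → ℝ, Continuous f →
        ∀ w, Tendsto (fun j => (transferReal ψ ^ j) f w) atTop (nhds (∫ v, f v ∂m)))
    {f : ShiftSpace Γ S P T → ℝ} (hf : Continuous f) :
    ∫ w, transferReal ψ f w ∂m = ∫ w, f w ∂m := by
  let o := Classical.arbitrary (ShiftSpace Γ S P T)
  refine tendsto_nhds_unique (hm _ (continuous_transferReal hψ hf) o) ?_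
  have := (hm f hf o).comp (tendsto_add_atTop_nat 1)
  refine this.congr fun j => ?_
  simp only [Function.comp]
  rw [transferReal_pow_add, pow_one]

lemma transferReal_comp_shift_mul (f g : ShiftSpace Γ S P T → ℝ) :
    transferReal ψ (fun w => f w.shift * g w) = fun w => f w * transferReal ψ g w := by
  ext w
  rw [transferReal_apply, transferReal_apply, Finset.mul_sum]
  refine Finset.sum_congr rfl fun u _ => ?_
  rw [u.2]; ring

theorem isInvariantFixedMeasure_of_tendsto [Nonempty (ShiftSpace Γ S P T)] (hψ : Continuous ψ)
    (h1 : transferReal ψ 1 = 1) {m : Measure (ShiftSpace Γ S P T)} [IsProbabilityMeasure m]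
    (hm : ∀ f : ShiftSpace Γ S P T → ℝ, Continuous f →
        ∀ w, Tendsto (fun j => (transferReal ψ ^ j) f w) atTop (nhds (∫ v, f v ∂m))) :
    IsInvariantFixedMeasure ψ m := by
  refine ⟨inferInstance, ⟨continuous_shift.measurable, ?_⟩, fun f hf => ?_⟩
  · have := Measure.isProbabilityMeasure_map (μ := m)
      (continuous_shift (Γ := Γ) (S := S) (P := P) (T := T)).measurable.aemeasurable
    refine measure_ext fun f hf => ?_
    rw [integral_map continuous_shift.measurable.aemeasurable hf.aestronglyMeasurable,
      ← show _ = ∫ w, f w.shift ∂m from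
        integral_transferReal_of_tendsto hψ hm (hf.comp continuous_shift)]
    -- `L_ψ (f ∘ σ) = f`, because `L_ψ 1 = 1`; a measure fixed by the dual operator is therefore
    -- shift invariant.
    have e := transferReal_comp_shift_mul (ψ := ψ) f 1
    simp only [Pi.one_apply, mul_one, h1] at e
    exact congrArg (fun F => ∫ w, F w ∂m) e
  · rw [← integral_re_add_im (integrable_of_continuous (continuous_transfer hψ hf)),
      ← integral_re_add_im (integrable_of_continuous hf)]
    have e1 := integral_transferReal_of_tendsto hψ hm (Complex.continuous_re.comp hf)
    have e2 := integral_transferReal_of_tendsto hψ hm (Complex.continuous_im.comp hf)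
    have e3 : ∫ w, RCLike.re (transfer ψ f w) ∂m = ∫ w, RCLike.re (f w) ∂m := by
      refine Eq.trans ?_ e1
      exact congrArg (fun F => ∫ w, F w ∂m) (funext fun w => re_transfer f w)
    have e4 : ∫ w, RCLike.im (transfer ψ f w) ∂m = ∫ w, RCLike.im (f w) ∂m := by
      refine Eq.trans ?_ e2
      exact congrArg (fun F => ∫ w, F w ∂m) (funext fun w => im_transfer f w)
    rw [e3, e4]

lemma IsInvariantFixedMeasure.integral_transferReal {m : Measure (ShiftSpace Γ S P T)}
    (hm : IsInvariantFixedMeasure ψ m) {f : ShiftSpace Γ S P T → ℝ} (hf : Continuous f) :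
    ∫ w, transferReal ψ f w ∂m = ∫ w, f w ∂m := by
  have h := hm.fixed (fun w => (f w : ℂ)) (Complex.continuous_ofReal.comp hf)
  simp only [transfer_ofReal] at h
  rw [integral_complex_ofReal, integral_complex_ofReal] at h
  exact_mod_cast h

/-- For a fixed measure the integrals of the iterates are constant, while the iterates converge
boundedly to the constant `∫ f ∂m`. -/
theorem IsInvariantFixedMeasure.eq_of_tendsto (hψ : Continuous ψ)
    (h1 : transferReal ψ 1 = 1) {m m' : Measure (ShiftSpace Γ S P T)} [IsProbabilityMeasure m]
    (hm : ∀ f : ShiftSpace Γ S P T → ℝ, Continuous f →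
        ∀ w, Tendsto (fun j => (transferReal ψ ^ j) f w) atTop (nhds (∫ v, f v ∂m)))
    (hm' : IsInvariantFixedMeasure ψ m') : m' = m := by
  have := hm'.isProbabilityMeasure
  refine measure_ext fun f hf => ?_
  obtain ⟨M, hM⟩ := (isCompact_range hf).isBounded.exists_norm_le
  have hcont : ∀ j, Continuous ((transferReal ψ ^ j) f) := by
    intro j
    induction j with
    | zero => exact hf
    | succ j ih => rw [transferReal_pow_succ]; exact continuous_transferReal hψ ih
  have hconst : ∀ j, ∫ w, (transferReal ψ ^ j) f w ∂m' = ∫ w, f w ∂m' := by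
    intro j
    induction j with
    | zero => rfl
    | succ j ih => rw [transferReal_pow_succ, hm'.integral_transferReal (hcont j), ih]
  have hlim := tendsto_integral_of_dominated_convergence (μ := m') (fun _ => M)
    (fun j => (hcont j).aestronglyMeasurable) (integrable_const M)
    (fun j => Filter.Eventually.of_forall fun w =>
      abs_transferReal_pow_le h1 (fun w => hM _ ⟨w, rfl⟩) j w)
    (Filter.Eventually.of_forall fun w => hm f hf w)
  simp only [hconst, integral_const, probReal_univ, one_smul] at hlim
  exact tendsto_nhds_unique tendsto_const_nhds hlim

end Measures

end BowenSeries

namespace BowenSeries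

section Gibbs

open ShiftSpace Filter

variable {Γ₀ : Subgroup SL(2, ℝ)} {A : Type*} {Γ : Subgroup SL(2, ℝ)} {p : ℕ}
  {S : Fin p → SL(2, ℝ)} {P : LabelledIdealPolygon Γ₀ A} {T θ : ℝ}

/-! ### The Gibbs property -/

/-- Birkhoff sums. -/
noncomputable def birkhoff (φ : ShiftSpace Γ S P T → ℝ) (n : ℕ) (w : ShiftSpace Γ S P T) : ℝ :=
  ∑ k ∈ Finset.range n, φ (shift^[k] w)

lemma birkhoff_zero (φ : ShiftSpace Γ S P T → ℝ) (w : ShiftSpace Γ S P T) :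
    birkhoff φ 0 w = 0 := rfl

lemma birkhoff_succ (φ : ShiftSpace Γ S P T → ℝ) (n : ℕ) (w : ShiftSpace Γ S P T) :
    birkhoff φ (n + 1) w = φ w + birkhoff φ n w.shift := by
  rw [birkhoff, Finset.sum_range_succ', add_comm]
  rfl

lemma birkhoff_const_mul (s : ℝ) (φ : ShiftSpace Γ S P T → ℝ) (n : ℕ) (w : ShiftSpace Γ S P T) :
    birkhoff (fun w => s * φ w) n w = s * birkhoff φ n w := by
  rw [birkhoff, birkhoff, Finset.mul_sum]

lemma birkhoff_normalizedPotential (φ : ShiftSpace Γ S P T → ℝ) (lam : ℝ)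
    (h : ShiftSpace Γ S P T → ℝ) (n : ℕ) (w : ShiftSpace Γ S P T) :
    birkhoff (normalizedPotential φ lam h) n w =
      -(n * Real.log lam) + birkhoff φ n w + (Real.log (h w) - Real.log (h (shift^[n] w))) := by
  induction n generalizing w with
  | zero => simp [birkhoff_zero]
  | succ n ih =>
    rw [birkhoff_succ, ih, birkhoff_succ, normalizedPotential, Function.iterate_succ_apply]
    push_cast
    ring

lemma continuous_indicator_cylinder (w : ShiftSpace Γ S P T) (n : ℕ) :
    Continuous ((w.cylinder n).indicator (1 : ShiftSpace Γ S P T → ℝ)) :=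
  continuous_const.indicator fun a ha => by
    rw [(isClopen_cylinder w n).frontier_eq] at ha
    exact absurd ha (Set.notMem_empty a)

/-! ### Comparison of eigenvalues -/

/-- Take the least `c` with `h ≤ c g`. Then `lam h ≤ L h ≤ c L g ≤ c r g`, so `c ≤ c r / lam` by
minimality. Bounded logarithms make `c` finite. -/
lemma eigenvalue_le [Nonempty (ShiftSpace Γ S P T)] (L : Module.End ℝ (ShiftSpace Γ S P T → ℝ))
    (hL : ∀ f g, f ≤ g → L f ≤ L g) {g h : ShiftSpace Γ S P T → ℝ} (hg : ∀ w, 0 < g w)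
    (hh : ∀ w, 0 < h w) (hgH : ∃ H : ℝ, ∀ w, |Real.log (g w)| ≤ H)
    (hhH : ∃ H : ℝ, ∀ w, |Real.log (h w)| ≤ H) {lam r : ℝ} (hlam : 0 < lam)
    (h1 : ∀ w, lam * h w ≤ L h w) (h2 : ∀ w, L g w ≤ r * g w) : lam ≤ r := by
  obtain ⟨H, hH⟩ := hgH
  obtain ⟨H', hH'⟩ := hhH
  have hb : BddAbove (Set.range fun w => h w / g w) := by
    refine ⟨Real.exp (H + H'), ?_⟩
    rintro _ ⟨w, rfl⟩
    have e : h w / g w = Real.exp (Real.log (h w) - Real.log (g w)) := by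
      rw [Real.exp_sub, Real.exp_log (hh w), Real.exp_log (hg w)]
    simp only [e]
    have := abs_le.1 (hH w)
    have := abs_le.1 (hH' w)
    exact Real.exp_le_exp.2 (by linarith)
  set c := ⨆ w, h w / g w with hc
  have hcle : ∀ w, h w / g w ≤ c := fun w => le_ciSup hb w
  let o := Classical.arbitrary (ShiftSpace Γ S P T)
  have hc0 : 0 < c := (div_pos (hh o) (hg o)).trans_le (hcle o)
  have h3 : h ≤ c • g := fun w => (div_le_iff₀ (hg w)).1 (hcle w)
  have h4 := hL _ _ h3
  rw [map_smul] at h4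
  have h5 : c ≤ c * r / lam := ciSup_le fun w => by
    rw [div_le_div_iff₀ (hg w) hlam]
    have h6 := h4 w
    simp only [Pi.smul_apply, smul_eq_mul] at h6
    have h7 := mul_le_mul_of_nonneg_left (h2 w) hc0.le
    linarith [h1 w]
  rw [le_div_iff₀ hlam] at h5
  exact le_of_mul_le_mul_left h5 hc0

/-! ### Cylinders -/

variable [Finite (Alphabet Γ S P T)] {φ ψ : ShiftSpace Γ S P T → ℝ} {C B : ℝ}

/-- At most one preimage of `x` starts with the prescribed first entry, so the sum has at most one
nonzero term. -/
lemma transferReal_indicator_cylinder (w x : ShiftSpace Γ S P T) (n : ℕ) :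
    (x ∈ w.shift.cylinder (n + 1) ∧ ∃ u, Agree (n + 1) u w ∧
      transferReal ψ ((w.cylinder (n + 2)).indicator 1) x = Real.exp (ψ u)) ∨
    (x ∉ w.shift.cylinder (n + 1) ∧ transferReal ψ ((w.cylinder (n + 2)).indicator 1) x = 0) := by
  by_cases hx : x ∈ w.shift.cylinder (n + 1)
  · refine Or.inl ⟨hx, ?_⟩
    have h1 := mem_cylinder_succ.1 hx
    have htr : P.Transition (w.1 0).1 (x.1 0).1 := by rw [h1 0 (Nat.zero_le _)]; exact w.2 0
    set u : Fiber x := ⟨cons (w.1 0) x htr, rfl⟩ with hu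
    have hag : Agree (n + 1) u.1 w := agree_succ_iff.2 ⟨rfl, h1⟩
    refine ⟨u.1, hag, ?_⟩
    rw [transferReal_apply, Finset.sum_eq_single u]
    · rw [Set.indicator_of_mem (mem_cylinder_succ.2 hag), Pi.one_apply, mul_one]
    · intro v _ hv
      rw [Set.indicator_of_notMem, mul_zero]
      intro hmem
      exact hv (Subtype.ext (ext_shift (mem_cylinder_succ.1 hmem 0 (Nat.zero_le _))
        (v.2.trans u.2.symm)))
    · intro h; exact absurd (Finset.mem_univ u) h
  · refine Or.inr ⟨hx, Finset.sum_eq_zero fun v _ => ?_⟩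
    rw [Set.indicator_of_notMem, mul_zero]
    intro hmem
    have := (mem_cylinder_succ.1 hmem).shift
    rw [v.2] at this
    exact hx (mem_cylinder_succ.2 this)

variable {m : Measure (ShiftSpace Γ S P T)}

lemma measureReal_cylinder_bounds (hψ : IsRegular θ C B ψ) (hθ0 : 0 ≤ θ) (hθ1 : θ < 1)
    (hm : IsInvariantFixedMeasure ψ m) (w : ShiftSpace Γ S P T) (n : ℕ) :
    Real.exp (ψ w - C * θ ^ (n + 1)) * m.real (w.shift.cylinder (n + 1)) ≤
        m.real (w.cylinder (n + 2)) ∧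
      m.real (w.cylinder (n + 2)) ≤
        Real.exp (ψ w + C * θ ^ (n + 1)) * m.real (w.shift.cylinder (n + 1)) := by
  have := hm.isProbabilityMeasure
  have hcont := hψ.continuous hθ0 hθ1
  have e : m.real (w.cylinder (n + 2)) =
      ∫ x, transferReal ψ ((w.cylinder (n + 2)).indicator 1) x ∂m := by
    rw [hm.integral_transferReal (continuous_indicator_cylinder w _),
      integral_indicator_one (measurableSet_cylinder w _)]
  have e' : m.real (w.shift.cylinder (n + 1)) =
      ∫ x, (w.shift.cylinder (n + 1)).indicator (1 : ShiftSpace Γ S P T → ℝ) x ∂m := by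
    rw [integral_indicator_one (measurableSet_cylinder w.shift _)]
  have i1 := integrable_of_continuous (m := m)
    (continuous_transferReal hcont (continuous_indicator_cylinder w (n + 2)))
  have i2 := integrable_of_continuous (m := m) (continuous_indicator_cylinder w.shift (n + 1))
  rw [e, e', ← integral_const_mul, ← integral_const_mul]
  constructor
  · refine integral_mono (i2.const_mul _) i1 fun x => ?_
    rcases transferReal_indicator_cylinder (ψ := ψ) w x n with ⟨hx, u, hu, h⟩ | ⟨hx, h⟩
    · have h1 := abs_le.1 (hψ.abs_sub_le hu)
      simp only [h]
      rw [Set.indicator_of_mem hx, Pi.one_apply, mul_one]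
      exact Real.exp_le_exp.2 (by linarith)
    · simp only [h]
      rw [Set.indicator_of_notMem hx, mul_zero]
  · refine integral_mono i1 (i2.const_mul _) fun x => ?_
    rcases transferReal_indicator_cylinder (ψ := ψ) w x n with ⟨hx, u, hu, h⟩ | ⟨hx, h⟩
    · have h1 := abs_le.1 (hψ.abs_sub_le hu)
      simp only [h]
      rw [Set.indicator_of_mem hx, Pi.one_apply, mul_one]
      exact Real.exp_le_exp.2 (by linarith)
    · simp only [h]
      rw [Set.indicator_of_notMem hx, mul_zero]

/-- By mixing every point has a preimage of order `N` in the cylinder, so the `N`-th iterate of its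
indicator is at least `exp (-(N * B))` everywhere. -/
lemma le_measureReal_cylinder_one (hψ : IsRegular θ C B ψ) (hθ0 : 0 ≤ θ) (hθ1 : θ < 1)
    (hm : IsInvariantFixedMeasure ψ m) {N : ℕ} (hN : Mixing Γ S P T N) (w : ShiftSpace Γ S P T) :
    Real.exp (-(N * B)) ≤ m.real (w.cylinder 1) := by
  have := hm.isProbabilityMeasure
  have hcont := hψ.continuous hθ0 hθ1
  set f : ShiftSpace Γ S P T → ℝ := (w.cylinder 1).indicator 1 with hf
  have hfc : Continuous f := continuous_indicator_cylinder w 1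
  have hfn : 0 ≤ f := fun x => Set.indicator_nonneg (fun _ _ => zero_le_one) x
  have hiter : ∀ j, Continuous ((transferReal ψ ^ j) f) ∧
      ∫ x, (transferReal ψ ^ j) f x ∂m = ∫ x, f x ∂m := by
    intro j
    induction j with
    | zero => exact ⟨hfc, rfl⟩
    | succ j ih =>
      rw [transferReal_pow_succ, hm.integral_transferReal ih.1]
      exact ⟨continuous_transferReal hcont ih.1, ih.2⟩
  have e : m.real (w.cylinder 1) = ∫ x, f x ∂m := by
    rw [hf, integral_indicator_one (measurableSet_cylinder w _)]
  rw [e, ← (hiter N).2]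
  have h1 : ∫ _, Real.exp (-(N * B)) ∂m ≤ ∫ x, (transferReal ψ ^ N) f x ∂m := by
    refine integral_mono (integrable_const _) (integrable_of_continuous (hiter N).1) fun x => ?_
    obtain ⟨u, hu, rfl⟩ := hN (w.1 0) x
    have h2 := le_transferReal_pow hψ hfn N u
    rwa [hf, Set.indicator_of_mem (mem_cylinder_succ.2 (agree_zero_iff.2 hu)), Pi.one_apply,
      mul_one] at h2
  simpa using h1

/-- Removing the first entry of a cylinder multiplies its mass by `exp ψ` up to an error factor `exp
(C θ ^ (n + 1))`; the errors form a convergent geometric series. -/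
lemma exists_gibbs_bounds (hψ : IsRegular θ C B ψ) (hθ0 : 0 ≤ θ) (hθ1 : θ < 1)
    (hm : IsInvariantFixedMeasure ψ m) {N : ℕ} (hN : Mixing Γ S P T N) :
    ∃ E : ℝ, ∀ (n : ℕ) (w : ShiftSpace Γ S P T),
      Real.exp (birkhoff ψ n w - E) ≤ m.real (w.cylinder n) ∧
      m.real (w.cylinder n) ≤ Real.exp (birkhoff ψ n w + E) := by
  have := hm.isProbabilityMeasure
  by_cases hne : Nonempty (ShiftSpace Γ S P T)
  swap
  · exact ⟨0, fun n w => absurd ⟨w⟩ hne⟩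
  have hB : 0 ≤ B := (abs_nonneg _).trans (hψ.abs_le (Classical.arbitrary _))
  -- The accumulated error: `N * B + B` for cylinders of one entry, and one term of the geometric
  -- series for each further entry.
  set G : ℕ → ℝ := fun n => N * B + B + C * ∑ k ∈ Finset.range n, θ ^ (k + 1) with hG
  have hGs : ∀ n, G (n + 1) = G n + C * θ ^ (n + 1) := fun n => by
    simp only [hG, Finset.sum_range_succ]; ring
  have hGle : ∀ n, G n ≤ N * B + B + C * (1 - θ)⁻¹ := by
    intro n
    have h1 : ∑ k ∈ Finset.range n, θ ^ (k + 1) ≤ ∑ k ∈ Finset.range n, θ ^ k :=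
      Finset.sum_le_sum fun k _ => pow_le_pow_of_le_one hθ0 hθ1.le (Nat.le_succ k)
    have h2 : ∑ k ∈ Finset.range n, θ ^ k ≤ (1 - θ)⁻¹ :=
      sum_le_hasSum _ (fun k _ => pow_nonneg hθ0 k) (hasSum_geometric_of_lt_one hθ0 hθ1)
    have := mul_le_mul_of_nonneg_left (h1.trans h2) hψ.nonneg
    simp only [hG]; linarith
  have key : ∀ (n : ℕ) (w : ShiftSpace Γ S P T),
      Real.exp (birkhoff ψ (n + 1) w - G n) ≤ m.real (w.cylinder (n + 1)) ∧
      m.real (w.cylinder (n + 1)) ≤ Real.exp (birkhoff ψ (n + 1) w + G n) := by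
    intro n
    induction n with
    | zero =>
      intro w
      have h1 := abs_le.1 (hψ.abs_le w)
      have hNB : 0 ≤ N * B := by positivity
      have h2 : G 0 = N * B + B := by simp [hG]
      rw [birkhoff_succ, birkhoff_zero, h2]
      refine ⟨le_trans (Real.exp_le_exp.2 (by linarith))
        (le_measureReal_cylinder_one hψ hθ0 hθ1 hm hN w),
        measureReal_le_one.trans (Real.one_le_exp (by linarith))⟩
    | succ n ih =>
      intro w
      obtain ⟨h1, h2⟩ := ih w.shift
      obtain ⟨h3, h4⟩ := measureReal_cylinder_bounds hψ hθ0 hθ1 hm w n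
      rw [birkhoff_succ, hGs]
      constructor
      · refine le_trans ?_ h3
        refine le_trans (le_of_eq ?_) (mul_le_mul_of_nonneg_left h1 (Real.exp_pos _).le)
        rw [← Real.exp_add]; congr 1; ring
      · refine h4.trans ((mul_le_mul_of_nonneg_left h2 (Real.exp_pos _).le).trans (le_of_eq ?_))
        rw [← Real.exp_add]; congr 1; ring
  have hE0 : 0 ≤ N * B + B + C * (1 - θ)⁻¹ := by
    have := mul_nonneg hψ.nonneg (inv_nonneg.2 (sub_nonneg.2 hθ1.le))
    positivity
  refine ⟨N * B + B + C * (1 - θ)⁻¹, fun n w => ?_⟩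
  cases n with
  | zero =>
    have e : w.cylinder 0 = Set.univ := by
      ext; simp [ShiftSpace.cylinder]
    rw [e, probReal_univ, birkhoff_zero]
    exact ⟨Real.exp_le_one_iff.2 (by linarith), Real.one_le_exp (by linarith)⟩
  | succ n =>
    obtain ⟨h1, h2⟩ := key n w
    have := hGle n
    exact ⟨(Real.exp_le_exp.2 (by linarith)).trans h1, h2.trans (Real.exp_le_exp.2 (by linarith))⟩

/-- The conclusion of the Ruelle-Perron-Frobenius theorem for the potential `φ`. -/
structure IsRuelleTriple (θ : ℝ) (φ : ShiftSpace Γ S P T → ℝ) (lam : ℝ)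
    (h : ShiftSpace Γ S P T → ℝ) (m : Measure (ShiftSpace Γ S P T)) : Prop where
  eigenpair : IsMaximalEigenpair θ φ lam h
  invariant : IsInvariantFixedMeasure (normalizedPotential φ lam h) m
  unique : ∀ m', IsInvariantFixedMeasure (normalizedPotential φ lam h) m' → m' = m
  gibbs : IsGibbs φ (Real.log lam) m
  eq : transferReal φ h = lam • h
  abs_log_le : ∃ H : ℝ, ∀ w, |Real.log (h w)| ≤ H

theorem exists_isRuelleTriple [Nonempty (ShiftSpace Γ S P T)] (hθ0 : 0 < θ) (hθ1 : θ < 1)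
    (hφ : IsRegular θ C B φ) {N : ℕ} (hN : Mixing Γ S P T N) :
    ∃ lam h m, IsRuelleTriple θ φ lam h m := by
  obtain ⟨lam, a, h, hlam, ha0, hcone, hpos, heq⟩ := exists_transferReal_eq hθ0 hθ1 hφ hN
  obtain ⟨C', B', hψ⟩ := exists_isRegular_normalizedPotential (lam := lam) hθ0 hφ ha0.le hcone hpos
  set ψ := normalizedPotential φ lam h with hψdef
  have h1 : transferReal ψ 1 = 1 := transferReal_normalizedPotential hlam hpos heq
  obtain ⟨K, γ, hK, hγ0, hγ1, hdec⟩ := exists_decay_complex hθ0 hθ1 hψ hN h1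
  have hd : HasDecay θ K γ ψ := ⟨hK, hγ0, hγ1, hdec⟩
  have hcont := hψ.continuous hθ0.le hθ1
  obtain ⟨m, hmp, hm⟩ := hd.exists_measure hθ0 hθ1 h1
  have hinv : IsInvariantFixedMeasure ψ m := isInvariantFixedMeasure_of_tendsto hcont h1 hm
  obtain ⟨H, hH0, hH⟩ := hcone.exists_abs_log_le hpos
  refine ⟨lam, h, m, isMaximalEigenpair hθ0 hθ1 ha0.le hlam hcone hpos heq hd, hinv,
    fun m' hm' => hm'.eq_of_tendsto hcont h1 hm, ⟨hmp, ?_⟩, heq, H, hH⟩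
  obtain ⟨E, hE⟩ := exists_gibbs_bounds hψ hθ0.le hθ1 hinv hN
  -- The normalised potential differs from `φ - log lam` by a bounded coboundary, so Birkhoff sums
  -- differ by at most `2 H` uniformly in `n`.
  have hE2 : ∀ (n : ℕ) (w : ShiftSpace Γ S P T),
      |birkhoff ψ n w - (-(n * Real.log lam) + birkhoff φ n w)| ≤ 2 * H := by
    intro n w
    rw [hψdef, birkhoff_normalizedPotential, add_sub_cancel_left]
    have := abs_sub (Real.log (h w)) (Real.log (h (shift^[n] w)))
    linarith [hH w, hH (shift^[n] w)]
  -- The summand `1` only serves the strict inequality `1 < C`.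
  refine ⟨Real.exp (E + 2 * H) + 1, by linarith [Real.exp_pos (E + 2 * H)], fun w n => ?_⟩
  obtain ⟨h2, h3⟩ := hE n w
  have h4 := abs_le.1 (hE2 n w)
  have h5 := Real.exp_pos (E + 2 * H)
  change 1 / (Real.exp (E + 2 * H) + 1) ≤ m.real (w.cylinder n) /
    Real.exp (-(n * Real.log lam) + birkhoff φ n w) ∧ m.real (w.cylinder n) /
    Real.exp (-(n * Real.log lam) + birkhoff φ n w) ≤ Real.exp (E + 2 * H) + 1
  constructor
  · rw [div_le_div_iff₀ (by linarith) (Real.exp_pos _), one_mul]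
    have h6 : Real.exp (-(n * Real.log lam) + birkhoff φ n w) ≤
        m.real (w.cylinder n) * Real.exp (E + 2 * H) := by
      refine le_trans ?_ (mul_le_mul_of_nonneg_right h2 h5.le)
      rw [← Real.exp_add]
      exact Real.exp_le_exp.2 (by linarith)
    have h7 : 0 ≤ m.real (w.cylinder n) := measureReal_nonneg
    linarith
  · rw [div_le_iff₀ (Real.exp_pos _)]
    refine h3.trans (le_trans ?_ (mul_le_mul_of_nonneg_right
      (le_add_of_nonneg_right zero_le_one) (Real.exp_pos _).le))
    rw [← Real.exp_add]
    exact Real.exp_le_exp.2 (by linarith)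

/-- The eigenfunction of `φ` is a test function for the operator of `φ'`: it is multiplied by at
most `lam * exp x`. -/
lemma IsRuelleTriple.le_of_le [Nonempty (ShiftSpace Γ S P T)] {φ' : ShiftSpace Γ S P T → ℝ}
    {lam lam' x : ℝ} {h h' : ShiftSpace Γ S P T → ℝ} {m m' : Measure (ShiftSpace Γ S P T)}
    (H : IsRuelleTriple θ φ lam h m) (H' : IsRuelleTriple θ φ' lam' h' m')
    (hle : ∀ w, φ' w ≤ φ w + x) : Real.log lam' ≤ Real.log lam + x := by
  have hlam := H.eigenpair.lam_pos
  have hlam' := H'.eigenpair.lam_pos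
  have key : lam' ≤ lam * Real.exp x := by
    refine eigenvalue_le (transferReal φ') (fun f g => transferReal_mono) H.eigenpair.h_pos
      H'.eigenpair.h_pos H.abs_log_le H'.abs_log_le hlam'
      (fun w => by rw [H'.eq]; rfl) fun w => ?_
    have h1 : transferReal φ' h w ≤ Real.exp x * transferReal φ h w := by
      rw [transferReal_apply, transferReal_apply, Finset.mul_sum]
      refine Finset.sum_le_sum fun u _ => ?_
      rw [← mul_assoc, ← Real.exp_add]
      exact mul_le_mul_of_nonneg_right (Real.exp_le_exp.2 (by linarith [hle u.1]))
        (H.eigenpair.h_pos _).le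
    rw [H.eq] at h1
    refine h1.trans (le_of_eq ?_)
    simp only [Pi.smul_apply, smul_eq_mul]
    ring
  have := Real.log_le_log hlam' key
  rwa [Real.log_mul hlam.ne' (Real.exp_pos x).ne', Real.log_exp] at this

/-- The bound `B = 0` means that `φ` vanishes, so `L ^ N 1` counts preimages of order `N`. Mixing
provides one preimage for each first entry, at least two in all, whence `lam ^ N ≥ 2`. -/
lemma IsRuelleTriple.log_pos [Nonempty (ShiftSpace Γ S P T)] [Nontrivial (Alphabet Γ S P T)]
    {lam : ℝ} {h : ShiftSpace Γ S P T → ℝ}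
    (H : IsRuelleTriple θ φ lam h m) (hφ : IsRegular θ C 0 φ) {N : ℕ} (hN : Mixing Γ S P T N) :
    0 < Real.log lam := by
  classical
  obtain ⟨W, W', hne⟩ := exists_pair_ne (Alphabet Γ S P T)
  have hlam := H.eigenpair.lam_pos
  set f : Alphabet Γ S P T → ShiftSpace Γ S P T → ℝ := fun W w => if w.1 0 = W then 1 else 0 with hf
  have hf0 : ∀ W, 0 ≤ f W := fun W w => by simp only [hf]; split_ifs <;> simp
  have hfN : ∀ W w, 1 ≤ (transferReal φ ^ N) (f W) w := by
    intro W w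
    obtain ⟨u, hu, rfl⟩ := hN W w
    have := le_transferReal_pow hφ (hf0 W) N u
    simpa [hf, hu] using this
  have hsum : f W + f W' ≤ 1 := by
    intro w
    simp only [hf, Pi.add_apply, Pi.one_apply]
    split_ifs with h1 h2
    · exact absurd (h1.symm.trans h2) hne
    all_goals norm_num
  have h2 : ∀ w, 2 ≤ (transferReal φ ^ N) 1 w := by
    intro w
    have h3 := transferReal_pow_mono (φ := φ) N hsum w
    rw [map_add, Pi.add_apply] at h3
    linarith [hfN W w, hfN W' w]
  have hpow : (transferReal φ ^ N) h = lam ^ N • h := by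
    clear h2 hfN hN
    induction N with
    | zero => simp
    | succ N ih => rw [transferReal_pow_succ, ih, map_smul, H.eq, smul_smul, pow_succ]
  have key : (2 : ℝ) ≤ lam ^ N := by
    refine eigenvalue_le (transferReal φ ^ N) (fun f g => transferReal_pow_mono N)
      H.eigenpair.h_pos (h := 1) (fun _ => one_pos) H.abs_log_le ⟨0, fun w => by simp⟩ two_pos
      (fun w => by simpa using h2 w) fun w => by rw [hpow]; rfl
  refine Real.log_pos ?_
  by_contra hle
  push Not at hle
  have := pow_le_one₀ hlam.le hle (n := N)
  linarith

end Gibbs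

end BowenSeries

namespace BowenSeries

section Geometry

open ShiftSpace Filter

variable {Γ₀ : Subgroup SL(2, ℝ)} {A : Type*} {Γ : Subgroup SL(2, ℝ)} {p : ℕ}
  {S : Fin p → SL(2, ℝ)} {P : LabelledIdealPolygon Γ₀ A} {T θ : ℝ}

/-! ### Metric properties of the coding map -/

lemma norm_code_sub_le (hθ : P.IsContractionFactor θ) {n : ℕ} {w w' : ShiftSpace Γ S P T}
    (h : w' ∈ w.cylinder n) : ‖w.code - w'.code‖ ≤ 2 * θ ^ n := by
  induction n generalizing w w' with
  | zero =>
    have := norm_sub_le w.code w'.code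
    rw [w.norm_code, w'.norm_code] at this
    linarith
  | succ n ih =>
    have h0 : w.1 0 = w'.1 0 := (h 0 (Nat.succ_pos n)).symm
    have h1 : w'.shift ∈ w.shift.cylinder n := fun r hr => h (r + 1) (Nat.succ_lt_succ hr)
    rw [norm_code_sub h0, pow_succ, ← mul_assoc, mul_comm]
    refine mul_le_mul (ih h1) ?_ (Real.exp_pos _).le (by have := hθ.1; positivity)
    rw [← Real.exp_log hθ.1]
    refine Real.exp_le_exp.2 ?_
    linarith [potential_le_log hθ w, potential_le_log hθ w']

lemma norm_code_sub_eq {n : ℕ} {w w' : ShiftSpace Γ S P T} (h : w' ∈ w.cylinder n) :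
    ‖w.code - w'.code‖ = Real.exp ((birkhoff potential n w + birkhoff potential n w') / 2) *
      ‖(shift^[n] w).code - (shift^[n] w').code‖ := by
  induction n generalizing w w' with
  | zero => simp [birkhoff_zero]
  | succ n ih =>
    have h0 : w.1 0 = w'.1 0 := (h 0 (Nat.succ_pos n)).symm
    have h1 : w'.shift ∈ w.shift.cylinder n := fun r hr => h (r + 1) (Nat.succ_lt_succ hr)
    rw [norm_code_sub h0, ih h1, birkhoff_succ, birkhoff_succ, ← mul_assoc, ← Real.exp_add]
    congr 2
    ring

lemma birkhoff_potential_le (hθ : P.IsContractionFactor θ) (n : ℕ) (w : ShiftSpace Γ S P T) :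
    birkhoff potential n w ≤ n * Real.log θ := by
  induction n generalizing w with
  | zero => simp [birkhoff_zero]
  | succ n ih =>
    rw [birkhoff_succ]
    push_cast
    linarith [ih w.shift, potential_le_log hθ w]

lemma IsRegular.const_mul {C B s : ℝ} {φ : ShiftSpace Γ S P T → ℝ} (hφ : IsRegular θ C B φ)
    (hs : 0 ≤ s) : IsRegular θ (s * C) (s * B) fun w => s * φ w := by
  refine ⟨mul_nonneg hs hφ.nonneg, fun h => ?_, fun w => ?_⟩
  · rw [← mul_sub, abs_mul, abs_of_nonneg hs, mul_assoc]
    exact mul_le_mul_of_nonneg_left (hφ.abs_sub_le h) hs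
  · rw [abs_mul, abs_of_nonneg hs]
    exact mul_le_mul_of_nonneg_left (hφ.abs_le w) hs

lemma continuous_code : Continuous (code : ShiftSpace Γ S P T → ℂ) := by
  obtain ⟨θ, hθ⟩ := P.exists_isContractionFactor
  refine continuous_of_agree fun ε hε => ?_
  obtain ⟨n, hn⟩ := ((tendsto_const_mul_pow hθ.1.le hθ.2.1 2).eventually (gt_mem_nhds hε)).exists
  refine ⟨n, fun w w' h => ?_⟩
  rw [dist_eq_norm]
  exact (norm_code_sub_le hθ fun r hr => (h r hr.le).symm).trans_lt hn

/-- Take the first entry at which two points of `V` differ. -/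
lemma exists_subset_cylinder {V : Set (ShiftSpace Γ S P T)} (hV : ¬ V.Subsingleton) :
    ∃ n, ∃ w ∈ V, ∃ w' ∈ V, w.1 n ≠ w'.1 n ∧ V ⊆ w.cylinder n := by
  classical
  have hex : ∃ n, ∃ w ∈ V, ∃ w' ∈ V, w.1 n ≠ w'.1 n := by
    obtain ⟨w, hw, w', hw', hne⟩ := Set.not_subsingleton_iff.1 hV
    by_contra! h
    exact hne (ext_word fun r => h r w hw w' hw')
  obtain ⟨w, hw, w', hw', hne⟩ := Nat.find_spec hex
  refine ⟨Nat.find hex, w, hw, w', hw', hne, fun v hv r hr => ?_⟩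
  by_contra h
  exact Nat.find_min hex hr ⟨v, hv, w, hw, h⟩

/-- The image lies in the unit circle, a Lipschitz image of a compact interval. -/
lemma hausdorffMeasure_range_code_lt_top :
    Measure.hausdorffMeasure 1 (Set.range (code : ShiftSpace Γ S P T → ℂ)) < ⊤ := by
  have h1 : LipschitzWith 1 LabelledIdealPolygon.pt := by
    refine LipschitzWith.of_dist_le_mul fun x y => ?_
    have e : LabelledIdealPolygon.pt x =
        LabelledIdealPolygon.pt y * Complex.exp (Complex.I * ((y - x : ℝ) : ℂ)) := by
      rw [LabelledIdealPolygon.pt, LabelledIdealPolygon.pt, ← Complex.exp_add]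
      congr 1
      push_cast
      ring
    rw [NNReal.coe_one, one_mul, dist_eq_norm, dist_eq_norm, e, ← mul_sub_one, norm_mul,
      LabelledIdealPolygon.norm_pt, one_mul, norm_sub_rev x y]
    exact Real.norm_exp_I_mul_ofReal_sub_one_le
  have h2 : Set.range (code : ShiftSpace Γ S P T → ℂ) ⊆
      LabelledIdealPolygon.pt '' Set.Icc 0 (2 * Real.pi) := by
    rintro _ ⟨w, rfl⟩
    obtain ⟨x, hx⟩ := LabelledIdealPolygon.exists_eq_pt (norm_code w)
    have h := toIcoMod_mem_Ico' Real.two_pi_pos x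
    refine ⟨toIcoMod Real.two_pi_pos 0 x, Set.Ico_subset_Icc_self h, ?_⟩
    rw [hx, LabelledIdealPolygon.pt_eq_pt_iff]
    refine ⟨toIcoDiv Real.two_pi_pos 0 x, ?_⟩
    have := toIcoMod_add_toIcoDiv_zsmul Real.two_pi_pos 0 x
    rw [zsmul_eq_mul] at this
    linarith
  refine (measure_mono h2).trans_lt ((h1.hausdorffMeasure_image_le zero_le_one _).trans_lt ?_)
  rw [hausdorffMeasure_real, Real.volume_Icc]
  exact ENNReal.mul_lt_top (by simp) ENNReal.ofReal_lt_top

/-- The mass distribution principle. It is enough to bound the masses of sets of small diameter;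
passing to closures keeps the diameter and makes preimages measurable. -/
lemma map_code_le_smul {m : Measure (ShiftSpace Γ S P T)} {d : ℝ} {k δ : ENNReal} (hk0 : k ≠ 0) (hk : k ≠ ⊤) (hδ : 0 < δ)
    (h : ∀ U : Set ℂ, Metric.ediam U ≤ δ → m (code ⁻¹' U) ≤ k * Metric.ediam U ^ d) :
    m.map code ≤ k • Measure.hausdorffMeasure d := by
  have h1 : k⁻¹ • m.map code ≤ Measure.hausdorffMeasure d := by
    refine Measure.le_hausdorffMeasure d _ δ hδ fun U hU => ?_
    have h2 : m.map code U ≤ k * Metric.ediam U ^ d := by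
      refine (measure_mono subset_closure).trans ?_
      rw [Measure.map_apply continuous_code.measurable isClosed_closure.measurableSet]
      have := h (closure U) (by rwa [Metric.ediam_closure])
      rwa [Metric.ediam_closure] at this
    rw [Measure.smul_apply, smul_eq_mul]
    calc k⁻¹ * m.map code U ≤ k⁻¹ * (k * Metric.ediam U ^ d) := by gcongr
      _ = Metric.ediam U ^ d := by rw [← mul_assoc, ENNReal.inv_mul_cancel hk0 hk, one_mul]
  refine Measure.le_iff.2 fun U _ => ?_
  have h3 := h1 U
  rw [Measure.smul_apply, smul_eq_mul] at h3 ⊢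
  calc m.map code U = k * (k⁻¹ * m.map code U) := by
        rw [← mul_assoc, ENNReal.mul_inv_cancel hk0 hk, one_mul]
    _ ≤ k * Measure.hausdorffMeasure d U := by gcongr

variable [Finite (Alphabet Γ S P T)]

lemma exists_isRegular_potential (hθ : P.IsContractionFactor θ) :
    ∃ C B, IsRegular θ C B (potential : ShiftSpace Γ S P T → ℝ) := by
  choose c hc using fun W : Alphabet Γ S P T => exists_abs_potential_sub_le W
  choose b hb using fun W : Alphabet Γ S P T => exists_le_potential W
  obtain ⟨c', hc'⟩ := (Set.finite_range c).bddAbove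
  obtain ⟨b', hb'⟩ := (Set.finite_range b).bddBelow
  refine ⟨2 * |c'|, max |b'| |Real.log θ|, by positivity, fun {n w w'} h => ?_,
    fun w => abs_le.2 ⟨?_, ?_⟩⟩
  · have h1 := hc _ w w' rfl (h 0 (Nat.zero_le _)).symm
    have h2 : ‖w.shift.code - w'.shift.code‖ ≤ 2 * θ ^ n :=
      norm_code_sub_le hθ fun r hr => (h (r + 1) hr).symm
    have h3 : c (w.1 0) ≤ |c'| := (hc' ⟨_, rfl⟩).trans (le_abs_self _)
    refine h1.trans ((mul_le_mul h3 h2 (norm_nonneg _) (abs_nonneg _)).trans (le_of_eq ?_))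
    ring
  · have h1 := hb _ w rfl
    have h2 : b' ≤ b (w.1 0) := hb' ⟨_, rfl⟩
    have h3 := neg_abs_le b'
    have h4 := le_max_left |b'| |Real.log θ|
    linarith
  · exact (potential_le_log hθ w).trans ((le_abs_self _).trans (le_max_right _ _))

lemma exists_birkhoff_distortion (hθ : P.IsContractionFactor θ) :
    ∃ D : ℝ, 0 ≤ D ∧ ∀ (n : ℕ) (w w' : ShiftSpace Γ S P T), w' ∈ w.cylinder n →
      |birkhoff potential n w - birkhoff potential n w'| ≤ D := by
  obtain ⟨C, B, hφ⟩ := exists_isRegular_potential (Γ := Γ) (S := S) (T := T) hθ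
  refine ⟨C * (1 - θ)⁻¹, mul_nonneg hφ.nonneg (inv_nonneg.2 (sub_nonneg.2 hθ.2.1.le)),
    fun n w w' h => ?_⟩
  have key : ∀ (n : ℕ) (w w' : ShiftSpace Γ S P T), w' ∈ w.cylinder n →
      |birkhoff potential n w - birkhoff potential n w'| ≤ C * ∑ k ∈ Finset.range n, θ ^ k := by
    intro n
    induction n with
    | zero => intro w w' _; simp [birkhoff_zero]
    | succ n ih =>
      intro w w' h
      have h1 := ih w.shift w'.shift fun r hr => h (r + 1) (Nat.succ_lt_succ hr)
      have h2 := hφ.abs_sub_le (mem_cylinder_succ.1 h).symm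
      rw [birkhoff_succ, birkhoff_succ, Finset.sum_range_succ, mul_add]
      have h3 := abs_add_le (potential w - potential w')
        (birkhoff potential n w.shift - birkhoff potential n w'.shift)
      rw [add_sub_add_comm]
      linarith
  refine (key n w w' h).trans (mul_le_mul_of_nonneg_left ?_ hφ.nonneg)
  exact sum_le_hasSum _ (fun k _ => pow_nonneg hθ.1.le k)
    (hasSum_geometric_of_lt_one hθ.1.le hθ.2.1)

/-- The pairs with different first entries form a compact set on which the distance of the codes is
continuous and, by injectivity, positive. -/
lemma exists_separation : ∃ c : ℝ, 0 < c ∧ ∀ w w' : ShiftSpace Γ S P T, w.1 0 ≠ w'.1 0 →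
    c ≤ ‖w.code - w'.code‖ := by
  set K : Set (ShiftSpace Γ S P T × ShiftSpace Γ S P T) := {q | q.1.1 0 ≠ q.2.1 0} with hK
  have hKc : IsCompact K := by
    have h1 : IsOpen {q : ShiftSpace Γ S P T × ShiftSpace Γ S P T | q.1.1 0 = q.2.1 0} :=
      (isOpen_discrete {x : Alphabet Γ S P T × Alphabet Γ S P T | x.1 = x.2}).preimage
        (((continuous_entry 0).comp continuous_fst).prodMk
          ((continuous_entry 0).comp continuous_snd))
    exact h1.isClosed_compl.isCompact
  rcases K.eq_empty_or_nonempty with h | h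
  · refine ⟨1, one_pos, fun w w' hne => ?_⟩
    have : (w, w') ∈ K := hne
    rw [h] at this
    exact absurd this (Set.notMem_empty _)
  · obtain ⟨q, hq, hmin⟩ := hKc.exists_isMinOn h
      (((continuous_code.comp continuous_fst).sub (continuous_code.comp continuous_snd)).norm
        ).continuousOn
    refine ⟨‖q.1.code - q.2.code‖, ?_, fun w w' hne => isMinOn_iff.1 hmin (w, w') hne⟩
    rw [norm_pos_iff, sub_ne_zero]
    intro heq
    have e : q.1 = q.2 := code_injective heq
    have hq' : q.1.1 0 ≠ q.2.1 0 := hq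
    exact hq' (by rw [e])

/-- The exact formula rescales `n` common entries to unit size. There the distance is at most two,
and at least the separation constant if the next entries differ; distortion replaces the mean of two
Birkhoff sums by one of them. -/
lemma exists_norm_code_sub_bounds (hθ : P.IsContractionFactor θ) :
    ∃ c c' : ℝ, 0 < c ∧ 0 < c' ∧ ∀ (n : ℕ) (w w' : ShiftSpace Γ S P T), w' ∈ w.cylinder n →
      (w.1 n ≠ w'.1 n → c * Real.exp (birkhoff potential n w) ≤ ‖w.code - w'.code‖) ∧
      ‖w.code - w'.code‖ ≤ c' * Real.exp (birkhoff potential n w) := by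
  obtain ⟨D, hD0, hD⟩ := exists_birkhoff_distortion (Γ := Γ) (S := S) (T := T) hθ
  obtain ⟨c, hc0, hc⟩ := exists_separation (Γ := Γ) (S := S) (P := P) (T := T)
  refine ⟨c * Real.exp (-D), 2 * Real.exp D, mul_pos hc0 (Real.exp_pos _),
    mul_pos two_pos (Real.exp_pos _), fun n w w' h => ?_⟩
  have h1 := abs_le.1 (hD n w w' h)
  rw [norm_code_sub_eq h]
  constructor
  · intro hne
    have h2 : (shift^[n] w).1 0 ≠ (shift^[n] w').1 0 := by
      rwa [shift_iterate_apply, shift_iterate_apply, zero_add]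
    rw [mul_assoc, mul_comm, ← Real.exp_add]
    exact mul_le_mul (Real.exp_le_exp.2 (by linarith)) (hc _ _ h2) hc0.le (Real.exp_pos _).le
  · have h2 : ‖(shift^[n] w).code - (shift^[n] w').code‖ ≤ 2 := by
      have := norm_sub_le (shift^[n] w).code (shift^[n] w').code
      rw [norm_code, norm_code] at this
      linarith
    rw [mul_assoc, mul_comm, ← Real.exp_add]
    exact mul_le_mul h2 (Real.exp_le_exp.2 (by linarith)) (Real.exp_pos _).le two_pos.le

/-! ### Bounds for the push-forward of a Gibbs measure -/

variable {m : Measure (ShiftSpace Γ S P T)}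

/-- The smallest cylinder containing the preimage of `U` also contains two points of it that
separate at the next entry, so the diameter of `U` controls its Birkhoff sum from above. The Gibbs
bound for that cylinder then bounds the mass. -/
lemma exists_measure_preimage_le (hθ : P.IsContractionFactor θ) {s Q : ℝ} (hs : 0 < s)
    (hQ : 0 ≤ Q) (hm : IsGibbs (fun w => s * potential w) Q m) :
    ∃ K c : ℝ, 0 < K ∧ 0 < c ∧ ∀ U : Set ℂ, m (code ⁻¹' U) = 0 ∨ ∃ (n : ℕ) (w : ShiftSpace Γ S P T),
      ENNReal.ofReal (c * Real.exp (birkhoff potential n w)) ≤ Metric.ediam U ∧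
      m (code ⁻¹' U) ≤ ENNReal.ofReal
        (K * Real.exp (-(n * Q)) * (c * Real.exp (birkhoff potential n w)) ^ s) := by
  obtain ⟨hmp, C, hC1, hC⟩ := hm
  obtain ⟨c, c', hc0, -, hc⟩ := exists_norm_code_sub_bounds (Γ := Γ) (S := S) (T := T) hθ
  have hup : ∀ (w : ShiftSpace Γ S P T) (n : ℕ), m (w.cylinder n) ≤
      ENNReal.ofReal (C * Real.exp (-(n * Q)) * Real.exp (s * birkhoff potential n w)) := by
    intro w n
    have h1 := (hC w n).2
    rw [div_le_iff₀ (Real.exp_pos _), Real.exp_add, ← mul_assoc] at h1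
    change _ ≤ C * Real.exp (-(n * Q)) * Real.exp (birkhoff (fun w => s * potential w) n w) at h1
    rw [birkhoff_const_mul] at h1
    rw [← ofReal_measureReal]
    exact ENNReal.ofReal_le_ofReal h1
  refine ⟨C / c ^ s, c, by positivity, hc0, fun U => ?_⟩
  by_cases hV : (code ⁻¹' U : Set (ShiftSpace Γ S P T)).Subsingleton
  · left
    rcases hV.eq_empty_or_singleton with h | ⟨w, h⟩
    · rw [h, measure_empty]
    · rw [h]
      -- Points have measure zero: the cylinders around them have masses of order `θ ^ (s n)`, and
      -- `Q ≥ 0` does not spoil this.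
      have hlim : Tendsto (fun n : ℕ => ENNReal.ofReal (C * (θ ^ s) ^ n)) atTop (nhds 0) := by
        rw [← ENNReal.ofReal_zero]
        exact (ENNReal.continuous_ofReal.tendsto 0).comp (tendsto_const_mul_pow
          (Real.rpow_nonneg hθ.1.le s) (Real.rpow_lt_one hθ.1.le hθ.2.1 hs) C)
      refine le_antisymm (ge_of_tendsto' hlim fun n => ?_) zero_le
      refine (measure_mono (Set.singleton_subset_iff.2 (show w ∈ w.cylinder n from fun _ _ => rfl))
        ).trans ((hup w n).trans (ENNReal.ofReal_le_ofReal ?_))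
      have h1 : Real.exp (-(n * Q)) ≤ 1 := Real.exp_le_one_iff.2 (by
        have : 0 ≤ n * Q := by positivity
        linarith)
      have h2 : Real.exp (s * birkhoff potential n w) ≤ (θ ^ s) ^ n := by
        rw [← Real.rpow_natCast, ← Real.rpow_mul hθ.1.le, Real.rpow_def_of_pos hθ.1]
        have := mul_le_mul_of_nonneg_left (birkhoff_potential_le hθ n w) hs.le
        exact Real.exp_le_exp.2 (by linarith)
      have hC0 : 0 ≤ C := by linarith
      have h3 := mul_le_mul h1 h2 (Real.exp_pos _).le zero_le_one
      rw [one_mul] at h3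
      rw [mul_assoc]
      exact mul_le_mul_of_nonneg_left h3 hC0
  · right
    obtain ⟨n, w, hw, w', hw', hne, hsub⟩ := exists_subset_cylinder hV
    refine ⟨n, w, ?_, (measure_mono hsub).trans ((hup w n).trans
      (ENNReal.ofReal_le_ofReal (le_of_eq ?_)))⟩
    · refine le_trans ?_ (Metric.edist_le_ediam_of_mem hw hw')
      rw [edist_dist, dist_eq_norm]
      exact ENNReal.ofReal_le_ofReal ((hc n w w' (hsub hw')).1 hne)
    · rw [Real.mul_rpow hc0.le (Real.exp_pos _).le, ← Real.exp_mul, mul_comm (birkhoff _ _ _) s]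
      have : (c ^ s) ≠ 0 := (Real.rpow_pos_of_pos hc0 s).ne'
      field_simp

/-- If `Q > 0`, the factor `exp (-(n * Q))` is arbitrarily small on sets of small diameter, since
these sit in cylinders of high order. The push-forward would then be at most `ε` times
one-dimensional Hausdorff measure for every `ε`, although the circle has finite length and the mass
is one. -/
lemma pressure_nonpos (hθ : P.IsContractionFactor θ) {Q : ℝ}
    (hm : IsGibbs (fun w => 1 * potential w) Q m) : Q ≤ 0 := by
  by_contra hQ
  push Not at hQ
  obtain ⟨K, c, hK, hc, h⟩ := exists_measure_preimage_le hθ one_pos hQ.le hm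
  obtain ⟨C, B, hφ⟩ := exists_isRegular_potential (Γ := Γ) (S := S) (T := T) hθ
  have hmp := hm.1
  have hbirk : ∀ (n : ℕ) (w : ShiftSpace Γ S P T), -(n * B) ≤ birkhoff potential n w := by
    intro n
    induction n with
    | zero => intro w; simp [birkhoff_zero]
    | succ n ih =>
      intro w
      have := (abs_le.1 (hφ.abs_le w)).1
      rw [birkhoff_succ]
      push_cast
      linarith [ih w.shift]
  have hne : Nonempty (ShiftSpace Γ S P T) := by
    by_contra hne
    rw [not_nonempty_iff] at hne
    have := measure_univ (μ := m)
    rw [Set.univ_eq_empty_iff.2 hne, measure_empty] at this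
    exact zero_ne_one this
  have hB : 0 ≤ B := (abs_nonneg _).trans (hφ.abs_le (Classical.arbitrary _))
  set H := Measure.hausdorffMeasure 1 (Set.range (code : ShiftSpace Γ S P T → ℂ)) with hH
  have hHtop : H < ⊤ := hausdorffMeasure_range_code_lt_top
  have key : ∀ ε : ℝ, 0 < ε → 1 ≤ ENNReal.ofReal ε * H := by
    intro ε hε
    have hlim : Tendsto (fun n : ℕ => K * Real.exp (-Q) ^ n) atTop (nhds 0) :=
      tendsto_const_mul_pow (Real.exp_pos _).le (Real.exp_lt_one_iff.2 (by linarith)) K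
    obtain ⟨N, hN⟩ := eventually_atTop.1 (hlim.eventually (gt_mem_nhds hε))
    -- A set of diameter at most `δ` can only correspond to an order `n ≥ N`, as Birkhoff sums of
    -- order `n` are at least `-(n * B)`.
    set δ := c * Real.exp (-(N * B)) / 2 with hδ
    have hδ0 : 0 < δ := by positivity
    have hle := map_code_le_smul (m := m) (d := 1) (k := ENNReal.ofReal ε)
      (δ := ENNReal.ofReal δ) (by simpa using hε) ENNReal.ofReal_ne_top
      (ENNReal.ofReal_pos.2 hδ0) fun U hU => by
        rcases h U with h0 | ⟨n, w, h1, h2⟩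
        · rw [h0]; exact zero_le
        · have h3 := h1.trans hU
          rw [ENNReal.ofReal_le_ofReal_iff hδ0.le] at h3
          have hn : N ≤ n := by
            by_contra hn
            push Not at hn
            have h4 : (n : ℝ) ≤ N := by exact_mod_cast hn.le
            have h5 : Real.exp (-(N * B)) ≤ Real.exp (birkhoff potential n w) :=
              Real.exp_le_exp.2 (le_trans (neg_le_neg (mul_le_mul_of_nonneg_right h4 hB))
                (hbirk n w))
            have h6 := mul_le_mul_of_nonneg_left h5 hc.le
            linarith
          have h4 := (hN n hn).le
          rw [← Real.exp_nat_mul, mul_neg] at h4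
          rw [Real.rpow_one] at h2
          rw [ENNReal.rpow_one]
          refine h2.trans ?_
          rw [ENNReal.ofReal_mul (by positivity)]
          exact mul_le_mul' (ENNReal.ofReal_le_ofReal h4) h1
    have h1 := hle (Set.range (code : ShiftSpace Γ S P T → ℂ))
    rw [Measure.smul_apply, smul_eq_mul, Measure.map_apply continuous_code.measurable
      (isCompact_range continuous_code).measurableSet, Set.preimage_range, measure_univ] at h1
    exact h1
  -- With this `ε` the product with `H` is less than one.
  have h1 := key (1 / (2 * (H.toReal + 1))) (by positivity)
  have h2 := ENNReal.toReal_nonneg (a := H)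
  rw [← ENNReal.toReal_le_toReal ENNReal.one_ne_top
    (ENNReal.mul_ne_top ENNReal.ofReal_ne_top hHtop.ne), ENNReal.toReal_one, ENNReal.toReal_mul,
    ENNReal.toReal_ofReal (by positivity), div_mul_eq_mul_div, one_mul,
    le_div_iff₀ (by positivity)] at h1
  linarith

end Geometry

end BowenSeries

namespace BowenSeries

section Geometry

open ShiftSpace Filter

variable {Γ₀ : Subgroup SL(2, ℝ)} {A : Type*} {Γ : Subgroup SL(2, ℝ)} {p : ℕ}
  {S : Fin p → SL(2, ℝ)} {P : LabelledIdealPolygon Γ₀ A} {T θ s : ℝ}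
  [Finite (Alphabet Γ S P T)] {m : Measure (ShiftSpace Γ S P T)}

/-! ### The Hausdorff measure and the Gibbs measure of pressure zero -/

lemma exists_map_code_le (hθ : P.IsContractionFactor θ) (hs : 0 < s)
    (hm : IsGibbs (fun w => s * potential w) 0 m) :
    ∃ K : ENNReal, K ≠ ⊤ ∧ m.map code ≤ K • Measure.hausdorffMeasure s := by
  obtain ⟨K, c, hK, hc, h⟩ := exists_measure_preimage_le hθ hs le_rfl hm
  refine ⟨ENNReal.ofReal K, ENNReal.ofReal_ne_top, map_code_le_smul (by simpa using hK)
    ENNReal.ofReal_ne_top ENNReal.zero_lt_top fun U _ => ?_⟩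
  rcases h U with h0 | ⟨n, w, h1, h2⟩
  · rw [h0]
    exact zero_le
  · refine h2.trans ?_
    rw [mul_zero, neg_zero, Real.exp_zero, mul_one, ENNReal.ofReal_mul hK.le]
    gcongr
    rw [← ENNReal.ofReal_rpow_of_nonneg (by positivity) hs.le]
    exact ENNReal.rpow_le_rpow h1 hs.le

lemma exists_ediam_cylinder_le (hθ : P.IsContractionFactor θ) :
    ∃ c : ℝ, 0 < c ∧ ∀ (w : ShiftSpace Γ S P T) (n : ℕ),
      Metric.ediam (code '' w.cylinder n) ≤
        ENNReal.ofReal (c * Real.exp (birkhoff potential n w)) := by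
  obtain ⟨_, c, _, hc, h⟩ := exists_norm_code_sub_bounds (Γ := Γ) (S := S) (T := T) hθ
  refine ⟨2 * c, by positivity, fun w n => Metric.ediam_le ?_⟩
  rintro _ ⟨v, hv, rfl⟩ _ ⟨v', hv', rfl⟩
  rw [edist_dist]
  refine ENNReal.ofReal_le_ofReal ((dist_triangle_left _ _ w.code).trans ?_)
  rw [dist_eq_norm, dist_eq_norm]
  linarith [(h n w v hv).2, (h n w v' hv').2]

/-- The cylinders of order `k ≥ j` partition `V`, their images have diameters tending to zero
uniformly, and the `s`-th powers of these diameters are bounded by a constant times their masses.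
The constant does not depend on `j`. -/
lemma exists_hausdorffMeasure_image_le (hθ : P.IsContractionFactor θ) (hs : 0 < s)
    (hm : IsGibbs (fun w => s * potential w) 0 m) :
    ∃ K : ENNReal, K ≠ ⊤ ∧ ∀ (j : ℕ) (V : Set (ShiftSpace Γ S P T)),
      (∀ w ∈ V, w.cylinder j ⊆ V) → Measure.hausdorffMeasure s (code '' V) ≤ K * m V := by
  obtain ⟨hmp, C, hC1, hC⟩ := hm
  obtain ⟨c, hc, hdiam⟩ := exists_ediam_cylinder_le (Γ := Γ) (S := S) (T := T) hθ
  have hC0 : 0 < C := by linarith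
  have hcyl : ∀ (w : ShiftSpace Γ S P T) (n : ℕ), Metric.ediam (code '' w.cylinder n) ^ s ≤
      ENNReal.ofReal (C * c ^ s) * m (w.cylinder n) := by
    intro w n
    have h1 := (hC w n).1
    rw [mul_zero, neg_zero, zero_add, div_le_div_iff₀ hC0 (Real.exp_pos _), one_mul] at h1
    change Real.exp (birkhoff (fun w => s * potential w) n w) ≤ _ at h1
    rw [birkhoff_const_mul] at h1
    refine (ENNReal.rpow_le_rpow (hdiam w n) hs.le).trans ?_
    rw [ENNReal.ofReal_rpow_of_nonneg (by positivity) hs.le, ← ofReal_measureReal,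
      ← ENNReal.ofReal_mul (by positivity), Real.mul_rpow hc.le (Real.exp_pos _).le,
      ← Real.exp_mul, mul_comm (birkhoff _ _ _) s]
    refine ENNReal.ofReal_le_ofReal ?_
    calc c ^ s * Real.exp (s * birkhoff potential n w)
        ≤ c ^ s * (m.real (w.cylinder n) * C) := by gcongr
      _ = C * c ^ s * m.real (w.cylinder n) := by ring
  refine ⟨ENNReal.ofReal (C * c ^ s), ENNReal.ofReal_ne_top, fun j V hV => ?_⟩
  let _ := Fintype.ofFinite (Alphabet Γ S P T)
  set π : ∀ k : ℕ, ShiftSpace Γ S P T → Fin k → Alphabet Γ S P T := fun k w i => w.1 i with hπ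
  have hπm : ∀ k x, MeasurableSet (π k ⁻¹' {x}) := fun k x =>
    ((isClosed_discrete {x}).preimage
      (continuous_pi fun i : Fin k => continuous_entry (i : ℕ))).measurableSet
  have hfib : ∀ k w, j ≤ k → w ∈ V → V ∩ π k ⁻¹' {π k w} = w.cylinder k := by
    intro k w hk hw
    ext v
    constructor
    · rintro ⟨-, h⟩ r hr
      exact congrFun h ⟨r, hr⟩
    · intro h
      exact ⟨hV w hw fun r hr => h r (hr.trans_le hk), funext fun i => h i i.2⟩
  set t : ∀ k : ℕ, (Fin k → Alphabet Γ S P T) → Set ℂ := fun k x => code '' (V ∩ π k ⁻¹' {x})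
    with ht
  have hcase : ∀ k x, j ≤ k → t k x = ∅ ∨ ∃ w : ShiftSpace Γ S P T, V ∩ π k ⁻¹' {x} = w.cylinder k := by
    intro k x hk
    rcases (V ∩ π k ⁻¹' {x}).eq_empty_or_nonempty with h | ⟨w, hw, hx⟩
    · left
      rw [ht]
      simp only [h, Set.image_empty]
    · right
      obtain rfl : π k w = x := hx
      exact ⟨w, hfib k w hk hw⟩
  have hr : Tendsto (fun k : ℕ => ENNReal.ofReal (c * θ ^ k)) atTop (nhds 0) := by
    rw [← ENNReal.ofReal_zero]
    exact (ENNReal.continuous_ofReal.tendsto 0).comp (tendsto_const_mul_pow hθ.1.le hθ.2.1 c)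
  refine (Measure.hausdorffMeasure_le_liminf_sum s (code '' V) _ hr t ?_ ?_).trans ?_
  · filter_upwards [eventually_ge_atTop j] with k hk x
    rcases hcase k x hk with h | ⟨w, h⟩
    · rw [h, Metric.ediam_empty]
      exact zero_le
    · rw [ht]
      simp only [h]
      refine (hdiam w k).trans (ENNReal.ofReal_le_ofReal (mul_le_mul_of_nonneg_left ?_ hc.le))
      rw [← Real.rpow_natCast, Real.rpow_def_of_pos hθ.1, mul_comm]
      exact Real.exp_le_exp.2 (birkhoff_potential_le hθ k w)
  · refine Eventually.of_forall fun k => ?_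
    rintro _ ⟨w, hw, rfl⟩
    exact Set.mem_iUnion.2 ⟨π k w, w, ⟨hw, rfl⟩, rfl⟩
  · have hev : ∀ᶠ k in atTop, ∑ x, Metric.ediam (t k x) ^ s ≤
        ENNReal.ofReal (C * c ^ s) * m V := by
      filter_upwards [eventually_ge_atTop j] with k hk
      calc ∑ x, Metric.ediam (t k x) ^ s
          ≤ ∑ x, ENNReal.ofReal (C * c ^ s) * m.restrict V (π k ⁻¹' {x}) := by
            refine Finset.sum_le_sum fun x _ => ?_
            rw [Measure.restrict_apply (hπm k x), Set.inter_comm]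
            rcases hcase k x hk with h | ⟨w, h⟩
            · rw [h, Metric.ediam_empty, ENNReal.zero_rpow_of_pos hs]
              exact zero_le
            · rw [ht]
              simp only [h]
              exact hcyl w k
        _ = ENNReal.ofReal (C * c ^ s) * m V := by
            rw [← Finset.mul_sum, sum_measure_preimage_singleton _ fun x _ => hπm k x]
            simp
    exact (liminf_le_liminf hev).trans (liminf_const _).le

lemma hausdorffMeasure_range_code_ne_top (hθ : P.IsContractionFactor θ) (hs : 0 < s)
    (hm : IsGibbs (fun w => s * potential w) 0 m) :
    Measure.hausdorffMeasure s (Set.range (code : ShiftSpace Γ S P T → ℂ)) ≠ ⊤ := by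
  obtain ⟨K, hK, h⟩ := exists_hausdorffMeasure_image_le hθ hs hm
  have hmp := hm.1
  have h1 := h 0 Set.univ fun _ _ => Set.subset_univ _
  rw [Set.image_univ, measure_univ, mul_one] at h1
  exact ne_top_of_le_ne_top hK h1

lemma hausdorffMeasure_range_code_ne_zero (hθ : P.IsContractionFactor θ) (hs : 0 < s)
    (hm : IsGibbs (fun w => s * potential w) 0 m) :
    Measure.hausdorffMeasure s (Set.range (code : ShiftSpace Γ S P T → ℂ)) ≠ 0 := by
  obtain ⟨K, -, h⟩ := exists_map_code_le hθ hs hm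
  have hmp := hm.1
  intro h0
  have h1 := h (Set.range (code : ShiftSpace Γ S P T → ℂ))
  rw [Measure.smul_apply, h0, smul_zero, Measure.map_apply continuous_code.measurable
    (isCompact_range continuous_code).measurableSet, Set.preimage_range, measure_univ] at h1
  exact absurd h1 (by simp)

lemma map_code_absolutelyContinuous (hθ : P.IsContractionFactor θ) (hs : 0 < s)
    (hm : IsGibbs (fun w => s * potential w) 0 m) :
    m.map code ≪ (Measure.hausdorffMeasure s).restrict
      (Set.range (code : ShiftSpace Γ S P T → ℂ)) := by
  obtain ⟨K, -, h⟩ := exists_map_code_le hθ hs hm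
  refine Measure.AbsolutelyContinuous.mk fun U hU h0 => ?_
  rw [Measure.restrict_apply hU] at h0
  have hE : MeasurableSet (Set.range (code : ShiftSpace Γ S P T → ℂ)) :=
    (isCompact_range continuous_code).measurableSet
  have h1 := h (U ∩ Set.range (code : ShiftSpace Γ S P T → ℂ))
  rw [Measure.smul_apply, h0, smul_zero, Measure.map_apply continuous_code.measurable
    (hU.inter hE), Set.preimage_inter, Set.preimage_range, Set.inter_univ] at h1
  rw [Measure.map_apply continuous_code.measurable hU]
  exact le_antisymm h1 zero_le

lemma eq_iUnion_cylinder_subset {V : Set (ShiftSpace Γ S P T)} (hV : IsOpen V) :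
    V = ⋃ j, {w | w.cylinder j ⊆ V} := by
  ext w
  rw [Set.mem_iUnion]
  constructor
  · intro hw
    obtain ⟨j, hj⟩ := exists_subset_nhds_of_compactSpace (V := fun j => w.cylinder j)
      (directed_of_isDirected_le fun j k hjk v hv r hr => hv r (hr.trans_le hjk))
      (fun j => (isClopen_cylinder w j).isClosed) (U := V) fun v hv => by
        have e : v = w := ext_word fun r => Set.mem_iInter.1 hv (r + 1) r r.lt_succ_self
        rw [e]
        exact hV.mem_nhds hw
    exact ⟨j, hj⟩
  · rintro ⟨j, hj⟩
    exact hj fun _ _ => rfl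

/-- An open set is the increasing union of unions of cylinders of growing order, so the covering
bound holds for all open sets with the same constant. Outer regularity then makes the image of a
null set null. -/
lemma restrict_hausdorffMeasure_absolutelyContinuous (hθ : P.IsContractionFactor θ) (hs : 0 < s)
    (hm : IsGibbs (fun w => s * potential w) 0 m) :
    (Measure.hausdorffMeasure s).restrict (Set.range (code : ShiftSpace Γ S P T → ℂ)) ≪
      m.map code := by
  obtain ⟨K, hK, h⟩ := exists_hausdorffMeasure_image_le hθ hs hm
  have hmp := hm.1
  have hopen : ∀ V : Set (ShiftSpace Γ S P T), IsOpen V →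
      Measure.hausdorffMeasure s (code '' V) ≤ K * m V := by
    intro V hV
    have hmono : Monotone fun j : ℕ => {w : ShiftSpace Γ S P T | w.cylinder j ⊆ V} :=
      fun j k hjk w hw v hv => hw fun r hr => hv r (hr.trans_le hjk)
    have himg : Monotone fun j : ℕ => code '' {w : ShiftSpace Γ S P T | w.cylinder j ⊆ V} :=
      fun j k hjk => Set.image_mono (hmono hjk)
    conv_lhs => rw [eq_iUnion_cylinder_subset hV, Set.image_iUnion]
    rw [himg.measure_iUnion]
    refine iSup_le fun j => (h j _ fun w hw v hv => ?_).trans ?_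
    · intro u hu
      exact hw fun r hr => (hu r hr).trans (hv r hr)
    · gcongr
      intro w hw
      exact hw fun _ _ => rfl
  refine Measure.AbsolutelyContinuous.mk fun U hU h0 => ?_
  rw [Measure.map_apply continuous_code.measurable hU] at h0
  rw [Measure.restrict_apply hU, ← Set.image_preimage_eq_inter_range]
  refine le_antisymm (ENNReal.le_of_forall_pos_le_add fun ε hε _ => ?_) zero_le
  obtain ⟨V, hUV, hV, hVm⟩ := (code ⁻¹' U : Set (ShiftSpace Γ S P T)).exists_isOpen_lt_add (μ := m)
    (by rw [h0]; exact ENNReal.zero_ne_top) (ε := (ε : ENNReal) / K)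
    (ENNReal.div_ne_zero.2 ⟨by exact_mod_cast hε.ne', hK⟩)
  rw [h0] at hVm
  rw [zero_add] at hVm ⊢
  calc _ ≤ Measure.hausdorffMeasure s (code '' V) := measure_mono (Set.image_mono hUV)
    _ ≤ K * m V := hopen V hV
    _ ≤ K * (ε / K) := by gcongr
    _ ≤ ε := ENNReal.mul_div_le

lemma dimH_range_code (hθ : P.IsContractionFactor θ) (hs : 0 < s)
    (hm : IsGibbs (fun w => s * potential w) 0 m) :
    dimH (Set.range (code : ShiftSpace Γ S P T → ℂ)) = ENNReal.ofReal s := by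
  have e : ((s.toNNReal : NNReal) : ℝ) = s := Real.coe_toNNReal s hs.le
  refine dimH_of_hausdorffMeasure_ne_zero_ne_top (d := s.toNNReal) ?_ ?_
  · rw [e]
    exact hausdorffMeasure_range_code_ne_zero hθ hs hm
  · rw [e]
    exact hausdorffMeasure_range_code_ne_top hθ hs hm

end Geometry

end BowenSeries

namespace BowenSeries

section Pressure

open ShiftSpace Filter

variable {Γ₀ : Subgroup SL(2, ℝ)} {A : Type*} {Γ : Subgroup SL(2, ℝ)} {p : ℕ}
  {S : Fin p → SL(2, ℝ)} {P : LabelledIdealPolygon Γ₀ A} {T θ : ℝ}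

/-! ### One-letter words -/

lemma LabelledIdealPolygon.isCuspidal_singleton (P : LabelledIdealPolygon Γ₀ A) (a : A) :
    P.IsCuspidal [a] := by
  obtain ⟨W, ⟨-, V, hV⟩, hW, -⟩ := P.exists_isCuspidal_follows a a
  obtain ⟨U, rfl⟩ : ∃ U, W = a :: U := by
    cases W with
    | nil => simp at hW
    | cons b U => exact ⟨U, by simpa using hW⟩
  exact ⟨List.cons_ne_nil _ _, U ++ V, hV⟩

variable (Γ S P) in
/-- The one-letter word `a`, as an element of `𝒲_T`. -/
def letterWord (hT : 0 ≤ T) (a : A) : Alphabet Γ S P T :=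
  ⟨[a], P.isCuspidal_singleton a, by simpa [geomLength] using hT⟩

lemma nontrivial_alphabet (hT : 0 ≤ T) : Nontrivial (Alphabet Γ S P T) := by
  obtain ⟨a, -⟩ := P.exists_notMem_finset ∅ (by simp)
  refine ⟨letterWord Γ S P hT a, letterWord Γ S P hT (P.hat a), fun h => P.hat_ne a ?_⟩
  exact (List.singleton_inj.1 (congrArg Subtype.val h)).symm

lemma nonempty_shiftSpace (hT : 0 ≤ T) : Nonempty (ShiftSpace Γ S P T) := by
  obtain ⟨a, -⟩ := P.exists_notMem_finset ∅ (by simp)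
  choose next hnext using fun a : A => P.exists_follows [a]
  refine ⟨fun r => letterWord Γ S P hT (next^[r] a), fun r b hb => ?_⟩
  obtain rfl : next (next^[r] a) = b := by
    simpa [letterWord, ← Function.iterate_succ_apply'] using hb
  exact hnext _

/-! ### The pressure function -/

variable [Finite (Alphabet Γ S P T)] [Nonempty (ShiftSpace Γ S P T)]
  {lam : ℝ → ℝ} {h : ℝ → ShiftSpace Γ S P T → ℝ} {m : ℝ → Measure (ShiftSpace Γ S P T)}

lemma exists_forall_isRuelleTriple (hθ : P.IsContractionFactor θ) (hM : IsAperiodic Γ S P T) :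
    ∃ (lam : ℝ → ℝ) (h : ℝ → ShiftSpace Γ S P T → ℝ) (m : ℝ → Measure (ShiftSpace Γ S P T)),
      ∀ s, 0 ≤ s → IsRuelleTriple θ (fun w => s * potential w) (lam s) (h s) (m s) := by
  obtain ⟨C, B, hφ⟩ := exists_isRegular_potential (Γ := Γ) (S := S) (T := T) hθ
  obtain ⟨N, hN⟩ := exists_mixing hM
  have key : ∀ s : ℝ, ∃ (l : ℝ) (g : ShiftSpace Γ S P T → ℝ) (μ : Measure (ShiftSpace Γ S P T)),
      0 ≤ s → IsRuelleTriple θ (fun w => s * potential w) l g μ := by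
    intro s
    by_cases hs : 0 ≤ s
    · obtain ⟨l, g, μ, H⟩ := exists_isRuelleTriple hθ.1 hθ.2.1 (hφ.const_mul hs) hN
      exact ⟨l, g, μ, fun _ => H⟩
    · exact ⟨0, 0, 0, fun h => absurd h hs⟩
  choose lam h m H using key
  exact ⟨lam, h, m, H⟩

/-- Contraction bounds the potential by `log θ < 0`, so raising `s` lowers the pressure at least at
this linear rate. -/
lemma log_add_le (hθ : P.IsContractionFactor θ)
    (H : ∀ s, 0 ≤ s → IsRuelleTriple θ (fun w => s * potential w) (lam s) (h s) (m s))
    {s t : ℝ} (hs : 0 ≤ s) (hst : s ≤ t) :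
    Real.log (lam t) ≤ Real.log (lam s) + (t - s) * Real.log θ :=
  (H s hs).le_of_le (H t (hs.trans hst)) fun w => by
    have := mul_le_mul_of_nonneg_left (potential_le_log hθ w) (sub_nonneg.2 hst)
    linarith

lemma strictAntiOn_log (hθ : P.IsContractionFactor θ)
    (H : ∀ s, 0 ≤ s → IsRuelleTriple θ (fun w => s * potential w) (lam s) (h s) (m s)) :
    StrictAntiOn (fun s => Real.log (lam s)) (Set.Ici 0) := by
  intro s hs t _ hst
  have h1 := log_add_le hθ H hs hst.le
  have h2 := mul_neg_of_pos_of_neg (sub_pos.2 hst) (Real.log_neg hθ.1 hθ.2.1)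
  simp only
  linarith

/-- The potential is at least `-B`, so the pressure cannot fall faster than linearly with slope `B`;
together with monotonicity this makes it Lipschitz. -/
lemma continuousOn_log (hθ : P.IsContractionFactor θ)
    (H : ∀ s, 0 ≤ s → IsRuelleTriple θ (fun w => s * potential w) (lam s) (h s) (m s)) :
    ContinuousOn (fun s => Real.log (lam s)) (Set.Ici 0) := by
  obtain ⟨C, B, hφ⟩ := exists_isRegular_potential (Γ := Γ) (S := S) (T := T) hθ
  have key : ∀ s t, 0 ≤ s → s ≤ t → Real.log (lam s) ≤ Real.log (lam t) + B * (t - s) := by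
    intro s t hs hst
    refine (H t (hs.trans hst)).le_of_le (H s hs) fun w => ?_
    have := mul_le_mul_of_nonneg_left (abs_le.1 (hφ.abs_le w)).1 (sub_nonneg.2 hst)
    linarith
  have hle : ∀ s ∈ Set.Ici (0 : ℝ), ∀ t ∈ Set.Ici (0 : ℝ),
      Real.log (lam s) ≤ Real.log (lam t) + B.toNNReal * dist s t := by
    intro s hs t ht
    rcases le_total s t with hst | hst
    · refine (key s t hs hst).trans ?_
      rw [dist_comm, Real.dist_eq, abs_of_nonneg (sub_nonneg.2 hst)]
      gcongr
      exact Real.le_coe_toNNReal B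
    · have h1 := (strictAntiOn_log hθ H).antitoneOn ht hs hst
      exact h1.trans (le_add_of_nonneg_right (by positivity))
  exact (LipschitzOnWith.of_le_add_mul _ fun s hs t ht => hle s hs t ht).continuousOn

lemma log_zero_pos [Nontrivial (Alphabet Γ S P T)] (hθ : P.IsContractionFactor θ)
    (hM : IsAperiodic Γ S P T)
    (H : ∀ s, 0 ≤ s → IsRuelleTriple θ (fun w => s * potential w) (lam s) (h s) (m s)) :
    0 < Real.log (lam 0) := by
  obtain ⟨C, B, hφ⟩ := exists_isRegular_potential (Γ := Γ) (S := S) (T := T) hθ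
  obtain ⟨N, hN⟩ := exists_mixing hM
  have h1 := hφ.const_mul le_rfl
  rw [zero_mul B] at h1
  exact (H 0 le_rfl).log_pos h1 hN

end Pressure

end BowenSeries

/-! ### Proof of the proposition -/

theorem mainTheorem4 {A : Type*} (Γ Γ₀ : Subgroup SL(2, ℝ))
    (hΓ : BowenSeries.IsNonuniformLattice Γ)
    (hle : Γ₀ ≤ Γ) (hfin : Γ₀.relIndex Γ ≠ 0) (hfree : IsFreeGroup Γ₀)
    {p : ℕ} (S : Fin p → SL(2, ℝ)) (hS : BowenSeries.IsCuspSystem Γ S)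
    (P : BowenSeries.LabelledIdealPolygon Γ₀ A) :
    -- contraction factors exist, and the transition matrix is aperiodic for all large `T`
    (∃ θ : ℝ, P.IsContractionFactor θ) ∧
    (∃ T₀ : ℝ, ∀ T ≥ T₀, BowenSeries.IsAperiodic Γ S P T) ∧
    ∀ θ : ℝ, P.IsContractionFactor θ →
    ∀ T : ℝ, 0 < T → BowenSeries.IsAperiodic Γ S P T →
    ∃ (lam : ℝ → ℝ) (h : ℝ → BowenSeries.ShiftSpace Γ S P T → ℝ)
      (m : ℝ → Measure (BowenSeries.ShiftSpace Γ S P T)),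
      -- `lam s` is the maximal eigenvalue and `m s` the Gibbs measure for the potential `s φ_T`
      (∀ s ∈ Set.Icc (0 : ℝ) 1,
        BowenSeries.IsMaximalEigenpair θ (fun w => s * BowenSeries.potential w) (lam s) (h s) ∧
        BowenSeries.IsInvariantFixedMeasure (BowenSeries.normalizedPotential
          (fun w => s * BowenSeries.potential w) (lam s) (h s)) (m s) ∧
        (∀ m', BowenSeries.IsInvariantFixedMeasure (BowenSeries.normalizedPotential
          (fun w => s * BowenSeries.potential w) (lam s) (h s)) m' → m' = m s) ∧
        BowenSeries.IsGibbs (fun w => s * BowenSeries.potential w) (Real.log (lam s)) (m s)) ∧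
      -- part 1
      ContinuousOn (fun s => Real.log (lam s)) (Set.Icc 0 1) ∧
      StrictAntiOn (fun s => Real.log (lam s)) (Set.Icc 0 1) ∧
      0 < Real.log (lam 0) ∧ Real.log (lam 1) ≤ 0 ∧
      -- part 2
      ∃ sT ∈ Set.Icc (0 : ℝ) 1, Real.log (lam sT) = 0 ∧
        (∀ s ∈ Set.Icc (0 : ℝ) 1, Real.log (lam s) = 0 → s = sT) ∧
        dimH (BowenSeries.cantorSet Γ S P T) = ENNReal.ofReal sT ∧
        (m sT).map BowenSeries.ShiftSpace.code ≪
          (Measure.hausdorffMeasure sT).restrict (BowenSeries.cantorSet Γ S P T) ∧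
        (Measure.hausdorffMeasure sT).restrict (BowenSeries.cantorSet Γ S P T) ≪
          (m sT).map BowenSeries.ShiftSpace.code := by
  refine ⟨P.exists_isContractionFactor, BowenSeries.exists_isAperiodic Γ S P,
    fun θ hθ T hT hM => ?_⟩
  have := BowenSeries.finite_alphabet (P := P) hΓ.discrete hle hS T
  have := BowenSeries.nontrivial_alphabet (Γ := Γ) (S := S) (P := P) hT.le
  have := BowenSeries.nonempty_shiftSpace (Γ := Γ) (S := S) (P := P) hT.le
  obtain ⟨lam, h, m, H⟩ := BowenSeries.exists_forall_isRuelleTriple hθ hM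
  have hcont := (BowenSeries.continuousOn_log hθ H).mono (Set.Icc_subset_Ici_self (a := 1) (b := 0))
  have hanti := (BowenSeries.strictAntiOn_log hθ H).mono (Set.Icc_subset_Ici_self (a := 1) (b := 0))
  have h0 := BowenSeries.log_zero_pos hθ hM H
  have h1 : Real.log (lam 1) ≤ 0 := BowenSeries.pressure_nonpos hθ (H 1 zero_le_one).gibbs
  obtain ⟨sT, hsT, hzero⟩ := intermediate_value_Icc' zero_le_one hcont ⟨h1, h0.le⟩
  simp only at hzero
  -- The zero is not at the left end because `P(0) > 0`; the comparison with Hausdorff measure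
  -- requires a positive exponent.
  have hpos : 0 < sT := hsT.1.lt_of_ne fun e => by
    rw [← e] at hzero
    exact h0.ne' hzero
  have hG := (H sT hsT.1).gibbs
  rw [hzero] at hG
  refine ⟨lam, h, m, fun s hs => ⟨(H s hs.1).eigenpair, (H s hs.1).invariant, (H s hs.1).unique,
    (H s hs.1).gibbs⟩, hcont, hanti, h0, h1, sT, hsT, hzero, fun s hs e => ?_, ?_⟩
  · exact hanti.injOn hs hsT (e.trans hzero.symm)
  · rw [BowenSeries.cantorSet_eq_range]
    exact ⟨BowenSeries.dimH_range_code hθ hpos hG,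
      BowenSeries.map_code_absolutelyContinuous hθ hpos hG,
      BowenSeries.restrict_hausdorffMeasure_absolutelyContinuous hθ hpos hG⟩
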